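/- **Setting.** An $n$-qubit circuit ($n\ge 1$) is a sequence $U_1,\dots,U_D$ of layers, each a product of one- and two-qubit unitary gates on disjoint qubits, listed in reverse order of time. A gate is Clifford if conjugation by it sends every Pauli operator to $\pm$ a Pauli operator. Let $d$ be the number of layers that contain a non-Clifford gate. The noisy circuit is $$\mathcal C\{\rho\}=\mathcal D_0\{U_1\mathcal D_1\{\cdots U_D\mathcal D_D\{\rho\}U_D^\dagger\cdots\}U_1^\dagger\},$$ where the read-out noise $\mathcal D_0$ applies the depolarizing channel $\rho\mapsto e^{-\gamma}\rho+(1-e^{-\gamma})\,\mathrm{tr}_j(\rho)\otimes I_j/2$ to every qubit $j$, and $\mathcal D_t$ ($t\ge 1$) applies it * (uniform noise on non-Clifford layers) to every qubit if $U_t$ contains a non-Clifford gate, and to none otherwise; * (gate-based noise on non-Clifford gates) exactly to the qubits that belong to non-Clifford gates of $U_t$. Let $O$ be a Hermitian observable with $\|O\|_F^2=2^{-n}\mathrm{tr}(O^\dagger O)=1$, and let $\rho_1,\dots,\rho_N$ ($N\ge1$) be density matrices forming a low-average ensemble with purity $c$, i.e. $\|\frac1N\sum_i\rho_i\|_\infty\le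 c/2^n$. The root-mean-square (RMS) error of an estimate is taken over this ensemble, of the difference to $\mathrm{tr}(\mathcal C\{\rho_i\}O)$. Let $0<\varepsilon\le1$. An algorithm is a single program (independent of all the data above) of a real RAM with unit-cost addition, subtraction and comparison of integers and addition, subtraction, multiplication and comparison of reals. It is given $n$, $d$, $e^{-\gamma}$ and an integer truncation threshold $\ell$, and may ask for Pauli coefficients of $O$ and $\rho_i$, for the placement, type and local Pauli transition amplitudes of the gates of the non-Clifford layers (unit time each), and for the image of a Pauli operator, with its sign, under conjugation by the unitary (or its inverse) of a maximal block of consecutive Clifford layers (time $n$). **Theorem.** 1. (Uniform noise, any $O$.) There are an algorithm and a choice of $\ell$ as a function of $(\gamma,\varepsilon,d)$ such that, for every $\gamma_0\in(0,1)$ there is a constant $K>0$ such that whenever $0<\gamma\le\gamma_0$, the algorithm outputs estimates with RMS error at most $\varepsilon\sqrt c$, in time at most $$K\,n^{K\frac{\log(1/\gamma)}{\gamma}+K\frac{\log(1/\varepsilon)}{\gamma\max(1,d)}}\,(1/\varepsilon)^{K\frac{\log(1/\gamma)}{\gamma^2}}.$$ 2. (Uniform noise, sums of polynomially many Paulis.)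 There are an algorithm and a choice of $\ell$ as a function of $(\gamma,\varepsilon,d)$ such that, for every $\gamma_0\in(0,1)$ there is a constant $K>0$ such that for every polynomial $p$ there is a polynomial $q$ such that: if $0<\gamma\le\gamma_0$ and $O$ is given as an explicit list of at most $p(n)$ Pauli operators with real coefficients (whose terms can be read in time $n$ each), the algorithm outputs estimates with RMS error at most $\varepsilon\sqrt c$, in time at most $q(n)\,(1/\varepsilon)^{K\log(1/\gamma)/\gamma^2}$. 3. (Gate-based noise, any $O$.) There are an algorithm and an absolute constant $K>0$ such that the following holds for all $\gamma>0$. Let $\ell$ be the least natural number with $\ell\ge\frac1\gamma\log(\sqrt{d+1}/\varepsilon)-1$, let $m$ be the number of Pauli operators of weight at most $\ell$ with non-zero coefficient in $O$, and let $O_{\le\ell}$ be the part of $O$ on these. The *non-Clifford distance* of a Pauli operator $P$ after $t$ layers is the least number of non-Clifford gates passed through (i.e. met on its support) by a Pauli path $P_0,\dots,P_t=P$, where $P_0$ has non-zero coefficient in $O_{\le\ell}$ and $\mathrm{tr}(P_sU_s^\dagger P_{s-1}U_s)\ne0$ for $1\le s\le t$; it is $\infty$ if there is no such path. Put $\tilde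 O^{(0)}=\mathcal D_0\{O_{\le\ell}\}$, and let $\tilde O^{(t)}$ be the part of $\mathcal D_t\{U_t^\dagger\tilde O^{(t-1)}U_t\}$ on the Pauli operators of non-Clifford distance at most $\ell$ after $t$ layers. Then the algorithm outputs $\mathrm{tr}(\rho_i\tilde O^{(D)})$, these estimates have RMS error at most $\varepsilon\sqrt c$, and the time is at most $$K\cdot\max(1,d)\cdot\max(1,m)^2\cdot n^{\frac2\gamma\log(\sqrt{d+1}/\varepsilon)}.$$ -/

import Mathlib

open Matrix

namespace NoisySim

noncomputable section

open scoped Classical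

/-! ## Qubits, Pauli operators, Clifford unitaries -/

/-- Operators on `n` qubits, in the computational basis. -/
abbrev Op (n : ℕ) := Matrix (Fin n → Fin 2) (Fin n → Fin 2) ℂ

/-- An `n`-qubit Pauli operator; the letters `0, 1, 2, 3` stand for `I, X, Y, Z`. -/
abbrev PauliString (n : ℕ) := Fin n → Fin 4

/-- The single-qubit Pauli matrices. -/
def pauliMat : Fin 4 → Matrix (Fin 2) (Fin 2) ℂ :=
  ![1, !![0, 1; 1, 0], !![0, -Complex.I; Complex.I, 0], !![1, 0; 0, -1]]

/-- The tensor product of the letters of `P`. -/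
def pauliOp {n : ℕ} (P : PauliString n) : Op n :=
  Matrix.of fun x y => ∏ j, pauliMat (P j) (x j) (y j)

/-- The number of non-identity letters. -/
def weight {n : ℕ} (P : PauliString n) : ℕ := (Finset.univ.filter fun j => P j ≠ 0).card

/-- The Pauli coefficient `tr(O P) / 2^n` (a real number for Hermitian `O`). -/
def coeff {n : ℕ} (O : Op n) (P : PauliString n) : ℝ := ((O * pauliOp P).trace / 2 ^ n).re

/-- The normalized Frobenius norm, `‖O‖_F² = tr(O† O) / 2^n`. -/
def frobNorm {n : ℕ} (O : Op n) : ℝ := Real.sqrt ((Oᴴ * O).trace.re / 2 ^ n)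

/-- The transition amplitude `tr(Q U† P U) / 2^n`. -/
def amp {n : ℕ} (U : Op n) (P Q : PauliString n) : ℝ := coeff (Uᴴ * pauliOp P * U) Q

/-- `U` is Clifford: conjugation by it sends every Pauli operator to plus or minus one. -/
def IsClifford {n : ℕ} (U : Op n) : Prop :=
  ∀ P : PauliString n, ∃ Q : PauliString n,
    Uᴴ * pauliOp P * U = pauliOp Q ∨ Uᴴ * pauliOp P * U = -pauliOp Q

/-- The restriction of `O` to the Pauli operators in `S`. -/
def project {n : ℕ} (S : Set (PauliString n)) (O : Op n) : Op n :=
  ∑ P : PauliString n, if P ∈ S then (coeff O P : ℂ) • pauliOp P else 0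

/-! ## Circuits -/

/-- A one- or two-qubit unitary gate. -/
inductive Gate (n : ℕ) where
  | one (j : Fin n) (U : Matrix.unitaryGroup (Fin 2) ℂ)
  | two (i j : Fin n) (hij : i ≠ j) (U : Matrix.unitaryGroup (Fin 2 × Fin 2) ℂ)

/-- The qubits on which a gate acts. -/
def Gate.support {n : ℕ} : Gate n → Finset (Fin n)
  | .one j _ => {j}
  | .two i j _ _ => {i, j}

/-- The gate as an operator on all `n` qubits. -/
def Gate.toOp {n : ℕ} : Gate n → Op n
  | .one j U => Matrix.of fun x y =>
      if ∀ k, k ≠ j → x k = y k then U.1 (x j) (y j) else 0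
  | .two i j _ U => Matrix.of fun x y =>
      if ∀ k, k ≠ i → k ≠ j → x k = y k then U.1 (x i, x j) (y i, y j) else 0

/-- A circuit layer: gates on pairwise disjoint sets of qubits. -/
structure Layer (n : ℕ) where
  gates : List (Gate n)
  disjoint : gates.Pairwise fun g h => Disjoint g.support h.support

/-- The depth-1 unitary of the layer (its gates commute, so their order is immaterial). -/
def Layer.toOp {n : ℕ} (L : Layer n) : Op n := (L.gates.map Gate.toOp).prod

/-- The layer contains a non-Clifford gate. -/
def Layer.NonClifford {n : ℕ} (L : Layer n) : Prop := ∃ g ∈ L.gates, ¬ IsClifford g.toOp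

/-- The qubits on which some non-Clifford gate of the layer acts. -/
def Layer.nonCliffordQubits {n : ℕ} (L : Layer n) : Finset (Fin n) :=
  Finset.univ.filter fun j => ∃ g ∈ L.gates, ¬ IsClifford g.toOp ∧ j ∈ g.support

/-- The number of non-Clifford gates of the layer that act on the support of `P`. -/
def Layer.touched {n : ℕ} (L : Layer n) (P : PauliString n) : ℕ :=
  (L.gates.filter fun g => decide (¬ IsClifford g.toOp ∧ ∃ j ∈ g.support, P j ≠ 0)).length

/-- A circuit, as the list `U₁, …, U_D` of all its layers, Clifford or not, with the last layer
in time (the one before read-out) first. -/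
abbrev Circuit (n : ℕ) := List (Layer n)

/-- The number of layers that contain non-Clifford gates. -/
def ncDepth {n : ℕ} (C : Circuit n) : ℕ := (C.filter fun L => decide L.NonClifford).length

/-! ## Noise -/

/-- The local depolarizing channel `ρ ↦ e^{-γ} ρ + (1 - e^{-γ}) tr_j(ρ) ⊗ I_j / 2`. -/
def depolarize {n : ℕ} (γ : ℝ) (j : Fin n) (ρ : Op n) : Op n :=
  Matrix.of fun x y =>
    (Real.exp (-γ) : ℂ) * ρ x y + (1 - (Real.exp (-γ) : ℂ)) *
      (if x j = y j then
        (∑ b : Fin 2, ρ (Function.update x j b) (Function.update y j b)) / 2 else 0)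

/-- The product of the depolarizing channels on the qubits in `S`. -/
def depolarizeOn {n : ℕ} (γ : ℝ) (S : Finset (Fin n)) (ρ : Op n) : Op n :=
  ((List.finRange n).filter fun j => decide (j ∈ S)).foldr (depolarize γ) ρ

/-- Uniform noise on layers with non-Clifford gates only: all qubits of such a layer are noisy. -/
def uniformNoise {n : ℕ} (L : Layer n) : Finset (Fin n) := if L.NonClifford then Finset.univ else ∅

/-- Gate-based noise on non-Clifford gates only: exactly the qubits in these gates are noisy. -/
def gateNoise {n : ℕ} (L : Layer n) : Finset (Fin n) := L.nonCliffordQubits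

/-- `ρ ↦ U₁ D₁{ ⋯ U_D D_D{ρ} U_D† ⋯ } U₁†`, where `D_t` acts on the qubits in `noise U_t`. -/
def evolve {n : ℕ} (γ : ℝ) (noise : Layer n → Finset (Fin n)) : Circuit n → Op n → Op n
  | [], ρ => ρ
  | L :: C, ρ => L.toOp * depolarizeOn γ (noise L) (evolve γ noise C ρ) * L.toOpᴴ

/-- The noisy circuit, with read-out noise on all qubits. -/
def noisyCircuit {n : ℕ} (γ : ℝ) (noise : Layer n → Finset (Fin n)) (C : Circuit n) (ρ : Op n) :
    Op n :=
  depolarizeOn γ Finset.univ (evolve γ noise C ρ)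

/-- The expectation value of `O` in the output of the noisy circuit. -/
def expectation {n : ℕ} (γ : ℝ) (noise : Layer n → Finset (Fin n)) (C : Circuit n) (O ρ : Op n) :
    ℝ :=
  (noisyCircuit γ noise C ρ * O).trace.re

/-! ## Ensembles of states -/

open scoped Matrix.Norms.L2Operator ComplexOrder in
/-- A low-average ensemble of states with purity `c` (`‖ ‖` is the operator norm). -/
def IsLowAverage {n N : ℕ} (c : ℝ) (ρ : Fin N → Op n) : Prop :=
  0 < N ∧ (∀ i, (ρ i).PosSemidef ∧ (ρ i).trace = 1) ∧
    ‖((N : ℂ)⁻¹ • ∑ i, ρ i : Op n)‖ ≤ c / 2 ^ n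

/-- Root-mean-square difference. -/
def rmsError {N : ℕ} (u v : Fin N → ℝ) : ℝ := Real.sqrt ((∑ i, (u i - v i) ^ 2) / N)

/-! ## Non-Clifford distance and the truncated evolution -/

/-- The part of `O` on Pauli operators of weight at most `ℓ`. -/
def lowWeight {n : ℕ} (ℓ : ℕ) (O : Op n) : Op n := project {P | weight P ≤ ℓ} O

/-- The number of Pauli operators with non-zero coefficient in `O` and weight at most `ℓ`. -/
def pauliCount {n : ℕ} (ℓ : ℕ) (O : Op n) : ℕ :=
  (Finset.univ.filter fun P : PauliString n => coeff O P ≠ 0 ∧ weight P ≤ ℓ).card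

/-- `p` is a Pauli path through the layers `C`, from a Pauli operator of `O` to `P`. -/
def IsPauliPath {n : ℕ} (O : Op n) (C : Circuit n) (P : PauliString n)
    (p : Fin (C.length + 1) → PauliString n) : Prop :=
  coeff O (p 0) ≠ 0 ∧ p (Fin.last _) = P ∧
    ∀ s : Fin C.length, amp (C.get s).toOp (p s.castSucc) (p s.succ) ≠ 0

/-- The non-Clifford distance of `P` after the layers `C`: the least number of non-Clifford gates
that a Pauli path from a Pauli operator of `O` to `P` passes through (`⊤` if there is no path). -/
def ncDistance {n : ℕ} (O : Op n) (C : Circuit n) (P : PauliString n) : ℕ∞ :=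
  ⨅ (p : Fin (C.length + 1) → PauliString n) (_ : IsPauliPath O C P p),
    ((∑ s : Fin C.length, (C.get s).touched (p s.castSucc) : ℕ) : ℕ∞)

/-- The approximate Heisenberg evolution of `O` through the first `t` layers under gate-based
noise: Pauli operators of weight above `ℓ` are dropped from `O`, and after each layer those of
non-Clifford distance above `ℓ`. -/
def truncEvolution {n : ℕ} (γ : ℝ) (ℓ : ℕ) (O : Op n) (C : Circuit n) : ℕ → Op n
  | 0 => depolarizeOn γ Finset.univ (lowWeight ℓ O)
  | t + 1 =>
    match C[t]? with
    | none => truncEvolution γ ℓ O C t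
    | some L =>
      project {P | ncDistance (lowWeight ℓ O) (C.take (t + 1)) P ≤ ℓ}
        (depolarizeOn γ (gateNoise L) (L.toOpᴴ * truncEvolution γ ℓ O C t * L.toOp))

/-- The estimate of the expectation value from the truncated evolution. -/
def ncEstimate {n : ℕ} (γ : ℝ) (ℓ : ℕ) (C : Circuit n) (O ρ : Op n) : ℝ :=
  (ρ * truncEvolution γ ℓ O C C.length).trace.re

/-! ## Machine model

A real RAM with oracle access to the instance, programmed in a small imperative language. A program
names finitely many two-dimensional arrays of natural numbers and of reals. Naturals can be added,
subtracted and compared; reals can be added, subtracted, multiplied and compared (there is no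
rounding); the only constants are integers. -/

/-- What a program has access to. -/
structure Input where
  /-- the number of qubits -/
  n : ℕ
  circuit : Circuit n
  /-- the truncation threshold -/
  ℓ : ℕ
  /-- the damping factor `e^{-γ}` of the noise -/
  damp : ℝ
  /-- the Pauli coefficients of the observable -/
  obs : PauliString n → ℝ
  /-- the observable as an explicit sum of Pauli operators, if it is given in that way -/
  terms : List (PauliString n × ℝ)
  /-- the Pauli coefficients `tr(ρ P)` of the input state -/
  state : PauliString n → ℝ

/-- Splits a circuit into its leading Clifford layers, and its non-Clifford layers, each with the
Clifford layers between it and the next non-Clifford layer. -/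
def blocks {n : ℕ} : Circuit n → List (Layer n) × List (Layer n × List (Layer n))
  | [] => ([], [])
  | L :: C =>
    if L.NonClifford then ([], (L, (blocks C).1) :: (blocks C).2)
    else (L :: (blocks C).1, (blocks C).2)

/-- The unitary of the `k`-th block of consecutive Clifford layers, `k = 0, …, d`: block `0` comes
before the first non-Clifford layer, block `k + 1` after non-Clifford layer number `k`. -/
def cliffordBlock {n : ℕ} (C : Circuit n) (k : ℕ) : Op n :=
  ((((blocks C).1 :: (blocks C).2.map Prod.snd).getD k []).map Layer.toOp).prod

/-- The gate on qubit `j` in the non-Clifford layer number `t` (counted from `0`), if any. -/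
def gateAt {n : ℕ} (C : Circuit n) (t j : ℕ) : Option (Gate n) :=
  ((blocks C).2[t]?).bind fun B => B.1.gates.find? fun g => decide (j ∈ g.support.image Fin.val)

/-- The other qubit of a two-qubit gate on qubit `j`, and `j` itself for a one-qubit gate. -/
def Gate.partner {n : ℕ} (j : ℕ) : Gate n → ℕ
  | .one _ _ => j
  | .two a b _ _ => if a.val = j then b.val else a.val

/-- The letters of `P` on the qubits of `g`, with the identity elsewhere. -/
def Gate.restrict {n : ℕ} (g : Gate n) (P : PauliString n) : PauliString n :=
  fun j => if j ∈ g.support then P j else 0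

/-- The Pauli operator to which a Clifford unitary `V` sends `P`, up to sign. -/
def cliffordImage {n : ℕ} (V : Op n) (P : PauliString n) : PauliString n :=
  Classical.epsilon fun Q => amp V P Q ≠ 0

/-- The memory: cell `(row, column)` of the array with a given number. -/
structure Mem where
  nat : ℕ → ℕ → ℕ → ℕ
  real : ℕ → ℕ → ℕ → ℝ

/-- Writes a natural number. -/
def Mem.setNat (μ : Mem) (A i j v : ℕ) : Mem :=
  { μ with nat := fun A' i' j' => if A' = A ∧ i' = i ∧ j' = j then v else μ.nat A' i' j' }

/-- Writes a real number. -/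
def Mem.setReal (μ : Mem) (A i j : ℕ) (v : ℝ) : Mem :=
  { μ with real := fun A' i' j' => if A' = A ∧ i' = i ∧ j' = j then v else μ.real A' i' j' }

/-- The Pauli operator stored, letter by letter, in a row of an array of naturals. -/
def Mem.getRow (μ : Mem) (n A i : ℕ) : PauliString n := fun j => Fin.ofNat 4 (μ.nat A i j)

/-- Stores a Pauli operator, letter by letter, in a row of an array of naturals. -/
def Mem.setRow {n : ℕ} (μ : Mem) (A i : ℕ) (P : PauliString n) : Mem :=
  { μ with nat := fun A' i' j' =>
      if h : A' = A ∧ i' = i ∧ j' < n then (P ⟨j', h.2.2⟩).val else μ.nat A' i' j' }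

/-- Expressions for natural numbers. -/
inductive NExpr where
  | const (k : ℕ)
  | read (A : ℕ) (i j : NExpr)
  | add (a b : NExpr)
  | sub (a b : NExpr)

/-- Evaluation; subtraction is truncated at `0`. -/
def NExpr.eval (μ : Mem) : NExpr → ℕ
  | .const k => k
  | .read A i j => μ.nat A (i.eval μ) (j.eval μ)
  | .add a b => a.eval μ + b.eval μ
  | .sub a b => a.eval μ - b.eval μ

/-- Expressions for real numbers. -/
inductive RExpr where
  | const (k : ℤ)
  | read (A : ℕ) (i j : NExpr)
  | add (a b : RExpr)
  | sub (a b : RExpr)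
  | mul (a b : RExpr)

/-- Evaluation. -/
def RExpr.eval (μ : Mem) : RExpr → ℝ
  | .const k => k
  | .read A i j => μ.real A (i.eval μ) (j.eval μ)
  | .add a b => a.eval μ + b.eval μ
  | .sub a b => a.eval μ - b.eval μ
  | .mul a b => a.eval μ * b.eval μ

/-- Tests. -/
inductive Test where
  | nlt (a b : NExpr)
  | rlt (a b : RExpr)
  | not (a : Test)
  | and (a b : Test)

/-- The test succeeds. -/
def Test.holds (μ : Mem) : Test → Prop
  | .nlt a b => a.eval μ < b.eval μ
  | .rlt a b => a.eval μ < b.eval μ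
  | .not a => ¬ a.holds μ
  | .and a b => a.holds μ ∧ b.holds μ

/-- The address of a cell. -/
structure Cell where
  arr : ℕ
  row : NExpr
  col : NExpr

/-- The address of a row. -/
structure Row where
  arr : ℕ
  row : NExpr

/-- Elementary instructions. -/
inductive Instr where
  /-- assign a natural number -/
  | nset (dst : Cell) (e : NExpr)
  /-- assign a real number -/
  | rset (dst : Cell) (e : RExpr)
  /-- the coefficient of `P` in the observable -/
  | askObs (dst : Cell) (P : Row)
  /-- the `i`-th term of the observable: its Pauli operator and its coefficient -/
  | askTerm (dst : Cell) (P : Row) (i : NExpr)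
  /-- the coefficient of `P` in the input state -/
  | askState (dst : Cell) (P : Row)
  /-- the gate on qubit `j` in non-Clifford layer `t`: none (0), Clifford (1), non-Clifford (2) -/
  | askKind (dst : Cell) (t j : NExpr)
  /-- the other qubit of that gate -/
  | askPartner (dst : Cell) (t j : NExpr)
  /-- the transition amplitude of that gate between `P` and `Q`, restricted to its qubits -/
  | askAmp (dst : Cell) (t j : NExpr) (P Q : Row)
  /-- the image of `P` (Pauli operator and sign) under conjugation by the `k`-th Clifford block,
  or by its inverse if `inv` is true -/
  | askClifford (inv : Bool) (dst : Cell) (Q : Row) (k : NExpr) (P : Row)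

/-- Writes a natural number at an address. -/
def Cell.putNat (c : Cell) (μ : Mem) (v : ℕ) : Mem := μ.setNat c.arr (c.row.eval μ) (c.col.eval μ) v

/-- Writes a real number at an address. -/
def Cell.putReal (c : Cell) (μ : Mem) (v : ℝ) : Mem :=
  μ.setReal c.arr (c.row.eval μ) (c.col.eval μ) v

/-- Reads the Pauli operator at an address. -/
def Row.get (r : Row) (n : ℕ) (μ : Mem) : PauliString n := μ.getRow n r.arr (r.row.eval μ)

/-- The effect of an instruction on the memory. -/
def Instr.run (x : Input) (μ : Mem) : Instr → Mem
  | .nset dst e => dst.putNat μ (e.eval μ)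
  | .rset dst e => dst.putReal μ (e.eval μ)
  | .askObs dst P => dst.putReal μ (x.obs (P.get x.n μ))
  | .askTerm dst P i =>
    match x.terms[i.eval μ]? with
    | none => μ
    | some a => (dst.putReal μ a.2).setRow P.arr (P.row.eval μ) a.1
  | .askState dst P => dst.putReal μ (x.state (P.get x.n μ))
  | .askKind dst t j => dst.putNat μ
    (match gateAt x.circuit (t.eval μ) (j.eval μ) with
      | none => 0
      | some g => if IsClifford g.toOp then 1 else 2)
  | .askPartner dst t j => dst.putNat μ
    (match gateAt x.circuit (t.eval μ) (j.eval μ) with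
      | none => j.eval μ
      | some g => g.partner (j.eval μ))
  | .askAmp dst t j P Q => dst.putReal μ
    (match gateAt x.circuit (t.eval μ) (j.eval μ) with
      | none => 0
      | some g => amp g.toOp (g.restrict (P.get x.n μ)) (g.restrict (Q.get x.n μ)))
  | .askClifford inv dst Q k P =>
    let V := cliffordBlock x.circuit (k.eval μ)
    let W := if inv then Vᴴ else V
    let S := P.get x.n μ
    (dst.putReal μ (amp W S (cliffordImage W S))).setRow Q.arr (Q.row.eval μ) (cliffordImage W S)

/-- The time of an instruction: `n` if it writes a whole Pauli operator, and `1` otherwise. -/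
def Instr.time (x : Input) : Instr → ℕ
  | .askTerm _ _ _ => x.n
  | .askClifford _ _ _ _ _ => x.n
  | _ => 1

/-- Programs. -/
inductive Program where
  | instr (a : Instr)
  | seq (p q : Program)
  | ite (b : Test) (p q : Program)
  | loop (b : Test) (p : Program)

/-- `Exec x p μ μ' T`: on input `x` the program `p`, started with memory `μ`, halts after time `T`
with memory `μ'`. Every evaluation of a test takes one unit of time. -/
inductive Exec (x : Input) : Program → Mem → Mem → ℕ → Prop where
  | instr (a : Instr) (μ : Mem) : Exec x (.instr a) μ (a.run x μ) (a.time x)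
  | seq {p q : Program} {μ μ' μ'' : Mem} {T T' : ℕ} :
      Exec x p μ μ' T → Exec x q μ' μ'' T' → Exec x (.seq p q) μ μ'' (T + T')
  | iteTrue {b : Test} {p q : Program} {μ μ' : Mem} {T : ℕ} :
      b.holds μ → Exec x p μ μ' T → Exec x (.ite b p q) μ μ' (T + 1)
  | iteFalse {b : Test} {p q : Program} {μ μ' : Mem} {T : ℕ} :
      ¬ b.holds μ → Exec x q μ μ' T → Exec x (.ite b p q) μ μ' (T + 1)
  | loopEnd {b : Test} {p : Program} {μ : Mem} :
      ¬ b.holds μ → Exec x (.loop b p) μ μ 1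
  | loopStep {b : Test} {p : Program} {μ μ' μ'' : Mem} {T T' : ℕ} :
      b.holds μ → Exec x p μ μ' T → Exec x (.loop b p) μ' μ'' T' →
        Exec x (.loop b p) μ μ'' (T + T' + 1)

/-- Initially row `0` of array `0` of naturals holds the number of qubits, the number of
non-Clifford layers, the threshold and the number of explicit terms, cell `(0, 0)` of array `0` of
reals holds `e^{-γ}`, and everything else is zero. -/
def Input.init (x : Input) : Mem where
  nat A i j := if A = 0 ∧ i = 0 then
    (if j = 0 then x.n else if j = 1 then ncDepth x.circuit else if j = 2 then x.ℓ
      else if j = 3 then x.terms.length else 0) else 0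
  real A i j := if A = 0 ∧ i = 0 ∧ j = 0 then x.damp else 0

/-- The program halts on input `x` after time `T` with output `v`, in cell `(0, 1)` of array `0` of
reals. -/
def Computes (p : Program) (x : Input) (v : ℝ) (T : ℕ) : Prop :=
  ∃ μ : Mem, Exec x p x.init μ T ∧ μ.real 0 0 1 = v

/-- The observable and the state are given by their Pauli coefficients. -/
def oracleInput {n : ℕ} (γ : ℝ) (ℓ : ℕ) (C : Circuit n) (O ρ : Op n) : Input where
  n := n
  circuit := C
  ℓ := ℓ
  damp := Real.exp (-γ)
  obs := coeff O
  terms := []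
  state P := (ρ * pauliOp P).trace.re

/-- The observable defined by a list of Pauli operators with coefficients. -/
def sumOfTerms {n : ℕ} (l : List (PauliString n × ℝ)) : Op n :=
  (l.map fun a => (a.2 : ℂ) • pauliOp a.1).sum

/-- As `oracleInput`, with the observable given in addition as an explicit sum. -/
def listInput {n : ℕ} (γ : ℝ) (ℓ : ℕ) (C : Circuit n) (l : List (PauliString n × ℝ)) (ρ : Op n) :
    Input :=
  { oracleInput γ ℓ C (sumOfTerms l) ρ with terms := l }

/-- The threshold for gate-based noise: the least natural number that is at least
`(1/γ) log(√(d+1)/ε) - 1`. -/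
def gateThreshold (γ ε : ℝ) (d : ℕ) : ℕ :=
  ⌈1 / γ * Real.log (Real.sqrt (d + 1) / ε) - 1⌉₊

end

end NoisySim

open NoisySim

/-! All three claims are proved in the Heisenberg picture and in the Pauli basis. There a unitary
acts on the real coefficients of an observable by the orthogonal matrix `amp U`
(`amp_row_orthonormal`, `sum_push_sq`), and depolarizing noise acts diagonally, by e^{-γ} to the
number of non-identity letters on the noisy qubits (`depolarizeOn_ofCoeff`). For a low-average
ensemble, non-negativity of the variance gives tr(ρX)² ≤ tr(ρX²), so replacing the evolved
observable by another one causes an RMS error of at most √c times the normalized Frobenius norm of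
the difference (`rmsError_le`). Hence all error bounds are ℓ²-estimates for coefficients. Clifford
layers carry no noise and permute the Pauli operators up to sign, so only the d non-Clifford layers
and the d + 1 Clifford blocks around them matter (`foldl_eq_of_blocks`).

Uniform noise. Expand into Pauli paths and collect those of total weight k over the d + 1 rounds of
noise: the noise multiplies this part by e^{-γk} (`heisAt_eq_sum_graded`). The squared norms of the
parts add up to at most that of O (`graded_sq_le`), so by Cauchy–Schwarz keeping only k ≤ ℓ costs a
geometric tail (`heisAt_sub_truncAt_sq_le`). A path that avoids the identity has weight at least 1
in each round; so if ℓ ≤ d only the identity is left, and its coefficient is the estimate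
(`rmsError_obs_zero_le`). If ℓ ≥ d + 1, a path of total weight at most ℓ has by pigeonhole a round
with weight at most ℓ/(d+1). The program lists these light Pauli operators, propagates them backward
to the observable, asks for the coefficients of what it finds, and propagates forward
(`exists_mem_sources`, `graded_sourcePart`). If the terms of O are listed, only the forward half is
needed. A path branches only at the non-Clifford gates that it meets, into at most 16 images, and a
layer meets at most as many gates as the weight on either side of it (`Layer.touched_eq`,
`Layer.touched_le_wt`). So each starting operator contributes at most 16^ℓ entries: the sum of
16^{-a} over a table, with a counting the gates met, never increases (`stage_potential`).

Gate-based noise. Weight the squared coefficients by e^{2γ · distance}. In a layer the distance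
grows by at most the number of non-Clifford gates met, each of which contains a damped letter, so
this energy does not increase (`energy_heisStep_le`). Whatever is dropped carries energy e^{2γ(ℓ+1)}
per unit of squared norm, so the dropped squared norms have sum at most e^{-2γ(ℓ+1)}; with d + 1
truncations the squared error is at most (d + 1) e^{-2γ(ℓ+1)} (`TruncInv.step`), which the threshold
makes at most ε². The tables have at most m · 256^ℓ rows, which n^ℓ absorbs for n ≥ 256; smaller n
go into the constant (`computes_gateProg_le`).

The programs work on tables of entries. A table is described by its sums `sumE φ` against arbitrary
test functions φ; one identity for all φ (`expandL_sum`) yields coefficients, membership and size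
together. Correctness and running time of programs are derived in a small total-correctness logic
(`wp`) with a frame condition (`Agree`). -/

namespace NoisySim

noncomputable section

open scoped Classical

/-! ## Tensor products of one-qubit matrices and the Pauli basis -/

/-- The tensor product of one-qubit matrices. -/
def tens {n : ℕ} (M : Fin n → Matrix (Fin 2) (Fin 2) ℂ) : Op n :=
  Matrix.of fun x y => ∏ j, M j (x j) (y j)

lemma pauliOp_eq_tens {n : ℕ} (P : PauliString n) : pauliOp P = tens fun j => pauliMat (P j) := rfl

lemma tens_mul {n : ℕ} (M N : Fin n → Matrix (Fin 2) (Fin 2) ℂ) :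
    tens M * tens N = tens fun j => M j * N j := by
  ext x y
  simp only [tens, Matrix.mul_apply, Matrix.of_apply, Fintype.prod_sum, Finset.prod_mul_distrib]

lemma tens_trace {n : ℕ} (M : Fin n → Matrix (Fin 2) (Fin 2) ℂ) :
    (tens M).trace = ∏ j, (M j).trace := by
  simp only [tens, Matrix.trace, Matrix.diag, Matrix.of_apply, Fintype.prod_sum]

lemma tens_conjTranspose {n : ℕ} (M : Fin n → Matrix (Fin 2) (Fin 2) ℂ) :
    (tens M)ᴴ = tens fun j => (M j)ᴴ := by
  ext x y
  simp [tens, Matrix.conjTranspose_apply]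

lemma tens_one {n : ℕ} : tens (fun _ : Fin n => 1) = 1 := by
  ext x y
  simp only [tens, Matrix.of_apply, Matrix.one_apply]
  by_cases h : x = y
  · simp [h]
  · obtain ⟨j, hj⟩ := Function.ne_iff.1 h
    rw [if_neg h]
    exact Finset.prod_eq_zero (Finset.mem_univ j) (by simp [hj])

lemma pauliMat_zero : pauliMat 0 = 1 := rfl

lemma pauliMat_mul_self (p : Fin 4) : pauliMat p * pauliMat p = 1 := by
  fin_cases p <;> ext i j <;> fin_cases i <;> fin_cases j <;>
    simp [pauliMat, Matrix.mul_apply, Fin.sum_univ_two]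

lemma pauliMat_conjTranspose (p : Fin 4) : (pauliMat p)ᴴ = pauliMat p := by
  fin_cases p <;> ext i j <;> fin_cases i <;> fin_cases j <;>
    simp [pauliMat, Matrix.conjTranspose_apply]

lemma pauliMat_trace_mul (p q : Fin 4) :
    (pauliMat p * pauliMat q).trace = if p = q then 2 else 0 := by
  fin_cases p <;> fin_cases q <;>
    simp [pauliMat, Matrix.trace, Fin.sum_univ_two, one_add_one_eq_two]

lemma pauliMat_complete (a b c d : Fin 2) :
    ∑ p, pauliMat p a b * pauliMat p c d = if a = d ∧ b = c then 2 else 0 := by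
  fin_cases a <;> fin_cases b <;> fin_cases c <;> fin_cases d <;>
    simp [pauliMat, Fin.sum_univ_four, one_add_one_eq_two]

/-- The product of two different letters is a multiple of X, Y or Z. Conjugation by X reverses the
sign of Y and Z, and conjugation by Y that of X, so r = 1 or r = 2 always works. This sign makes
amplitudes vanish in `amp_localOn`. -/
lemma exists_pauliMat_anticomm {p q : Fin 4} (h : p ≠ q) :
    ∃ r, pauliMat r * (pauliMat p * pauliMat q) * pauliMat r = -(pauliMat p * pauliMat q) := by
  have key : ∀ r s t : Fin 4, pauliMat r * (pauliMat s * pauliMat t) * pauliMat r =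
      -(pauliMat s * pauliMat t) ↔ ∀ i j, (pauliMat r * (pauliMat s * pauliMat t) * pauliMat r) i j
        = -(pauliMat s * pauliMat t) i j := fun r s t =>
    ⟨fun h i j => by rw [h]; rfl, fun h => by ext i j; exact h i j⟩
  fin_cases p <;> fin_cases q <;> first | exact absurd rfl h | skip
  all_goals
    first
    | refine ⟨1, (key _ _ _).2 ?_⟩; intro i j; fin_cases i <;> fin_cases j <;>
        simp [pauliMat, Matrix.mul_apply, Fin.sum_univ_two]; done
    | refine ⟨2, (key _ _ _).2 ?_⟩; intro i j; fin_cases i <;> fin_cases j <;>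
        simp [pauliMat, Matrix.mul_apply, Fin.sum_univ_two]

lemma pauliOp_zero {n : ℕ} : pauliOp (0 : PauliString n) = 1 := tens_one

lemma pauliOp_mul_self {n : ℕ} (P : PauliString n) : pauliOp P * pauliOp P = 1 := by
  simp only [pauliOp_eq_tens, tens_mul, pauliMat_mul_self, tens_one]

lemma pauliOp_conjTranspose {n : ℕ} (P : PauliString n) : (pauliOp P)ᴴ = pauliOp P := by
  simp only [pauliOp_eq_tens, tens_conjTranspose, pauliMat_conjTranspose]

lemma pauliOp_isHermitian {n : ℕ} (P : PauliString n) : (pauliOp P).IsHermitian :=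
  pauliOp_conjTranspose P

lemma trace_pauliOp_mul {n : ℕ} (P Q : PauliString n) :
    (pauliOp P * pauliOp Q).trace = if P = Q then 2 ^ n else 0 := by
  simp only [pauliOp_eq_tens, tens_mul, tens_trace, pauliMat_trace_mul]
  by_cases h : P = Q
  · simp [h]
  · obtain ⟨j, hj⟩ := Function.ne_iff.1 h
    rw [if_neg h]
    exact Finset.prod_eq_zero (Finset.mem_univ j) (by simp [hj])

/-- The relation factors over the qubits; on one qubit it says that the sum of all σ ⊗ σ is twice
the swap. It is what makes the Pauli operators span all operators (`pauli_expand`). -/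
lemma pauliOp_complete {n : ℕ} (x y z w : Fin n → Fin 2) :
    ∑ P : PauliString n, pauliOp P x y * pauliOp P z w = if x = w ∧ y = z then 2 ^ n else 0 := by
  simp only [pauliOp, Matrix.of_apply, ← Finset.prod_mul_distrib]
  rw [← Fintype.prod_sum (fun j p => pauliMat p (x j) (y j) * pauliMat p (z j) (w j))]
  simp only [pauliMat_complete]
  by_cases h : x = w ∧ y = z
  · simp [h.1, h.2]
  · rw [if_neg h]
    have : ∃ j, ¬ (x j = w j ∧ y j = z j) := by
      by_contra hc
      push Not at hc
      exact h ⟨funext fun j => (hc j).1, funext fun j => (hc j).2⟩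
    obtain ⟨j, hj⟩ := this
    exact Finset.prod_eq_zero (Finset.mem_univ j) (by rw [if_neg hj])

lemma pauli_expand {n : ℕ} (X : Op n) :
    X = ∑ P : PauliString n, ((X * pauliOp P).trace / 2 ^ n) • pauliOp P := by
  ext z w
  have h2 : (2 : ℂ) ^ n ≠ 0 := pow_ne_zero _ two_ne_zero
  have h : ∀ P : PauliString n, (((X * pauliOp P).trace / 2 ^ n) • pauliOp P) z w =
      ∑ x, ∑ y, (X x y / 2 ^ n) * (pauliOp P y x * pauliOp P z w) := by
    intro P
    simp only [Matrix.smul_apply, smul_eq_mul, Matrix.trace, Matrix.diag, Matrix.mul_apply,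
      Finset.sum_div, Finset.sum_mul]
    refine Finset.sum_congr rfl fun x _ => Finset.sum_congr rfl fun y _ => by ring
  rw [Matrix.sum_apply, Finset.sum_congr rfl fun P _ => h P, Finset.sum_comm,
    Finset.sum_eq_single z, Finset.sum_comm, Finset.sum_eq_single w]
  · rw [← Finset.mul_sum, pauliOp_complete, if_pos ⟨rfl, rfl⟩, div_mul_cancel₀ _ h2]
  · intro y _ hy
    rw [← Finset.mul_sum, pauliOp_complete, if_neg (by tauto), mul_zero]
  · simp
  · intro x _ hx
    rw [Finset.sum_comm]
    refine Finset.sum_eq_zero fun y _ => ?_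
    rw [← Finset.mul_sum, pauliOp_complete, if_neg (fun h => hx h.2), mul_zero]
  · simp

/-- The operator with given real Pauli coefficients. -/
def ofCoeff {n : ℕ} (f : PauliString n → ℝ) : Op n := ∑ P, (f P : ℂ) • pauliOp P

lemma trace_mul_pauliOp_im {n : ℕ} {X : Op n} (hX : X.IsHermitian) (P : PauliString n) :
    ((X * pauliOp P).trace).im = 0 := by
  rw [← Complex.conj_eq_iff_im]
  change star _ = _
  rw [← Matrix.trace_conjTranspose, Matrix.conjTranspose_mul, pauliOp_conjTranspose, hX.eq,
    Matrix.trace_mul_comm]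

lemma coeff_coe {n : ℕ} {X : Op n} (hX : X.IsHermitian) (P : PauliString n) :
    (coeff X P : ℂ) = (X * pauliOp P).trace / 2 ^ n := by
  have h : ((X * pauliOp P).trace / 2 ^ n).im = 0 := by
    have e : (2 : ℂ) ^ n = ((2 ^ n : ℝ) : ℂ) := by push_cast; rfl
    rw [e, Complex.div_ofReal_im, trace_mul_pauliOp_im hX, zero_div]
  exact Complex.ext (by simp [coeff]) (by simp [h])

lemma ofCoeff_coeff {n : ℕ} {X : Op n} (hX : X.IsHermitian) : ofCoeff (coeff X) = X := by
  conv_rhs => rw [pauli_expand X]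
  simp only [ofCoeff, coeff_coe hX]

lemma ofCoeff_isHermitian {n : ℕ} (f : PauliString n → ℝ) : (ofCoeff f).IsHermitian := by
  unfold ofCoeff Matrix.IsHermitian
  rw [Matrix.conjTranspose_sum]
  refine Finset.sum_congr rfl fun P _ => ?_
  rw [Matrix.conjTranspose_smul, pauliOp_conjTranspose]
  simp

lemma trace_ofCoeff_mul {n : ℕ} (f : PauliString n → ℝ) (Y : Op n) :
    (ofCoeff f * Y).trace = ∑ P, (f P : ℂ) * (pauliOp P * Y).trace := by
  simp [ofCoeff, Matrix.sum_mul, Matrix.trace_sum]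

lemma trace_ofCoeff_mul_ofCoeff {n : ℕ} (f g : PauliString n → ℝ) :
    (ofCoeff f * ofCoeff g).trace = ((2 ^ n * ∑ P, f P * g P : ℝ) : ℂ) := by
  rw [trace_ofCoeff_mul]
  have : ∀ P, (pauliOp P * ofCoeff g).trace = 2 ^ n * (g P : ℂ) := by
    intro P
    rw [Matrix.trace_mul_comm, trace_ofCoeff_mul, Finset.sum_eq_single P]
    · rw [trace_pauliOp_mul, if_pos rfl, mul_comm]
    · intro Q _ h; rw [trace_pauliOp_mul, if_neg h, mul_zero]
    · simp
  simp only [this]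
  push_cast
  rw [Finset.mul_sum]
  exact Finset.sum_congr rfl fun P _ => by ring

lemma coeff_ofCoeff {n : ℕ} (f : PauliString n → ℝ) : coeff (ofCoeff f) = f := by
  funext P
  have h2 : (2 : ℂ) ^ n ≠ 0 := pow_ne_zero _ two_ne_zero
  unfold coeff
  rw [trace_ofCoeff_mul, Finset.sum_eq_single P]
  · rw [trace_pauliOp_mul, if_pos rfl, mul_div_cancel_right₀ _ h2, Complex.ofReal_re]
  · intro Q _ h; rw [trace_pauliOp_mul, if_neg h, mul_zero]
  · simp

lemma coeff_neg {n : ℕ} (X : Op n) (P : PauliString n) : coeff (-X) P = -coeff X P := by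
  simp [coeff, neg_div]

lemma coeff_pauliOp {n : ℕ} (P Q : PauliString n) :
    coeff (pauliOp P) Q = if P = Q then 1 else 0 := by
  have h2 : (2 : ℂ) ^ n ≠ 0 := pow_ne_zero _ two_ne_zero
  unfold coeff
  rw [trace_pauliOp_mul]
  split_ifs <;> simp [h2]

lemma frobNorm_sq {n : ℕ} {X : Op n} (hX : X.IsHermitian) :
    frobNorm X ^ 2 = ∑ P, coeff X P ^ 2 := by
  have h2 : (2 : ℝ) ^ n ≠ 0 := by positivity
  have h : (Xᴴ * X).trace.re / 2 ^ n = ∑ P, coeff X P ^ 2 := by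
    rw [hX.eq]
    conv_lhs => rw [← ofCoeff_coeff hX]
    rw [trace_ofCoeff_mul_ofCoeff, Complex.ofReal_re, mul_div_cancel_left₀ _ h2]
    exact Finset.sum_congr rfl fun P _ => by ring
  unfold frobNorm
  rw [h, Real.sq_sqrt (Finset.sum_nonneg fun P _ => sq_nonneg _)]

/-! ## Transition amplitudes -/

lemma conj_pauliOp {n : ℕ} (U : Op n) (P : PauliString n) :
    Uᴴ * pauliOp P * U = ofCoeff (amp U P) :=
  (ofCoeff_coeff (Matrix.isHermitian_conjTranspose_mul_mul U (pauliOp_isHermitian P))).symm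

/-- The action of conjugation by `U` on Pauli coefficients. -/
def push {n : ℕ} (U : Op n) (f : PauliString n → ℝ) : PauliString n → ℝ :=
  fun Q => ∑ P, f P * amp U P Q

lemma conj_ofCoeff {n : ℕ} (U : Op n) (f : PauliString n → ℝ) :
    Uᴴ * ofCoeff f * U = ofCoeff (push U f) := by
  have : Uᴴ * ofCoeff f * U = ∑ P, (f P : ℂ) • (Uᴴ * pauliOp P * U) := by
    simp [ofCoeff, Matrix.mul_sum, Matrix.sum_mul]
  rw [this]
  simp only [conj_pauliOp, ofCoeff, push, Finset.smul_sum]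
  rw [Finset.sum_comm]
  refine Finset.sum_congr rfl fun Q _ => ?_
  push_cast
  rw [Finset.sum_smul]
  exact Finset.sum_congr rfl fun P _ => by rw [smul_smul]

lemma amp_mul {n : ℕ} (U V : Op n) (P Q : PauliString n) :
    amp (U * V) P Q = ∑ R, amp U P R * amp V R Q := by
  have : (U * V)ᴴ * pauliOp P * (U * V) = Vᴴ * ofCoeff (amp U P) * V := by
    rw [← conj_pauliOp, Matrix.conjTranspose_mul]; simp only [Matrix.mul_assoc]
  unfold amp
  rw [this, conj_ofCoeff, coeff_ofCoeff]
  rfl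

lemma amp_conjTranspose {n : ℕ} (U : Op n) (P Q : PauliString n) : amp Uᴴ P Q = amp U Q P := by
  unfold amp coeff
  rw [Matrix.conjTranspose_conjTranspose, Matrix.mul_assoc (U * _), Matrix.trace_mul_comm (U * _)]
  simp only [Matrix.mul_assoc]

lemma amp_one {n : ℕ} (P Q : PauliString n) : amp 1 P Q = if P = Q then 1 else 0 := by
  simp [amp, coeff_pauliOp]

/-- `amp` is multiplicative and turns adjoints into transposes, so `amp U` times its transpose is
`amp (U * Uᴴ) = amp 1`, the identity matrix: unitaries act on Pauli coefficients by orthogonal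
matrices. -/
lemma amp_row_orthonormal {n : ℕ} {U : Op n} (hU : U * Uᴴ = 1) (P P' : PauliString n) :
    ∑ Q, amp U P Q * amp U P' Q = if P = P' then 1 else 0 := by
  rw [← amp_one, ← hU, amp_mul]
  simp only [amp_conjTranspose]

/-- Conjugation by a unitary preserves the trace, so the identity component is neither created nor
destroyed. -/
lemma amp_zero_right {n : ℕ} {U : Op n} (hU : U * Uᴴ = 1) (P : PauliString n) :
    amp U P 0 = if P = 0 then 1 else 0 := by
  unfold amp coeff
  rw [pauliOp_zero, Matrix.mul_one, Matrix.trace_mul_comm, ← Matrix.mul_assoc, hU,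
    Matrix.one_mul, ← Matrix.mul_one (pauliOp P), ← pauliOp_zero]
  exact coeff_pauliOp P 0

lemma amp_zero_left {n : ℕ} {U : Op n} (hU : Uᴴ * U = 1) (Q : PauliString n) :
    amp U 0 Q = if Q = 0 then 1 else 0 := by
  rw [← amp_conjTranspose, amp_zero_right (by simpa using hU)]

lemma sum_push_sq {n : ℕ} {U : Op n} (hU : U * Uᴴ = 1) (f : PauliString n → ℝ) :
    ∑ Q, push U f Q ^ 2 = ∑ P, f P ^ 2 := by
  have : ∀ Q, push U f Q ^ 2 = ∑ P, ∑ P', f P * f P' * (amp U P Q * amp U P' Q) := by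
    intro Q
    rw [sq, push, Finset.sum_mul_sum]
    exact Finset.sum_congr rfl fun P _ => Finset.sum_congr rfl fun P' _ => by ring
  simp only [this]
  rw [Finset.sum_comm]
  refine Finset.sum_congr rfl fun P _ => ?_
  rw [Finset.sum_comm]
  simp only [← Finset.mul_sum, amp_row_orthonormal hU]
  simp [sq]

lemma push_one {n : ℕ} (f : PauliString n → ℝ) : push 1 f = f := by
  funext Q; simp [push, amp_one]

lemma push_mul {n : ℕ} (U V : Op n) (f : PauliString n → ℝ) :
    push (U * V) f = push V (push U f) := by
  funext Q
  simp only [push, amp_mul, Finset.mul_sum, Finset.sum_mul]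
  rw [Finset.sum_comm]
  exact Finset.sum_congr rfl fun P _ => Finset.sum_congr rfl fun P' _ => by ring

/-! ## Clifford unitaries -/

lemma IsClifford.amp_eq {n : ℕ} {U : Op n} (h : IsClifford U) (P : PauliString n) :
    ∃ Q, ∃ s : ℝ, s ^ 2 = 1 ∧ ∀ R, amp U P R = if R = Q then s else 0 := by
  obtain ⟨Q, hQ | hQ⟩ := h P
  · refine ⟨Q, 1, by norm_num, fun R => ?_⟩
    rw [amp, hQ, coeff_pauliOp]; simp only [eq_comm]
  · refine ⟨Q, -1, by norm_num, fun R => ?_⟩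
    rw [amp, hQ, coeff_neg, coeff_pauliOp]; simp only [eq_comm]; split_ifs <;> simp

/-- Row P of `amp U` has a single non-zero entry, so the arbitrary choice in `cliffordImage` is in
fact forced. -/
lemma cliffordImage_spec {n : ℕ} {U : Op n} (h : IsClifford U) (P R : PauliString n) :
    amp U P R ≠ 0 ↔ R = cliffordImage U P := by
  obtain ⟨Q, s, hs, hR⟩ := h.amp_eq P
  have hs0 : s ≠ 0 := by rintro rfl; norm_num at hs
  have hQ : ∀ R, amp U P R ≠ 0 ↔ R = Q := fun R => by rw [hR]; split_ifs <;> simp [*]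
  have : amp U P (cliffordImage U P) ≠ 0 :=
    Classical.epsilon_spec (p := fun Q => amp U P Q ≠ 0) ⟨Q, (hQ Q).2 rfl⟩
  rw [hQ] at this ⊢
  rw [this]

lemma amp_cliffordImage_sq {n : ℕ} {U : Op n} (h : IsClifford U) (P : PauliString n) :
    amp U P (cliffordImage U P) ^ 2 = 1 := by
  obtain ⟨Q, s, hs, hR⟩ := h.amp_eq P
  have := (cliffordImage_spec h P _).2 rfl
  rw [hR] at this ⊢
  split_ifs at this ⊢ with h1
  · exact hs
  · exact absurd rfl this

lemma isClifford_one {n : ℕ} : IsClifford (1 : Op n) := fun P => ⟨P, Or.inl (by simp)⟩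

lemma IsClifford.mul {n : ℕ} {U V : Op n} (hU : IsClifford U) (hV : IsClifford V) :
    IsClifford (U * V) := by
  intro P
  obtain ⟨Q, hQ⟩ := hU P
  obtain ⟨R, hR⟩ := hV Q
  refine ⟨R, ?_⟩
  have : (U * V)ᴴ * pauliOp P * (U * V) = Vᴴ * (Uᴴ * pauliOp P * U) * V := by
    rw [Matrix.conjTranspose_mul]; simp only [Matrix.mul_assoc]
  rw [this]
  rcases hQ with h | h <;> rcases hR with h' | h' <;> simp [h, h']

/-- Two rows of `amp U` whose only non-zero entries stood in the same column could not be
orthogonal. -/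
lemma cliffordImage_injective {n : ℕ} {U : Op n} (h : IsClifford U) (hU : U * Uᴴ = 1) :
    Function.Injective (cliffordImage U) := by
  intro P P' hP
  by_contra hne
  have h0 := amp_row_orthonormal hU P P'
  rw [if_neg hne, Finset.sum_eq_single (cliffordImage U P)] at h0
  · have h1 := (cliffordImage_spec h P _).2 rfl
    have h2 := (cliffordImage_spec h P' _).2 rfl
    rw [← hP] at h2
    exact mul_ne_zero h1 h2 h0
  · intro Q _ hQ
    rw [ne_eq, ← cliffordImage_spec h, not_not] at hQ
    rw [hQ, zero_mul]
  · simp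

/-- `cliffordImage U` is injective on a finite set, hence a permutation. So column P of `amp U`,
which is row P of `amp Uᴴ`, has a single non-zero entry, in the row of the preimage of P, and this
entry is 1 or -1. -/
lemma IsClifford.conjTranspose {n : ℕ} {U : Op n} (h : IsClifford U) (hU : U * Uᴴ = 1) :
    IsClifford Uᴴ := by
  intro P
  obtain ⟨Q, hQ⟩ := (Finite.injective_iff_surjective.1 (cliffordImage_injective h hU)) P
  refine ⟨Q, ?_⟩
  rw [conj_pauliOp]
  have key : ∀ R, amp Uᴴ P R = if R = Q then amp U Q P else 0 := by
    intro R
    rw [amp_conjTranspose]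
    split_ifs with hR
    · rw [hR]
    · by_contra h0
      rw [← ne_eq, cliffordImage_spec h, ← hQ] at h0
      exact hR (cliffordImage_injective h hU h0).symm
  have hs := amp_cliffordImage_sq h Q
  rw [hQ] at hs
  have e : ofCoeff (amp Uᴴ P) = (amp U Q P : ℂ) • pauliOp Q := by
    rw [ofCoeff, Finset.sum_eq_single Q]
    · rw [key, if_pos rfl]
    · intro R _ hR; rw [key, if_neg hR]; simp
    · simp
  rw [e]
  rcases (by simpa using hs : amp U Q P = 1 ∨ amp U Q P = -1) with h | h <;> simp [h]

/-! ## Local operators -/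

/-- `G` acts on the qubits in `S` only. -/
def LocalOn {n : ℕ} (S : Finset (Fin n)) (G : Op n) : Prop :=
  (∀ x y, G x y ≠ 0 → ∀ k, k ∉ S → x k = y k) ∧
  ∀ x y x' y', (∀ k ∈ S, x k = x' k ∧ y k = y' k) → (∀ k, k ∉ S → x k = y k) →
    (∀ k, k ∉ S → x' k = y' k) → G x y = G x' y'

/-- Off S the first factor cannot change a bit, and off T, in particular on S, the second cannot. So
only one intermediate basis state contributes. -/
lemma LocalOn.mul_apply {n : ℕ} {S T : Finset (Fin n)} {G H : Op n} (hG : LocalOn S G)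
    (hH : LocalOn T H) (hST : Disjoint S T) (x y : Fin n → Fin 2) :
    (G * H) x y = G x (fun k => if k ∈ S then y k else x k) *
      H (fun k => if k ∈ S then y k else x k) y := by
  rw [Matrix.mul_apply]
  refine Finset.sum_eq_single _ (fun z _ hz => ?_) (by simp)
  by_contra h0
  refine hz (funext fun k => ?_)
  have h1 := hG.1 x z (left_ne_zero_of_mul h0) k
  have h2 := hH.1 z y (right_ne_zero_of_mul h0) k
  split_ifs with hk
  · exact h2 (Finset.disjoint_left.1 hST hk)
  · exact (h1 hk).symm

lemma LocalOn.commute {n : ℕ} {S T : Finset (Fin n)} {G H : Op n} (hG : LocalOn S G)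
    (hH : LocalOn T H) (hST : Disjoint S T) : Commute G H := by
  unfold Commute SemiconjBy
  ext x y
  rw [hG.mul_apply hH hST, hH.mul_apply hG hST.symm, mul_comm]
  have hd := fun k (h : k ∈ S) => Finset.disjoint_left.1 hST h
  by_cases hxy : ∀ k, k ∉ S → k ∉ T → x k = y k
  · congr 1
    · refine hH.2 _ _ _ _ (fun k hk => ?_) (fun k hk => ?_) (fun k hk => ?_)
      · have := fun h => hd k h hk
        exact ⟨if_neg this, (if_pos hk).symm⟩
      · split_ifs with h
        · rfl
        · exact hxy k h hk
      · simp [hk]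
    · refine hG.2 _ _ _ _ (fun k hk => ?_) (fun k hk => ?_) (fun k hk => ?_)
      · simp [hk, hd k hk]
      · simp [hk]
      · split_ifs with h
        · rfl
        · exact hxy k hk h
  · push Not at hxy
    obtain ⟨k, hS, hT, hk⟩ := hxy
    have e1 : H (fun k => if k ∈ S then y k else x k) y = 0 := by
      by_contra h0
      exact hk (by simpa [hS] using hH.1 _ _ h0 k hT)
    have e2 : H x (fun k => if k ∈ T then y k else x k) *
        G (fun k => if k ∈ T then y k else x k) y = 0 := by
      by_contra h0
      exact hk (by simpa [hT] using hG.1 _ _ (right_ne_zero_of_mul h0) k hS)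
    rw [e1, e2, zero_mul]

lemma pauliOp_localOn {n : ℕ} {S : Finset (Fin n)} {P : PauliString n}
    (hP : ∀ k, k ∉ S → P k = 0) : LocalOn S (pauliOp P) := by
  have h1 : ∀ x y : Fin n → Fin 2, ∀ k, k ∉ S → x k = y k → pauliMat (P k) (x k) (y k) = 1 := by
    intro x y k hk h
    rw [hP k hk, h, pauliMat_zero, Matrix.one_apply_eq]
  constructor
  · intro x y h k hk
    by_contra hne
    refine h (show ∏ j, pauliMat (P j) (x j) (y j) = 0 from
      Finset.prod_eq_zero (Finset.mem_univ k) ?_)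
    rw [hP k hk, pauliMat_zero, Matrix.one_apply_ne hne]
  · intro x y x' y' hS h h'
    change ∏ j, pauliMat (P j) (x j) (y j) = ∏ j, pauliMat (P j) (x' j) (y' j)
    refine Finset.prod_congr rfl fun k _ => ?_
    by_cases hk : k ∈ S
    · rw [(hS k hk).1, (hS k hk).2]
    · rw [h1 x y k hk (h k hk), h1 x' y' k hk (h' k hk)]

lemma Gate.localOn {n : ℕ} (g : Gate n) : LocalOn g.support g.toOp := by
  cases g with
  | one j U =>
    refine ⟨fun x y h k hk => ?_, fun x y x' y' hS h h' => ?_⟩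
    · by_contra hne
      refine h (if_neg fun hc => hne (hc k ?_))
      simpa [Gate.support] using hk
    · have := hS j (by simp [Gate.support])
      simp only [Gate.toOp, Matrix.of_apply]
      rw [if_pos fun k hk => h k (by simpa [Gate.support] using hk),
        if_pos fun k hk => h' k (by simpa [Gate.support] using hk), this.1, this.2]
  | two i j hij U =>
    refine ⟨fun x y h k hk => ?_, fun x y x' y' hS h h' => ?_⟩
    · by_contra hne
      simp only [Gate.support, Finset.mem_insert, Finset.mem_singleton, not_or] at hk
      exact h (if_neg fun hc => hne (hc k hk.1 hk.2))
    · have h1 := hS i (by simp [Gate.support])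
      have h2 := hS j (by simp [Gate.support])
      simp only [Gate.toOp, Matrix.of_apply]
      rw [if_pos fun k hk hk' => h k (by simp [Gate.support, hk, hk']),
        if_pos fun k hk hk' => h' k (by simp [Gate.support, hk, hk']), h1.1, h1.2, h2.1, h2.2]

/-- Used with φ writing bits into the qubits of a gate: the sum over basis states in a product of
the gate with its adjoint becomes a sum over those bits. -/
lemma sum_ite_eq_sum_param {α β : Type*} [Fintype α] [Fintype β] (φ : β → α)
    (hφ : Function.Injective φ) (p : α → Prop) [DecidablePred p] (hp : ∀ z, p z ↔ ∃ b, φ b = z) (F : α → ℂ) :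
    ∑ z, (if p z then F z else 0) = ∑ b, F (φ b) := by
  rw [← Finset.sum_filter, ← Finset.sum_image (f := F) (g := φ) fun a _ b _ h => hφ h]
  refine Finset.sum_congr ?_ fun _ _ => rfl
  ext z
  simp [hp]

lemma Gate.toOp_mul_conjTranspose {n : ℕ} (g : Gate n) : g.toOp * g.toOpᴴ = 1 := by
  cases g with
  | one j U =>
    have hU : U.1 * U.1ᴴ = 1 := Matrix.mem_unitaryGroup_iff.1 U.2
    have hU' : ∀ a b, ∑ c, U.1 a c * star (U.1 b c) = if a = b then 1 else 0 := by
      intro a b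
      have := congrFun (congrFun hU a) b
      rwa [Matrix.mul_apply, Matrix.one_apply] at this
    ext x y
    simp only [Matrix.mul_apply, Matrix.conjTranspose_apply, Gate.toOp, Matrix.of_apply, ite_mul,
      zero_mul]
    rw [sum_ite_eq_sum_param (fun b => Function.update x j b) (Function.update_injective x j)]
    · by_cases h : ∀ k, k ≠ j → y k = x k
      · have : ∀ b, ∀ k, k ≠ j → y k = Function.update x j b k := by
          intro b k hk; rw [Function.update_of_ne hk]; exact h k hk
        simp only [Function.update_self, if_pos (this _), hU', Matrix.one_apply]
        congr 1
        refine propext ⟨fun hj => funext fun k => ?_, fun e => by rw [e]⟩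
        by_cases hk : k = j
        · rw [hk, hj]
        · exact (h k hk).symm
      · have : ∀ b, ¬ ∀ k, k ≠ j → y k = Function.update x j b k := by
          intro b hc
          exact h fun k hk => by simpa [Function.update_of_ne hk] using hc k hk
        simp only [if_neg (this _), star_zero, mul_zero, Finset.sum_const_zero]
        rw [Matrix.one_apply_ne]
        rintro rfl
        exact h fun _ _ => rfl
    · intro z
      constructor
      · intro h
        refine ⟨z j, funext fun k => ?_⟩
        by_cases hk : k = j
        · subst hk; simp
        · rw [Function.update_of_ne hk, h k hk]
      · rintro ⟨b, rfl⟩ k hk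
        rw [Function.update_of_ne hk]
  | two i j hij U =>
    have hU : U.1 * U.1ᴴ = 1 := Matrix.mem_unitaryGroup_iff.1 U.2
    have hU' : ∀ a b, ∑ c, U.1 a c * star (U.1 b c) = if a = b then 1 else 0 := by
      intro a b
      have := congrFun (congrFun hU a) b
      rwa [Matrix.mul_apply, Matrix.one_apply] at this
    ext x y
    let φ : Fin 2 × Fin 2 → Fin n → Fin 2 :=
      fun b => Function.update (Function.update x i b.1) j b.2
    have φi : ∀ b, φ b i = b.1 := fun b => by simp [φ, Function.update_of_ne hij]
    have φj : ∀ b, φ b j = b.2 := fun b => by simp [φ]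
    have φk : ∀ b k, k ≠ i → k ≠ j → φ b k = x k := fun b k h1 h2 => by
      simp [φ, Function.update_of_ne h1, Function.update_of_ne h2]
    simp only [Matrix.mul_apply, Matrix.conjTranspose_apply, Gate.toOp, Matrix.of_apply, ite_mul,
      zero_mul]
    rw [sum_ite_eq_sum_param φ (fun a b h => Prod.ext (by rw [← φi a, h, φi])
      (by rw [← φj a, h, φj]))]
    · by_cases h : ∀ k, k ≠ i → k ≠ j → y k = x k
      · have : ∀ b, ∀ k, k ≠ i → k ≠ j → y k = φ b k := by
          intro b k h1 h2; rw [φk b k h1 h2]; exact h k h1 h2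
        simp only [φi, φj, Prod.mk.eta, if_pos (this _), hU', Matrix.one_apply]
        congr 1
        refine propext ⟨fun hj => funext fun k => ?_, fun e => by rw [e]⟩
        by_cases hk : k = i
        · rw [hk]; exact congrArg Prod.fst hj
        · by_cases hk' : k = j
          · rw [hk']; exact congrArg Prod.snd hj
          · exact (h k hk hk').symm
      · have : ∀ b, ¬ ∀ k, k ≠ i → k ≠ j → y k = φ b k := by
          intro b hc
          exact h fun k h1 h2 => by rw [hc k h1 h2, φk b k h1 h2]
        simp only [if_neg (this _), star_zero, mul_zero, Finset.sum_const_zero]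
        rw [Matrix.one_apply_ne]
        rintro rfl
        exact h fun _ _ _ => rfl
    · intro z
      constructor
      · intro h
        refine ⟨(z i, z j), funext fun k => ?_⟩
        by_cases hk : k = i
        · rw [hk, φi]
        · by_cases hk' : k = j
          · rw [hk', φj]
          · rw [φk _ k hk hk', h k hk hk']
      · rintro ⟨b, rfl⟩ k h1 h2
        rw [φk b k h1 h2]

/-- The letters of `P` on `S`, with the identity elsewhere. -/
def resOn {n : ℕ} (S : Finset (Fin n)) (P : PauliString n) : PauliString n :=
  fun j => if j ∈ S then P j else 0

lemma tens_neg_at {n : ℕ} {M M' : Fin n → Matrix (Fin 2) (Fin 2) ℂ} (k : Fin n)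
    (hk : M' k = -M k) (h : ∀ j, j ≠ k → M' j = M j) : tens M' = -tens M := by
  ext x y
  simp only [tens, Matrix.of_apply, Matrix.neg_apply]
  rw [← Finset.mul_prod_erase _ _ (Finset.mem_univ k), ← Finset.mul_prod_erase _ _
    (Finset.mem_univ k), hk, Matrix.neg_apply, neg_mul]
  congr 2
  exact Finset.prod_congr rfl fun j hj => by rw [h j (Finset.ne_of_mem_erase hj)]

/-- Split off the letters P' of P outside S; they commute with G. If P and Q agree outside S, these
letters cancel against those of Q. If they differ at a qubit k, some one-qubit Pauli operator T at k
anticommutes with P' Q and commutes with everything local on S; conjugating by T shows that the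
trace is its own negative. -/
lemma amp_localOn {n : ℕ} {S : Finset (Fin n)} {G : Op n} (hG : LocalOn S G)
    (P Q : PauliString n) :
    amp G P Q = if ∀ k, k ∉ S → P k = Q k then amp G (resOn S P) (resOn S Q) else 0 := by
  set P' : PauliString n := fun j => if j ∈ S then 0 else P j with hP'
  have hdec : pauliOp P = pauliOp (resOn S P) * pauliOp P' := by
    simp only [pauliOp_eq_tens, tens_mul]
    congr 1
    funext j
    by_cases hj : j ∈ S <;> simp [resOn, hP', hj, pauliMat_zero]
  have hc : Commute G (pauliOp P') := by
    refine hG.commute (T := Sᶜ) (pauliOp_localOn fun k hk => ?_) disjoint_compl_right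
    simpa [hP'] using fun h => absurd h (by simpa using hk)
  have hA : Gᴴ * pauliOp P * G = Gᴴ * pauliOp (resOn S P) * G * pauliOp P' := by
    rw [hdec, Matrix.mul_assoc, Matrix.mul_assoc (pauliOp (resOn S P)), ← hc.eq]
    simp only [Matrix.mul_assoc]
  split_ifs with h
  · have : pauliOp P' * pauliOp Q = pauliOp (resOn S Q) := by
      simp only [pauliOp_eq_tens, tens_mul]
      congr 1
      funext j
      by_cases hj : j ∈ S
      · simp [resOn, hP', hj, pauliMat_zero]
      · simp [resOn, hP', hj, pauliMat_zero, h j hj, pauliMat_mul_self]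
    rw [amp, amp, hA, coeff, coeff, Matrix.mul_assoc _ (pauliOp P'), this]
  · push Not at h
    obtain ⟨k, hk, hne⟩ := h
    obtain ⟨r, hr⟩ := exists_pauliMat_anticomm hne
    set T : PauliString n := Pi.single k r with hT
    have hTl : LocalOn {k} (pauliOp T) := pauliOp_localOn fun j hj => by
      rw [hT, Pi.single_eq_of_ne (by simpa using hj)]
    have hd : Disjoint ({k} : Finset (Fin n)) S := by simpa using hk
    have c1 : Commute (pauliOp T) G := hTl.commute hG hd
    have c2 : Commute (pauliOp T) Gᴴ := by
      have := congrArg Matrix.conjTranspose c1.eq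
      simp only [Matrix.conjTranspose_mul, pauliOp_conjTranspose] at this
      exact this.symm
    have c3 : Commute (pauliOp T) (pauliOp (resOn S P)) :=
      hTl.commute (pauliOp_localOn fun k hk => by simp [resOn, hk]) hd
    have c4 : Commute (pauliOp T) (Gᴴ * pauliOp (resOn S P) * G) := (c2.mul_right c3).mul_right c1
    have hB : pauliOp T * (pauliOp P' * pauliOp Q) * pauliOp T = -(pauliOp P' * pauliOp Q) := by
      simp only [pauliOp_eq_tens, tens_mul]
      refine tens_neg_at k ?_ fun j hj => ?_
      · simpa [hT, hP', hk] using hr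
      · simp [hT, Pi.single_eq_of_ne hj, pauliMat_zero]
    have ht : (Gᴴ * pauliOp (resOn S P) * G * (pauliOp P' * pauliOp Q)).trace = 0 := by
      set A := Gᴴ * pauliOp (resOn S P) * G
      set B := pauliOp P' * pauliOp Q
      have : (A * B).trace = -(A * B).trace := by
        calc (A * B).trace = (pauliOp T * (pauliOp T * (A * B))).trace := by
              rw [← Matrix.mul_assoc (pauliOp T), pauliOp_mul_self, Matrix.one_mul]
          _ = (A * (pauliOp T * B * pauliOp T)).trace := by
              rw [Matrix.trace_mul_comm, ← Matrix.mul_assoc, c4.eq]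
              simp only [Matrix.mul_assoc]
          _ = -(A * B).trace := by rw [hB, Matrix.mul_neg, Matrix.trace_neg]
      exact self_eq_neg.1 this
    rw [amp, hA, coeff, Matrix.mul_assoc _ (pauliOp P'), ht]
    simp

lemma LocalOn.conjTranspose {n : ℕ} {S : Finset (Fin n)} {G : Op n} (hG : LocalOn S G) :
    LocalOn S Gᴴ := by
  refine ⟨fun x y h k hk => ?_, fun x y x' y' hS h h' => ?_⟩
  · rw [Matrix.conjTranspose_apply, star_ne_zero] at h
    exact (hG.1 y x h k hk).symm
  · simp only [Matrix.conjTranspose_apply]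
    rw [hG.2 y x y' x' (fun k hk => (hS k hk).symm) (fun k hk => (h k hk).symm)
      fun k hk => (h' k hk).symm]

lemma LocalOn.amp_ne_zero {n : ℕ} {S : Finset (Fin n)} {G : Op n} (hG : LocalOn S G)
    {P Q : PauliString n} (h : amp G P Q ≠ 0) {k : Fin n} (hk : k ∉ S) : P k = Q k := by
  rw [amp_localOn hG] at h
  by_contra hne
  exact h (if_neg fun hc => hne (hc k hk))

/-- `U`, or its adjoint if `dir` is true. -/
def dirOp {n : ℕ} (dir : Bool) (U : Op n) : Op n := if dir then Uᴴ else U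

lemma dirOp_one {n : ℕ} (dir : Bool) : dirOp dir (1 : Op n) = 1 := by cases dir <;> simp [dirOp]

lemma LocalOn.dirOp {n : ℕ} {S : Finset (Fin n)} {G : Op n} (hG : LocalOn S G) (dir : Bool) :
    LocalOn S (dirOp dir G) := by
  cases dir
  · exact hG
  · exact hG.conjTranspose

lemma dirOp_mul {n : ℕ} (dir : Bool) {U V : Op n} (h : Commute U V) :
    dirOp dir (U * V) = dirOp dir U * dirOp dir V := by
  cases dir
  · rfl
  · simp only [dirOp, if_true]; rw [h.eq, Matrix.conjTranspose_mul]

lemma Commute.dirOp {n : ℕ} (dir : Bool) {U V : Op n} (h : Commute U V) :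
    Commute (dirOp dir U) (dirOp dir V) := by
  cases dir
  · exact h
  · simp only [NoisySim.dirOp, if_true]
    have := congrArg Matrix.conjTranspose h.eq
    simp only [Matrix.conjTranspose_mul] at this
    exact this.symm

lemma dirOp_mul_conjTranspose {n : ℕ} (dir : Bool) {U : Op n} (h : U * Uᴴ = 1) :
    dirOp dir U * (dirOp dir U)ᴴ = 1 := by
  cases dir
  · exact h
  · simpa [dirOp] using mul_eq_one_comm.1 h

lemma amp_dirOp {n : ℕ} (dir : Bool) (U : Op n) (P Q : PauliString n) :
    amp (dirOp dir U) P Q = if dir then amp U Q P else amp U P Q := by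
  cases dir
  · rfl
  · simp [dirOp, amp_conjTranspose]

lemma IsClifford.dirOp {n : ℕ} {U : Op n} (h : IsClifford U) (hU : U * Uᴴ = 1) (dir : Bool) :
    IsClifford (dirOp dir U) := by
  cases dir
  · exact h
  · exact h.conjTranspose hU

/-! ## Layers as sequences of gates -/

/-- The gates act on pairwise disjoint sets of qubits. -/
abbrev DisjointGates {n : ℕ} (G : List (Gate n)) : Prop :=
  G.Pairwise fun g h => Disjoint g.support h.support

/-- The gate on qubit `j`, if any. -/
def gateOn {n : ℕ} (G : List (Gate n)) (j : ℕ) : Option (Gate n) :=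
  G.find? fun g => decide (j ∈ g.support.image Fin.val)

/-- The smallest qubit of a gate. -/
def Gate.low {n : ℕ} : Gate n → Fin n
  | .one j _ => j
  | .two i j _ _ => min i j

lemma Gate.low_mem {n : ℕ} (g : Gate n) : g.low ∈ g.support := by
  cases g with
  | one j U => simp [Gate.low, Gate.support]
  | two i j h U => simp only [Gate.low, Gate.support]; rcases min_choice i j with e | e <;> simp [e]

lemma Gate.partner_lt_iff {n : ℕ} (g : Gate n) {k : Fin n} (hk : k ∈ g.support) :
    g.partner k < k ↔ k ≠ g.low := by
  cases g with
  | one j U => simp [Gate.partner, Gate.low, Gate.support] at hk ⊢; exact hk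
  | two i j h U =>
    simp only [Gate.support, Finset.mem_insert, Finset.mem_singleton] at hk
    have h' : i.val ≠ j.val := fun e => h (Fin.ext e)
    simp only [Gate.partner, Gate.low, ne_eq, Fin.ext_iff]
    rcases hk with rfl | rfl
    · rw [if_pos rfl, Fin.coe_min]; omega
    · rw [if_neg h', Fin.coe_min]; omega

lemma Gate.mem_support_iff {n : ℕ} (g : Gate n) {k : Fin n} (hk : k ∈ g.support) (i : Fin n) :
    i ∈ g.support ↔ i.val = k.val ∨ i.val = g.partner k := by
  cases g with
  | one j U =>
    simp [Gate.partner, Gate.support] at hk ⊢; rw [hk, Fin.ext_iff]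
  | two a b h U =>
    simp only [Gate.support, Finset.mem_insert, Finset.mem_singleton] at hk ⊢
    have h' : a.val ≠ b.val := fun e => h (Fin.ext e)
    simp only [Gate.partner, Fin.ext_iff]
    rcases hk with rfl | rfl
    · rw [if_pos rfl]
    · rw [if_neg h']; exact or_comm

lemma Gate.partner_lt {n : ℕ} (g : Gate n) {k : Fin n} (hk : k ∈ g.support) :
    g.partner k < n := by
  cases g with
  | one j U => exact k.2
  | two a b h U => simp only [Gate.partner]; split_ifs <;> exact Fin.is_lt _

lemma gateOn_some {n : ℕ} {G : List (Gate n)} {j : ℕ} {g : Gate n} (h : gateOn G j = some g) :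
    g ∈ G ∧ ∃ k : Fin n, k.val = j ∧ k ∈ g.support := by
  refine ⟨List.mem_of_find?_eq_some h, ?_⟩
  have := List.find?_some h
  simp only [decide_eq_true_eq, Finset.mem_image] at this
  obtain ⟨k, hk, e⟩ := this
  exact ⟨k, e, hk⟩

/-- The unitary of the gate whose smallest qubit is `j`, if any, and the identity otherwise. -/
def stepOp {n : ℕ} (G : List (Gate n)) (j : ℕ) : Op n :=
  match gateOn G j with
  | none => 1
  | some g => if g.partner j < j then 1 else g.toOp

/-- The qubits of the gate whose smallest qubit is `j`. -/
def stepSupp {n : ℕ} (G : List (Gate n)) (j : ℕ) : Finset (Fin n) :=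
  match gateOn G j with
  | none => ∅
  | some g => if g.partner j < j then ∅ else g.support

/-- Whether the gate whose smallest qubit is `j` is non-Clifford and acts on the support of `P`. -/
def stepTouch {n : ℕ} (G : List (Gate n)) (j : ℕ) (P : PauliString n) : ℕ :=
  match gateOn G j with
  | none => 0
  | some g => if g.partner j < j then 0
    else if ¬ IsClifford g.toOp ∧ ∃ k ∈ g.support, P k ≠ 0 then 1 else 0

lemma gateOn_cons {n : ℕ} (g : Gate n) (G : List (Gate n)) (j : ℕ) :
    gateOn (g :: G) j = if j ∈ g.support.image Fin.val then some g else gateOn G j := by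
  unfold gateOn
  rw [List.find?_cons]
  split_ifs with h <;> simp [h]

lemma gateOn_eq_none {n : ℕ} {g : Gate n} {G : List (Gate n)} (h : DisjointGates (g :: G))
    {k : Fin n} (hk : k ∈ g.support) : gateOn G k = none := by
  by_contra hne
  obtain ⟨g', hg'⟩ := Option.ne_none_iff_exists'.1 hne
  obtain ⟨hm, k', e, hk'⟩ := gateOn_some hg'
  rw [Fin.val_injective e] at hk'
  exact Finset.disjoint_left.1 ((List.pairwise_cons.1 h).1 g' hm) hk hk'

/-- How a quantity defined by the gate with smallest qubit `j` changes with a new gate. -/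
lemma step_cons {α : Type*} {n : ℕ} {g : Gate n} {G : List (Gate n)}
    (h : DisjointGates (g :: G)) (F : Gate n → α) (z : α) (j : ℕ) :
    (match gateOn (g :: G) j with
      | none => z
      | some g => if g.partner j < j then z else F g) =
    if j = g.low then F g else
      match gateOn G j with
      | none => z
      | some g => if g.partner j < j then z else F g := by
  rw [gateOn_cons]
  by_cases hj : j ∈ g.support.image Fin.val
  · rw [if_pos hj]
    obtain ⟨k, hk, rfl⟩ := Finset.mem_image.1 hj
    rw [gateOn_eq_none h hk]
    have := g.partner_lt_iff hk
    simp only [this, ne_eq, Fin.ext_iff]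
    by_cases e : k.val = g.low.val <;> simp [e]
  · rw [if_neg hj, if_neg]
    rintro rfl
    exact hj (Finset.mem_image_of_mem _ g.low_mem)

lemma low_gateOn_none {α : Type*} {n : ℕ} {g : Gate n} {G : List (Gate n)}
    (h : DisjointGates (g :: G)) (F : Gate n → α) (z : α) :
    (match gateOn G g.low with
      | none => z
      | some g' => if g'.partner g.low < g.low then z else F g') = z := by
  rw [gateOn_eq_none h g.low_mem]

lemma prod_range_update {M : Type*} [Monoid M] {f f' : ℕ → M} {m n : ℕ} {x : M} (hm : m < n)
    (h : ∀ j, j ≠ m → f' j = f j) (h1 : f m = 1) (h2 : f' m = x) (hx : ∀ j, Commute x (f j)) :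
    ((List.range n).map f').prod = x * ((List.range n).map f).prod := by
  induction n with
  | zero => omega
  | succ n ih =>
    simp only [List.range_succ, List.map_append, List.prod_append, List.map_cons, List.map_nil,
      List.prod_singleton]
    rcases Nat.lt_succ_iff_lt_or_eq.1 hm with hlt | rfl
    · rw [ih hlt, h n (by omega), mul_assoc]
    · have e : (List.range m).map f' = (List.range m).map f :=
        List.map_congr_left fun j hj => h j (by simpa using (List.mem_range.1 hj).ne)
      rw [e, h2, h1, mul_one]
      refine ((Commute.list_prod_right _ _ fun y hy => ?_).eq).symm
      obtain ⟨j, _, rfl⟩ := List.mem_map.1 hy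
      exact hx j

lemma gate_commute_stepOp {n : ℕ} {g : Gate n} {G : List (Gate n)} (h : DisjointGates (g :: G))
    (j : ℕ) : Commute g.toOp (stepOp G j) := by
  unfold stepOp
  split
  · exact Commute.one_right _
  · rename_i g' hg'
    split_ifs
    · exact Commute.one_right _
    · exact g.localOn.commute g'.localOn ((List.pairwise_cons.1 h).1 g' (gateOn_some hg').1)

lemma gate_commute_prod {n : ℕ} {g : Gate n} {G : List (Gate n)} (h : DisjointGates (g :: G)) :
    Commute g.toOp (G.map Gate.toOp).prod := by
  refine Commute.list_prod_right _ _ fun y hy => ?_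
  obtain ⟨g', hg', rfl⟩ := List.mem_map.1 hy
  exact g.localOn.commute g'.localOn ((List.pairwise_cons.1 h).1 g' hg')

/-- The product of the first `m` gates, in the order of their smallest qubits. -/
def partialOp {n : ℕ} (dir : Bool) (G : List (Gate n)) (m : ℕ) : Op n :=
  ((List.range m).map fun j => dirOp dir (stepOp G j)).prod

/-- The gates commute because their supports are disjoint, and so do their adjoints. The product may
therefore be taken in the order in which a scan of the qubits meets the gates, each one at its
smallest qubit; this is what the program does. -/
lemma dirOp_prod_gates {n : ℕ} (dir : Bool) {G : List (Gate n)} (h : DisjointGates G) :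
    dirOp dir (G.map Gate.toOp).prod = partialOp dir G n := by
  unfold partialOp
  induction G with
  | nil => simp [stepOp, gateOn, dirOp_one]
  | cons g G ih =>
    have hs := fun j => step_cons h Gate.toOp (1 : Op n) j
    rw [List.map_cons, List.prod_cons, dirOp_mul dir (gate_commute_prod h),
      ih (List.pairwise_cons.1 h).2]
    refine (prod_range_update (f := fun j => dirOp dir (stepOp G j)) g.low.2 (fun j hj => ?_)
      ?_ ?_ fun j => ?_).symm
    · exact congrArg _ ((hs j).trans (if_neg hj))
    · have := low_gateOn_none h Gate.toOp (1 : Op n)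
      change dirOp dir (stepOp G g.low) = 1
      rw [show stepOp G g.low = 1 from this, dirOp_one]
    · exact congrArg _ ((hs g.low).trans (if_pos rfl))
    · exact Commute.dirOp dir (gate_commute_stepOp h j)

lemma sum_range_update {f f' : ℕ → ℕ} {m n : ℕ} (hm : m < n)
    (h : ∀ j, j ≠ m → f' j = f j) (h1 : f m = 0) :
    ∑ j ∈ Finset.range n, f' j = f' m + ∑ j ∈ Finset.range n, f j := by
  rw [← Finset.add_sum_erase _ _ (Finset.mem_range.2 hm),
    ← Finset.add_sum_erase _ f (Finset.mem_range.2 hm), h1, zero_add]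
  congr 1
  exact Finset.sum_congr rfl fun j hj => h j (Finset.ne_of_mem_erase hj)

lemma sum_stepTouch {n : ℕ} {G : List (Gate n)} (h : DisjointGates G) (P : PauliString n) :
    ∑ j ∈ Finset.range n, stepTouch G j P =
      (G.filter fun g => decide (¬ IsClifford g.toOp ∧ ∃ j ∈ g.support, P j ≠ 0)).length := by
  induction G with
  | nil => simp [stepTouch, gateOn]
  | cons g G ih =>
    have hs := fun j => step_cons h (fun g =>
      if ¬ IsClifford g.toOp ∧ ∃ k ∈ g.support, P k ≠ 0 then 1 else 0) 0 j
    have h0 := low_gateOn_none h (fun g =>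
      if ¬ IsClifford g.toOp ∧ ∃ k ∈ g.support, P k ≠ 0 then 1 else 0) 0
    rw [sum_range_update (f := fun j => stepTouch G j P) (f' := fun j => stepTouch (g :: G) j P) g.low.2
      (fun j hj => (hs j).trans (if_neg hj)) h0, ih (List.pairwise_cons.1 h).2]
    have e := (hs g.low).trans (if_pos rfl)
    rw [show stepTouch (g :: G) g.low P = _ from e, List.filter_cons]
    split_ifs with h1 h2 h2
    · rw [List.length_cons, add_comm]
    · simp [h1] at h2
    · simp only [decide_eq_true_eq] at h2; exact absurd h2 h1
    · rw [zero_add]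

lemma stepOp_localOn {n : ℕ} (G : List (Gate n)) (j : ℕ) : LocalOn (stepSupp G j) (stepOp G j) := by
  have h1 : LocalOn ∅ (1 : Op n) := by
    rw [← pauliOp_zero]; exact pauliOp_localOn fun _ _ => rfl
  unfold stepOp stepSupp
  split
  · exact h1
  · split_ifs
    · exact h1
    · exact Gate.localOn _

lemma stepSupp_disjoint {n : ℕ} {G : List (Gate n)} (h : DisjointGates G) {i j : ℕ}
    (hij : i ≠ j) : Disjoint (stepSupp G i) (stepSupp G j) := by
  unfold stepSupp
  split
  · simp
  · rename_i g hg
    split_ifs with h1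
    · simp
    · split
      · simp
      · rename_i g' hg'
        split_ifs with h2
        · simp
        · obtain ⟨hm, k, rfl, hk⟩ := gateOn_some hg
          obtain ⟨hm', k', rfl, hk'⟩ := gateOn_some hg'
          rw [g.partner_lt_iff hk, not_not] at h1
          rw [g'.partner_lt_iff hk', not_not] at h2
          have : Std.Symm fun g h : Gate n => Disjoint g.support h.support :=
            ⟨fun _ _ h => h.symm⟩
          refine h.forall hm hm' ?_
          rintro rfl
          exact hij (by rw [h1, h2])

lemma stepTouch_congr {n : ℕ} (G : List (Gate n)) (j : ℕ) {P Q : PauliString n}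
    (h : ∀ k ∈ stepSupp G j, P k = Q k) : stepTouch G j P = stepTouch G j Q := by
  unfold stepTouch
  unfold stepSupp at h
  split
  · rfl
  · rename_i g hg
    rw [hg] at h
    split_ifs with h1 h2 h3 h3
    · rfl
    · rfl
    · simp only [h1, if_false] at h
      obtain ⟨hc, k, hk, h0⟩ := h2
      exact absurd ⟨hc, k, hk, by rwa [← h k hk]⟩ h3
    · simp only [h1, if_false] at h
      obtain ⟨hc, k, hk, h0⟩ := h3
      exact absurd ⟨hc, k, hk, by rwa [h k hk]⟩ h2
    · rfl

lemma partialOp_succ {n : ℕ} (dir : Bool) (G : List (Gate n)) (m : ℕ) :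
    partialOp dir G (m + 1) = partialOp dir G m * dirOp dir (stepOp G m) := by
  simp [partialOp, List.range_succ]

lemma partialOp_amp_ne_zero {n : ℕ} (dir : Bool) (G : List (Gate n)) (m : ℕ)
    {P Q : PauliString n} (h : amp (partialOp dir G m) P Q ≠ 0) {k : Fin n}
    (hk : ∀ j < m, k ∉ stepSupp G j) : P k = Q k := by
  induction m generalizing Q with
  | zero =>
    simp only [partialOp, List.range_zero, List.map_nil, List.prod_nil, amp_one] at h
    by_cases e : P = Q
    · rw [e]
    · exact absurd (if_neg e) h
  | succ m ih =>
    rw [partialOp_succ, amp_mul] at h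
    obtain ⟨R, _, hR⟩ := Finset.exists_ne_zero_of_sum_ne_zero h
    rw [ih (left_ne_zero_of_mul hR) fun j hj => hk j (by omega)]
    exact ((stepOp_localOn G m).dirOp dir).amp_ne_zero (right_ne_zero_of_mul hR) (hk m (by omega))

/-- A sum with at most one non-zero term. -/
lemma sum_apply_of_subsingleton {α : Type*} [Fintype α] (u : α → ℝ)
    (hu : ∀ a b, u a ≠ 0 → u b ≠ 0 → a = b) (ψ : ℝ → ℝ) :
    (∑ a, if u a ≠ 0 then ψ (u a) else 0) = if ∑ a, u a ≠ 0 then ψ (∑ a, u a) else 0 := by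
  by_cases h : ∃ a, u a ≠ 0
  · obtain ⟨a, ha⟩ := h
    have h0 : ∀ b, b ≠ a → u b = 0 := fun b hb => by
      by_contra hc
      exact hb (hu b a hc ha)
    rw [Finset.sum_eq_single a (fun b _ hb => by rw [if_neg (by simp [h0 b hb])]) (by simp),
      Finset.sum_eq_single a (fun b _ hb => h0 b hb) (by simp)]
  · push Not at h
    simp [h]

/-- Two paths through the gates in order with the same ends coincide. -/
lemma partialOp_path_unique {n : ℕ} (dir : Bool) {G : List (Gate n)} (h : DisjointGates G) (m : ℕ)
    (P Q : PauliString n) {R : PauliString n}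
    (hR : amp (partialOp dir G m) P R * amp (dirOp dir (stepOp G m)) R Q ≠ 0) :
    R = fun k => if k ∈ stepSupp G m then P k else Q k := by
  funext k
  split_ifs with hk
  · refine (partialOp_amp_ne_zero dir G m (left_ne_zero_of_mul hR) fun j hj hc => ?_).symm
    exact Finset.disjoint_left.1 (stepSupp_disjoint h (ne_of_lt hj)) hc hk
  · exact ((stepOp_localOn G m).dirOp dir).amp_ne_zero (right_ne_zero_of_mul hR) hk

/-! ## Tables of weighted Pauli operators and the gate-by-gate expansion -/

/-- An entry of a table: a Pauli operator with two counters and a coefficient. -/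
structure Entry (n : ℕ) where
  P : PauliString n
  a : ℕ
  b : ℕ
  c : ℝ

/-- The sum of a function over a table. -/
def sumE {n : ℕ} (φ : Entry n → ℝ) (l : List (Entry n)) : ℝ := (l.map φ).sum

@[simp] lemma sumE_nil {n : ℕ} (φ : Entry n → ℝ) : sumE φ [] = 0 := rfl

@[simp] lemma sumE_cons {n : ℕ} (φ : Entry n → ℝ) (e : Entry n) (l : List (Entry n)) :
    sumE φ (e :: l) = φ e + sumE φ l := rfl

@[simp] lemma sumE_append {n : ℕ} (φ : Entry n → ℝ) (l l' : List (Entry n)) :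
    sumE φ (l ++ l') = sumE φ l + sumE φ l' := by simp [sumE]

lemma sumE_flatMap {n : ℕ} (φ : Entry n → ℝ) (f : Entry n → List (Entry n))
    (l : List (Entry n)) : sumE φ (l.flatMap f) = sumE (fun e => sumE φ (f e)) l := by
  induction l with
  | nil => rfl
  | cons e l ih => simp [ih]

lemma sumE_congr {n : ℕ} {φ ψ : Entry n → ℝ} {l : List (Entry n)} (h : ∀ e ∈ l, φ e = ψ e) :
    sumE φ l = sumE ψ l := by
  unfold sumE; rw [List.map_congr_left h]

lemma sumE_mono {n : ℕ} {φ ψ : Entry n → ℝ} {l : List (Entry n)} (h : ∀ e ∈ l, φ e ≤ ψ e) :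
    sumE φ l ≤ sumE ψ l := List.sum_le_sum h

lemma sumE_one {n : ℕ} (l : List (Entry n)) : sumE (fun _ => 1) l = l.length := by
  simp [sumE]

lemma sumE_const_mul {n : ℕ} (φ : Entry n → ℝ) (r : ℝ) (l : List (Entry n)) :
    sumE (fun e => r * φ e) l = r * sumE φ l := by
  induction l with
  | nil => simp
  | cons e l ih => simp [ih, mul_add]

lemma sumE_flatMap_range {n : ℕ} (φ : Entry n → ℝ) (f : ℕ → List (Entry n)) (m : ℕ) :
    sumE φ ((List.range m).flatMap f) = ∑ i ∈ Finset.range m, sumE φ (f i) := by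
  induction m with
  | zero => rfl
  | succ m ih => simp [List.range_succ, Finset.sum_range_succ, ih]

/-- Membership is read off from the sum of an indicator, so that the identities for `sumE` with
arbitrary test functions also determine which entries occur. -/
lemma mem_iff_sumE {n : ℕ} (l : List (Entry n)) (p : Entry n → Prop) :
    (∃ e ∈ l, p e) ↔ 0 < sumE (fun e => if p e then 1 else 0) l := by
  induction l with
  | nil => simp
  | cons e l ih =>
    have h0 : 0 ≤ sumE (fun e => if p e then 1 else 0) l :=
      List.sum_nonneg fun x hx => by
        obtain ⟨e, _, rfl⟩ := List.mem_map.1 hx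
        split_ifs <;> norm_num
    rw [List.exists_mem_cons_iff, ih, sumE_cons]
    by_cases h : p e
    · simp only [h, if_true, true_or, true_iff]; linarith
    · simp [h]

/-- The letter of `P` at a qubit given by its number. -/
def letter {n : ℕ} (P : PauliString n) (j : ℕ) : ℕ := if h : j < n then (P ⟨j, h⟩).val else 0

/-- `P` with the letter at qubit `j` replaced. -/
def setLetter {n : ℕ} (P : PauliString n) (j : ℕ) (x : ℕ) : PauliString n :=
  fun k => if k.val = j then Fin.ofNat 4 x else P k

/-- The transition amplitude of a gate (or of its inverse), on its qubits. -/
def gateAmp {n : ℕ} (dir : Bool) (g : Gate n) (P Q : PauliString n) : ℝ :=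
  if dir then amp g.toOp (g.restrict Q) (g.restrict P) else amp g.toOp (g.restrict P) (g.restrict Q)

/-- Replaces an entry by its images under the gate whose smallest qubit is `j`; the first counter
counts non-Clifford gates that were met, and may not exceed `ℓ`. -/
def stage {n : ℕ} (dir : Bool) (G : List (Gate n)) (ℓ j : ℕ) (e : Entry n) : List (Entry n) :=
  match gateOn G j with
  | none => [e]
  | some g =>
    if g.partner j < j ∨ (letter e.P j = 0 ∧ letter e.P (g.partner j) = 0) then [e]
    else if e.a + (if IsClifford g.toOp then 0 else 1) ≤ ℓ then
      (List.range 4).flatMap fun x => (List.range 4).flatMap fun y =>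
        if (g.partner j ≠ j ∨ x = y) ∧
            gateAmp dir g e.P (setLetter (setLetter e.P j x) (g.partner j) y) ≠ 0 then
          [⟨setLetter (setLetter e.P j x) (g.partner j) y,
            e.a + (if IsClifford g.toOp then 0 else 1), e.b,
            e.c * gateAmp dir g e.P (setLetter (setLetter e.P j x) (g.partner j) y)⟩]
        else []
    else []

/-- The images of the entries of a table under a layer with gates `G`. -/
def expandTo {n : ℕ} (dir : Bool) (G : List (Gate n)) (ℓ m : ℕ) (l : List (Entry n)) :
    List (Entry n) :=
  (List.range m).foldl (fun l j => l.flatMap (stage dir G ℓ j)) l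

lemma expandTo_succ {n : ℕ} (dir : Bool) (G : List (Gate n)) (ℓ m : ℕ) (l : List (Entry n)) :
    expandTo dir G ℓ (m + 1) l = (expandTo dir G ℓ m l).flatMap (stage dir G ℓ m) := by
  simp [expandTo, List.range_succ]

lemma stage_a_le {n : ℕ} {dir : Bool} {G : List (Gate n)} {ℓ j : ℕ} {e e' : Entry n}
    (he : e.a ≤ ℓ) (h : e' ∈ stage dir G ℓ j e) : e'.a ≤ ℓ := by
  unfold stage at h
  split at h
  · simp at h; rwa [h]
  · rename_i g hg
    by_cases h1 : g.partner j < j ∨ (letter e.P j = 0 ∧ letter e.P (g.partner j) = 0)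
    · rw [if_pos h1, List.mem_singleton] at h; rwa [h]
    · rw [if_neg h1] at h
      by_cases h2 : e.a + (if IsClifford g.toOp then 0 else 1) ≤ ℓ
      · rw [if_pos h2] at h
        simp only [List.mem_flatMap] at h
        obtain ⟨x, _, y, _, h⟩ := h
        by_cases h3 : (g.partner j ≠ j ∨ x = y) ∧
            gateAmp dir g e.P (setLetter (setLetter e.P j x) (g.partner j) y) ≠ 0
        · rw [if_pos h3, List.mem_singleton] at h; rw [h]; exact h2
        · rw [if_neg h3] at h; simp at h
      · rw [if_neg h2] at h; simp at h

lemma expandTo_a_le {n : ℕ} {dir : Bool} {G : List (Gate n)} {ℓ m : ℕ} {l : List (Entry n)}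
    (hl : ∀ e ∈ l, e.a ≤ ℓ) : ∀ e ∈ expandTo dir G ℓ m l, e.a ≤ ℓ := by
  induction m with
  | zero => exact hl
  | succ m ih =>
    intro e he
    rw [expandTo_succ, List.mem_flatMap] at he
    obtain ⟨e', he', h⟩ := he
    exact stage_a_le (ih e' he') h

lemma sum_range_four (F : Fin 4 → ℝ) :
    ∑ x ∈ Finset.range 4, F (Fin.ofNat 4 x) = ∑ x, F x := by
  simp [Finset.sum_range_succ, Fin.sum_univ_four]
  rfl

/-- An image of P can differ from P only at j and at its partner p, so it is determined by its two
letters there. For a one-qubit gate p = j and the second letter overwrites the first; the condition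
x = y then keeps every image just once. -/
lemma stage_touched_sum {n : ℕ} (dir : Bool) (g : Gate n) {j : Fin n} (hj : j ∈ g.support)
    (P : PauliString n) (F : PauliString n → ℝ → ℝ) :
    (∑ x ∈ Finset.range 4, ∑ y ∈ Finset.range 4,
      if (g.partner j ≠ j ∨ x = y) ∧
          gateAmp dir g P (setLetter (setLetter P j x) (g.partner j) y) ≠ 0 then
        F (setLetter (setLetter P j x) (g.partner j) y)
          (gateAmp dir g P (setLetter (setLetter P j x) (g.partner j) y)) else 0) =
    ∑ Q, if amp (dirOp dir g.toOp) P Q ≠ 0 then F Q (amp (dirOp dir g.toOp) P Q) else 0 := by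
  obtain ⟨p, hp⟩ : ∃ p : Fin n, p.val = g.partner j := ⟨⟨_, g.partner_lt hj⟩, rfl⟩
  have hsupp : ∀ i, i ∈ g.support ↔ i = j ∨ i = p := fun i => by
    rw [g.mem_support_iff hj, ← hp, Fin.ext_iff, Fin.ext_iff]
  have hamp : ∀ Q, (∀ k, k ∉ g.support → P k = Q k) →
      amp (dirOp dir g.toOp) P Q = gateAmp dir g P Q := by
    intro Q hQ
    rw [amp_dirOp, gateAmp]
    cases dir
    · exact (amp_localOn g.localOn P Q).trans (if_pos hQ)
    · exact (amp_localOn g.localOn Q P).trans (if_pos fun k hk => (hQ k hk).symm)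
  have hset : ∀ (x y : Fin 4) k, setLetter (setLetter P j x) p y k =
      if k = p then y else if k = j then x else P k := by
    intro x y k
    simp only [setLetter, Fin.ext_iff]
    split_ifs <;> simp
  simp only [← hp]
  let H : Fin 4 → Fin 4 → ℝ := fun x y =>
    if (p ≠ j ∨ x = y) ∧ gateAmp dir g P (setLetter (setLetter P j x) p y) ≠ 0 then
      F (setLetter (setLetter P j x) p y) (gateAmp dir g P (setLetter (setLetter P j x) p y)) else 0
  have e1 : ∀ x ∈ Finset.range 4, ∀ y ∈ Finset.range 4,
      (if (p.val ≠ j ∨ x = y) ∧ gateAmp dir g P (setLetter (setLetter P j x) p y) ≠ 0 then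
        F (setLetter (setLetter P j x) p y)
          (gateAmp dir g P (setLetter (setLetter P j x) p y)) else 0) =
      H (Fin.ofNat 4 x) (Fin.ofNat 4 y) := by
    intro x hx y hy
    have hx' := Finset.mem_range.1 hx
    have hy' := Finset.mem_range.1 hy
    have ex : ((Fin.ofNat 4 x : Fin 4) : ℕ) = x := Nat.mod_eq_of_lt hx'
    have ey : ((Fin.ofNat 4 y : Fin 4) : ℕ) = y := Nat.mod_eq_of_lt hy'
    simp only [H, ex, ey, Fin.ext_iff, ne_eq]
  rw [Finset.sum_congr rfl fun x hx => Finset.sum_congr rfl fun y hy => e1 x hx y hy]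
  rw [sum_range_four fun x => ∑ y ∈ Finset.range 4, H x (Fin.ofNat 4 y)]
  simp only [sum_range_four]
  rw [← Finset.sum_product', Finset.univ_product_univ]
  simp only [H]
  rw [← Finset.sum_filter, ← Finset.sum_filter]
  refine Finset.sum_bij' (fun q _ => setLetter (setLetter P j q.1) p q.2)
    (fun Q _ => (Q j, Q p)) ?_ ?_ ?_ ?_ ?_
  · intro q hq
    rw [Finset.mem_filter] at hq ⊢
    refine ⟨Finset.mem_univ _, ?_⟩
    rw [hamp _ fun k hk => ?_]
    · exact hq.2.2
    · rw [hsupp, not_or] at hk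
      rw [hset, if_neg hk.2, if_neg hk.1]
  · intro Q hQ
    rw [Finset.mem_filter] at hQ ⊢
    have hloc : ∀ k, k ∉ g.support → P k = Q k := fun k hk =>
      (g.localOn.dirOp dir).amp_ne_zero hQ.2 hk
    have e : setLetter (setLetter P j (Q j)) p (Q p) = Q := by
      funext k
      rw [hset]
      split_ifs with h1 h2
      · rw [h1]
      · rw [h2]
      · exact hloc k (by rw [hsupp]; tauto)
    refine ⟨Finset.mem_univ _, ?_, ?_⟩
    · by_cases h : p = j
      · right; simp [h]
      · exact Or.inl h
    · dsimp only
      rw [e, ← hamp Q hloc]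
      exact hQ.2
  · rintro ⟨x, y⟩ hq
    rw [Finset.mem_filter] at hq
    refine Prod.ext ?_ ?_
    · dsimp only
      rw [hset]
      split_ifs with h
      · rcases hq.2.1 with h' | h'
        · exact absurd h.symm h'
        · exact h'.symm
      · rfl
      · exact absurd rfl ‹_›
    · dsimp only; rw [hset, if_pos rfl]
  · intro Q hQ
    rw [Finset.mem_filter] at hQ
    have hloc : ∀ k, k ∉ g.support → P k = Q k := fun k hk =>
      (g.localOn.dirOp dir).amp_ne_zero hQ.2 hk
    funext k
    rw [hset]
    split_ifs with h1 h2
    · rw [h1]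
    · rw [h2]
    · exact hloc k (by rw [hsupp]; tauto)
  · intro q hq
    rw [hamp _ fun k hk => ?_]
    rw [hsupp, not_or] at hk
    rw [hset, if_neg hk.2, if_neg hk.1]

lemma amp_untouched {n : ℕ} (dir : Bool) (g : Gate n) {P : PauliString n}
    (h : ∀ k ∈ g.support, P k = 0) (Q : PauliString n) :
    amp (dirOp dir g.toOp) P Q = if P = Q then 1 else 0 := by
  have hU : (dirOp dir g.toOp)ᴴ * dirOp dir g.toOp = 1 :=
    mul_eq_one_comm.1 (dirOp_mul_conjTranspose dir g.toOp_mul_conjTranspose)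
  rw [amp_localOn (g.localOn.dirOp dir)]
  have e : resOn g.support P = 0 := by
    funext k; unfold resOn; split_ifs with hk
    · exact h k hk
    · rfl
  rw [e, amp_zero_left hU]
  by_cases hPQ : P = Q
  · subst hPQ
    rw [if_pos fun _ _ => rfl, if_pos e, if_pos rfl]
  · rw [if_neg hPQ]
    split_ifs with h1 h2
    · exfalso
      refine hPQ (funext fun k => ?_)
      by_cases hk : k ∈ g.support
      · have := congrFun h2 k
        simp only [resOn, hk, if_true] at this
        rw [h k hk, this]; rfl
      · exact h1 k hk
    · rfl
    · rfl

/-- As φ is arbitrary, this describes the whole multiset of new entries. In the cases where `stage`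
keeps the entry (no gate here, a gate already treated at its smaller qubit, a gate that sees only
identity letters) the step acts on this Pauli operator as the identity. -/
lemma stage_sum {n : ℕ} (dir : Bool) (G : List (Gate n)) {ℓ j : ℕ} {e : Entry n} (he : e.a ≤ ℓ)
    (φ : Entry n → ℝ) :
    sumE φ (stage dir G ℓ j e) =
      if e.a + stepTouch G j e.P ≤ ℓ then
        ∑ Q, (if amp (dirOp dir (stepOp G j)) e.P Q ≠ 0 then
          φ ⟨Q, e.a + stepTouch G j e.P, e.b, e.c * amp (dirOp dir (stepOp G j)) e.P Q⟩ else 0)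
      else 0 := by
  have hid : ∀ V : Op n, (∀ Q, amp V e.P Q = if e.P = Q then 1 else 0) → φ e =
      ∑ Q, (if amp V e.P Q ≠ 0 then φ ⟨Q, e.a + 0, e.b, e.c * amp V e.P Q⟩ else 0) := by
    intro V hV
    rw [Finset.sum_eq_single e.P]
    · simp [hV]
    · intro Q _ hQ; rw [hV, if_neg hQ.symm]; simp
    · simp
  unfold stage stepTouch stepOp
  rcases hg : gateOn G j with _ | g
  · dsimp only
    rw [if_pos (by simpa using he), ← hid]
    · simp
    · intro Q; rw [dirOp_one, amp_one]
  · dsimp only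
    obtain ⟨hm, k, rfl, hk⟩ := gateOn_some hg
    by_cases hlt : g.partner k < k
    · rw [if_pos (Or.inl hlt)]
      simp only [if_pos hlt]
      rw [if_pos (by simpa using he), ← hid]
      · simp
      · intro Q; rw [dirOp_one, amp_one]
    · simp only [if_neg hlt]
      have hl : ∀ i : Fin n, letter e.P i = 0 ↔ e.P i = 0 := by
        intro i; unfold letter; rw [dif_pos i.2]
        exact ⟨fun h => Fin.ext h, fun h => by rw [Fin.eta, h]; rfl⟩
      obtain ⟨p, hp⟩ : ∃ p : Fin n, p.val = g.partner k := ⟨⟨_, g.partner_lt hk⟩, rfl⟩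
      have hsupp : ∀ i, i ∈ g.support ↔ i = k ∨ i = p := fun i => by
        rw [g.mem_support_iff hk, ← hp, Fin.ext_iff, Fin.ext_iff]
      by_cases hz : letter e.P k = 0 ∧ letter e.P (g.partner k) = 0
      · rw [if_pos (Or.inr hz)]
        rw [← hp, hl, hl] at hz
        have h0 : ∀ i ∈ g.support, e.P i = 0 := by
          intro i hi
          rcases (hsupp i).1 hi with rfl | rfl
          exacts [hz.1, hz.2]
        rw [if_neg (c := ¬ IsClifford g.toOp ∧ _) (by rintro ⟨_, i, hi, h⟩; exact h (h0 i hi)),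
          if_pos (by simpa using he), ← hid]
        · simp
        · exact amp_untouched dir g h0
      · rw [if_neg (not_or.2 ⟨hlt, hz⟩)]
        have ht : ∃ i ∈ g.support, e.P i ≠ 0 := by
          rw [← hp, hl, hl, not_and_or] at hz
          rcases hz with h | h
          exacts [⟨k, hk, h⟩, ⟨p, (hsupp p).2 (Or.inr rfl), h⟩]
        have hτ : (if ¬ IsClifford g.toOp ∧ ∃ i ∈ g.support, e.P i ≠ 0 then 1 else 0) =
            if IsClifford g.toOp then 0 else 1 := by
          by_cases hc : IsClifford g.toOp <;> simp [hc, ht]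
        rw [hτ]
        generalize (if IsClifford g.toOp then 0 else 1) = δ
        by_cases hle : e.a + δ ≤ ℓ
        · rw [if_pos hle, if_pos hle, sumE_flatMap_range]
          simp only [sumE_flatMap_range, apply_ite (sumE φ), sumE_cons, sumE_nil, add_zero]
          exact stage_touched_sum dir g hk e.P fun Q r =>
            φ ⟨Q, e.a + δ, e.b, e.c * r⟩
        · rw [if_neg hle, if_neg hle, sumE_nil]

/-- The number of non-Clifford gates met by `P` among those with smallest qubit below `m`. -/
def touchTo {n : ℕ} (G : List (Gate n)) (m : ℕ) (P : PauliString n) : ℕ :=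
  ∑ j ∈ Finset.range m, stepTouch G j P

/-- Induction over the gates. Since their supports are disjoint, two Pauli operators are joined by
at most one path through the gates (`partialOp_path_unique`). There is no interference, and
amplitudes simply multiply; this is why the identity holds for φ that are not linear in the
coefficient. -/
lemma expandTo_sum {n : ℕ} (dir : Bool) {G : List (Gate n)} (hG : DisjointGates G) {ℓ : ℕ} (m : ℕ)
    {l : List (Entry n)} (hl : ∀ e ∈ l, e.a ≤ ℓ) (φ : Entry n → ℝ) :
    sumE φ (expandTo dir G ℓ m l) = sumE (fun e =>
      if e.a + touchTo G m e.P ≤ ℓ then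
        ∑ Q, (if amp (partialOp dir G m) e.P Q ≠ 0 then
          φ ⟨Q, e.a + touchTo G m e.P, e.b, e.c * amp (partialOp dir G m) e.P Q⟩ else 0)
      else 0) l := by
  induction m generalizing φ with
  | zero =>
    refine sumE_congr fun e he => ?_
    simp only [touchTo, Finset.range_zero, Finset.sum_empty, add_zero, partialOp, List.range_zero,
      List.map_nil, List.prod_nil, amp_one]
    rw [if_pos (hl e he), Finset.sum_eq_single e.P (fun Q _ hQ => by rw [if_neg hQ.symm]; simp)
      (by simp)]
    simp
  | succ m ih =>
    rw [expandTo_succ, sumE_flatMap,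
      sumE_congr fun e he => stage_sum dir G (expandTo_a_le hl e he) φ, ih]
    refine sumE_congr fun e he => ?_
    -- The earlier gates do not act on the qubits of gate m, so the original operator already
    -- decides whether this gate is met.
    have hτ : ∀ R, amp (partialOp dir G m) e.P R ≠ 0 → stepTouch G m R = stepTouch G m e.P :=
      fun R hR => stepTouch_congr G m fun k hk =>
        (partialOp_amp_ne_zero dir G m hR fun j hj hc => Finset.disjoint_left.1
          (stepSupp_disjoint hG (ne_of_lt hj)) hc hk).symm
    have hts : touchTo G (m + 1) e.P = touchTo G m e.P + stepTouch G m e.P :=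
      Finset.sum_range_succ _ _
    rw [hts, ← add_assoc]
    set κ := e.a + touchTo G m e.P with hκ
    by_cases h1 : κ + stepTouch G m e.P ≤ ℓ
    · rw [if_pos (show κ ≤ ℓ by omega), if_pos h1]
      have e1 : ∀ R, (if amp (partialOp dir G m) e.P R ≠ 0 then
          if κ + stepTouch G m R ≤ ℓ then
            ∑ Q, (if amp (dirOp dir (stepOp G m)) R Q ≠ 0 then
              φ ⟨Q, κ + stepTouch G m R, e.b, e.c * amp (partialOp dir G m) e.P R *
                amp (dirOp dir (stepOp G m)) R Q⟩ else 0) else 0 else 0) =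
          ∑ Q, if amp (partialOp dir G m) e.P R * amp (dirOp dir (stepOp G m)) R Q ≠ 0 then
            φ ⟨Q, κ + stepTouch G m e.P, e.b, e.c * (amp (partialOp dir G m) e.P R *
              amp (dirOp dir (stepOp G m)) R Q)⟩ else 0 := by
        intro R
        by_cases hR : amp (partialOp dir G m) e.P R ≠ 0
        · rw [if_pos hR, hτ R hR, if_pos h1]
          refine Finset.sum_congr rfl fun Q _ => ?_
          by_cases hQ : amp (dirOp dir (stepOp G m)) R Q ≠ 0
          · rw [if_pos hQ, if_pos (mul_ne_zero hR hQ), mul_assoc]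
          · rw [if_neg hQ, if_neg (fun h => hQ (right_ne_zero_of_mul h))]
        · rw [if_neg hR]
          refine (Finset.sum_eq_zero fun Q _ => ?_).symm
          rw [if_neg fun h => hR (left_ne_zero_of_mul h)]
      rw [Finset.sum_congr rfl fun R _ => e1 R, Finset.sum_comm]
      refine Finset.sum_congr rfl fun Q _ => ?_
      rw [partialOp_succ, amp_mul]
      exact sum_apply_of_subsingleton
        (fun R => amp (partialOp dir G m) e.P R * amp (dirOp dir (stepOp G m)) R Q)
        (fun a b ha hb => by
          rw [partialOp_path_unique dir hG m e.P Q ha, partialOp_path_unique dir hG m e.P Q hb])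
        fun r => φ ⟨Q, κ + stepTouch G m e.P, e.b, e.c * r⟩
    · rw [if_neg h1]
      split_ifs with h2
      · refine Finset.sum_eq_zero fun R _ => ?_
        by_cases hR : amp (partialOp dir G m) e.P R ≠ 0
        · rw [if_pos hR, hτ R hR, if_neg h1]
        · rw [if_neg hR]
      · rfl

/-- The images of the entries of a table under a whole layer. -/
def expandL {n : ℕ} (dir : Bool) (L : Layer n) (ℓ : ℕ) (l : List (Entry n)) : List (Entry n) :=
  expandTo dir L.gates ℓ n l

lemma expandL_sum {n : ℕ} (dir : Bool) (L : Layer n) {ℓ : ℕ} {l : List (Entry n)}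
    (hl : ∀ e ∈ l, e.a ≤ ℓ) (φ : Entry n → ℝ) :
    sumE φ (expandL dir L ℓ l) = sumE (fun e =>
      if e.a + L.touched e.P ≤ ℓ then
        ∑ Q, (if amp (dirOp dir L.toOp) e.P Q ≠ 0 then
          φ ⟨Q, e.a + L.touched e.P, e.b, e.c * amp (dirOp dir L.toOp) e.P Q⟩ else 0)
      else 0) l := by
  unfold expandL Layer.toOp
  rw [expandTo_sum dir L.disjoint n hl φ, dirOp_prod_gates dir L.disjoint]
  refine sumE_congr fun e _ => ?_
  have : touchTo L.gates n e.P = L.touched e.P := sum_stepTouch L.disjoint e.P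
  rw [this]

lemma expandL_mem {n : ℕ} (dir : Bool) (L : Layer n) {ℓ : ℕ} {l : List (Entry n)}
    (hl : ∀ e ∈ l, e.a ≤ ℓ) (p : Entry n → Prop) :
    (∃ e ∈ expandL dir L ℓ l, p e) ↔ ∃ e ∈ l, e.a + L.touched e.P ≤ ℓ ∧
      ∃ Q, amp (dirOp dir L.toOp) e.P Q ≠ 0 ∧
        p ⟨Q, e.a + L.touched e.P, e.b, e.c * amp (dirOp dir L.toOp) e.P Q⟩ := by
  have hpos : ∀ (e : Entry n), 0 ≤ ∑ Q, (if amp (dirOp dir L.toOp) e.P Q ≠ 0 then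
      (if p ⟨Q, e.a + L.touched e.P, e.b, e.c * amp (dirOp dir L.toOp) e.P Q⟩ then (1 : ℝ) else 0)
      else 0) := fun e => Finset.sum_nonneg fun Q _ => by split_ifs <;> norm_num
  have hiff : ∀ (e : Entry n), (∃ Q, amp (dirOp dir L.toOp) e.P Q ≠ 0 ∧
        p ⟨Q, e.a + L.touched e.P, e.b, e.c * amp (dirOp dir L.toOp) e.P Q⟩) ↔
      0 < ∑ Q, (if amp (dirOp dir L.toOp) e.P Q ≠ 0 then
      (if p ⟨Q, e.a + L.touched e.P, e.b, e.c * amp (dirOp dir L.toOp) e.P Q⟩ then (1 : ℝ) else 0)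
      else 0) := by
    intro e
    rw [(Finset.sum_pos_iff_of_nonneg fun Q _ => by split_ifs <;> norm_num)]
    refine exists_congr fun Q => ?_
    simp only [Finset.mem_univ, true_and]
    split_ifs with h1 h2 <;> simp [*]
  rw [mem_iff_sumE, expandL_sum dir L hl]
  constructor
  · intro h
    by_contra hc
    push Not at hc
    refine absurd h (not_lt.2 ?_)
    rw [← sumE_congr (φ := fun _ => (0 : ℝ)) (fun e he => ?_)]
    · simp [sumE]
    · split_ifs with h1
      · have h2 := hc e he h1
        refine ((hpos e).lt_or_eq.resolve_left fun h3 => ?_)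
        obtain ⟨Q, h4, h5⟩ := (hiff e).2 h3
        exact h2 Q h4 h5
      · rfl
  · rintro ⟨e, he, h1, h2⟩
    refine lt_of_lt_of_le ((hiff e).1 h2) ?_
    have := List.single_le_sum (l := l.map fun e => if e.a + L.touched e.P ≤ ℓ then
        ∑ Q, (if amp (dirOp dir L.toOp) e.P Q ≠ 0 then
          (if p ⟨Q, e.a + L.touched e.P, e.b, e.c * amp (dirOp dir L.toOp) e.P Q⟩ then (1 : ℝ)
            else 0) else 0) else 0) (fun x hx => by
        obtain ⟨e, _, rfl⟩ := List.mem_map.1 hx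
        split_ifs
        · exact hpos e
        · exact le_rfl) _ (List.mem_map_of_mem he)
    rwa [if_pos h1] at this

/-! ## A program logic with running times -/

/-- The program halts, and its final memory and running time satisfy `Q`. -/
def wp (x : Input) (p : Program) (μ : Mem) (Q : Mem → ℕ → Prop) : Prop :=
  ∃ μ' T, Exec x p μ μ' T ∧ Q μ' T

/-- The arrays that an instruction may change. -/
def Instr.writes : Instr → List ℕ
  | .nset dst _ => [dst.arr]
  | .rset dst _ => [dst.arr]
  | .askObs dst _ => [dst.arr]
  | .askTerm dst P _ => [dst.arr, P.arr]
  | .askState dst _ => [dst.arr]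
  | .askKind dst _ _ => [dst.arr]
  | .askPartner dst _ _ => [dst.arr]
  | .askAmp dst _ _ _ _ => [dst.arr]
  | .askClifford _ dst Q _ _ => [dst.arr, Q.arr]

/-- The arrays that a program may change. -/
def Program.writes : Program → List ℕ
  | .instr a => a.writes
  | .seq p q => p.writes ++ q.writes
  | .ite _ p q => p.writes ++ q.writes
  | .loop _ p => p.writes

/-- The memories agree outside the arrays in `W`. -/
def Agree (W : List ℕ) (μ μ' : Mem) : Prop :=
  ∀ A, A ∉ W → μ'.nat A = μ.nat A ∧ μ'.real A = μ.real A

lemma Agree.refl (W : List ℕ) (μ : Mem) : Agree W μ μ := fun _ _ => ⟨rfl, rfl⟩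

lemma Agree.trans {W W' : List ℕ} {μ μ' μ'' : Mem} (h : Agree W μ μ') (h' : Agree W' μ' μ'') :
    Agree (W ++ W') μ μ'' := fun A hA => by
  rw [List.mem_append, not_or] at hA
  exact ⟨(h' A hA.2).1.trans (h A hA.1).1, (h' A hA.2).2.trans (h A hA.1).2⟩

lemma Agree.mono {W W' : List ℕ} {μ μ' : Mem} (h : Agree W μ μ') (hW : W ⊆ W') :
    Agree W' μ μ' := fun A hA => h A fun hc => hA (hW hc)

lemma agree_setNat (μ : Mem) (A i j v : ℕ) : Agree [A] μ (μ.setNat A i j v) := by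
  intro B hB
  have : B ≠ A := by simpa using hB
  simp [Mem.setNat, this]

lemma agree_setReal (μ : Mem) (A i j : ℕ) (v : ℝ) : Agree [A] μ (μ.setReal A i j v) := by
  intro B hB
  have : B ≠ A := by simpa using hB
  simp [Mem.setReal, this]

lemma agree_setRow {n : ℕ} (μ : Mem) (A i : ℕ) (P : PauliString n) :
    Agree [A] μ (μ.setRow A i P) := by
  intro B hB
  have : B ≠ A := by simpa using hB
  simp [Mem.setRow, this]

lemma Instr.agree (x : Input) (μ : Mem) (a : Instr) : Agree a.writes μ (a.run x μ) := by
  cases a with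
  | nset dst e => exact agree_setNat _ _ _ _ _
  | rset dst e => exact agree_setReal _ _ _ _ _
  | askObs dst P => exact agree_setReal _ _ _ _ _
  | askTerm dst P i =>
    simp only [Instr.run]
    split
    · exact Agree.refl _ _
    · exact (agree_setReal _ _ _ _ _).trans (agree_setRow _ _ _ _)
  | askState dst P => exact agree_setReal _ _ _ _ _
  | askKind dst t j => exact agree_setNat _ _ _ _ _
  | askPartner dst t j => exact agree_setNat _ _ _ _ _
  | askAmp dst t j P Q => exact agree_setReal _ _ _ _ _
  | askClifford inv dst Q k P => exact (agree_setReal _ _ _ _ _).trans (agree_setRow _ _ _ _)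

lemma Exec.agree {x : Input} {p : Program} {μ μ' : Mem} {T : ℕ} (h : Exec x p μ μ' T) :
    Agree p.writes μ μ' := by
  induction h with
  | instr a μ => exact a.agree x μ
  | seq _ _ h1 h2 => exact h1.trans h2
  | iteTrue _ _ h => exact h.mono (List.subset_append_left _ _)
  | iteFalse _ _ h => exact h.mono (List.subset_append_right _ _)
  | loopEnd _ => exact Agree.refl _ _
  | loopStep _ _ _ h1 h2 => exact (h1.trans h2).mono (by simp [Program.writes])

lemma wp_instr {x : Input} {a : Instr} {μ : Mem} {Q : Mem → ℕ → Prop}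
    (h : Q (a.run x μ) (a.time x)) : wp x (.instr a) μ Q := ⟨_, _, .instr a μ, h⟩

/-- The new postcondition may use that the arrays not written by the program are unchanged. This
frame rule carries registers and tables across subprograms. -/
lemma wp_mono {x : Input} {p : Program} {μ : Mem} {Q Q' : Mem → ℕ → Prop} (h : wp x p μ Q)
    (hQ : ∀ μ' T, Agree p.writes μ μ' → Q μ' T → Q' μ' T) : wp x p μ Q' := by
  obtain ⟨μ', T, he, hq⟩ := h
  exact ⟨μ', T, he, hQ μ' T he.agree hq⟩

lemma wp_seq {x : Input} {p q : Program} {μ : Mem} {Q R : Mem → ℕ → Prop} (h : wp x p μ R)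
    (h' : ∀ μ' T, Agree p.writes μ μ' → R μ' T → wp x q μ' fun μ'' T' => Q μ'' (T + T')) :
    wp x (.seq p q) μ Q := by
  obtain ⟨μ', T, he, hr⟩ := h
  obtain ⟨μ'', T', he', hq⟩ := h' μ' T he.agree hr
  exact ⟨μ'', T + T', .seq he he', hq⟩

lemma wp_instr_seq {x : Input} {a : Instr} {q : Program} {μ : Mem} {Q : Mem → ℕ → Prop}
    (h : wp x q (a.run x μ) fun μ'' T' => Q μ'' (a.time x + T')) :
    wp x (.seq (.instr a) q) μ Q := by
  obtain ⟨μ'', T', he', hq⟩ := h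
  exact ⟨μ'', _, .seq (.instr a μ) he', hq⟩

lemma wp_ite {x : Input} {b : Test} {p q : Program} {μ : Mem} {Q : Mem → ℕ → Prop}
    (h1 : b.holds μ → wp x p μ fun μ' T => Q μ' (T + 1))
    (h2 : ¬ b.holds μ → wp x q μ fun μ' T => Q μ' (T + 1)) : wp x (.ite b p q) μ Q := by
  by_cases hb : b.holds μ
  · obtain ⟨μ', T, he, hq⟩ := h1 hb
    exact ⟨μ', T + 1, .iteTrue hb he, hq⟩
  · obtain ⟨μ', T, he, hq⟩ := h2 hb
    exact ⟨μ', T + 1, .iteFalse hb he, hq⟩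

/-- The scalar variable `v`: cell `(0, 0)` of array `v`. -/
def scal (v : ℕ) : Cell := ⟨v, .const 0, .const 0⟩

/-- The value of a scalar variable for natural numbers. -/
def nvar (v : ℕ) : NExpr := .read v (.const 0) (.const 0)

/-- The value of a scalar variable for real numbers. -/
def rvar (v : ℕ) : RExpr := .read v (.const 0) (.const 0)

/-- Assigns a scalar variable for natural numbers. -/
def assign (v : ℕ) (e : NExpr) : Program := .instr (.nset (scal v) e)

/-- The program that does nothing (it writes an unused cell). -/
def skip : Program := assign 1 (.const 0)

/-- Disjunction of tests. -/
def Test.or (a b : Test) : Test := .not (.and (.not a) (.not b))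

/-- Equality of natural numbers. -/
def Test.neq (a b : NExpr) : Test := .or (.nlt a b) (.nlt b a)

lemma Test.holds_or (a b : Test) (μ : Mem) : (Test.or a b).holds μ ↔ a.holds μ ∨ b.holds μ := by
  simp only [Test.or, Test.holds]; tauto

lemma Test.holds_neq (a b : NExpr) (μ : Mem) : (Test.neq a b).holds μ ↔ a.eval μ ≠ b.eval μ := by
  rw [Test.neq, Test.holds_or]; simp only [Test.holds]; omega

/-- `for v < N do body`. -/
def forLoop (v : ℕ) (N : NExpr) (body : Program) : Program :=
  .seq (assign v (.const 0))
    (.loop (.nlt (nvar v) N) (.seq body (assign v (.add (nvar v) (.const 1)))))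

lemma forLoop_writes (v : ℕ) (N : NExpr) (body : Program) {A : ℕ} :
    A ∈ (forLoop v N body).writes ↔ A ∈ v :: body.writes := by
  simp [forLoop, Program.writes, Instr.writes, assign, scal]; tauto

lemma nat_setNat_self (μ : Mem) (A i j v : ℕ) : (μ.setNat A i j v).nat A i j = v := by
  simp [Mem.setNat]

/-- Time: one unit to initialize v, c i + 2 for a passage (test, body, increment), and one for the
last test. The invariant must tolerate a change of v because the increment follows the body, and N
must keep its value because it is evaluated again at every test. -/
lemma wp_for_sum {x : Input} {v : ℕ} {N : NExpr} {body : Program} {μ : Mem} (I : ℕ → Mem → Prop)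
    (K : ℕ) (c : ℕ → ℕ) (hv : v ∉ body.writes)
    (hN : ∀ μ', Agree (v :: body.writes) μ μ' → N.eval μ' = K)
    (hI : ∀ i μ₁ μ₂, Agree [v] μ₁ μ₂ → I i μ₁ → I i μ₂) (h0 : I 0 μ)
    (hb : ∀ i < K, ∀ μ', Agree (v :: body.writes) μ μ' → μ'.nat v 0 0 = i → I i μ' →
      wp x body μ' fun μ'' T => I (i + 1) μ'' ∧ T ≤ c i) :
    wp x (forLoop v N body) μ fun μ' T => I K μ' ∧ T ≤ 2 + ∑ i ∈ Finset.range K, (c i + 2) := by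
  have key : ∀ k i, i + k = K → ∀ μ', Agree (v :: body.writes) μ μ' → μ'.nat v 0 0 = i → I i μ' →
      wp x (.loop (.nlt (nvar v) N) (.seq body (assign v (.add (nvar v) (.const 1))))) μ'
        fun μ'' T => I K μ'' ∧ T ≤ 1 + ∑ j ∈ Finset.range k, (c (i + j) + 2) := by
    intro k
    induction k with
    | zero =>
      intro i hi μ' ha hi' hIi
      refine ⟨μ', 1, .loopEnd ?_, ?_⟩
      · simp only [Test.holds, hN μ' ha, nvar, NExpr.eval, hi']; omega
      · rw [← hi]; exact ⟨by simpa using hIi, by omega⟩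
    | succ k ih =>
      intro i hi μ' ha hi' hIi
      obtain ⟨μ₁, T₁, he₁, hI₁, hT₁⟩ := hb i (by omega) μ' ha hi' hIi
      have hv₁ : μ₁.nat v 0 0 = i := by rw [(he₁.agree v hv).1, hi']
      set μ₂ := μ₁.setNat v 0 0 (i + 1) with hμ₂
      have hag : Agree (v :: body.writes) μ μ₂ := by
        refine ((ha.trans he₁.agree).trans (agree_setNat μ₁ v 0 0 (i + 1))).mono ?_
        intro A hA
        simp only [List.mem_append, List.mem_cons, List.not_mem_nil] at hA ⊢
        tauto
      obtain ⟨μ₃, T₃, he₃, hI₃, hT₃⟩ := ih (i + 1) (by omega) μ₂ hag (nat_setNat_self _ _ _ _ _)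
        (hI _ _ _ (agree_setNat _ _ _ _ _) hI₁)
      refine ⟨μ₃, T₁ + 1 + T₃ + 1, .loopStep ?_ (.seq he₁ ?_) he₃, hI₃, ?_⟩
      · simp only [Test.holds, hN μ' ha, nvar, NExpr.eval, hi']; omega
      · have := Exec.instr (x := x) (.nset (scal v) (.add (nvar v) (.const 1))) μ₁
        simpa [Instr.run, Cell.putNat, scal, nvar, NExpr.eval, hv₁, assign, Instr.time, hμ₂]
          using this
      · rw [Finset.sum_range_succ', add_zero]
        have : ∑ j ∈ Finset.range k, (c (i + 1 + j) + 2) =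
            ∑ j ∈ Finset.range k, (c (i + (j + 1)) + 2) :=
          Finset.sum_congr rfl fun j _ => by rw [add_assoc, add_comm 1 j]
        omega
  refine wp_instr_seq ?_
  obtain ⟨μ₃, T₃, he₃, hI₃, hT₃⟩ := key K 0 (by omega) (μ.setNat v 0 0 0)
    ((agree_setNat μ v 0 0 0).mono (by simp)) (nat_setNat_self _ _ _ _ _)
    (hI _ _ _ (agree_setNat _ _ _ _ _) h0)
  exact ⟨μ₃, T₃, he₃, hI₃, by simp only [Instr.time, zero_add] at hT₃ ⊢; omega⟩

lemma wp_for {x : Input} {v : ℕ} {N : NExpr} {body : Program} {μ : Mem} (I : ℕ → Mem → Prop)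
    (K c : ℕ) (hv : v ∉ body.writes)
    (hN : ∀ μ', Agree (v :: body.writes) μ μ' → N.eval μ' = K)
    (hI : ∀ i μ₁ μ₂, Agree [v] μ₁ μ₂ → I i μ₁ → I i μ₂) (h0 : I 0 μ)
    (hb : ∀ i < K, ∀ μ', Agree (v :: body.writes) μ μ' → μ'.nat v 0 0 = i → I i μ' →
      wp x body μ' fun μ'' T => I (i + 1) μ'' ∧ T ≤ c) :
    wp x (forLoop v N body) μ fun μ' T => I K μ' ∧ T ≤ 2 + K * (c + 2) := by
  simpa using wp_for_sum I K (fun _ => c) hv hN hI h0 hb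

/-! ## Tables in memory -/

/-- Row `i` of the table with base `b` holds the entry `e`. -/
def RowIs {n : ℕ} (μ : Mem) (b i : ℕ) (e : Entry n) : Prop :=
  (∀ j : Fin n, μ.nat b i j = (e.P j).val) ∧ μ.nat (b + 1) i 0 = e.a ∧ μ.nat (b + 1) i 1 = e.b ∧
    μ.real b i 0 = e.c

/-- The table with base `b` holds the list `l`. -/
def Tab {n : ℕ} (μ : Mem) (b : ℕ) (l : List (Entry n)) : Prop :=
  μ.nat (b + 2) 0 0 = l.length ∧ ∀ i (h : i < l.length), RowIs μ b i l[i]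

/-- The input data are in place. -/
def Base (x : Input) (μ : Mem) : Prop :=
  μ.nat 0 0 0 = x.n ∧ μ.nat 0 0 1 = ncDepth x.circuit ∧ μ.nat 0 0 2 = x.ℓ ∧
    μ.nat 0 0 3 = x.terms.length ∧ μ.real 0 0 0 = x.damp

lemma Base.agree {x : Input} {μ μ' : Mem} {W : List ℕ} (h : Base x μ) (ha : Agree W μ μ')
    (hW : 0 ∉ W) : Base x μ' := by
  unfold Base
  rw [(ha 0 hW).1, (ha 0 hW).2]
  exact h

lemma RowIs.agree {n : ℕ} {μ μ' : Mem} {W : List ℕ} {b i : ℕ} {e : Entry n} (h : RowIs μ b i e)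
    (ha : Agree W μ μ') (h0 : b ∉ W) (h1 : b + 1 ∉ W) : RowIs μ' b i e := by
  unfold RowIs
  rw [(ha b h0).1, (ha _ h1).1, (ha b h0).2]
  exact h

lemma Tab.agree {n : ℕ} {μ μ' : Mem} {W : List ℕ} {b : ℕ} {l : List (Entry n)} (h : Tab μ b l)
    (ha : Agree W μ μ') (h0 : b ∉ W) (h1 : b + 1 ∉ W) (h2 : b + 2 ∉ W) : Tab μ' b l :=
  ⟨by rw [(ha _ h2).1]; exact h.1, fun i hi => (h.2 i hi).agree ha h0 h1⟩

lemma RowIs.getRow {n : ℕ} {μ : Mem} {b i : ℕ} {e : Entry n} (h : RowIs μ b i e) :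
    μ.getRow n b i = e.P := by
  funext j
  rw [Mem.getRow, h.1 j]
  exact Fin.ext (Nat.mod_eq_of_lt (e.P j).2)

lemma RowIs.letter {n : ℕ} {μ : Mem} {b i : ℕ} {e : Entry n} (h : RowIs μ b i e) {j : ℕ}
    (hj : j < n) : μ.nat b i j = letter e.P j := by
  rw [NoisySim.letter, dif_pos hj]
  exact h.1 ⟨j, hj⟩

/-- The number of qubits. -/
def qubits : NExpr := .read 0 (.const 0) (.const 0)

/-- The threshold. -/
def thresh : NExpr := .read 0 (.const 0) (.const 2)

/-- The length of a table. -/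
def len (b : ℕ) : NExpr := nvar (b + 2)

/-- Copies row `i` of the table `s` to row `k` of the table `t`. -/
def copyEntry (s : ℕ) (i : NExpr) (t : ℕ) (k : NExpr) : Program :=
  .seq (forLoop 1 qubits (.instr (.nset ⟨t, k, nvar 1⟩ (.read s i (nvar 1)))))
    (.seq (.instr (.nset ⟨t + 1, k, .const 0⟩ (.read (s + 1) i (.const 0))))
      (.seq (.instr (.nset ⟨t + 1, k, .const 1⟩ (.read (s + 1) i (.const 1))))
        (.instr (.rset ⟨t, k, .const 0⟩ (.read s i (.const 0))))))

/-- An entry lives in the arrays b and b + 1, hence the separation of s and t. The row expressions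
are evaluated anew at every instruction, so their values must survive the writes already made. The
letters cost 2 + 3n; the two counters and the coefficient cost one unit each. -/
lemma wp_copyEntry {x : Input} {μ : Mem} {s t : ℕ} {i k : NExpr} {i' k' : ℕ} {e : Entry x.n}
    (hB : Base x μ) (hs : 2 ≤ s) (ht : 2 ≤ t) (hst : s + 1 < t ∨ t + 1 < s)
    (hi : ∀ μ', Agree [1, t, t + 1] μ μ' → i.eval μ' = i')
    (hk : ∀ μ', Agree [1, t, t + 1] μ μ' → k.eval μ' = k') (he : RowIs μ s i' e) :
    wp x (copyEntry s i t k) μ fun μ' T => RowIs μ' t k' e ∧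
      (∀ r, r ≠ k' → (∀ j, μ'.nat t r j = μ.nat t r j) ∧
        (∀ j, μ'.nat (t + 1) r j = μ.nat (t + 1) r j) ∧ ∀ j, μ'.real t r j = μ.real t r j) ∧
      T ≤ 3 * x.n + 5 := by
  refine wp_seq (wp_for (fun m μ' => (∀ j < m, ∀ h : j < x.n, μ'.nat t k' j = (e.P ⟨j, h⟩).val) ∧
    (∀ r, r ≠ k' → ∀ j, μ'.nat t r j = μ.nat t r j) ∧ μ'.real t = μ.real t) x.n 1
    ?_ ?_ ?_ ?_ ?_) ?_
  · simp [Program.writes, Instr.writes]; omega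
  · intro μ' ha
    have h0 := ha 0 (by simp [Program.writes, Instr.writes]; omega)
    simp only [qubits, NExpr.eval, h0.1, hB.1]
  · intro m μ₁ μ₂ ha h
    have := ha t (by simp; omega)
    rw [this.1, this.2]; exact h
  · exact ⟨fun j hj => absurd hj (by omega), fun _ _ _ => rfl, rfl⟩
  · intro m hm μ' ha hv hI
    have ha' : Agree [1, t, t + 1] μ μ' := ha.mono (by simp [Program.writes, Instr.writes])
    refine wp_instr ⟨?_, le_rfl⟩
    have hsrc : μ'.nat s i' m = (e.P ⟨m, hm⟩).val := by
      rw [(ha' s (by simp; omega)).1]; exact he.1 ⟨m, hm⟩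
    simp only [Instr.run, Cell.putNat, NExpr.eval, nvar, hv, hi _ ha', hk _ ha', hsrc, Mem.setNat]
    refine ⟨?_, ?_, hI.2.2⟩
    · intro j hj h
      by_cases hjm : j = m
      · subst hjm; simp
      · simp only [hjm, and_false, if_false]
        exact hI.1 j (by omega) h
    · intro r hr j
      simp only [hr, false_and, and_false, if_false]
      exact hI.2.1 r hr j
  · rintro μ₁ T₁ ha ⟨⟨h1, h2, h3⟩, hT⟩
    have ha₁ : Agree [1, t] μ μ₁ := ha.mono fun A hA => by
      rw [forLoop_writes] at hA
      simpa [Program.writes, Instr.writes] using hA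
    have n1 : μ₁.nat (t + 1) = μ.nat (t + 1) := (ha₁ (t + 1) (by simp; omega)).1
    have ha₂ : Agree [1, t, t + 1] μ μ₁ := ha₁.mono (by simp)
    have s0 := ha₂ s (by simp; omega)
    have s1 := (ha₂ (s + 1) (by simp; omega)).1
    set μ₂ := μ₁.setNat (t + 1) k' 0 e.a with hμ₂
    have ha₃ : Agree [1, t, t + 1] μ μ₂ := (ha₁.trans (agree_setNat μ₁ (t + 1) k' 0 e.a)).mono
      (by simp)
    set μ₃ := μ₂.setNat (t + 1) k' 1 e.b with hμ₃
    have ha₄ : Agree [1, t, t + 1] μ μ₃ := (ha₃.trans (agree_setNat μ₂ (t + 1) k' 1 e.b)).mono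
      (by simp)
    have t1 : s + 1 ≠ t + 1 := by omega
    have t2 : t ≠ t + 1 := by omega
    refine wp_instr_seq ?_
    have e1 : Instr.run x μ₁ (.nset ⟨t + 1, k, .const 0⟩ (.read (s + 1) i (.const 0))) = μ₂ := by
      simp only [Instr.run, Cell.putNat, NExpr.eval, hk _ ha₂, hi _ ha₂, s1, he.2.1, hμ₂]
    rw [e1]
    refine wp_instr_seq ?_
    have e2 : Instr.run x μ₂ (.nset ⟨t + 1, k, .const 1⟩ (.read (s + 1) i (.const 1))) = μ₃ := by
      have : μ₂.nat (s + 1) i' 1 = e.b := by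
        rw [(ha₃ (s + 1) (by simp; omega)).1]; exact he.2.2.1
      simp only [Instr.run, Cell.putNat, NExpr.eval, hk _ ha₃, hi _ ha₃, this, hμ₃]
    rw [e2]
    refine wp_instr ?_
    have e3 : Instr.run x μ₃ (.rset ⟨t, k, .const 0⟩ (.read s i (.const 0))) =
        μ₃.setReal t k' 0 e.c := by
      have : μ₃.real s i' 0 = e.c := by
        rw [(ha₄ s (by simp; omega)).2]; exact he.2.2.2
      simp only [Instr.run, Cell.putReal, NExpr.eval, RExpr.eval, hk _ ha₄, hi _ ha₄, this]
    rw [e3]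
    simp only [Instr.time]
    refine ⟨⟨fun j => ?_, ?_, ?_, ?_⟩, fun r hr => ⟨fun j => ?_, fun j => ?_, fun j => ?_⟩, by omega⟩
    · simp only [hμ₃, hμ₂, Mem.setNat, Mem.setReal, t2, false_and, if_false]
      exact h1 j j.2 j.2
    · simp [hμ₃, hμ₂, Mem.setNat, Mem.setReal]
    · simp [hμ₃, hμ₂, Mem.setNat, Mem.setReal]
    · simp [Mem.setReal]
    · simp only [hμ₃, hμ₂, Mem.setNat, Mem.setReal, t2, false_and, if_false]
      exact h2 r hr j
    · simp [hμ₃, hμ₂, Mem.setNat, Mem.setReal, hr, n1]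
    · simp [hμ₃, hμ₂, Mem.setNat, Mem.setReal, hr, h3]

/-- Loads row `v` of the table `b` into the register `r`. -/
def load (b v r : ℕ) : Program := copyEntry b (nvar v) r (.const 0)

lemma wp_load {x : Input} {μ : Mem} {b v r i : ℕ} {e : Entry x.n} (hB : Base x μ) (hb : 2 ≤ b)
    (hr : 2 ≤ r) (hbr : b + 1 < r ∨ r + 1 < b) (hv : v ∉ [1, r, r + 1]) (hi : μ.nat v 0 0 = i)
    (he : RowIs μ b i e) :
    wp x (load b v r) μ fun μ' T => RowIs μ' r 0 e ∧ T ≤ 3 * x.n + 5 := by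
  refine wp_mono (wp_copyEntry hB hb hr hbr (fun μ' ha => ?_) (fun _ _ => rfl) he)
    fun μ' T _ h => ⟨h.1, h.2.2⟩
  simp only [nvar, NExpr.eval]
  rw [(ha v hv).1, hi]

/-- Appends the entry in the register `r` to the table `b`. -/
def pushEntry (r b : ℕ) : Program :=
  .seq (copyEntry r (.const 0) b (len b)) (assign (b + 2) (.add (len b) (.const 1)))

lemma wp_pushEntry {x : Input} {μ : Mem} {r b : ℕ} {e : Entry x.n} {l : List (Entry x.n)}
    (hB : Base x μ) (hr : 2 ≤ r) (hb : 2 ≤ b) (hbr : r + 1 < b ∨ b + 1 < r) (he : RowIs μ r 0 e)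
    (hl : Tab μ b l) :
    wp x (pushEntry r b) μ fun μ' T => Tab μ' b (l ++ [e]) ∧ T ≤ 3 * x.n + 6 := by
  have hlen : ∀ μ', Agree [1, b, b + 1] μ μ' → μ'.nat (b + 2) 0 0 = l.length := by
    intro μ' ha
    rw [(ha (b + 2) (by simp)).1]; exact hl.1
  refine wp_seq (wp_copyEntry hB hr hb hbr (fun _ _ => rfl) hlen he) ?_
  rintro μ₁ T₁ ha ⟨h1, h2, hT⟩
  have hl₁ : μ₁.nat (b + 2) 0 0 = l.length := by
    refine hlen μ₁ (ha.mono fun A hA => ?_)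
    simp only [copyEntry, Program.writes, List.mem_append, forLoop_writes, Instr.writes] at hA
    simp at hA ⊢; tauto
  refine wp_instr ⟨⟨?_, fun i hi => ?_⟩, by simp only [Instr.time]; omega⟩
  · simp [Instr.run, Cell.putNat, scal, len, nvar, NExpr.eval, Mem.setNat, hl₁]
  · have hag : Agree [b + 2] μ₁ (μ₁.setNat (b + 2) 0 0 (l.length + 1)) := agree_setNat _ _ _ _ _
    simp only [Instr.run, Cell.putNat, scal, len, nvar, NExpr.eval, hl₁]
    refine RowIs.agree ?_ hag (by simp) (by simp)
    by_cases hil : i = l.length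
    · subst hil
      simpa using h1
    · have hi' : i < l.length := by simp at hi; omega
      rw [List.getElem_append_left hi']
      obtain ⟨g1, g2, g3⟩ := h2 i hil
      have := hl.2 i hi'
      unfold RowIs
      simp only [g1, g2, g3]
      exact this

/-- Empties the table `b`. -/
def clear (b : ℕ) : Program := assign (b + 2) (.const 0)

lemma wp_clear {x : Input} {μ : Mem} {b : ℕ} :
    wp x (clear b) μ fun μ' T => Tab μ' b ([] : List (Entry x.n)) ∧ T ≤ 1 := by
  refine wp_instr ⟨⟨?_, fun i hi => absurd hi (by simp)⟩, le_rfl⟩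
  simp [Instr.run, Cell.putNat, scal, NExpr.eval, Mem.setNat]

/-- Runs `body` for every entry of the table `s`, which is put into register `50`. -/
def each (s : ℕ) (body : Program) : Program := forLoop 2 (len s) (.seq (load s 2 50) body)

/-- Fold over a table, given that `body` performs one step. -/
lemma wp_each {x : Input} {μ : Mem} {s t : ℕ} {body : Program} {l l₀ : List (Entry x.n)}
    (h : List (Entry x.n) → Entry x.n → List (Entry x.n)) (c : ℕ) (hB : Base x μ) (hs : 60 ≤ s)
    (ht : 60 ≤ t) (hsW : ∀ A ∈ [0, 2, s, s + 1, s + 2], A ∉ body.writes)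
    (hl : Tab μ s l) (hl₀ : Tab μ t l₀)
    (hb : ∀ μ' acc e, e ∈ l → (∃ k, acc = (l.take k).foldl h l₀) →
      Agree (1 :: 2 :: 50 :: 51 :: body.writes) μ μ' → Base x μ' →
      RowIs μ' 50 0 e → Tab μ' t acc →
      wp x body μ' fun μ'' T => Tab μ'' t (h acc e) ∧ T ≤ c) :
    wp x (each s body) μ fun μ' T =>
      Tab μ' t (l.foldl h l₀) ∧ T ≤ 2 + l.length * (c + 3 * x.n + 7) := by
  simp only [List.mem_cons, List.not_mem_nil, or_false, forall_eq_or_imp, forall_eq] at hsW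
  obtain ⟨w0, w2, ws, ws1, ws2⟩ := hsW
  have hwr : ∀ A, A ∈ (2 :: (Program.seq (load s 2 50) body).writes) →
      A ∈ 1 :: 2 :: 50 :: 51 :: body.writes := by
    intro A hA
    simp only [load, copyEntry, Program.writes, List.mem_append, forLoop_writes, Instr.writes,
      List.mem_cons] at hA ⊢
    simp at hA ⊢; tauto
  refine wp_mono (wp_for (fun i μ' => Tab μ' t ((l.take i).foldl h l₀)) l.length (c + 3 * x.n + 5)
    ?_ ?_ ?_ ?_ ?_) ?_
  · simp only [load, copyEntry, Program.writes, List.mem_append, forLoop_writes, Instr.writes,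
      List.mem_cons]
    simp [w2]
  · intro μ' ha
    have := (ha.mono hwr (s + 2) (by simp [ws2]; omega)).1
    simp only [len, nvar, NExpr.eval, this, hl.1]
  · intro i μ₁ μ₂ ha h
    exact h.agree ha (by simp; omega) (by simp; omega) (by simp; omega)
  · simpa using hl₀
  · intro i hi μ' ha hv hI
    have ha' := ha.mono hwr
    have hB' : Base x μ' := hB.agree ha' (by simp [w0])
    have hl' : Tab μ' s l :=
      hl.agree ha' (by simp [ws]; omega) (by simp [ws1]; omega) (by simp [ws2]; omega)
    refine wp_seq (wp_load hB' (by omega) (by norm_num) (by omega) (by norm_num) hv (hl'.2 i hi)) ?_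
    rintro μ₁ T₁ ha₁ ⟨hr, hT⟩
    have ha₁' : Agree [1, 50, 51] μ' μ₁ := ha₁.mono fun A hA => by
      simp only [load, copyEntry, Program.writes, List.mem_append, forLoop_writes, Instr.writes,
        List.mem_cons] at hA
      simp at hA ⊢; tauto
    have ha₂ : Agree (1 :: 2 :: 50 :: 51 :: body.writes) μ μ₁ := (ha'.trans ha₁').mono fun A hA => by
      simp at hA ⊢; tauto
    refine wp_mono (hb μ₁ _ l[i] (List.getElem_mem hi) ⟨i, rfl⟩ ha₂ (hB'.agree ha₁' (by norm_num)) hr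
      (hI.agree ha₁' (by simp; omega) (by simp; omega) (by simp; omega))) ?_
    rintro μ₂ T₂ _ ⟨h1, h2⟩
    refine ⟨?_, by omega⟩
    rw [List.take_add_one, List.foldl_append, List.getElem?_eq_getElem hi]
    exact h1
  · rintro μ' T _ ⟨h1, h2⟩
    rw [List.take_length] at h1
    exact ⟨h1, by rwa [show c + 3 * x.n + 7 = c + 3 * x.n + 5 + 2 by omega]⟩

/-- Appending the images of all entries of a table to another table. -/
lemma wp_each_flatMap {x : Input} {μ : Mem} {s t : ℕ} {body : Program} {l l₀ : List (Entry x.n)}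
    (f : Entry x.n → List (Entry x.n)) (c : ℕ) (hB : Base x μ) (hs : 60 ≤ s)
    (ht : 60 ≤ t) (hsW : ∀ A ∈ [0, 2, s, s + 1, s + 2], A ∉ body.writes)
    (hl : Tab μ s l) (hl₀ : Tab μ t l₀)
    (hb : ∀ μ' acc e, e ∈ l → Agree (1 :: 2 :: 50 :: 51 :: body.writes) μ μ' → Base x μ' →
      RowIs μ' 50 0 e → Tab μ' t acc →
      wp x body μ' fun μ'' T => Tab μ'' t (acc ++ f e) ∧ T ≤ c) :
    wp x (each s body) μ fun μ' T =>
      Tab μ' t (l₀ ++ l.flatMap f) ∧ T ≤ 2 + l.length * (c + 3 * x.n + 7) := by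
  have : l.foldl (fun acc e => acc ++ f e) l₀ = l₀ ++ l.flatMap f := by
    clear hb hl hl₀
    induction l generalizing l₀ with
    | nil => simp
    | cons e l ih => rw [List.foldl_cons, ih]; simp
  rw [← this]
  exact wp_each _ c hB hs ht hsW hl hl₀ fun μ' acc e he _ => hb μ' acc e he

/-- Appends the table `s` to the table `t`. -/
def appendTab (s t : ℕ) : Program := each s (pushEntry 50 t)

lemma wp_appendTab {x : Input} {μ : Mem} {s t : ℕ} {l l₀ : List (Entry x.n)} (hB : Base x μ)
    (hs : 60 ≤ s) (ht : 60 ≤ t) (hst : s + 2 < t ∨ t + 2 < s) (hl : Tab μ s l) (hl₀ : Tab μ t l₀) :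
    wp x (appendTab s t) μ fun μ' T =>
      Tab μ' t (l₀ ++ l) ∧ T ≤ 2 + l.length * (6 * x.n + 13) := by
  have := wp_each_flatMap (x := x) (body := pushEntry 50 t) (fun e => [e]) (3 * x.n + 6) hB hs ht
    ?_ hl hl₀ ?_
  · refine wp_mono this fun μ' T _ h => ⟨by simpa using h.1, h.2.trans (le_of_eq ?_)⟩
    ring
  · intro A hA
    simp only [pushEntry, copyEntry, Program.writes, List.mem_append, forLoop_writes, Instr.writes,
      List.mem_cons, assign, scal, List.not_mem_nil, or_false] at hA ⊢
    omega
  · intro μ' acc e _ _ hB' he hacc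
    exact wp_pushEntry hB' (by norm_num) (by omega) (by omega) he hacc

/-- Moves the table `s` to `t`. -/
def moveTab (s t : ℕ) : Program := .seq (clear t) (appendTab s t)

lemma wp_moveTab {x : Input} {μ : Mem} {s t : ℕ} {l : List (Entry x.n)} (hB : Base x μ)
    (hs : 60 ≤ s) (ht : 60 ≤ t) (hst : s + 2 < t ∨ t + 2 < s) (hl : Tab μ s l) :
    wp x (moveTab s t) μ fun μ' T => Tab μ' t l ∧ T ≤ 3 + l.length * (6 * x.n + 13) := by
  refine wp_seq wp_clear ?_
  rintro μ₁ T₁ ha ⟨h1, h2⟩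
  have ha' : Agree [t + 2] μ μ₁ := ha
  refine wp_mono (wp_appendTab (hB.agree ha' (by simp)) hs ht hst
    (hl.agree ha' (by simp; omega) (by simp; omega) (by simp; omega)) h1) ?_
  rintro μ' T _ ⟨h3, h4⟩
  exact ⟨by simpa using h3, by omega⟩

/-! ### Assignments to scalar variables, and updates of one component of a stored entry. -/

lemma wp_seq_nat {x : Input} {a : Instr} {q : Program} {μ : Mem} {Q : Mem → ℕ → Prop} (v w : ℕ)
    (h : a.run x μ = μ.setNat v 0 0 w) (ht : a.time x = 1)
    (k : ∀ μ', Agree [v] μ μ' → μ'.nat v 0 0 = w → μ'.real = μ.real →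
      wp x q μ' fun μ'' T => Q μ'' (1 + T)) :
    wp x (.seq (.instr a) q) μ Q := by
  refine wp_instr_seq ?_
  rw [h, ht]
  exact k _ (agree_setNat _ _ _ _ _) (nat_setNat_self _ _ _ _ _) rfl

lemma wp_seq_real {x : Input} {a : Instr} {q : Program} {μ : Mem} {Q : Mem → ℕ → Prop} (v : ℕ)
    (w : ℝ) (h : a.run x μ = μ.setReal v 0 0 w) (ht : a.time x = 1)
    (k : ∀ μ', Agree [v] μ μ' → μ'.real v 0 0 = w → μ'.nat = μ.nat →
      wp x q μ' fun μ'' T => Q μ'' (1 + T)) :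
    wp x (.seq (.instr a) q) μ Q := by
  refine wp_instr_seq ?_
  rw [h, ht]
  exact k _ (agree_setReal _ _ _ _ _) (by simp [Mem.setReal]) rfl

lemma wp_skip {x : Input} {μ : Mem} : wp x skip μ fun μ' T => Agree [1] μ μ' ∧ T ≤ 1 :=
  wp_instr ⟨agree_setNat _ _ _ _ _, le_rfl⟩

lemma RowIs.setLetter {n : ℕ} {μ : Mem} {b i : ℕ} {e : Entry n} (h : RowIs μ b i e) {j y : ℕ}
    (hy : y < 4) : RowIs (μ.setNat b i j y) b i ⟨NoisySim.setLetter e.P j y, e.a, e.b, e.c⟩ := by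
  refine ⟨fun k => ?_, by simpa [Mem.setNat] using h.2.1, by simpa [Mem.setNat] using h.2.2.1,
    h.2.2.2⟩
  simp only [Mem.setNat, true_and, NoisySim.setLetter]
  split_ifs
  · exact (Nat.mod_eq_of_lt hy).symm
  · exact h.1 k

lemma RowIs.setA {n : ℕ} {μ : Mem} {b i : ℕ} {e : Entry n} (h : RowIs μ b i e) (v : ℕ) :
    RowIs (μ.setNat (b + 1) i 0 v) b i ⟨e.P, v, e.b, e.c⟩ :=
  ⟨by simpa [Mem.setNat] using h.1, by simp [Mem.setNat], by simpa [Mem.setNat] using h.2.2.1,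
    h.2.2.2⟩

lemma RowIs.setB {n : ℕ} {μ : Mem} {b i : ℕ} {e : Entry n} (h : RowIs μ b i e) (v : ℕ) :
    RowIs (μ.setNat (b + 1) i 1 v) b i ⟨e.P, e.a, v, e.c⟩ :=
  ⟨by simpa [Mem.setNat] using h.1, by simpa [Mem.setNat] using h.2.1, by simp [Mem.setNat],
    h.2.2.2⟩

lemma RowIs.setC {n : ℕ} {μ : Mem} {b i : ℕ} {e : Entry n} (h : RowIs μ b i e) (v : ℝ) :
    RowIs (μ.setReal b i 0 v) b i ⟨e.P, e.a, e.b, v⟩ :=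
  ⟨h.1, h.2.1, h.2.2.1, by simp [Mem.setReal]⟩

lemma RowIs.setP {n : ℕ} {μ : Mem} {b i : ℕ} {e : Entry n} (h : RowIs μ b i e)
    (Q : PauliString n) : RowIs (μ.setRow b i Q) b i ⟨Q, e.a, e.b, e.c⟩ :=
  ⟨fun j => by simp [Mem.setRow], by simpa [Mem.setRow] using h.2.1,
    by simpa [Mem.setRow] using h.2.2.1, h.2.2.2⟩

/-- A loop that appends to a table. -/
lemma wp_for_append {x : Input} {v : ℕ} {N : NExpr} {body : Program} {μ : Mem} {t : ℕ}
    {l : List (Entry x.n)} (f : ℕ → List (Entry x.n)) (K c : ℕ) (hv : v ∉ body.writes)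
    (hvt : v ∉ [t, t + 1, t + 2])
    (hN : ∀ μ', Agree (v :: body.writes) μ μ' → N.eval μ' = K) (hl : Tab μ t l)
    (hb : ∀ i < K, ∀ μ' acc, Agree (v :: body.writes) μ μ' → μ'.nat v 0 0 = i → Tab μ' t acc →
      wp x body μ' fun μ'' T => Tab μ'' t (acc ++ f i) ∧ T ≤ c) :
    wp x (forLoop v N body) μ fun μ' T =>
      Tab μ' t (l ++ (List.range K).flatMap f) ∧ T ≤ 2 + K * (c + 2) := by
  simp only [List.mem_cons, List.not_mem_nil, or_false, not_or] at hvt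
  refine wp_for (fun i μ' => Tab μ' t (l ++ (List.range i).flatMap f)) K c hv hN ?_ ?_ ?_
  · intro i μ₁ μ₂ ha h
    exact h.agree ha (by simp; omega) (by simp; omega) (by simp; omega)
  · simpa using hl
  · intro i hi μ' ha hv hI
    have := hb i hi μ' _ ha hv hI
    rwa [List.append_assoc, ← List.flatMap_singleton (f := f), ← List.flatMap_append,
      ← List.range_succ] at this

/-- Replaces every entry of table `60` by the entries that `body` appends to table `64`. -/
def flat (body : Program) : Program := .seq (clear 64) (.seq (each 60 body) (moveTab 64 60))

/-- The body may use that the accumulator is the fold over an initial segment of the table. Merging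
needs this: the time of one insertion grows with the accumulator, whose length is controlled only
through this description. -/
lemma wp_flat {x : Input} {μ : Mem} {body : Program} {l : List (Entry x.n)}
    (h : List (Entry x.n) → Entry x.n → List (Entry x.n)) (c : ℕ) (hB : Base x μ)
    (hW : ∀ A ∈ [0, 2, 60, 61, 62], A ∉ body.writes) (hl : Tab μ 60 l)
    (hb : ∀ μ' acc e, e ∈ l → (∃ k, acc = (l.take k).foldl h []) →
      Agree (1 :: 2 :: 50 :: 51 :: 66 :: body.writes) μ μ' → Base x μ' →
      RowIs μ' 50 0 e → Tab μ' 64 acc →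
      wp x body μ' fun μ'' T => Tab μ'' 64 (h acc e) ∧ T ≤ c) :
    wp x (flat body) μ fun μ' T => Tab μ' 60 (l.foldl h []) ∧
      T ≤ 6 + l.length * (c + 3 * x.n + 7) + (l.foldl h []).length * (6 * x.n + 13) := by
  refine wp_seq wp_clear ?_
  rintro μ₁ T₁ ha ⟨h1, h2⟩
  have ha' : Agree [66] μ μ₁ := ha
  refine wp_seq (wp_each h c (hB.agree ha' (by norm_num)) (by norm_num) (by norm_num) hW
    (hl.agree ha' (by norm_num) (by norm_num) (by norm_num)) h1 ?_) ?_
  · intro μ' acc e he hk hag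
    refine hb μ' acc e he hk ((ha'.trans hag).mono fun A hA => ?_)
    simp at hA ⊢; tauto
  · rintro μ₂ T₂ ha₂ ⟨h3, h4⟩
    have hB₂ : Base x μ₂ := by
      refine (hB.agree ha' (by norm_num)).agree ha₂ ?_
      have := hW 0 (by simp)
      simp only [each, load, copyEntry, Program.writes, List.mem_append, forLoop_writes,
        Instr.writes, List.mem_cons]
      simpa using this
    refine wp_mono (wp_moveTab hB₂ (by norm_num) (by norm_num) (by norm_num) h3) ?_
    rintro μ₃ T₃ _ ⟨h5, h6⟩
    exact ⟨h5, by omega⟩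

lemma foldl_append_eq {α : Type*} (f : α → List α) (l : List α) :
    l.foldl (fun acc e => acc ++ f e) [] = l.flatMap f := by
  suffices ∀ l₀, l.foldl (fun acc e => acc ++ f e) l₀ = l₀ ++ l.flatMap f by simpa using this []
  intro l₀
  induction l generalizing l₀ with
  | nil => simp
  | cons e l ih => rw [List.foldl_cons, ih]; simp

lemma wp_flat_flatMap {x : Input} {μ : Mem} {body : Program} {l : List (Entry x.n)}
    (f : Entry x.n → List (Entry x.n)) (c : ℕ) (hB : Base x μ)
    (hW : ∀ A ∈ [0, 2, 60, 61, 62], A ∉ body.writes) (hl : Tab μ 60 l)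
    (hb : ∀ μ' acc e, e ∈ l → Agree (1 :: 2 :: 50 :: 51 :: 66 :: body.writes) μ μ' → Base x μ' →
      RowIs μ' 50 0 e → Tab μ' 64 acc →
      wp x body μ' fun μ'' T => Tab μ'' 64 (acc ++ f e) ∧ T ≤ c) :
    wp x (flat body) μ fun μ' T => Tab μ' 60 (l.flatMap f) ∧
      T ≤ 6 + l.length * (c + 3 * x.n + 7) + (l.flatMap f).length * (6 * x.n + 13) := by
  rw [← foldl_append_eq f l]
  exact wp_flat _ c hB hW hl fun μ' acc e he _ => hb μ' acc e he

/-! ## Expanding a layer -/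

/-- The non-Clifford layer number `t`. -/
def ncLayer {n : ℕ} (C : Circuit n) (t : ℕ) : Layer n :=
  ((blocks C).2.map Prod.fst).getD t ⟨[], List.Pairwise.nil⟩

lemma gateAt_eq {n : ℕ} (C : Circuit n) (t j : ℕ) :
    gateAt C t j = gateOn (ncLayer C t).gates j := by
  unfold gateAt gateOn ncLayer
  rw [List.getD_eq_getElem?_getD, List.getElem?_map]
  cases (blocks C).2[t]? <;> rfl

/-- Tries the letters in variables `8` and `9` on the qubits in variables `4` and `6`. -/
def childBody (dir : Bool) : Program :=
  .seq (copyEntry 50 (.const 0) 54 (.const 0))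
  (.seq (.instr (.nset ⟨54, .const 0, nvar 4⟩ (nvar 8)))
  (.seq (.instr (.nset ⟨54, .const 0, nvar 6⟩ (nvar 9)))
  (.seq (.instr (.askAmp (scal 10) (nvar 3) (nvar 4) ⟨if dir then 54 else 50, .const 0⟩
    ⟨if dir then 50 else 54, .const 0⟩))
  (.ite (.and (.or (.neq (nvar 6) (nvar 4)) (.not (.neq (nvar 8) (nvar 9))))
      (.or (.rlt (rvar 10) (.const 0)) (.rlt (.const 0) (rvar 10))))
    (.seq (.instr (.nset ⟨55, .const 0, .const 0⟩ (nvar 7)))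
    (.seq (.instr (.rset ⟨54, .const 0, .const 0⟩
      (.mul (.read 50 (.const 0) (.const 0)) (rvar 10)))) (pushEntry 54 64)))
    skip))))

lemma wp_childBody {x : Input} {μ : Mem} {dir : Bool} {t j p y z κ : ℕ} {g : Gate x.n}
    {e : Entry x.n} {acc : List (Entry x.n)} (hB : Base x μ) (hg : gateAt x.circuit t j = some g)
    (h3 : μ.nat 3 0 0 = t) (h4 : μ.nat 4 0 0 = j) (h6 : μ.nat 6 0 0 = p) (h7 : μ.nat 7 0 0 = κ)
    (h8 : μ.nat 8 0 0 = y) (h9 : μ.nat 9 0 0 = z) (hy : y < 4) (hz : z < 4)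
    (he : RowIs μ 50 0 e) (hacc : Tab μ 64 acc) :
    wp x (childBody dir) μ fun μ' T => Tab μ' 64 (acc ++
      if (p ≠ j ∨ y = z) ∧ gateAmp dir g e.P (setLetter (setLetter e.P j y) p z) ≠ 0 then
        [⟨setLetter (setLetter e.P j y) p z, κ, e.b,
          e.c * gateAmp dir g e.P (setLetter (setLetter e.P j y) p z)⟩] else []) ∧
      T ≤ 6 * x.n + 17 := by
  refine wp_seq (wp_copyEntry hB (by norm_num) (by norm_num) (by norm_num) (fun _ _ => rfl)
    (fun _ _ => rfl) he) ?_
  rintro μ₁ T₁ ha₁ ⟨r1, -, hT₁⟩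
  have ha₁ : Agree [1, 54, 55] μ μ₁ := ha₁.mono (by decide)
  refine wp_instr_seq ?_
  have q1 : Instr.run x μ₁ (.nset ⟨54, .const 0, nvar 4⟩ (nvar 8)) = μ₁.setNat 54 0 j y := by
    simp only [Instr.run, Cell.putNat, NExpr.eval, nvar]
    rw [(ha₁ 4 (by decide)).1, (ha₁ 8 (by decide)).1, h4, h8]
  rw [q1]
  set μ₂ := μ₁.setNat 54 0 j y with hμ₂
  have r2 := r1.setLetter (j := j) hy
  rw [← hμ₂] at r2
  have ha₂ : Agree [1, 54, 55] μ μ₂ := (ha₁.trans (agree_setNat μ₁ 54 0 j y)).mono (by decide)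
  refine wp_instr_seq ?_
  have q2 : Instr.run x μ₂ (.nset ⟨54, .const 0, nvar 6⟩ (nvar 9)) = μ₂.setNat 54 0 p z := by
    simp only [Instr.run, Cell.putNat, NExpr.eval, nvar]
    rw [(ha₂ 6 (by decide)).1, (ha₂ 9 (by decide)).1, h6, h9]
  rw [q2]
  set μ₃ := μ₂.setNat 54 0 p z with hμ₃
  have r3 := r2.setLetter (j := p) hz
  rw [← hμ₃] at r3
  have ha₃ : Agree [1, 54, 55] μ μ₃ := (ha₂.trans (agree_setNat μ₂ 54 0 p z)).mono (by decide)
  set Q := setLetter (setLetter e.P j y) p z with hQ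
  set r := gateAmp dir g e.P Q with hr
  have e3 : RowIs μ₃ 50 0 e := he.agree ha₃ (by decide) (by decide)
  refine wp_seq_real 10 r ?_ rfl ?_
  -- For the inverse gate the program interchanges the two rows, because `amp Uᴴ P Q = amp U Q P`.
  · have g1 := e3.getRow
    have g2 := r3.getRow
    simp only [Instr.run, Cell.putReal, NExpr.eval, nvar, scal, Row.get]
    rw [(ha₃ 3 (by decide)).1, (ha₃ 4 (by decide)).1, h3, h4, hg, hr, gateAmp]
    cases dir
    · simp [g1, g2]
    · simp [g1, g2]
  intro μ₄ ha₄ v10 hnat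
  have hag : Agree [1, 10, 54, 55] μ μ₄ := (ha₃.trans ha₄).mono (by decide)
  have r4 := r3.agree ha₄ (by decide) (by decide)
  have e4 := e3.agree ha₄ (by decide) (by decide)
  have hc : (Test.and (.or (.neq (nvar 6) (nvar 4)) (.not (.neq (nvar 8) (nvar 9))))
      (.or (.rlt (rvar 10) (.const 0)) (.rlt (.const 0) (rvar 10)))).holds μ₄ ↔
      (p ≠ j ∨ y = z) ∧ r ≠ 0 := by
    simp only [Test.holds, Test.holds_or, Test.holds_neq, nvar, rvar, NExpr.eval, RExpr.eval, v10]
    rw [(hag 4 (by decide)).1, (hag 6 (by decide)).1, (hag 8 (by decide)).1, (hag 9 (by decide)).1,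
      h4, h6, h8, h9, Int.cast_zero, ne_iff_lt_or_gt (a := r)]
    simp
  refine wp_ite (fun hb => ?_) (fun hb => ?_)
  · rw [hc] at hb
    rw [if_pos hb]
    refine wp_instr_seq ?_
    have q5 : Instr.run x μ₄ (.nset ⟨55, .const 0, .const 0⟩ (nvar 7)) = μ₄.setNat 55 0 0 κ := by
      simp only [Instr.run, Cell.putNat, NExpr.eval, nvar]
      rw [(hag 7 (by decide)).1, h7]
    rw [q5]
    have r5 := r4.setA κ
    have a5 := agree_setNat μ₄ 55 0 0 κ
    set μ₅ := μ₄.setNat 55 0 0 κ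
    refine wp_instr_seq ?_
    have q6 : Instr.run x μ₅ (.rset ⟨54, .const 0, .const 0⟩
        (.mul (.read 50 (.const 0) (.const 0)) (rvar 10))) = μ₅.setReal 54 0 0 (e.c * r) := by
      simp only [Instr.run, Cell.putReal, NExpr.eval, RExpr.eval, rvar]
      rw [(a5 50 (by decide)).2, (a5 10 (by decide)).2, v10, e4.2.2.2]
    rw [q6]
    have r6 := r5.setC (e.c * r)
    have a6 := agree_setReal μ₅ 54 0 0 (e.c * r)
    set μ₆ := μ₅.setReal 54 0 0 (e.c * r)
    have hag₆ : Agree [1, 10, 54, 55] μ μ₆ := ((hag.trans a5).trans a6).mono (by decide)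
    refine wp_mono (wp_pushEntry (hB.agree hag₆ (by decide)) (by norm_num) (by norm_num)
      (by norm_num) r6 (hacc.agree hag₆ (by decide) (by decide) (by decide))) ?_
    rintro μ₇ T₇ _ ⟨h1, h2⟩
    exact ⟨h1, by simp only [Instr.time]; omega⟩
  · rw [hc] at hb
    rw [if_neg hb, List.append_nil]
    refine wp_mono wp_skip ?_
    rintro μ₇ T₇ _ ⟨h1, h2⟩
    exact ⟨hacc.agree (hag.trans h1) (by decide) (by decide) (by decide),
      by simp only [Instr.time]; omega⟩

/-- Applies the gate at the qubit in variable `4` of the layer in variable `3` to an entry. -/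
def stageBody (dir : Bool) : Program :=
  .seq (.instr (.askKind (scal 5) (nvar 3) (nvar 4)))
  (.seq (.instr (.askPartner (scal 6) (nvar 3) (nvar 4)))
  (.ite (.or (.nlt (nvar 5) (.const 1)) (.or (.nlt (nvar 6) (nvar 4))
      (.and (.nlt (.read 50 (.const 0) (nvar 4)) (.const 1))
        (.nlt (.read 50 (.const 0) (nvar 6)) (.const 1)))))
    (pushEntry 50 64)
    (.seq (assign 7 (.add (.read 51 (.const 0) (.const 0)) (.sub (nvar 5) (.const 1))))
      (.ite (.nlt thresh (nvar 7)) skip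
        (forLoop 8 (.const 4) (forLoop 9 (.const 4) (childBody dir)))))))

lemma wp_stageBody {x : Input} {μ : Mem} {dir : Bool} {t j : ℕ} {e : Entry x.n}
    {acc : List (Entry x.n)} (hB : Base x μ) (hj : j < x.n)
    (h3 : μ.nat 3 0 0 = t) (h4 : μ.nat 4 0 0 = j) (he : RowIs μ 50 0 e) (hacc : Tab μ 64 acc) :
    wp x (stageBody dir) μ fun μ' T =>
      Tab μ' 64 (acc ++ stage dir (ncLayer x.circuit t).gates x.ℓ j e) ∧
      T ≤ 96 * x.n + 350 := by
  set kd : ℕ := (match gateAt x.circuit t j with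
      | none => 0
      | some g => if IsClifford g.toOp then 1 else 2) with hkd
  set p : ℕ := (match gateAt x.circuit t j with
      | none => j
      | some g => g.partner j) with hp
  refine wp_seq_nat 5 kd ?_ rfl fun μ₁ a₁ v5 _ => ?_
  · simp only [Instr.run, Cell.putNat, scal, nvar, NExpr.eval, h3, h4, hkd]
  refine wp_seq_nat 6 p ?_ rfl fun μ₂ a₂ v6 _ => ?_
  · simp only [Instr.run, Cell.putNat, scal, nvar, NExpr.eval]
    rw [(a₁ 3 (by decide)).1, (a₁ 4 (by decide)).1, h3, h4, hp]
  have hag : Agree [5, 6] μ μ₂ := (a₁.trans a₂).mono (by decide)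
  have w3 : μ₂.nat 3 0 0 = t := by rw [(hag 3 (by decide)).1, h3]
  have w4 : μ₂.nat 4 0 0 = j := by rw [(hag 4 (by decide)).1, h4]
  have w5 : μ₂.nat 5 0 0 = kd := by rw [(a₂ 5 (by decide)).1, v5]
  have e₂ : RowIs μ₂ 50 0 e := he.agree hag (by decide) (by decide)
  have hB₂ := hB.agree hag (by decide)
  have acc₂ := hacc.agree hag (by decide) (by decide) (by decide)
  have hpn : p < x.n := by
    rw [hp]
    rcases hg : gateAt x.circuit t j with _ | g
    · exact hj
    · rw [gateAt_eq] at hg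
      obtain ⟨-, k, rfl, hk⟩ := gateOn_some hg
      exact g.partner_lt hk
  have hc : (Test.or (.nlt (nvar 5) (.const 1)) (.or (.nlt (nvar 6) (nvar 4))
      (.and (.nlt (.read 50 (.const 0) (nvar 4)) (.const 1))
        (.nlt (.read 50 (.const 0) (nvar 6)) (.const 1))))).holds μ₂ ↔
      kd = 0 ∨ p < j ∨ (letter e.P j = 0 ∧ letter e.P p = 0) := by
    simp only [Test.holds, Test.holds_or, nvar, NExpr.eval, w4, w5, v6, e₂.letter hj,
      e₂.letter hpn]
    omega
  have hstage : stage dir (ncLayer x.circuit t).gates x.ℓ j e =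
      match gateAt x.circuit t j with
      | none => [e]
      | some g =>
        if g.partner j < j ∨ (letter e.P j = 0 ∧ letter e.P (g.partner j) = 0) then [e]
        else if e.a + (if IsClifford g.toOp then 0 else 1) ≤ x.ℓ then
          (List.range 4).flatMap fun x => (List.range 4).flatMap fun y =>
            if (g.partner j ≠ j ∨ x = y) ∧
                gateAmp dir g e.P (setLetter (setLetter e.P j x) (g.partner j) y) ≠ 0 then
              [⟨setLetter (setLetter e.P j x) (g.partner j) y,
                e.a + (if IsClifford g.toOp then 0 else 1), e.b,
                e.c * gateAmp dir g e.P (setLetter (setLetter e.P j x) (g.partner j) y)⟩]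
            else []
        else [] := by
    rw [gateAt_eq, stage]; cases gateOn (ncLayer x.circuit t).gates j <;> rfl
  refine wp_ite (fun hb => ?_) (fun hb => ?_)
  · rw [hc] at hb
    have : stage dir (ncLayer x.circuit t).gates x.ℓ j e = [e] := by
      rw [hstage]
      rcases hg : gateAt x.circuit t j with _ | g
      · rfl
      · simp only [hg] at hkd hp
        dsimp only
        refine if_pos ?_
        rw [← hp]
        refine hb.resolve_left ?_
        rw [hkd]; split_ifs <;> norm_num
    rw [this]
    refine wp_mono (wp_pushEntry hB₂ (by norm_num) (by norm_num) (by norm_num) e₂ acc₂) ?_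
    rintro μ' T _ ⟨h1, h2⟩
    exact ⟨h1, by omega⟩
  · rw [hc] at hb
    rcases hg : gateAt x.circuit t j with _ | g
    · simp only [hg] at hkd; exact absurd (Or.inl hkd) hb
    simp only [hg] at hkd hp hstage
    rw [not_or] at hb
    -- The kind is 1 for a Clifford gate and 2 for a non-Clifford one, so the kind minus one is the
    -- increment of the counter.
    have hκ : e.a + (kd - 1) = e.a + (if IsClifford g.toOp then 0 else 1) := by
      rw [hkd]; split_ifs <;> rfl
    rw [hstage, if_neg (by rw [← hp]; exact hb.2), ← hκ, ← hp]
    set κ := e.a + (kd - 1) with hκdef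
    refine wp_seq_nat 7 κ ?_ rfl fun μ₃ a₃ v7 _ => ?_
    · simp only [Instr.run, Cell.putNat, scal, nvar, NExpr.eval, e₂.2.1, w5, hκdef]
    have B₃ := hB₂.agree a₃ (by decide)
    have acc₃ := acc₂.agree a₃ (by decide) (by decide) (by decide)
    have e₃ := e₂.agree a₃ (by decide) (by decide)
    have hc' : (Test.nlt thresh (nvar 7)).holds μ₃ ↔ x.ℓ < κ := by
      simp only [Test.holds, thresh, nvar, NExpr.eval, v7, B₃.2.2.1]
    refine wp_ite (fun hb' => ?_) (fun hb' => ?_)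
    · rw [hc'] at hb'
      rw [if_neg (by omega), List.append_nil]
      refine wp_mono wp_skip ?_
      rintro μ' T _ ⟨h1, h2⟩
      exact ⟨acc₃.agree h1 (by decide) (by decide) (by decide), by omega⟩
    · rw [hc'] at hb'
      rw [if_pos (by omega)]
      have hwr : (childBody dir).writes ⊆ [1, 10, 54, 55, 64, 65, 66] := by
        clear hstage; cases dir <;> decide
      have hw8 : 8 ∉ (forLoop 9 (.const 4) (childBody dir)).writes := by
        clear hstage; cases dir <;> decide
      have hw9 : 9 ∉ (childBody dir).writes := fun h => absurd (hwr h) (by decide)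
      have hwf : (8 :: (forLoop 9 (.const 4) (childBody dir)).writes) ++
          (9 :: (childBody dir).writes) ⊆ [1, 8, 9, 10, 54, 55, 64, 65, 66] := by
        clear hstage; cases dir <;> decide
      -- The nested loops over the sixteen pairs of letters cost 2 + 4(24n + 80) = 96n + 322; the
      -- instructions before them fit into the rest of 350.
      refine wp_mono (wp_for_append (t := 64) (l := acc) (fun y => (List.range 4).flatMap fun z =>
          if (p ≠ j ∨ y = z) ∧ gateAmp dir g e.P (setLetter (setLetter e.P j y) p z) ≠ 0 then
            [⟨setLetter (setLetter e.P j y) p z, κ, e.b,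
              e.c * gateAmp dir g e.P (setLetter (setLetter e.P j y) p z)⟩] else [])
        4 (2 + 4 * (6 * x.n + 17 + 2)) hw8 (by decide)
        (fun _ _ => rfl) acc₃ ?_) ?_
      · intro y hy μ₄ acc' a₄ v8 hacc'
        refine wp_for_append (t := 64) (l := acc') _ 4 (6 * x.n + 17) hw9 (by decide) (fun _ _ => rfl) hacc' ?_
        intro z hz μ₅ acc'' a₅ v9 hacc''
        have a : Agree [1, 8, 9, 10, 54, 55, 64, 65, 66] μ₃ μ₅ :=
          (a₄.trans a₅).mono hwf
        have a' : Agree [1, 7, 8, 9, 10, 54, 55, 64, 65, 66] μ₂ μ₅ := (a₃.trans a).mono (by decide)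
        refine wp_childBody (B₃.agree a (by decide)) hg ?_ ?_ ?_ ?_ ?_ v9 hy hz
          (e₃.agree a (by decide) (by decide)) hacc''
        · rw [(a' 3 (by decide)).1, w3]
        · rw [(a' 4 (by decide)).1, w4]
        · rw [(a' 6 (by decide)).1, v6]
        · rw [(a 7 (by decide)).1, v7]
        · rw [(a₅ 8 (fun h => by
            rcases List.mem_cons.1 h with h | h
            · exact absurd h (by decide)
            · exact absurd (hwr h) (by decide))).1, v8]
      · rintro μ' T _ ⟨h1, h2⟩
        exact ⟨h1, by omega⟩

/-- Replaces table `60` by its images under the layer in variable `3`. -/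
def expandProg (dir : Bool) : Program := forLoop 4 qubits (flat (stageBody dir))

/-- The cost of one gate depends on the tables before and after it, so M has to bound all
intermediate tables and not just the first and the last. -/
lemma wp_expandProg {x : Input} {μ : Mem} {dir : Bool} {t M : ℕ} {l : List (Entry x.n)}
    (hB : Base x μ) (h3 : μ.nat 3 0 0 = t) (hl : Tab μ 60 l)
    (hM : ∀ m ≤ x.n, (expandTo dir (ncLayer x.circuit t).gates x.ℓ m l).length ≤ M) :
    wp x (expandProg dir) μ fun μ' T => Tab μ' 60 (expandL dir (ncLayer x.circuit t) x.ℓ l) ∧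
      T ≤ 2 + x.n * (8 + M * (105 * x.n + 370)) := by
  refine wp_mono (wp_for (fun i μ' => Tab μ' 60
    (expandTo dir (ncLayer x.circuit t).gates x.ℓ i l)) x.n (6 + M * (105 * x.n + 370))
    (by cases dir <;> decide) ?_ ?_ hl ?_) ?_
  · intro μ' ha
    have h0 := ha 0 (by cases dir <;> decide)
    simp only [qubits, NExpr.eval, h0.1, hB.1]
  · intro i μ₁ μ₂ ha h
    exact h.agree ha (by decide) (by decide) (by decide)
  · intro j hj μ₁ ha v4 hI
    have hB₁ : Base x μ₁ := hB.agree ha (by cases dir <;> decide)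
    have v3 : μ₁.nat 3 0 0 = t := by rw [(ha 3 (by cases dir <;> decide)).1, h3]
    refine wp_mono (wp_flat_flatMap (stage dir (ncLayer x.circuit t).gates x.ℓ j)
      (96 * x.n + 350) hB₁ (by cases dir <;> decide) hI ?_) ?_
    · intro μ₂ acc e _ a₂ hB₂ he hacc
      refine wp_stageBody hB₂ hj ?_ ?_ he hacc
      · rw [(a₂ 3 (by cases dir <;> decide)).1, v3]
      · rw [(a₂ 4 (by cases dir <;> decide)).1, v4]
    · rintro μ₂ T _ ⟨h1, h2⟩
      rw [← expandTo_succ] at h1 h2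
      refine ⟨h1, h2.trans ?_⟩
      have m1 := Nat.mul_le_mul_right (96 * x.n + 350 + 3 * x.n + 7) (hM j hj.le)
      have m2 := Nat.mul_le_mul_right (6 * x.n + 13) (hM (j + 1) hj)
      -- An entry costs 96n + 350 for the gate and 3n + 7 for loading and looping; an image costs 6n
      -- + 13 for moving it back.
      have : M * (105 * x.n + 370) =
        M * (96 * x.n + 350 + 3 * x.n + 7) + M * (6 * x.n + 13) := by ring
      omega
  · rintro μ' T _ ⟨h1, h2⟩
    refine ⟨h1, h2.trans (le_of_eq ?_)⟩
    ring

/-! ## Programs that act on each entry of a table -/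

/-- The number of non-identity letters on `S`. -/
def wt {n : ℕ} (S : Finset (Fin n)) (P : PauliString n) : ℕ := (S.filter fun j => P j ≠ 0).card

lemma wt_univ {n : ℕ} (P : PauliString n) : wt Finset.univ P = weight P := rfl

lemma gateOn_of_mem {n : ℕ} {G : List (Gate n)} (h : DisjointGates G) {g : Gate n} (hg : g ∈ G)
    {j : Fin n} (hj : j ∈ g.support) : gateOn G j = some g := by
  induction G with
  | nil => simp at hg
  | cons g' G ih =>
    rw [gateOn_cons]
    rcases List.mem_cons.1 hg with rfl | hg'
    · rw [if_pos (Finset.mem_image_of_mem _ hj)]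
    · have hd : Disjoint g'.support g.support := (List.pairwise_cons.1 h).1 g hg'
      rw [if_neg, ih (List.pairwise_cons.1 h).2 hg']
      intro hc
      obtain ⟨k, hk, hkj⟩ := Finset.mem_image.1 hc
      rw [Fin.val_injective hkj] at hk
      exact Finset.disjoint_left.1 hd hk hj

lemma mem_nonCliffordQubits_iff {n : ℕ} (L : Layer n) (j : Fin n) :
    j ∈ L.nonCliffordQubits ↔ ∃ g, gateOn L.gates j = some g ∧ ¬ IsClifford g.toOp := by
  simp only [Layer.nonCliffordQubits, Finset.mem_filter, Finset.mem_univ, true_and]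
  constructor
  · rintro ⟨g, h1, h2, h3⟩
    exact ⟨g, gateOn_of_mem L.disjoint h1 h3, h2⟩
  · rintro ⟨g, h1, h2⟩
    obtain ⟨h3, k, hk, h4⟩ := gateOn_some h1
    rw [Fin.val_injective hk] at h4
    exact ⟨g, h3, h2, h4⟩

/-- The noisy qubits: all, or those in non-Clifford gates of layer `t`. -/
def noiseSet {n : ℕ} (C : Circuit n) (gate : Bool) (t : ℕ) : Finset (Fin n) :=
  if gate then (ncLayer C t).nonCliffordQubits else Finset.univ

/-- Computes the weight of the Pauli operator in register `50` on the noisy qubits (variable `11`)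
and its damped coefficient (variable `12`). -/
def weigh (gate : Bool) : Program :=
  .seq (.instr (.nset (scal 11) (.const 0)))
  (.seq (.instr (.rset (scal 12) (.read 50 (.const 0) (.const 0))))
  (forLoop 4 qubits (.seq (.instr (.askKind (scal 5) (nvar 3) (nvar 4)))
    (.ite (if gate then .and (.nlt (.const 0) (.read 50 (.const 0) (nvar 4)))
        (.nlt (.const 1) (nvar 5)) else .nlt (.const 0) (.read 50 (.const 0) (nvar 4)))
      (.seq (.instr (.nset (scal 11) (.add (nvar 11) (.const 1))))
        (.instr (.rset (scal 12) (.mul (rvar 12) (.read 0 (.const 0) (.const 0))))))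
      skip))))

lemma wp_weigh {x : Input} {μ : Mem} {gate : Bool} {t : ℕ} {e : Entry x.n} (hB : Base x μ)
    (h3 : gate = true → μ.nat 3 0 0 = t) (he : RowIs μ 50 0 e) :
    wp x (weigh gate) μ fun μ' T =>
      μ'.nat 11 0 0 = wt (noiseSet x.circuit gate t) e.P ∧
      μ'.real 12 0 0 = e.c * x.damp ^ wt (noiseSet x.circuit gate t) e.P ∧ T ≤ 6 * x.n + 4 := by
  set S := noiseSet x.circuit gate t with hS
  have hw4 : 4 ∉ (Program.seq (.instr (.askKind (scal 5) (nvar 3) (nvar 4)))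
    (.ite (if gate then .and (.nlt (.const 0) (.read 50 (.const 0) (nvar 4)))
        (.nlt (.const 1) (nvar 5)) else .nlt (.const 0) (.read 50 (.const 0) (nvar 4)))
      (.seq (.instr (.nset (scal 11) (.add (nvar 11) (.const 1))))
        (.instr (.rset (scal 12) (.mul (rvar 12) (.read 0 (.const 0) (.const 0))))))
      skip)).writes := by simp [Program.writes, Instr.writes, scal, skip, assign]
  refine wp_seq_nat 11 0 rfl rfl fun μ₁ a₁ v11 _ => ?_
  have e₁ := he.agree a₁ (by decide) (by decide)
  refine wp_seq_real 12 e.c ?_ rfl fun μ₂ a₂ v12 hn => ?_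
  · simp [Instr.run, Cell.putReal, scal, NExpr.eval, RExpr.eval, e₁.2.2.2]
  have hag : Agree [11, 12] μ μ₂ := a₁.trans a₂
  refine wp_mono (wp_for (fun i μ' => μ'.nat 11 0 0 = wt (S.filter fun j => j.val < i) e.P ∧
    μ'.real 12 0 0 = e.c * x.damp ^ wt (S.filter fun j => j.val < i) e.P) x.n 4 hw4 ?_ ?_ ?_ ?_) ?_
  · intro μ' ha
    have h0 := ha 0 (by simp [Program.writes, Instr.writes, scal, skip, assign])
    simp only [qubits, NExpr.eval, h0.1, (hag 0 (by decide)).1, hB.1]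
  · intro i μ₃ μ₄ ha h
    rw [(ha 11 (by decide)).1, (ha 12 (by decide)).2]; exact h
  · rw [hn]; simp [wt, v11, v12]
  · rintro i hi μ₃ ha v4 ⟨i1, i2⟩
    have ha' : Agree [1, 4, 5, 11, 12] μ μ₃ := (hag.trans ha).mono (by
      simp [Program.writes, Instr.writes, scal, skip, assign])
    have e₃ := he.agree ha' (by decide) (by decide)
    have hB₃ := hB.agree ha' (by decide)
    set kd : ℕ := (match gateAt x.circuit (μ₃.nat 3 0 0) i with
      | none => 0
      | some g => if IsClifford g.toOp then 1 else 2) with hkd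
    refine wp_seq_nat 5 kd ?_ rfl fun μ₄ a₄ v5 _ => ?_
    · simp only [Instr.run, Cell.putNat, scal, nvar, NExpr.eval, v4, hkd]
    have e₄ := e₃.agree a₄ (by decide) (by decide)
    have hB₄ := hB₃.agree a₄ (by decide)
    have w4 : μ₄.nat 4 0 0 = i := by rw [(a₄ 4 (by decide)).1, v4]
    have hl : letter e.P i = (e.P ⟨i, hi⟩).val := by rw [letter, dif_pos hi]
    have hmem : gate = true → (1 < kd ↔ (⟨i, hi⟩ : Fin x.n) ∈ S) := by
      intro hg
      rw [hS, noiseSet, if_pos hg, mem_nonCliffordQubits_iff, hkd, (ha' 3 (by decide)).1, h3 hg,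
        gateAt_eq]
      cases gateOn (ncLayer x.circuit t).gates i with
      | none => simp
      | some g => by_cases hc : IsClifford g.toOp <;> simp [hc]
    have hc : (if gate then Test.and (.nlt (.const 0) (.read 50 (.const 0) (nvar 4)))
        (.nlt (.const 1) (nvar 5)) else .nlt (.const 0) (.read 50 (.const 0) (nvar 4))).holds μ₄ ↔
        (⟨i, hi⟩ : Fin x.n) ∈ S ∧ e.P ⟨i, hi⟩ ≠ 0 := by
      have hp : 0 < (e.P ⟨i, hi⟩).val ↔ e.P ⟨i, hi⟩ ≠ 0 := by
        rw [Nat.pos_iff_ne_zero, ne_eq, ne_eq, Fin.ext_iff]; rfl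
      by_cases hg : gate = true
      · rw [if_pos hg]
        simp only [Test.holds, nvar, NExpr.eval, w4, v5, e₄.letter hi, hl, hmem hg, hp]
        tauto
      · rw [if_neg hg]
        simp only [Test.holds, nvar, NExpr.eval, w4, e₄.letter hi, hl, hp]
        simp [hS, noiseSet, hg]
    have hsucc : wt (S.filter fun j => j.val < i + 1) e.P = wt (S.filter fun j => j.val < i) e.P +
        if (⟨i, hi⟩ : Fin x.n) ∈ S ∧ e.P ⟨i, hi⟩ ≠ 0 then 1 else 0 := by
      unfold wt
      simp only [Finset.filter_filter]
      split_ifs with h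
      · rw [← Finset.card_insert_of_notMem (a := (⟨i, hi⟩ : Fin x.n)) (by simp)]
        congr 1
        ext j
        simp only [Finset.mem_filter, Finset.mem_insert, Fin.ext_iff]
        constructor
        · rintro ⟨h1, h2, h3⟩
          by_cases h4 : j.val = i
          · exact Or.inl h4
          · exact Or.inr ⟨h1, by omega, h3⟩
        · rintro (h1 | ⟨h1, h2, h3⟩)
          · have : j = ⟨i, hi⟩ := Fin.ext h1
            subst this
            exact ⟨h.1, Nat.lt_succ_self _, fun h5 => h.2 h5⟩
          · exact ⟨h1, by omega, h3⟩
      · rw [add_zero]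
        congr 1
        ext j
        simp only [Finset.mem_filter]
        refine and_congr_right fun h1 => and_congr_left fun h2 => ?_
        have : j.val ≠ i := fun h3 => h (by
          have : j = ⟨i, hi⟩ := Fin.ext h3
          subst this
          exact ⟨h1, h2⟩)
        omega
    have j1 : μ₄.nat 11 0 0 = wt (S.filter fun j => j.val < i) e.P := by
      rw [(a₄ 11 (by decide)).1, i1]
    have j2 : μ₄.real 12 0 0 = e.c * x.damp ^ wt (S.filter fun j => j.val < i) e.P := by
      rw [(a₄ 12 (by decide)).2, i2]
    refine wp_ite (fun hb => ?_) (fun hb => ?_)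
    · rw [hc] at hb
      rw [if_pos hb] at hsucc
      refine wp_instr_seq (wp_instr ⟨⟨?_, ?_⟩, ?_⟩)
      · rw [hsucc]
        simp [Instr.run, Cell.putNat, Cell.putReal, scal, nvar, NExpr.eval, Mem.setNat,
          Mem.setReal, j1]
      · rw [hsucc]
        simp [Instr.run, Cell.putNat, Cell.putReal, scal, rvar, nvar, NExpr.eval, RExpr.eval,
          Mem.setNat, Mem.setReal, j2, hB₄.2.2.2.2, pow_succ, mul_assoc]
      · simp [Instr.time]
    · rw [hc] at hb
      rw [if_neg hb, add_zero] at hsucc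
      refine wp_mono wp_skip ?_
      rintro μ₅ T _ ⟨h1, h2⟩
      rw [(h1 11 (by decide)).1, (h1 12 (by decide)).2, hsucc]
      exact ⟨⟨j1, j2⟩, by omega⟩
  · rintro μ₃ T _ ⟨⟨h1, h2⟩, hT⟩
    have : (S.filter fun j => j.val < x.n) = S := Finset.filter_true_of_mem fun j _ => j.2
    rw [this] at h1 h2
    exact ⟨h1, h2, by omega⟩

/-- Damps an entry according to its weight, and updates the counters; the new second counter may
not exceed `ℓ`. -/
def weighE {n : ℕ} (S : Finset (Fin n)) (fa fb : ℕ → ℕ → ℕ) (ℓ : ℕ) (damp : ℝ) (e : Entry n) :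
    List (Entry n) :=
  if fb e.b (wt S e.P) ≤ ℓ then
    [⟨e.P, fa e.b (wt S e.P), fb e.b (wt S e.P), e.c * damp ^ wt S e.P⟩] else []

/-- The program for `weighE`; the new counters are given by expressions. -/
def weighBody (gate : Bool) (ea eb : NExpr) : Program :=
  .seq (weigh gate)
  (.seq (copyEntry 50 (.const 0) 54 (.const 0))
  (.seq (.instr (.nset ⟨55, .const 0, .const 0⟩ ea))
  (.seq (.instr (.nset ⟨55, .const 0, .const 1⟩ eb))
  (.seq (.instr (.rset ⟨54, .const 0, .const 0⟩ (rvar 12)))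
  (.ite (.nlt thresh (.read 55 (.const 0) (.const 1))) skip (pushEntry 54 64))))))

lemma weighBody_writes (gate : Bool) (ea eb : NExpr) :
    (weighBody gate ea eb).writes = [11, 12, 4, 5, 11, 12, 1, 4, 1, 54, 1, 55, 55, 54, 55, 55, 54,
      1, 1, 64, 1, 65, 65, 64, 66] := rfl

lemma wp_weighBody {x : Input} {μ : Mem} {gate : Bool} {ea eb : NExpr} {fa fb : ℕ → ℕ → ℕ} {t : ℕ}
    {e : Entry x.n} {acc : List (Entry x.n)} (hB : Base x μ) (h3 : gate = true → μ.nat 3 0 0 = t)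
    (ha : ∀ μ, ea.eval μ = fa (μ.nat 51 0 1) (μ.nat 11 0 0))
    (hb : ∀ μ, eb.eval μ = fb (μ.nat 51 0 1) (μ.nat 11 0 0))
    (he : RowIs μ 50 0 e) (hacc : Tab μ 64 acc) :
    wp x (weighBody gate ea eb) μ fun μ' T =>
      Tab μ' 64 (acc ++ weighE (noiseSet x.circuit gate t) fa fb x.ℓ x.damp e) ∧
      T ≤ 12 * x.n + 20 := by
  set w := wt (noiseSet x.circuit gate t) e.P with hw
  refine wp_seq (wp_weigh (t := t) hB h3 he) ?_
  rintro μ₁ T₁ a₁ ⟨h1, h2, hT₁⟩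
  have a₁ : Agree [1, 4, 5, 11, 12] μ μ₁ := a₁.mono (by cases gate <;> decide)
  have e₁ := he.agree a₁ (by decide) (by decide)
  refine wp_seq (wp_copyEntry (hB.agree a₁ (by decide)) (by norm_num) (by norm_num) (by norm_num)
    (fun _ _ => rfl) (fun _ _ => rfl) e₁) ?_
  rintro μ₂ T₂ a₂ ⟨r2, -, hT₂⟩
  have a₂ : Agree [1, 54, 55] μ₁ μ₂ := a₂.mono (by decide)
  have e₂ := e₁.agree a₂ (by decide) (by decide)
  have w2 : μ₂.nat 11 0 0 = w := by rw [(a₂ 11 (by decide)).1, h1]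
  have q2 : μ₂.real 12 0 0 = e.c * x.damp ^ w := by rw [(a₂ 12 (by decide)).2, h2]
  refine wp_instr_seq ?_
  have s3 : Instr.run x μ₂ (.nset ⟨55, .const 0, .const 0⟩ ea) = μ₂.setNat 55 0 0 (fa e.b w) := by
    simp only [Instr.run, Cell.putNat, NExpr.eval, ha, e₂.2.2.1, w2]
  rw [s3]
  have r3 := r2.setA (fa e.b w)
  have a3 := agree_setNat μ₂ 55 0 0 (fa e.b w)
  set μ₃ := μ₂.setNat 55 0 0 (fa e.b w)
  refine wp_instr_seq ?_
  have s4 : Instr.run x μ₃ (.nset ⟨55, .const 0, .const 1⟩ eb) = μ₃.setNat 55 0 1 (fb e.b w) := by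
    simp only [Instr.run, Cell.putNat, NExpr.eval, hb]
    rw [(a3 51 (by decide)).1, (a3 11 (by decide)).1, e₂.2.2.1, w2]
  rw [s4]
  have r4 := r3.setB (fb e.b w)
  have a4 := agree_setNat μ₃ 55 0 1 (fb e.b w)
  set μ₄ := μ₃.setNat 55 0 1 (fb e.b w)
  refine wp_instr_seq ?_
  have s5 : Instr.run x μ₄ (.rset ⟨54, .const 0, .const 0⟩ (rvar 12)) =
      μ₄.setReal 54 0 0 (e.c * x.damp ^ w) := by
    simp only [Instr.run, Cell.putReal, NExpr.eval, RExpr.eval, rvar]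
    rw [(a4 12 (by decide)).2, (a3 12 (by decide)).2, q2]
  rw [s5]
  have r5 := r4.setC (e.c * x.damp ^ w)
  have a5 := agree_setReal μ₄ 54 0 0 (e.c * x.damp ^ w)
  set μ₅ := μ₄.setReal 54 0 0 (e.c * x.damp ^ w)
  have hag : Agree [1, 4, 5, 11, 12, 54, 55] μ μ₅ :=
    ((((a₁.trans a₂).trans a3).trans a4).trans a5).mono (by decide)
  have B₅ := hB.agree hag (by decide)
  have acc₅ := hacc.agree hag (by decide) (by decide) (by decide)
  have hc : (Test.nlt thresh (.read 55 (.const 0) (.const 1))).holds μ₅ ↔ x.ℓ < fb e.b w := by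
    simp only [Test.holds, thresh, NExpr.eval, B₅.2.2.1]
    rw [show μ₅.nat (54 + 1) 0 1 = fb e.b w from r5.2.2.1]
  refine wp_ite (fun hb' => ?_) (fun hb' => ?_)
  · rw [hc] at hb'
    rw [weighE, ← hw, if_neg (by omega), List.append_nil]
    refine wp_mono wp_skip ?_
    rintro μ' T _ ⟨g1, g2⟩
    exact ⟨acc₅.agree g1 (by decide) (by decide) (by decide), by simp only [Instr.time]; omega⟩
  · rw [hc] at hb'
    rw [weighE, ← hw, if_pos (by omega)]
    refine wp_mono (wp_pushEntry B₅ (by norm_num) (by norm_num) (by norm_num) r5 acc₅) ?_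
    rintro μ' T _ ⟨g1, g2⟩
    exact ⟨g1, by simp only [Instr.time]; omega⟩

/-- The image of an entry under a Clifford unitary. -/
def cliffE {n : ℕ} (V : Op n) (e : Entry n) : Entry n :=
  ⟨cliffordImage V e.P, e.a, e.b, e.c * amp V e.P (cliffordImage V e.P)⟩

/-- The program for `cliffE`, for the Clifford block in variable `13` or its inverse. -/
def cliffBody (inv : Bool) : Program :=
  .seq (copyEntry 50 (.const 0) 54 (.const 0))
  (.seq (.instr (.askClifford inv (scal 12) ⟨54, .const 0⟩ (nvar 13) ⟨50, .const 0⟩))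
  (.seq (.instr (.rset ⟨54, .const 0, .const 0⟩
    (.mul (.read 50 (.const 0) (.const 0)) (rvar 12))))
  (pushEntry 54 64)))

lemma wp_cliffBody {x : Input} {μ : Mem} {inv : Bool} {k : ℕ} {e : Entry x.n}
    {acc : List (Entry x.n)} (hB : Base x μ) (h13 : μ.nat 13 0 0 = k)
    (he : RowIs μ 50 0 e) (hacc : Tab μ 64 acc) :
    wp x (cliffBody inv) μ fun μ' T =>
      Tab μ' 64 (acc ++ [cliffE (dirOp inv (cliffordBlock x.circuit k)) e]) ∧
      T ≤ 7 * x.n + 12 := by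
  set V := dirOp inv (cliffordBlock x.circuit k) with hV
  refine wp_seq (wp_copyEntry hB (by norm_num) (by norm_num) (by norm_num)
    (fun _ _ => rfl) (fun _ _ => rfl) he) ?_
  rintro μ₁ T₁ a₁ ⟨r1, -, hT₁⟩
  have a₁ : Agree [1, 54, 55] μ μ₁ := a₁.mono (by decide)
  have e₁ := he.agree a₁ (by decide) (by decide)
  refine wp_instr_seq ?_
  have s2 : Instr.run x μ₁ (.askClifford inv (scal 12) ⟨54, .const 0⟩ (nvar 13) ⟨50, .const 0⟩) =
      (μ₁.setReal 12 0 0 (amp V e.P (cliffordImage V e.P))).setRow 54 0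
        (cliffordImage V e.P) := by
    have hk : μ₁.nat 13 0 0 = k := by rw [(a₁ 13 (by decide)).1, h13]
    simp only [Instr.run, Cell.putReal, NExpr.eval, nvar, scal, Row.get, e₁.getRow, hk]
    rfl
  rw [s2]
  have a2 := agree_setReal μ₁ 12 0 0 (amp V e.P (cliffordImage V e.P))
  have v2 : (μ₁.setReal 12 0 0 (amp V e.P (cliffordImage V e.P))).real 12 0 0 =
    amp V e.P (cliffordImage V e.P) := by simp [Mem.setReal]
  have r2 := r1.agree a2 (by decide) (by decide)
  set μ₂ := μ₁.setReal 12 0 0 (amp V e.P (cliffordImage V e.P))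
  have a3 := agree_setRow μ₂ 54 0 (cliffordImage V e.P)
  have r3 := r2.setP (cliffordImage V e.P)
  set μ₃ := μ₂.setRow 54 0 (cliffordImage V e.P)
  refine wp_instr_seq ?_
  have s4 : Instr.run x μ₃ (.rset ⟨54, .const 0, .const 0⟩
      (.mul (.read 50 (.const 0) (.const 0)) (rvar 12))) =
      μ₃.setReal 54 0 0 (e.c * amp V e.P (cliffordImage V e.P)) := by
    simp only [Instr.run, Cell.putReal, NExpr.eval, RExpr.eval, rvar]
    rw [(a3 50 (by decide)).2, (a3 12 (by decide)).2, v2, (a2 50 (by decide)).2, e₁.2.2.2]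
  rw [s4]
  have r4 := r3.setC (e.c * amp V e.P (cliffordImage V e.P))
  have a4 := agree_setReal μ₃ 54 0 0 (e.c * amp V e.P (cliffordImage V e.P))
  set μ₄ := μ₃.setReal 54 0 0 (e.c * amp V e.P (cliffordImage V e.P))
  have hag : Agree [1, 12, 54, 55] μ μ₄ := (((a₁.trans a2).trans a3).trans a4).mono (by decide)
  refine wp_mono (wp_pushEntry (hB.agree hag (by decide)) (by norm_num) (by norm_num) (by norm_num)
    r4 (hacc.agree hag (by decide) (by decide) (by decide))) ?_
  rintro μ' T _ ⟨g1, g2⟩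
  exact ⟨g1, by simp only [Instr.time]; omega⟩

/-- Replaces the coefficient by that of the observable. -/
def obsE {n : ℕ} (o : PauliString n → ℝ) (e : Entry n) : List (Entry n) :=
  if o e.P ≠ 0 then [⟨e.P, 0, 0, o e.P⟩] else []

/-- The program for `obsE`. -/
def obsBody : Program :=
  .seq (.instr (.askObs (scal 12) ⟨50, .const 0⟩))
  (.ite (.or (.rlt (rvar 12) (.const 0)) (.rlt (.const 0) (rvar 12)))
    (.seq (.instr (.nset ⟨51, .const 0, .const 0⟩ (.const 0)))
    (.seq (.instr (.nset ⟨51, .const 0, .const 1⟩ (.const 0)))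
    (.seq (.instr (.rset ⟨50, .const 0, .const 0⟩ (rvar 12))) (pushEntry 50 64))))
    skip)

lemma wp_obsBody {x : Input} {μ : Mem} {e : Entry x.n} {acc : List (Entry x.n)} (hB : Base x μ)
    (he : RowIs μ 50 0 e) (hacc : Tab μ 64 acc) :
    wp x obsBody μ fun μ' T => Tab μ' 64 (acc ++ obsE x.obs e) ∧ T ≤ 3 * x.n + 11 := by
  refine wp_seq_real 12 (x.obs e.P) ?_ rfl fun μ₁ a₁ v12 _ => ?_
  · simp only [Instr.run, Cell.putReal, NExpr.eval, scal, Row.get, he.getRow]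
  have e₁ := he.agree a₁ (by decide) (by decide)
  have hc : (Test.or (.rlt (rvar 12) (.const 0)) (.rlt (.const 0) (rvar 12))).holds μ₁ ↔
      x.obs e.P ≠ 0 := by
    simp only [Test.holds_or, Test.holds, rvar, RExpr.eval, NExpr.eval, v12, Int.cast_zero]
    exact ne_iff_lt_or_gt.symm
  refine wp_ite (fun hb => ?_) (fun hb => ?_)
  · rw [hc] at hb
    rw [obsE, if_pos hb]
    refine wp_instr_seq ?_
    have r2 := e₁.setA 0
    have a2 := agree_setNat μ₁ 51 0 0 0
    rw [show Instr.run x μ₁ (.nset ⟨51, .const 0, .const 0⟩ (.const 0)) = μ₁.setNat 51 0 0 0 from rfl]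
    set μ₂ := μ₁.setNat 51 0 0 0
    refine wp_instr_seq ?_
    have r3 := r2.setB 0
    have a3 := agree_setNat μ₂ 51 0 1 0
    rw [show Instr.run x μ₂ (.nset ⟨51, .const 0, .const 1⟩ (.const 0)) = μ₂.setNat 51 0 1 0 from rfl]
    set μ₃ := μ₂.setNat 51 0 1 0
    refine wp_instr_seq ?_
    have s4 : Instr.run x μ₃ (.rset ⟨50, .const 0, .const 0⟩ (rvar 12)) =
        μ₃.setReal 50 0 0 (x.obs e.P) := by
      simp only [Instr.run, Cell.putReal, NExpr.eval, RExpr.eval, rvar]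
      rw [(a3 12 (by decide)).2, (a2 12 (by decide)).2, v12]
    rw [s4]
    have r4 := r3.setC (x.obs e.P)
    have a4 := agree_setReal μ₃ 50 0 0 (x.obs e.P)
    set μ₄ := μ₃.setReal 50 0 0 (x.obs e.P)
    have hag : Agree [12, 50, 51] μ μ₄ := (((a₁.trans a2).trans a3).trans a4).mono (by decide)
    refine wp_mono (wp_pushEntry (hB.agree hag (by decide)) (by norm_num) (by norm_num)
      (by norm_num) r4 (hacc.agree hag (by decide) (by decide) (by decide))) ?_
    rintro μ' T _ ⟨g1, g2⟩
    exact ⟨g1, by simp only [Instr.time]; omega⟩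
  · rw [hc] at hb
    rw [obsE, if_neg hb, List.append_nil]
    refine wp_mono wp_skip ?_
    rintro μ' T _ ⟨g1, g2⟩
    exact ⟨hacc.agree (a₁.trans g1) (by decide) (by decide) (by decide), by omega⟩

/-! ## Merging entries with equal Pauli operators -/

/-- Adds an entry to a table without repetitions. -/
def insertE {n : ℕ} (acc : List (Entry n)) (e : Entry n) : List (Entry n) :=
  if h : acc.findIdx (fun e' => decide (e'.P = e.P)) < acc.length then
    acc.set (acc.findIdx fun e' => decide (e'.P = e.P))
      ⟨(acc[acc.findIdx fun e' => decide (e'.P = e.P)]).P, 0,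
        min (acc[acc.findIdx fun e' => decide (e'.P = e.P)]).b (e.a + e.b),
        (acc[acc.findIdx fun e' => decide (e'.P = e.P)]).c + e.c⟩
  else acc ++ [⟨e.P, 0, e.a + e.b, e.c⟩]

/-- Compares the letters of row `16` of table `64` with those in register `50`. -/
def sameBody : Program :=
  .seq (.instr (.nset (scal 15) (.const 0)))
    (forLoop 4 qubits (.ite (.neq (.read 64 (nvar 16) (nvar 4)) (.read 50 (.const 0) (nvar 4)))
      (.instr (.nset (scal 15) (.const 1))) skip))

lemma wp_sameBody {x : Input} {μ : Mem} {i : ℕ} {e : Entry x.n} {acc : List (Entry x.n)}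
    (hB : Base x μ) (h16 : μ.nat 16 0 0 = i) (hi : i < acc.length) (he : RowIs μ 50 0 e)
    (hacc : Tab μ 64 acc) :
    wp x sameBody μ fun μ' T => (μ'.nat 15 0 0 = 0 ↔ acc[i].P = e.P) ∧ T ≤ 4 * x.n + 3 := by
  refine wp_seq_nat 15 0 rfl rfl fun μ₁ a₁ v15 _ => ?_
  refine wp_mono (wp_for (fun k μ' => μ'.nat 15 0 0 = 0 ↔
    ∀ j : Fin x.n, j.val < k → acc[i].P j = e.P j) x.n 2 (by decide) ?_ ?_ ?_ ?_) ?_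
  · intro μ' ha
    simp only [qubits, NExpr.eval, (ha 0 (by decide)).1, (a₁ 0 (by decide)).1, hB.1]
  · intro k μ₂ μ₃ ha h
    rw [(ha 15 (by decide)).1]; exact h
  · simp [v15]
  · intro k hk μ₂ ha v4 hI
    have ag : Agree [1, 4, 15] μ μ₂ := (a₁.trans ha).mono (by decide)
    have hc : (Test.neq (.read 64 (nvar 16) (nvar 4)) (.read 50 (.const 0) (nvar 4))).holds μ₂ ↔
        acc[i].P ⟨k, hk⟩ ≠ e.P ⟨k, hk⟩ := by
      simp only [Test.holds_neq, NExpr.eval, nvar, v4]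
      rw [(ag 16 (by decide)).1, h16, (ag 64 (by decide)).1, (ag 50 (by decide)).1]
      rw [(hacc.2 i hi).1 ⟨k, hk⟩, he.1 ⟨k, hk⟩]
      simp [Fin.ext_iff]
    have hs : (∀ j : Fin x.n, j.val < k + 1 → acc[i].P j = e.P j) ↔
        (∀ j : Fin x.n, j.val < k → acc[i].P j = e.P j) ∧ acc[i].P ⟨k, hk⟩ = e.P ⟨k, hk⟩ := by
      constructor
      · exact fun h => ⟨fun j hj => h j (by omega), h ⟨k, hk⟩ (Nat.lt_succ_self k)⟩
      · rintro ⟨h1, h2⟩ j hj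
        by_cases hjk : j.val = k
        · rwa [show j = ⟨k, hk⟩ from Fin.ext hjk]
        · exact h1 j (by omega)
    refine wp_ite (fun hb => ?_) (fun hb => ?_)
    · rw [hc] at hb
      refine wp_instr ⟨?_, by simp [Instr.time]⟩
      rw [hs]
      simp [Instr.run, Cell.putNat, scal, NExpr.eval, Mem.setNat, hb]
    · rw [hc, not_not] at hb
      refine wp_mono wp_skip ?_
      rintro μ₃ T _ ⟨h1, h2⟩
      rw [hs, (h1 15 (by decide)).1, hI]
      exact ⟨⟨fun h => ⟨h, hb⟩, fun h => h.1⟩, by omega⟩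
  · rintro μ₂ T _ ⟨h1, h2⟩
    refine ⟨h1.trans ⟨fun h => funext fun j => h j j.2, fun h j _ => congrFun h j⟩, by omega⟩

/-- Finds the row of table `64` with the Pauli operator in register `50`. -/
def findBody : Program :=
  .seq (.instr (.nset (scal 14) (len 64)))
    (forLoop 16 (len 64) (.seq sameBody
      (.ite (.and (.not (.nlt (nvar 14) (len 64))) (.nlt (nvar 15) (.const 1)))
        (.instr (.nset (scal 14) (nvar 16))) skip)))

/-- As for `List.findIdx`, absence is encoded by the length of the table. Once a row is found,
variable 14 is below the length and is not overwritten, so the first match survives. -/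
lemma wp_findBody {x : Input} {μ : Mem} {e : Entry x.n} {acc : List (Entry x.n)}
    (hB : Base x μ) (he : RowIs μ 50 0 e) (hacc : Tab μ 64 acc) :
    wp x findBody μ fun μ' T => μ'.nat 14 0 0 = acc.findIdx (fun e' => decide (e'.P = e.P)) ∧
      T ≤ 3 + acc.length * (4 * x.n + 7) := by
  refine wp_seq_nat 14 acc.length ?_ rfl fun μ₁ a₁ v14 _ => ?_
  · simp only [Instr.run, Cell.putNat, scal, len, nvar, NExpr.eval, hacc.1]
  refine wp_mono (wp_for (fun k μ' =>
    (μ'.nat 14 0 0 = acc.length ∧ ∀ j, ∀ h : j < acc.length, j < k → acc[j].P ≠ e.P) ∨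
    (∃ h : μ'.nat 14 0 0 < acc.length, acc[μ'.nat 14 0 0].P = e.P ∧
      ∀ j, ∀ h' : j < μ'.nat 14 0 0, acc[j].P ≠ e.P)) acc.length (4 * x.n + 5)
    (by decide) ?_ ?_ ?_ ?_) ?_
  · intro μ' ha
    simp only [len, nvar, NExpr.eval, (ha 66 (by decide)).1, (a₁ 66 (by decide)).1]
    exact hacc.1
  · intro k μ₂ μ₃ ha h
    simp only [(ha 14 (by decide)).1]; exact h
  · left; exact ⟨v14, fun j _ hj => absurd hj (by omega)⟩
  · intro k hk μ₂ ha v16 hI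
    have ag : Agree [1, 4, 14, 15, 16] μ μ₂ := (a₁.trans ha).mono (by decide)
    refine wp_seq (wp_sameBody (hB.agree ag (by decide)) v16 hk
      (he.agree ag (by decide) (by decide))
      (hacc.agree ag (by decide) (by decide) (by decide))) ?_
    rintro μ₃ T₃ a₃ ⟨h15, hT₃⟩
    have a₃ : Agree [1, 4, 15] μ₂ μ₃ := a₃.mono (by decide)
    have ag3 : Agree [1, 4, 14, 15, 16] μ μ₃ := (ag.trans a₃).mono (by decide)
    have l3 : μ₃.nat 66 0 0 = acc.length := by
      rw [(ag3 66 (by decide)).1]; exact hacc.1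
    simp only [← (a₃ 14 (by decide)).1] at hI
    rw [← (a₃ 16 (by decide)).1] at v16
    have hc : (Test.and (.not (.nlt (nvar 14) (len 64))) (.nlt (nvar 15) (.const 1))).holds μ₃ ↔
        acc.length ≤ μ₃.nat 14 0 0 ∧ acc[k].P = e.P := by
      simp only [Test.holds, nvar, len, NExpr.eval, l3, ← h15]
      omega
    refine wp_ite (fun hb => ?_) (fun hb => ?_)
    · rw [hc] at hb
      have hs : (Instr.run x μ₃ (.nset (scal 14) (nvar 16))).nat 14 0 0 = k := by
        simp [Instr.run, Cell.putNat, scal, nvar, NExpr.eval, Mem.setNat, v16]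
      refine wp_instr ⟨Or.inr ?_, by simp only [Instr.time]; omega⟩
      simp only [hs]
      rcases hI with hI | ⟨h, -⟩
      · exact ⟨hk, hb.2, fun j hj => hI.2 j (by omega) hj⟩
      · omega
    · rw [hc, not_and_or] at hb
      refine wp_mono wp_skip ?_
      rintro μ₄ T _ ⟨h1, h2⟩
      refine ⟨?_, by omega⟩
      simp only [(h1 14 (by decide)).1]
      rcases hI with ⟨hI, hI'⟩ | hI
      · left
        refine ⟨hI, fun j hj hjk => ?_⟩
        by_cases hjk' : j = k
        · subst hjk'
          exact hb.resolve_left (by omega)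
        · exact hI' j hj (by omega)
      · exact Or.inr hI
  · rintro μ₂ T _ ⟨h1, h2⟩
    refine ⟨?_, by rw [show 4 * x.n + 7 = 4 * x.n + 5 + 2 from rfl]; omega⟩
    rcases h1 with ⟨h, h'⟩ | ⟨h, h', h''⟩
    · rw [h, eq_comm, List.findIdx_eq_length]
      intro e' he'
      obtain ⟨j, hj, rfl⟩ := List.getElem_of_mem he'
      simpa using h' j hj hj
    · rw [eq_comm, List.findIdx_eq h]
      refine ⟨by simpa using h', fun j hj => by simpa using h'' j hj⟩

lemma Tab.set {n : ℕ} {μ μ' : Mem} {b i : ℕ} {l : List (Entry n)} {e : Entry n} (h : Tab μ b l)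
    (hl : μ'.nat (b + 2) 0 0 = l.length) (he : RowIs μ' b i e)
    (ho : ∀ r, r ≠ i → ∀ e' : Entry n, RowIs μ b r e' → RowIs μ' b r e') : Tab μ' b (l.set i e) := by
  refine ⟨by rw [List.length_set]; exact hl, fun r hr => ?_⟩
  rw [List.length_set] at hr
  rw [List.getElem_set]
  split_ifs with hri
  · rw [← hri]; exact he
  · exact ho r (Ne.symm hri) _ (h.2 r hr)

/-- The program for `insertE`. -/
def dedupeBody : Program :=
  .seq findBody
  (.seq (.instr (.nset (scal 7)
    (.add (.read 51 (.const 0) (.const 0)) (.read 51 (.const 0) (.const 1)))))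
  (.ite (.nlt (nvar 14) (len 64))
    (.seq (.instr (.nset ⟨65, nvar 14, .const 0⟩ (.const 0)))
    (.seq (.instr (.rset ⟨64, nvar 14, .const 0⟩
      (.add (.read 64 (nvar 14) (.const 0)) (.read 50 (.const 0) (.const 0)))))
    (.ite (.nlt (nvar 7) (.read 65 (nvar 14) (.const 1)))
      (.instr (.nset ⟨65, nvar 14, .const 1⟩ (nvar 7))) skip)))
    (.seq (.instr (.nset ⟨51, .const 0, .const 0⟩ (.const 0)))
    (.seq (.instr (.nset ⟨51, .const 0, .const 1⟩ (nvar 7))) (pushEntry 50 64)))))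

lemma wp_dedupeBody {x : Input} {μ : Mem} {e : Entry x.n} {acc : List (Entry x.n)}
    (hB : Base x μ) (he : RowIs μ 50 0 e) (hacc : Tab μ 64 acc) :
    wp x dedupeBody μ fun μ' T => Tab μ' 64 (insertE acc e) ∧
      T ≤ 15 + 3 * x.n + acc.length * (4 * x.n + 7) := by
  refine wp_seq (wp_findBody hB he hacc) ?_
  rintro μ₁ T₁ a₁ ⟨v14, hT₁⟩
  have a₁ : Agree [1, 4, 14, 15, 16] μ μ₁ := a₁.mono (by decide)
  have e₁ := he.agree a₁ (by decide) (by decide)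
  refine wp_seq_nat 7 (e.a + e.b) ?_ rfl fun μ₂ a₂ v7 _ => ?_
  · simp only [Instr.run, Cell.putNat, scal, NExpr.eval, e₁.2.1, e₁.2.2.1]
  have ag : Agree [1, 4, 7, 14, 15, 16] μ μ₂ := (a₁.trans a₂).mono (by decide)
  have e₂ := he.agree ag (by decide) (by decide)
  have B₂ := hB.agree ag (by decide)
  have acc₂ := hacc.agree ag (by decide) (by decide) (by decide)
  rw [← (a₂ 14 (by decide)).1] at v14
  have l2 : μ₂.nat 66 0 0 = acc.length := acc₂.1
  unfold insertE
  generalize acc.findIdx (fun e' => decide (e'.P = e.P)) = i at v14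
  have hc : (Test.nlt (nvar 14) (len 64)).holds μ₂ ↔ i < acc.length := by
    simp only [Test.holds, nvar, len, NExpr.eval, l2, v14]
  refine wp_ite (fun hb => ?_) (fun hb => ?_)
  · rw [hc] at hb
    rw [dif_pos hb]
    have hrow := acc₂.2 i hb
    have n14 : ∀ (μ' : Mem), Agree [64, 65] μ₂ μ' → μ'.nat 14 0 0 = i := fun μ' h => by
      rw [(h 14 (by decide)).1, v14]
    have n7 : ∀ (μ' : Mem), Agree [64, 65] μ₂ μ' → μ'.nat 7 0 0 = e.a + e.b := fun μ' h => by
      rw [(h 7 (by decide)).1, v7]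
    refine wp_instr_seq ?_
    have r3 := hrow.setA 0
    have a3 := agree_setNat μ₂ 65 i 0 0
    have o3 : ∀ r, r ≠ i → ∀ e' : Entry x.n, RowIs μ₂ 64 r e' →
        RowIs (μ₂.setNat 65 i 0 0) 64 r e' := by
      intro r hr e' h
      simpa [RowIs, Mem.setNat, hr] using h
    rw [show Instr.run x μ₂ (.nset ⟨65, nvar 14, .const 0⟩ (.const 0)) = μ₂.setNat 65 i 0 0 by
      simp only [Instr.run, Cell.putNat, nvar, NExpr.eval, v14]]
    set μ₃ := μ₂.setNat 65 i 0 0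
    have a3 : Agree [64, 65] μ₂ μ₃ := a3.mono (by decide)
    refine wp_instr_seq ?_
    have r4 := r3.setC (acc[i].c + e.c)
    have a4 := agree_setReal μ₃ 64 i 0 (acc[i].c + e.c)
    have s4 : Instr.run x μ₃ (.rset ⟨64, nvar 14, .const 0⟩
      (.add (.read 64 (nvar 14) (.const 0)) (.read 50 (.const 0) (.const 0)))) =
        μ₃.setReal 64 i 0 (acc[i].c + e.c) := by
      simp only [Instr.run, Cell.putReal, nvar, NExpr.eval, RExpr.eval]
      have := n14 _ a3
      rw [this, r3.2.2.2, (a3 50 (by decide)).2, e₂.2.2.2]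
    rw [s4]
    have o4 : ∀ r, r ≠ i → ∀ e' : Entry x.n, RowIs μ₃ 64 r e' →
        RowIs (μ₃.setReal 64 i 0 (acc[i].c + e.c)) 64 r e' := by
      intro r hr e' h
      simpa [RowIs, Mem.setReal, hr] using h
    set μ₄ := μ₃.setReal 64 i 0 (acc[i].c + e.c)
    have a4 : Agree [64, 65] μ₂ μ₄ := (a3.trans a4).mono (by decide)
    have l4 : μ₄.nat 66 0 0 = acc.length := by rw [(a4 66 (by decide)).1]; exact l2
    have hc' : (Test.nlt (nvar 7) (.read 65 (nvar 14) (.const 1))).holds μ₄ ↔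
        e.a + e.b < acc[i].b := by
      have h1 := n7 _ a4
      have h2 := n14 _ a4
      simp only [Test.holds, nvar, NExpr.eval, h1, h2]
      rw [show μ₄.nat 65 i 1 = acc[i].b from r4.2.2.1]
    refine wp_ite (fun hb' => ?_) (fun hb' => ?_)
    · rw [hc'] at hb'
      rw [min_eq_right hb'.le]
      have h1 := n7 _ a4
      have h2 := n14 _ a4
      have s5 : Instr.run x μ₄ (.nset ⟨65, nvar 14, .const 1⟩ (nvar 7)) =
          μ₄.setNat 65 i 1 (e.a + e.b) := by
        simp only [nvar] at *
        simp only [Instr.run, Cell.putNat, NExpr.eval, h1, h2]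
      refine wp_instr ?_
      rw [s5]
      refine ⟨acc₂.set ?_ (r4.setB (e.a + e.b)) ?_, by simp only [Instr.time]; omega⟩
      · rw [(agree_setNat μ₄ 65 i 1 (e.a + e.b) 66 (by decide)).1]; exact l4
      · intro r hr e' h
        have := o4 r hr e' (o3 r hr e' h)
        simpa [RowIs, Mem.setNat, hr] using this
    · rw [hc'] at hb'
      rw [min_eq_left (by omega)]
      refine wp_mono wp_skip ?_
      rintro μ₅ T₅ _ ⟨g1, g2⟩
      refine ⟨Tab.agree (μ := μ₄) ?_ g1 (by decide) (by decide) (by decide),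
        by simp only [Instr.time]; omega⟩
      exact acc₂.set l4 r4 fun r hr e' h => o4 r hr e' (o3 r hr e' h)
  · rw [hc] at hb
    rw [dif_neg hb]
    refine wp_instr_seq ?_
    have r3 := e₂.setA 0
    have a3 := agree_setNat μ₂ 51 0 0 0
    rw [show Instr.run x μ₂ (.nset ⟨51, .const 0, .const 0⟩ (.const 0)) = μ₂.setNat 51 0 0 0 from rfl]
    set μ₃ := μ₂.setNat 51 0 0 0
    refine wp_instr_seq ?_
    have r4 := r3.setB (e.a + e.b)
    have a4 := agree_setNat μ₃ 51 0 1 (e.a + e.b)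
    have s4 : Instr.run x μ₃ (.nset ⟨51, .const 0, .const 1⟩ (nvar 7)) =
        μ₃.setNat 51 0 1 (e.a + e.b) := by
      simp only [Instr.run, Cell.putNat, nvar, NExpr.eval]
      rw [(a3 7 (by decide)).1, v7]
    rw [s4]
    set μ₄ := μ₃.setNat 51 0 1 (e.a + e.b)
    have hag : Agree [51] μ₂ μ₄ := (a3.trans a4).mono (by decide)
    refine wp_mono (wp_pushEntry (B₂.agree hag (by decide)) (by norm_num) (by norm_num)
      (by norm_num) r4 (acc₂.agree hag (by decide) (by decide) (by decide))) ?_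
    rintro μ' T _ ⟨g1, g2⟩
    exact ⟨g1, by simp only [Instr.time]; omega⟩

/-! ## Whole-table operations with their running times -/

/-- The arrays that the operations on table `60` may change. -/
def flatW : List ℕ :=
  [1, 2, 4, 5, 6, 7, 8, 9, 10, 11, 12, 14, 15, 16, 50, 51, 54, 55, 60, 61, 62, 64, 65, 66]

/-- The unit of time for operations on tables of length at most `M`. -/
def unitT (n M : ℕ) : ℕ := (n + 1) ^ 2 * (M + 1) ^ 2

/-- The allowance c for a single entry contains a factor M + 1 because merging searches the
accumulated table. This is what makes the unit of time quadratic in M. -/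
lemma flat_cost {n M a b c : ℕ} (ha : a ≤ M) (hb : b ≤ M) (hc : c ≤ 350 * (n + 1) * (M + 1)) :
    6 + a * (c + 3 * n + 7) + b * (6 * n + 13) ≤ 500 * unitT n M := by
  have h1 : a * (c + 3 * n + 7) ≤ (M + 1) * (350 * (n + 1) * (M + 1) + 7 * (n + 1)) :=
    Nat.mul_le_mul (by omega) (by omega)
  have h2 : b * (6 * n + 13) ≤ (M + 1) * (13 * (n + 1)) := Nat.mul_le_mul (by omega) (by omega)
  have h3 : (M + 1) * (n + 1) ≤ unitT n M := by unfold unitT; nlinarith [Nat.zero_le (M * n)]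
  have h4 : (M + 1) * (M + 1) * (n + 1) ≤ unitT n M := by
    unfold unitT
    calc (M + 1) * (M + 1) * (n + 1) ≤ (M + 1) * (M + 1) * ((n + 1) * (n + 1)) :=
          Nat.mul_le_mul_left _ (by nlinarith)
      _ = _ := by ring
  have h5 : 1 ≤ unitT n M := Nat.mul_pos (by positivity) (by positivity)
  have e1 : (M + 1) * (350 * (n + 1) * (M + 1) + 7 * (n + 1)) =
    350 * ((M + 1) * (M + 1) * (n + 1)) + 7 * ((M + 1) * (n + 1)) := by ring
  have e2 : (M + 1) * (13 * (n + 1)) = 13 * ((M + 1) * (n + 1)) := by ring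
  omega

lemma small_cost {n M c : ℕ} (hc : c ≤ 350 * (n + 1)) : c ≤ 350 * (n + 1) * (M + 1) :=
  hc.trans (Nat.le_mul_of_pos_right _ (Nat.succ_pos M))

lemma length_flatMap_le {n : ℕ} {f : Entry n → List (Entry n)} {k : ℕ} (l : List (Entry n))
    (hf : ∀ e ∈ l, (f e).length ≤ k) : (l.flatMap f).length ≤ l.length * k := by
  induction l with
  | nil => simp
  | cons e l ih =>
    have h1 := hf e List.mem_cons_self
    have h2 := ih fun e' h' => hf e' (List.mem_cons_of_mem _ h')
    rw [List.flatMap_cons, List.length_append, List.length_cons, Nat.succ_mul]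
    omega

lemma weighE_length_le {n : ℕ} (S : Finset (Fin n)) (fa fb : ℕ → ℕ → ℕ) (ℓ : ℕ) (damp : ℝ)
    (e : Entry n) : (weighE S fa fb ℓ damp e).length ≤ 1 := by
  unfold weighE; split_ifs <;> simp

lemma obsE_length_le {n : ℕ} (o : PauliString n → ℝ) (e : Entry n) : (obsE o e).length ≤ 1 := by
  unfold obsE; split_ifs <;> simp

lemma insertE_length_le {n : ℕ} (acc : List (Entry n)) (e : Entry n) :
    (insertE acc e).length ≤ acc.length + 1 := by
  unfold insertE; split_ifs <;> simp

/-- Merges the entries with equal Pauli operators. -/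
def dedupe {n : ℕ} (l : List (Entry n)) : List (Entry n) := l.foldl insertE []

lemma dedupe_length_le {n : ℕ} (l : List (Entry n)) : (dedupe l).length ≤ l.length := by
  suffices ∀ acc : List (Entry n), (l.foldl insertE acc).length ≤ acc.length + l.length by
    simpa [dedupe] using this []
  induction l with
  | nil => simp
  | cons e l ih =>
    intro acc
    have := ih (insertE acc e)
    have := insertE_length_le acc e
    simp only [List.foldl_cons, List.length_cons]
    omega

lemma wp_flat_weigh {x : Input} {μ : Mem} {gate : Bool} {ea eb : NExpr} {t M : ℕ}
    {l : List (Entry x.n)} (fa fb : ℕ → ℕ → ℕ) (hB : Base x μ)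
    (h3 : gate = true → μ.nat 3 0 0 = t)
    (ha : ∀ μ, ea.eval μ = fa (μ.nat 51 0 1) (μ.nat 11 0 0))
    (hb : ∀ μ, eb.eval μ = fb (μ.nat 51 0 1) (μ.nat 11 0 0)) (hl : Tab μ 60 l)
    (hM : l.length ≤ M) :
    wp x (flat (weighBody gate ea eb)) μ fun μ' T => Agree flatW μ μ' ∧
      Tab μ' 60 (l.flatMap (weighE (noiseSet x.circuit gate t) fa fb x.ℓ x.damp)) ∧
      T ≤ 500 * unitT x.n M := by
  have hw := weighBody_writes gate ea eb
  refine wp_mono (wp_flat_flatMap (weighE (noiseSet x.circuit gate t) fa fb x.ℓ x.damp)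
    (12 * x.n + 20) hB (by rw [hw]; decide) hl ?_) ?_
  · intro μ' acc e _ hag hB' he hacc
    refine wp_weighBody hB' (fun hg => ?_) ha hb he hacc
    rw [(hag 3 (by rw [hw]; decide)).1, h3 hg]
  · rintro μ' T hag ⟨h1, h2⟩
    refine ⟨hag.mono ?_, h1, h2.trans (flat_cost hM ?_ (small_cost (by omega)))⟩
    · have : (flat (weighBody gate ea eb)).writes = [66, 2, 1, 50, 1, 51, 51, 50] ++
          (weighBody gate ea eb).writes ++ [2, 62, 2, 1, 50, 1, 51, 51, 50, 1, 60, 1, 61, 61, 60, 62, 2] := rfl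
      rw [this, hw]; decide
    · have := length_flatMap_le l fun e _ =>
        weighE_length_le (noiseSet x.circuit gate t) fa fb x.ℓ x.damp e
      omega

lemma wp_flat_cliff {x : Input} {μ : Mem} {inv : Bool} {k M : ℕ} {l : List (Entry x.n)}
    (hB : Base x μ) (h13 : μ.nat 13 0 0 = k) (hl : Tab μ 60 l) (hM : l.length ≤ M) :
    wp x (flat (cliffBody inv)) μ fun μ' T => Agree flatW μ μ' ∧
      Tab μ' 60 (l.map (cliffE (dirOp inv (cliffordBlock x.circuit k)))) ∧
      T ≤ 500 * unitT x.n M := by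
  refine wp_mono (wp_flat_flatMap (fun e => [cliffE (dirOp inv (cliffordBlock x.circuit k)) e])
    (7 * x.n + 12) hB (by cases inv <;> decide) hl ?_) ?_
  · intro μ' acc e _ hag hB' he hacc
    refine wp_cliffBody hB' ?_ he hacc
    rw [(hag 13 (by cases inv <;> decide)).1, h13]
  · rintro μ' T hag ⟨h1, h2⟩
    have e1 : l.flatMap (fun e => [cliffE (dirOp inv (cliffordBlock x.circuit k)) e]) =
        l.map (cliffE (dirOp inv (cliffordBlock x.circuit k))) := by
      clear h1 h2 hl hM
      induction l <;> simp_all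
    rw [e1] at h1 h2
    exact ⟨hag.mono (by cases inv <;> decide), h1,
      h2.trans (flat_cost hM (by rwa [List.length_map]) (small_cost (by omega)))⟩

lemma wp_flat_obs {x : Input} {μ : Mem} {l : List (Entry x.n)} (hB : Base x μ) (hl : Tab μ 60 l) :
    wp x (flat obsBody) μ fun μ' T => Agree flatW μ μ' ∧
      Tab μ' 60 (l.flatMap (obsE x.obs)) ∧ T ≤ 6 + l.length * (12 * x.n + 31) := by
  refine wp_mono (wp_flat_flatMap (obsE x.obs) (3 * x.n + 11) hB (by decide) hl ?_) ?_
  · intro μ' acc e _ hag hB' he hacc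
    exact wp_obsBody hB' he hacc
  · rintro μ' T hag ⟨h1, h2⟩
    refine ⟨hag.mono (by decide), h1, h2.trans ?_⟩
    have h3 := length_flatMap_le l fun e _ => obsE_length_le x.obs e
    have h4 := Nat.mul_le_mul_right (6 * x.n + 13) h3
    have : l.length * (12 * x.n + 31) =
      l.length * (3 * x.n + 11 + 3 * x.n + 7) + l.length * 1 * (6 * x.n + 13) := by ring
    omega

lemma wp_flat_dedupe {x : Input} {μ : Mem} {M : ℕ} {l : List (Entry x.n)} (hB : Base x μ)
    (hl : Tab μ 60 l) (hM : l.length ≤ M) :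
    wp x (flat dedupeBody) μ fun μ' T => Agree flatW μ μ' ∧ Tab μ' 60 (dedupe l) ∧
      T ≤ 500 * unitT x.n M := by
  refine wp_mono (wp_flat insertE (15 + 3 * x.n + M * (4 * x.n + 7)) hB (by decide) hl ?_) ?_
  · rintro μ' acc e _ ⟨k, rfl⟩ hag hB' he hacc
    refine wp_mono (wp_dedupeBody hB' he hacc) fun μ'' T _ h => ⟨h.1, h.2.trans ?_⟩
    have h1 : ((l.take k).foldl insertE []).length ≤ M :=
      (dedupe_length_le (l.take k)).trans ((List.length_take_le' k l).trans hM)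
    have := Nat.mul_le_mul_right (4 * x.n + 7) h1
    omega
  · rintro μ' T hag ⟨h1, h2⟩
    refine ⟨hag.mono (by decide), h1, h2.trans (flat_cost hM ((dedupe_length_le l).trans hM) ?_)⟩
    have h3 : M * (4 * x.n + 7) ≤ (M + 1) * (7 * (x.n + 1)) :=
      Nat.mul_le_mul (by omega) (by omega)
    have h4 : x.n + 1 ≤ (M + 1) * (x.n + 1) := Nat.le_mul_of_pos_left _ (by omega)
    have e1 : (M + 1) * (7 * (x.n + 1)) = 7 * ((M + 1) * (x.n + 1)) := by ring
    have e2 : 350 * (x.n + 1) * (M + 1) = 350 * ((M + 1) * (x.n + 1)) := by ring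
    omega

lemma wp_expand {x : Input} {μ : Mem} {dir : Bool} {t M : ℕ} {l : List (Entry x.n)}
    (hB : Base x μ) (h3 : μ.nat 3 0 0 = t) (hl : Tab μ 60 l)
    (hM : ∀ m ≤ x.n, (expandTo dir (ncLayer x.circuit t).gates x.ℓ m l).length ≤ M) :
    wp x (expandProg dir) μ fun μ' T => Agree flatW μ μ' ∧
      Tab μ' 60 (expandL dir (ncLayer x.circuit t) x.ℓ l) ∧ T ≤ 500 * unitT x.n M := by
  refine wp_mono (wp_expandProg hB h3 hl hM) ?_
  rintro μ' T hag ⟨h1, h2⟩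
  refine ⟨hag.mono (by cases dir <;> decide), h1, h2.trans ?_⟩
  have h3 : 8 + M * (105 * x.n + 370) ≤ 370 * ((x.n + 1) * (M + 1)) := by nlinarith
  have h4 := Nat.mul_le_mul_left x.n h3
  have h5 : x.n * (370 * ((x.n + 1) * (M + 1))) ≤ 370 * unitT x.n M := by
    unfold unitT
    have : x.n * (x.n + 1) * (M + 1) ≤ (x.n + 1) ^ 2 * (M + 1) ^ 2 :=
      Nat.mul_le_mul (by nlinarith) (by nlinarith)
    nlinarith
  have h6 : 1 ≤ unitT x.n M := Nat.mul_pos (by positivity) (by positivity)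
  omega

/-! ## Enumeration of Pauli operators of low weight -/

/-- The Pauli operators obtained from an entry by a new letter at a qubit before its second
counter. -/
def extendE {n : ℕ} (e : Entry n) : List (Entry n) :=
  (List.range e.b).flatMap fun q => (List.range 3).flatMap fun y =>
    [⟨setLetter e.P q (y + 1), e.a, q, e.c⟩]

/-- The program for `extendE`. -/
def extendBody : Program :=
  forLoop 4 (.read 51 (.const 0) (.const 1)) (forLoop 8 (.const 3)
    (.seq (copyEntry 50 (.const 0) 54 (.const 0))
    (.seq (.instr (.nset ⟨54, .const 0, nvar 4⟩ (.add (nvar 8) (.const 1))))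
    (.seq (.instr (.nset ⟨55, .const 0, .const 1⟩ (nvar 4))) (pushEntry 54 64)))))

lemma wp_extendBody {x : Input} {μ : Mem} {e : Entry x.n} {acc : List (Entry x.n)} (hB : Base x μ)
    (he : RowIs μ 50 0 e) (hacc : Tab μ 64 acc) (hb : e.b ≤ x.n) :
    wp x extendBody μ fun μ' T => Tab μ' 64 (acc ++ extendE e) ∧
      T ≤ 2 + x.n * (18 * x.n + 49) := by
  refine wp_mono (wp_for_append (t := 64) (l := acc) (fun q => (List.range 3).flatMap fun y =>
    [(⟨setLetter e.P q (y + 1), e.a, q, e.c⟩ : Entry x.n)]) e.b (2 + 3 * (6 * x.n + 13 + 2))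
    (by decide) (by decide) ?_ hacc ?_) ?_
  · intro μ' ha
    simp only [NExpr.eval, (ha 51 (by decide)).1]
    exact he.2.2.1
  · intro q hq μ₁ acc' a₁ v4 hacc'
    refine wp_for_append (t := 64) (l := acc') (fun y =>
      [(⟨setLetter e.P q (y + 1), e.a, q, e.c⟩ : Entry x.n)]) 3 (6 * x.n + 13)
      (by decide) (by decide) (fun _ _ => rfl) hacc' ?_
    intro y hy μ₂ acc'' a₂ v8 hacc''
    have ag : Agree [1, 4, 8, 54, 55, 64, 65, 66] μ μ₂ := (a₁.trans a₂).mono (by decide)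
    have v4' : μ₂.nat 4 0 0 = q := by rw [(a₂ 4 (by decide)).1, v4]
    refine wp_seq (wp_copyEntry (hB.agree ag (by decide)) (by norm_num) (by norm_num)
      (by norm_num) (fun _ _ => rfl) (fun _ _ => rfl) (he.agree ag (by decide) (by decide))) ?_
    rintro μ₃ T₃ a₃ ⟨r3, -, hT₃⟩
    have a₃ : Agree [1, 54, 55] μ₂ μ₃ := a₃.mono (by decide)
    refine wp_instr_seq ?_
    rw [show Instr.run x μ₃ (.nset ⟨54, .const 0, nvar 4⟩ (.add (nvar 8) (.const 1))) =
        μ₃.setNat 54 0 q (y + 1) by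
      simp only [Instr.run, Cell.putNat, NExpr.eval, nvar]
      rw [(a₃ 4 (by decide)).1, (a₃ 8 (by decide)).1, v4', v8]]
    have r4 := r3.setLetter (j := q) (y := y + 1) (by omega)
    have a4 := agree_setNat μ₃ 54 0 q (y + 1)
    set μ₄ := μ₃.setNat 54 0 q (y + 1)
    refine wp_instr_seq ?_
    rw [show Instr.run x μ₄ (.nset ⟨55, .const 0, .const 1⟩ (nvar 4)) = μ₄.setNat 55 0 1 q by
      simp only [Instr.run, Cell.putNat, NExpr.eval, nvar]
      rw [(a4 4 (by decide)).1, (a₃ 4 (by decide)).1, v4']]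
    have r5 := r4.setB q
    have a5 := agree_setNat μ₄ 55 0 1 q
    set μ₅ := μ₄.setNat 55 0 1 q
    have hag : Agree [1, 54, 55] μ₂ μ₅ := ((a₃.trans a4).trans a5).mono (by decide)
    refine wp_mono (wp_pushEntry ((hB.agree ag (by decide)).agree hag (by decide)) (by norm_num)
      (by norm_num) (by norm_num) r5 (hacc''.agree hag (by decide) (by decide) (by decide))) ?_
    rintro μ' T _ ⟨g1, g2⟩
    exact ⟨g1, by simp only [Instr.time]; omega⟩
  · rintro μ' T _ ⟨g1, g2⟩
    refine ⟨g1, g2.trans ?_⟩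
    have := Nat.mul_le_mul_right (18 * x.n + 49) hb
    have e1 : 2 + 3 * (6 * x.n + 13 + 2) + 2 = 18 * x.n + 49 := by ring
    rw [e1]
    omega

lemma extendE_length {n : ℕ} (e : Entry n) : (extendE e).length = 3 * e.b := by
  simp [extendE, List.length_flatMap, mul_comm]

/-- The Pauli operators of weight `i`; the second counter is the first qubit of the support. -/
def level (n : ℕ) : ℕ → List (Entry n)
  | 0 => [⟨0, 0, n, 0⟩]
  | i + 1 => (level n i).flatMap extendE

lemma level_b_le {n : ℕ} (i : ℕ) : ∀ e ∈ level n i, e.b ≤ n := by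
  induction i with
  | zero => simp [level]
  | succ i ih =>
    intro e he
    simp only [level, List.mem_flatMap, extendE, List.mem_singleton, List.mem_range] at he
    obtain ⟨e', he', q, hq, y, hy, rfl⟩ := he
    have := ih e' he'
    dsimp only
    omega

lemma level_length_succ_le {n : ℕ} (i : ℕ) :
    (level n (i + 1)).length ≤ (level n i).length * (3 * n) :=
  length_flatMap_le _ fun e he => by
    rw [extendE_length]; exact Nat.mul_le_mul_left _ (level_b_le i e he)

/-- The Pauli operators of weight at most `r`. -/
def levels (n r : ℕ) : List (Entry n) := (List.range (r + 1)).flatMap (level n)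

/-- The machine cannot divide, so the quotient is found by subtracting st from a budget in each
round: round i takes place exactly when the remaining budget is still at least st. After the last
round the budget no longer changes, hence the minimum on the right. -/
lemma lt_min_div_iff {n st ℓ i : ℕ} (hst : 1 ≤ st) (hi : i < n) :
    i < min n (ℓ / st) ↔ st ≤ ℓ - min i (min n (ℓ / st)) * st := by
  by_cases h : i < min n (ℓ / st)
  · rw [min_eq_left h.le]
    have h1 := (Nat.le_div_iff_mul_le hst).1 (Nat.succ_le_of_lt (lt_min_iff.1 h).2)
    rw [Nat.succ_mul] at h1
    exact iff_of_true h (by omega)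
  · refine iff_of_false h fun hc => ?_
    rw [min_eq_right (not_lt.1 h)] at hc
    have h1 : ℓ / st ≤ i := by
      by_contra h2
      exact h (lt_min hi (not_le.1 h2))
    rw [min_eq_right (by omega : ℓ / st ≤ n)] at hc
    have h2 := Nat.lt_div_mul_add hst (a := ℓ)
    omega

lemma enum_cost (n : ℕ) : 3 * n * (6 * n + 13) + 3 * n * (6 * n + 13) +
    (2 + n * (18 * n + 49) + 3 * n + 7) ≤ 130 * (n + 1) ^ 2 := by
  have : 130 * (n + 1) ^ 2 = 3 * n * (6 * n + 13) + 3 * n * (6 * n + 13) +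
    (2 + n * (18 * n + 49) + 3 * n + 7) + (76 * (n * n) + 130 * n + 121) := by ring
  omega

lemma enum_cost' (n : ℕ) : 18 * n + 50 ≤ 300 * (n + 1) ^ 2 := by
  have : 300 * (n + 1) ^ 2 = 300 * (n * n) + 600 * n + 300 := by ring
  omega

/-- One round of the enumeration; the remaining budget is in variable `17`. -/
def enumRound (step : NExpr) : Program :=
  .ite (.nlt (nvar 17) step) skip
    (.seq (flat extendBody) (.seq (appendTab 60 68)
      (.instr (.nset (scal 17) (.sub (nvar 17) step)))))

lemma enumRound_writes (step : NExpr) :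
    (enumRound step).writes ⊆ 1 :: 17 :: 68 :: 69 :: 70 :: flatW := by
  rw [show (enumRound step).writes = (enumRound (.const 0)).writes from rfl]
  decide

/-- Lists in table `68` the Pauli operators of weight at most `ℓ / step`. -/
def enumerate (step : NExpr) : Program :=
  .seq (.instr (.nset ⟨51, .const 0, .const 1⟩ qubits))
  (.seq (.instr (.nset (scal 17) thresh))
  (.seq (clear 60) (.seq (pushEntry 50 60)
  (.seq (clear 68) (.seq (pushEntry 50 68)
  (forLoop 18 qubits (enumRound step)))))))

/-- The arrays that the enumeration may change. -/
def enumW : List ℕ := 17 :: 18 :: 68 :: 69 :: 70 :: flatW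

/-- The loop always has n rounds, since no weight exceeds n, but a round without budget does
nothing. Only the levels below the last one appear in the time: extending a level pays also for its
extensions, at most 3n for each entry. The bound for gate-based noise needs this precision. -/
lemma wp_enumerate {x : Input} {μ : Mem} {step : NExpr} {st : ℕ} (hB : Base x μ) (hst : 1 ≤ st)
    (hs : ∀ μ, Base x μ → step.eval μ = st) (he : RowIs μ 50 0 (⟨0, 0, 0, 0⟩ : Entry x.n)) :
    wp x (enumerate step) μ fun μ' T => Agree enumW μ μ' ∧
      Tab μ' 68 (levels x.n (min x.n (x.ℓ / st))) ∧
      T ≤ 300 * (x.n + 1) ^ 2 *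
        (1 + ∑ i ∈ Finset.range (min x.n (x.ℓ / st)), (level x.n i).length) := by
  set r := min x.n (x.ℓ / st) with hr
  have hw := enumRound_writes step
  refine wp_instr_seq ?_
  have r1 := he.setB x.n
  have a1 := agree_setNat μ 51 0 1 x.n
  rw [show Instr.run x μ (.nset ⟨51, .const 0, .const 1⟩ qubits) = μ.setNat 51 0 1 x.n by
    simp only [Instr.run, Cell.putNat, NExpr.eval, qubits, hB.1]]
  set μ₁ := μ.setNat 51 0 1 x.n
  refine wp_seq_nat 17 x.ℓ ?_ rfl fun μ₂ a₂ v17 _ => ?_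
  · simp only [Instr.run, Cell.putNat, scal, NExpr.eval, thresh, (a1 0 (by decide)).1, hB.2.2.1]
  have g2 : Agree [17, 51] μ μ₂ := (a1.trans a₂).mono (by decide)
  refine wp_seq wp_clear ?_
  rintro μ₃ T₃ a₃ ⟨t3, hT₃⟩
  have a₃ : Agree [62] μ₂ μ₃ := a₃
  have g3 : Agree [17, 51, 62] μ μ₃ := (g2.trans a₃).mono (by decide)
  refine wp_seq (wp_pushEntry (hB.agree g3 (by decide)) (by norm_num) (by norm_num) (by norm_num)
    ((r1.agree a₂ (by decide) (by decide)).agree a₃ (by decide) (by decide)) t3) ?_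
  rintro μ₄ T₄ a₄ ⟨t4, hT₄⟩
  have a₄ : Agree [1, 60, 61, 62] μ₃ μ₄ := a₄.mono (by decide)
  refine wp_seq wp_clear ?_
  rintro μ₅ T₅ a₅ ⟨t5, hT₅⟩
  have a₅ : Agree [70] μ₄ μ₅ := a₅
  have b5 : Agree [1, 17, 60, 61, 62, 70] μ₁ μ₅ :=
    (((a₂.trans a₃).trans a₄).trans a₅).mono (by decide)
  have g5 : Agree [1, 17, 51, 60, 61, 62, 70] μ μ₅ := (a1.trans b5).mono (by decide)
  refine wp_seq (wp_pushEntry (hB.agree g5 (by decide)) (by norm_num) (by norm_num) (by norm_num)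
    (r1.agree b5 (by decide) (by decide)) t5) ?_
  rintro μ₆ T₆ a₆ ⟨t6, hT₆⟩
  have a₆ : Agree [1, 68, 69, 70] μ₅ μ₆ := a₆.mono (by decide)
  have g6 : Agree [1, 17, 51, 60, 61, 62, 68, 69, 70] μ μ₆ := (g5.trans a₆).mono (by decide)
  have v17' : μ₆.nat 17 0 0 = x.ℓ := by
    rw [(a₆ 17 (by decide)).1, (a₅ 17 (by decide)).1, (a₄ 17 (by decide)).1,
      (a₃ 17 (by decide)).1, v17]
  have t4' := (t4.agree a₅ (by decide) (by decide) (by decide)).agree a₆ (by decide) (by decide)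
    (by decide)
  rw [List.nil_append] at t4' t6
  have hsub : [1, 17, 51, 60, 61, 62, 68, 69, 70] ++ 18 :: (enumRound step).writes ⊆ enumW := by
    intro A hA
    rcases List.mem_append.1 hA with h | h
    · exact (by decide : [1, 17, 51, 60, 61, 62, 68, 69, 70] ⊆ enumW) h
    · rcases List.mem_cons.1 h with rfl | h
      · decide
      · exact (by decide : 1 :: 17 :: 68 :: 69 :: 70 :: flatW ⊆ enumW) (hw h)
  refine wp_mono (wp_for_sum (fun i μ' => Tab μ' 60 (level x.n (min i r)) ∧
    Tab μ' 68 (levels x.n (min i r)) ∧ μ'.nat 17 0 0 = x.ℓ - min i r * st) x.n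
    (fun i => 10 + if i < r then (level x.n i).length * (130 * (x.n + 1) ^ 2) else 0)
    (fun h => absurd (hw h) (by decide)) ?_ ?_ ?_ ?_) ?_
  · intro μ' ha
    have h0 : 0 ∉ 18 :: (enumRound step).writes := fun h => by
      rcases List.mem_cons.1 h with h | h
      · exact absurd h (by decide)
      · exact absurd (hw h) (by decide)
    simp only [qubits, NExpr.eval, (ha 0 h0).1, (g6 0 (by decide)).1, hB.1]
  · rintro i μ' μ'' ha ⟨h1, h2, h3⟩
    exact ⟨h1.agree ha (by decide) (by decide) (by decide),
      h2.agree ha (by decide) (by decide) (by decide), by rw [(ha 17 (by decide)).1]; exact h3⟩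
  · refine ⟨by simpa [level] using t4', by simpa [levels, level] using t6, by simpa using v17'⟩
  · rintro i hi μ' ha v18 ⟨h1, h2, h3⟩
    have ha' : Agree enumW μ μ' := (g6.trans ha).mono hsub
    have B' : Base x μ' := hB.agree ha' (by decide)
    have hir : i < r ↔ st ≤ x.ℓ - min i r * st := lt_min_div_iff hst hi
    have hc : (Test.nlt (nvar 17) step).holds μ' ↔ ¬ i < r := by
      simp only [Test.holds, nvar, NExpr.eval, hs μ' B', h3, hir]
      omega
    refine wp_ite (fun hb => ?_) (fun hb => ?_)
    · rw [hc] at hb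
      refine wp_mono wp_skip ?_
      rintro μ'' T ha'' ⟨h4, h5⟩
      rw [min_eq_right (by omega : r ≤ i + 1)]
      rw [min_eq_right (by omega : r ≤ i)] at h1 h2 h3
      exact ⟨⟨h1.agree h4 (by decide) (by decide) (by decide),
        h2.agree h4 (by decide) (by decide) (by decide),
        by rw [(h4 17 (by decide)).1]; exact h3⟩, by omega⟩
    · rw [hc, not_not] at hb
      rw [min_eq_left hb.le] at h1 h2 h3
      rw [min_eq_left (by omega : i + 1 ≤ r)]
      refine wp_seq (wp_flat_flatMap extendE (2 + x.n * (18 * x.n + 49)) B' (by decide) h1 ?_) ?_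
      · intro μ'' acc e he' hag hB' he hacc
        exact wp_extendBody hB' he hacc (level_b_le i e he')
      rintro μ₇ T₇ a₇ ⟨t7, hT₇⟩
      have a₇ : Agree flatW μ' μ₇ := a₇.mono (by decide)
      refine wp_seq (wp_appendTab (B'.agree a₇ (by decide)) (by norm_num) (by norm_num)
        (by norm_num) t7 (h2.agree a₇ (by decide) (by decide) (by decide))) ?_
      rintro μ₈ T₈ a₈ ⟨t8, hT₈⟩
      have a₈ : Agree [1, 2, 50, 51, 68, 69, 70] μ₇ μ₈ := a₈.mono (by decide)
      have a9 : Agree (68 :: 69 :: 70 :: flatW) μ' μ₈ := (a₇.trans a₈).mono (by decide)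
      have a10 := agree_setNat μ₈ 17 0 0 (x.ℓ - (i + 1) * st)
      refine wp_instr ?_
      rw [show Instr.run x μ₈ (.nset (scal 17) (.sub (nvar 17) step)) =
          μ₈.setNat 17 0 0 (x.ℓ - (i + 1) * st) by
        have B8 := hs μ₈ (B'.agree a9 (by decide))
        simp only [Instr.run, Cell.putNat, NExpr.eval, nvar, scal, B8, (a9 17 (by decide)).1, h3]
        rw [Nat.succ_mul, Nat.sub_sub]]
      refine ⟨⟨?_, ?_, nat_setNat_self _ _ _ _ _⟩, ?_⟩
      · exact (t7.agree a₈ (by decide) (by decide) (by decide)).agree a10 (by decide) (by decide)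
          (by decide)
      · have := t8.agree a10 (by decide) (by decide) (by decide)
        rw [levels, List.range_succ, List.flatMap_append, List.flatMap_singleton]
        exact this
      · rw [if_pos hb]
        simp only [Instr.time]
        have h4 := Nat.mul_le_mul_right (6 * x.n + 13) (level_length_succ_le (n := x.n) i)
        have h5 : (level x.n i).length * (3 * x.n) * (6 * x.n + 13) +
            (level x.n i).length * (3 * x.n) * (6 * x.n + 13) +
            (level x.n i).length * (2 + x.n * (18 * x.n + 49) + 3 * x.n + 7) ≤
            (level x.n i).length * (130 * (x.n + 1) ^ 2) := by
          rw [mul_assoc, ← mul_add, ← mul_add]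
          exact Nat.mul_le_mul_left _ (enum_cost x.n)
        have e7 : (level x.n (i + 1)).length = ((level x.n i).flatMap extendE).length := rfl
        rw [e7] at h4
        omega
  · rintro μ' T ha ⟨⟨h1, h2, h3⟩, hT⟩
    rw [min_eq_right (hr ▸ min_le_left _ _)] at h2
    have h18 : (forLoop 18 qubits (enumRound step)).writes ⊆ 18 :: (enumRound step).writes :=
      fun A hA => (forLoop_writes _ _ _).1 hA
    refine ⟨(g6.trans (ha.mono h18)).mono hsub, h2, ?_⟩
    have e1 : ∑ i ∈ Finset.range x.n,
        (10 + (if i < r then (level x.n i).length * (130 * (x.n + 1) ^ 2) else 0) + 2) =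
        12 * x.n + (∑ i ∈ Finset.range r, (level x.n i).length) * (130 * (x.n + 1) ^ 2) := by
      rw [Finset.sum_add_distrib, Finset.sum_add_distrib, ← Finset.sum_filter, Finset.sum_mul]
      have : (Finset.range x.n).filter (fun i => i < r) = Finset.range r := by
        ext i
        simp only [Finset.mem_filter, Finset.mem_range]
        have : r ≤ x.n := min_le_left _ _
        omega
      rw [this]
      simp
      ring
    rw [e1] at hT
    set s := ∑ i ∈ Finset.range r, (level x.n i).length
    simp only [Instr.time]
    have e2 : 300 * (x.n + 1) ^ 2 * (1 + s) =
      300 * (x.n + 1) ^ 2 + s * (130 * (x.n + 1) ^ 2) + s * (170 * (x.n + 1) ^ 2) := by ring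
    have e3 : 18 * x.n + 50 ≤ 300 * (x.n + 1) ^ 2 := enum_cost' x.n
    omega

lemma one_le_unitT (n M : ℕ) : 1 ≤ unitT n M := Nat.mul_pos (by positivity) (by positivity)

lemma table_cost {n M a k : ℕ} (ha : a ≤ M) (hk : k ≤ 31 * (n + 1)) :
    6 + a * k ≤ 500 * unitT n M := by
  have h1 : a * k ≤ (M + 1) * (31 * (n + 1)) := Nat.mul_le_mul (by omega) hk
  have h3 : (M + 1) * (n + 1) ≤ unitT n M := by unfold unitT; nlinarith [Nat.zero_le (M * n)]
  have h5 := one_le_unitT n M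
  have e2 : (M + 1) * (31 * (n + 1)) = 31 * ((M + 1) * (n + 1)) := by ring
  omega

lemma wp_move {x : Input} {μ : Mem} {s t M : ℕ} {l : List (Entry x.n)} (hB : Base x μ)
    (hs : 60 ≤ s) (ht : 60 ≤ t) (hst : s + 2 < t ∨ t + 2 < s) (hl : Tab μ s l)
    (hM : l.length ≤ M) :
    wp x (moveTab s t) μ fun μ' T => Agree [1, 2, 50, 51, t, t + 1, t + 2] μ μ' ∧ Tab μ' t l ∧
      T ≤ 500 * unitT x.n M := by
  refine wp_mono (wp_moveTab hB hs ht hst hl) ?_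
  rintro μ' T ha ⟨h1, h2⟩
  refine ⟨ha.mono ?_, h1, ?_⟩
  · intro A hA
    simp only [moveTab, appendTab, each, load, copyEntry, pushEntry, clear, assign, scal,
      Program.writes, Instr.writes, List.mem_append, forLoop_writes, List.mem_cons,
      List.not_mem_nil, or_false] at hA ⊢
    omega
  · have := table_cost hM (n := x.n) (k := 6 * x.n + 13) (by omega)
    omega

lemma wp_append {x : Input} {μ : Mem} {s t M : ℕ} {l l₀ : List (Entry x.n)} (hB : Base x μ)
    (hs : 60 ≤ s) (ht : 60 ≤ t) (hst : s + 2 < t ∨ t + 2 < s) (hl : Tab μ s l) (hl₀ : Tab μ t l₀)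
    (hM : l.length ≤ M) :
    wp x (appendTab s t) μ fun μ' T => Agree [1, 2, 50, 51, t, t + 1, t + 2] μ μ' ∧
      Tab μ' t (l₀ ++ l) ∧ T ≤ 500 * unitT x.n M := by
  refine wp_mono (wp_appendTab hB hs ht hst hl hl₀) ?_
  rintro μ' T ha ⟨h1, h2⟩
  refine ⟨ha.mono ?_, h1, ?_⟩
  · intro A hA
    simp only [appendTab, each, load, copyEntry, pushEntry, assign, scal,
      Program.writes, Instr.writes, List.mem_append, forLoop_writes, List.mem_cons,
      List.not_mem_nil, or_false] at hA ⊢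
    omega
  · have := table_cost hM (n := x.n) (k := 6 * x.n + 13) (by omega)
    omega

/-! ## Terms of the observable, and the final sum -/

/-- Reads the terms of the observable into table `60`. -/
def readTerms : Program :=
  .seq (clear 60) (forLoop 18 (.read 0 (.const 0) (.const 3))
    (.seq (.instr (.askTerm ⟨54, .const 0, .const 0⟩ ⟨54, .const 0⟩ (nvar 18)))
    (.seq (.instr (.nset ⟨55, .const 0, .const 0⟩ (.const 0)))
    (.seq (.instr (.nset ⟨55, .const 0, .const 1⟩ (.const 0))) (pushEntry 54 60)))))

lemma wp_readTerms {x : Input} {μ : Mem} (hB : Base x μ) :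
    wp x readTerms μ fun μ' T =>
      Tab μ' 60 (x.terms.map fun a => (⟨a.1, 0, 0, a.2⟩ : Entry x.n)) ∧
      T ≤ 3 + x.terms.length * (4 * x.n + 10) := by
  refine wp_seq wp_clear ?_
  rintro μ₁ T₁ a₁ ⟨t1, hT₁⟩
  have a₁ : Agree [62] μ μ₁ := a₁
  refine wp_mono (wp_for (fun i μ' => Tab μ' 60 ((x.terms.take i).map fun a =>
    (⟨a.1, 0, 0, a.2⟩ : Entry x.n))) x.terms.length (4 * x.n + 8) (by decide) ?_ ?_ ?_ ?_) ?_
  · intro μ' ha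
    simp only [NExpr.eval, (ha 0 (by decide)).1, (a₁ 0 (by decide)).1, hB.2.2.2.1]
  · intro i μ₂ μ₃ ha h
    exact h.agree ha (by decide) (by decide) (by decide)
  · simpa using t1
  · intro i hi μ₂ ha v18 hI
    have B₂ : Base x μ₂ := (hB.agree a₁ (by decide)).agree ha (by decide)
    set a := x.terms[i] with ha'
    refine wp_instr_seq ?_
    rw [show Instr.run x μ₂ (.askTerm ⟨54, .const 0, .const 0⟩ ⟨54, .const 0⟩ (nvar 18)) =
        (μ₂.setReal 54 0 0 a.2).setRow 54 0 a.1 by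
      simp only [Instr.run, nvar, NExpr.eval, v18, List.getElem?_eq_getElem hi]
      rfl]
    have g1 := agree_setReal μ₂ 54 0 0 a.2
    have c1 : (μ₂.setReal 54 0 0 a.2).real 54 0 0 = a.2 := by simp [Mem.setReal]
    set μ₃ := μ₂.setReal 54 0 0 a.2
    have g2 := agree_setRow μ₃ 54 0 a.1
    have c2 : (μ₃.setRow 54 0 a.1).real 54 0 0 = a.2 := c1
    have p2 : ∀ j : Fin x.n, (μ₃.setRow 54 0 a.1).nat 54 0 j = (a.1 j).val := by
      intro j; simp [Mem.setRow]
    set μ₄ := μ₃.setRow 54 0 a.1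
    refine wp_instr_seq (wp_instr_seq ?_)
    rw [show Instr.run x (Instr.run x μ₄ (.nset ⟨55, .const 0, .const 0⟩ (.const 0)))
      (.nset ⟨55, .const 0, .const 1⟩ (.const 0)) = (μ₄.setNat 55 0 0 0).setNat 55 0 1 0 from rfl]
    have g3 := (agree_setNat μ₄ 55 0 0 0).trans (agree_setNat (μ₄.setNat 55 0 0 0) 55 0 1 0)
    have r5 : RowIs ((μ₄.setNat 55 0 0 0).setNat 55 0 1 0) 54 0
        (⟨a.1, 0, 0, a.2⟩ : Entry x.n) :=
      ⟨fun j => by simpa [Mem.setNat] using p2 j, by simp [Mem.setNat], by simp [Mem.setNat], c2⟩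
    set μ₅ := (μ₄.setNat 55 0 0 0).setNat 55 0 1 0
    have hag : Agree [54, 55] μ₂ μ₅ := ((g1.trans g2).trans g3).mono (by decide)
    refine wp_mono (wp_pushEntry (B₂.agree hag (by decide)) (by norm_num) (by norm_num)
      (by norm_num) r5 (hI.agree hag (by decide) (by decide) (by decide))) ?_
    rintro μ' T _ ⟨h1, h2⟩
    refine ⟨?_, by simp only [Instr.time]; omega⟩
    rw [List.take_add_one, List.map_append, List.getElem?_eq_getElem hi]
    exact h1
  · rintro μ' T _ ⟨h1, h2⟩
    rw [List.take_length] at h1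
    exact ⟨h1, by rw [show 4 * x.n + 10 = 4 * x.n + 8 + 2 from rfl]; omega⟩

/-- Outputs the expectation value of the observable in table `60`. -/
def sumUp : Program :=
  .seq (.instr (.rset (scal 19) (.const 0)))
  (.seq (forLoop 2 (len 60) (.seq (load 60 2 50)
    (.seq (.instr (.askState (scal 12) ⟨50, .const 0⟩))
      (.instr (.rset (scal 19) (.add (rvar 19)
        (.mul (.read 50 (.const 0) (.const 0)) (rvar 12))))))))
  (.instr (.rset ⟨0, .const 0, .const 1⟩ (rvar 19))))

lemma wp_sumUp {x : Input} {μ : Mem} {M : ℕ} {l : List (Entry x.n)} (hB : Base x μ)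
    (hl : Tab μ 60 l) (hM : l.length ≤ M) :
    wp x sumUp μ fun μ' T => μ'.real 0 0 1 = sumE (fun e => e.c * x.state e.P) l ∧
      T ≤ 500 * unitT x.n M := by
  refine wp_seq_real 19 0 ?_ rfl fun μ₁ a₁ v19 _ => ?_
  · simp [Instr.run, Cell.putReal, scal, NExpr.eval, RExpr.eval]
  refine wp_seq (wp_for (fun i μ' =>
    μ'.real 19 0 0 = sumE (fun e => e.c * x.state e.P) (l.take i)) l.length (3 * x.n + 7)
    (by decide) ?_ ?_ ?_ ?_) ?_
  · intro μ' ha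
    simp only [len, nvar, NExpr.eval, (ha 62 (by decide)).1, (a₁ 62 (by decide)).1]
    exact hl.1
  · intro i μ₂ μ₃ ha h
    rw [(ha 19 (by decide)).2]; exact h
  · simpa using v19
  · intro i hi μ₂ ha v2 hI
    have ag : Agree [1, 2, 12, 19, 50, 51] μ μ₂ := (a₁.trans ha).mono (by decide)
    refine wp_seq (wp_load (hB.agree ag (by decide)) (by norm_num) (by norm_num) (by norm_num)
      (by decide) v2 ((hl.2 i hi).agree ag (by decide) (by decide))) ?_
    rintro μ₃ T₃ a₃ ⟨r3, hT₃⟩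
    have a₃ : Agree [1, 50, 51] μ₂ μ₃ := a₃.mono (by decide)
    refine wp_seq_real 12 (x.state l[i].P) ?_ rfl fun μ₄ a₄ v12 _ => ?_
    · simp only [Instr.run, Cell.putReal, scal, NExpr.eval, Row.get, r3.getRow]
    have r4 := r3.agree a₄ (by decide) (by decide)
    refine wp_instr ⟨?_, by simp only [Instr.time]; omega⟩
    have v19' : μ₄.real 19 0 0 = sumE (fun e => e.c * x.state e.P) (l.take i) := by
      rw [(a₄ 19 (by decide)).2, (a₃ 19 (by decide)).2, hI]
    have hs : sumE (fun e => e.c * x.state e.P) (l.take (i + 1)) =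
        sumE (fun e => e.c * x.state e.P) (l.take i) + l[i].c * x.state l[i].P := by
      rw [List.take_add_one, List.getElem?_eq_getElem hi, sumE_append]
      simp only [Option.toList, sumE_cons, sumE_nil, add_zero]
    rw [hs]
    simp [Instr.run, Cell.putReal, scal, NExpr.eval, RExpr.eval, rvar, Mem.setReal, v12, v19',
      r4.2.2.2]
  · rintro μ₂ T₂ _ ⟨h1, h2⟩
    refine wp_instr ⟨?_, ?_⟩
    · rw [List.take_length] at h1
      simp [Instr.run, Cell.putReal, NExpr.eval, RExpr.eval, rvar, Mem.setReal, h1]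
    · have := table_cost hM (n := x.n) (k := 3 * x.n + 7 + 2) (by omega)
      simp only [Instr.time]; omega

/-! ## The truncated Heisenberg evolution -/

/-- The new counters after weighing: for uniform noise (`false`) both are the total weight, for
gate-based noise the first one is reset. -/
def cntA (g : Bool) (b w : ℕ) : ℕ := if g then 0 else b + w

/-- See `cntA`. -/
def cntB (g : Bool) (b w : ℕ) : ℕ := if g then b else b + w

/-- The expression for `cntA`. -/
def exprA (g : Bool) : NExpr :=
  if g then .const 0 else .add (.read 51 (.const 0) (.const 1)) (nvar 11)

/-- The expression for `cntB`. -/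
def exprB (g : Bool) : NExpr :=
  if g then .read 51 (.const 0) (.const 1) else .add (.read 51 (.const 0) (.const 1)) (nvar 11)

lemma exprA_eval (g : Bool) (μ : Mem) :
    (exprA g).eval μ = cntA g (μ.nat 51 0 1) (μ.nat 11 0 0) := by cases g <;> rfl

lemma exprB_eval (g : Bool) (μ : Mem) :
    (exprB g).eval μ = cntB g (μ.nat 51 0 1) (μ.nat 11 0 0) := by cases g <;> rfl

/-- Noise followed by a Clifford block, on tables. -/
def roundL {n : ℕ} (g : Bool) (S : Finset (Fin n)) (V : Op n) (ℓ : ℕ) (damp : ℝ)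
    (l : List (Entry n)) : List (Entry n) :=
  (l.flatMap (weighE S (cntA g) (cntB g) ℓ damp)).map (cliffE V)

/-- The program for `roundL`; the number of the block is in variable `13`. -/
def roundProg (g g' : Bool) : Program :=
  .seq (flat (weighBody g (exprA g') (exprB g'))) (flat (cliffBody false))

lemma wp_roundProg {x : Input} {μ : Mem} {g g' : Bool} {t k M : ℕ} {l : List (Entry x.n)}
    (hB : Base x μ) (h3 : g = true → μ.nat 3 0 0 = t) (h13 : μ.nat 13 0 0 = k) (hl : Tab μ 60 l)
    (hM : l.length ≤ M) :
    wp x (roundProg g g') μ fun μ' T => Agree flatW μ μ' ∧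
      Tab μ' 60 (roundL g' (noiseSet x.circuit g t) (cliffordBlock x.circuit k) x.ℓ x.damp l) ∧
      T ≤ 1000 * unitT x.n M := by
  refine wp_seq (wp_flat_weigh (cntA g') (cntB g') hB h3 (exprA_eval g') (exprB_eval g') hl hM) ?_
  rintro μ₁ T₁ _ ⟨a₁, t1, hT₁⟩
  refine wp_mono (wp_flat_cliff (k := k) (M := M) (hB.agree a₁ (by decide)) ?_ t1 ?_) ?_
  · rw [(a₁ 13 (by decide)).1, h13]
  · have := length_flatMap_le l fun e _ =>
      weighE_length_le (noiseSet x.circuit g t) (cntA g') (cntB g') x.ℓ x.damp e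
    omega
  · rintro μ₂ T₂ _ ⟨a₂, t2, hT₂⟩
    exact ⟨(a₁.trans a₂).mono (by decide), t2, by omega⟩

/-- The table for the observable before the block of Clifford layers that ends after `t`
non-Clifford layers is undone. -/
def heisL (x : Input) (g : Bool) (l : List (Entry x.n)) : ℕ → List (Entry x.n)
  | 0 => roundL g Finset.univ (cliffordBlock x.circuit 0) x.ℓ x.damp l
  | t + 1 => roundL g (noiseSet x.circuit g t) (cliffordBlock x.circuit (t + 1)) x.ℓ x.damp
      (if g then dedupe (expandL false (ncLayer x.circuit t) x.ℓ (heisL x g l t))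
        else expandL false (ncLayer x.circuit t) x.ℓ (heisL x g l t))

/-- The program for `heisL`. -/
def heisProg (g : Bool) : Program :=
  .seq (.instr (.nset (scal 13) (.const 0)))
  (.seq (roundProg false g)
  (forLoop 3 (.read 0 (.const 0) (.const 1))
    (.seq (expandProg false)
    (.seq (if g then flat dedupeBody else skip)
    (.seq (.instr (.nset (scal 13) (.add (nvar 3) (.const 1)))) (roundProg g g))))))

lemma wp_heisProg {x : Input} {μ : Mem} {g : Bool} {M : ℕ} {l : List (Entry x.n)}
    (hB : Base x μ) (hl : Tab μ 60 l) (hM : l.length ≤ M)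
    (hE : ∀ t < ncDepth x.circuit, ∀ m ≤ x.n,
      (expandTo false (ncLayer x.circuit t).gates x.ℓ m (heisL x g l t)).length ≤ M) :
    wp x (heisProg g) μ fun μ' T => Base x μ' ∧
      Tab μ' 60 (heisL x g l (ncDepth x.circuit)) ∧
      T ≤ 2100 * (ncDepth x.circuit + 1) * unitT x.n M := by
  have h1 := one_le_unitT x.n M
  refine wp_seq_nat 13 0 rfl rfl fun μ₁ a₁ v13 _ => ?_
  refine wp_seq (wp_roundProg (g := false) (t := 0) (hB.agree a₁ (by decide)) (by simp) v13
    (hl.agree a₁ (by decide) (by decide) (by decide)) hM) ?_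
  rintro μ₂ T₂ _ ⟨a₂, t2, hT₂⟩
  have B₂ := (hB.agree a₁ (by decide)).agree a₂ (by decide)
  refine wp_mono (wp_for (fun i μ' => Tab μ' 60 (heisL x g l i)) (ncDepth x.circuit)
    (2002 * unitT x.n M) (by cases g <;> decide) ?_ ?_ t2 ?_) ?_
  · intro μ' ha
    simp only [NExpr.eval, (ha 0 (by cases g <;> decide)).1, B₂.2.1]
  · intro i μ₃ μ₄ ha h
    exact h.agree ha (by decide) (by decide) (by decide)
  · intro t ht μ₃ ha v3 hI
    have B₃ : Base x μ₃ := B₂.agree ha (by cases g <;> decide)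
    refine wp_seq (wp_expand B₃ v3 hI (hE t ht)) ?_
    rintro μ₄ T₄ _ ⟨a₄, t4, hT₄⟩
    have B₄ := B₃.agree a₄ (by decide)
    have hM4 : (expandL false (ncLayer x.circuit t) x.ℓ (heisL x g l t)).length ≤ M :=
      hE t ht x.n le_rfl
    refine wp_seq (R := fun μ' T => Agree flatW μ₄ μ' ∧ Tab μ' 60
      (if g then dedupe (expandL false (ncLayer x.circuit t) x.ℓ (heisL x g l t))
        else expandL false (ncLayer x.circuit t) x.ℓ (heisL x g l t)) ∧
      T ≤ 500 * unitT x.n M) ?_ ?_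
    · cases g with
      | true => exact wp_flat_dedupe B₄ t4 hM4
      | false =>
        refine wp_mono wp_skip ?_
        rintro μ' T _ ⟨b1, b2⟩
        exact ⟨b1.mono (by decide), t4.agree b1 (by decide) (by decide) (by decide), by omega⟩
    rintro μ₅ T₅ _ ⟨a₅, t5, hT₅⟩
    have B₅ := B₄.agree a₅ (by decide)
    refine wp_seq_nat 13 (t + 1) ?_ rfl fun μ₆ a₆ v13 _ => ?_
    · simp only [Instr.run, Cell.putNat, scal, nvar, NExpr.eval]
      rw [(a₅ 3 (by decide)).1, (a₄ 3 (by decide)).1, v3]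
    refine wp_mono (wp_roundProg (g := g) (g' := g) (t := t) (k := t + 1) (M := M)
      (B₅.agree a₆ (by decide)) ?_ v13 (t5.agree a₆ (by decide) (by decide) (by decide)) ?_) ?_
    · intro _
      rw [(a₆ 3 (by decide)).1, (a₅ 3 (by decide)).1, (a₄ 3 (by decide)).1, v3]
    · split_ifs
      · exact (dedupe_length_le _).trans hM4
      · exact hM4
    · rintro μ₇ T₇ _ ⟨a₇, t7, hT₇⟩
      exact ⟨t7, by omega⟩
  · rintro μ₃ T₃ ha ⟨t3, hT₃⟩
    refine ⟨B₂.agree ha (by cases g <;> decide), t3, ?_⟩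
    have e1 : ncDepth x.circuit * (2002 * unitT x.n M + 2) =
      2002 * (ncDepth x.circuit * unitT x.n M) + 2 * ncDepth x.circuit := by ring
    have e2 : 2100 * (ncDepth x.circuit + 1) * unitT x.n M =
      2100 * (ncDepth x.circuit * unitT x.n M) + 2100 * unitT x.n M := by ring
    have e3 : ncDepth x.circuit ≤ ncDepth x.circuit * unitT x.n M := Nat.le_mul_of_pos_right _ h1
    omega

/-! ## Backward propagation and the three programs -/

/-- One step of the backward propagation of table entries through layer `t` and the Clifford block
before it. -/
def bwdStep (x : Input) (t : ℕ) (l : List (Entry x.n)) : List (Entry x.n) :=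
  ((expandL true (ncLayer x.circuit t) x.ℓ l).map
    (cliffE (dirOp true (cliffordBlock x.circuit t)))).flatMap
      (weighE Finset.univ (fun b _ => b) (fun b w => b + w) x.ℓ x.damp)

/-- The first `i` steps of the backward propagation from level `s`. -/
def bwdL (x : Input) (s : ℕ) (l : List (Entry x.n)) : ℕ → List (Entry x.n)
  | 0 => l
  | i + 1 => bwdStep x (s - (i + 1)) (bwdL x s l i)

/-- The program for `bwdL`, from the level in variable `18`. -/
def bwdProg : Program :=
  forLoop 20 (nvar 18)
    (.seq (.instr (.nset (scal 3) (.sub (nvar 18) (.add (nvar 20) (.const 1)))))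
    (.seq (expandProg true)
    (.seq (.instr (.nset (scal 13) (nvar 3)))
    (.seq (flat (cliffBody true))
    (flat (weighBody false (.read 51 (.const 0) (.const 1))
      (.add (.read 51 (.const 0) (.const 1)) (nvar 11))))))))

/-- The arrays that the backward propagation may change. -/
def bwdW : List ℕ := 3 :: 13 :: 20 :: flatW

set_option maxRecDepth 4000 in
lemma wp_bwdProg {x : Input} {μ : Mem} {s M : ℕ} {l : List (Entry x.n)} (hB : Base x μ)
    (h18 : μ.nat 18 0 0 = s) (hl : Tab μ 60 l)
    (hE : ∀ i < s, ∀ m ≤ x.n,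
      (expandTo true (ncLayer x.circuit (s - (i + 1))).gates x.ℓ m (bwdL x s l i)).length ≤ M) :
    wp x bwdProg μ fun μ' T => Agree bwdW μ μ' ∧ Tab μ' 60 (bwdL x s l s) ∧
      T ≤ 2 + s * (1504 * unitT x.n M) := by
  have hu := one_le_unitT x.n M
  refine wp_mono (wp_for (fun i μ' => Tab μ' 60 (bwdL x s l i)) s (1502 * unitT x.n M)
    (by decide) ?_ ?_ hl ?_) ?_
  · intro μ' ha
    simp only [nvar, NExpr.eval, (ha 18 (by decide)).1, h18]
  · intro i μ₃ μ₄ ha h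
    exact h.agree ha (by decide) (by decide) (by decide)
  · intro i hi μ₁ ha v20 hI
    have B₁ : Base x μ₁ := hB.agree ha (by decide)
    refine wp_seq_nat 3 (s - (i + 1)) ?_ rfl fun μ₂ a₂ v3 _ => ?_
    · simp only [Instr.run, Cell.putNat, scal, nvar, NExpr.eval, v20]
      rw [(ha 18 (by decide)).1, h18]
    have B₂ := B₁.agree a₂ (by decide)
    refine wp_seq (wp_expand B₂ v3 (hI.agree a₂ (by decide) (by decide) (by decide)) (hE i hi)) ?_
    rintro μ₃ T₃ _ ⟨a₃, t3, hT₃⟩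
    have B₃ := B₂.agree a₃ (by decide)
    have hM3 := hE i hi x.n le_rfl
    refine wp_seq_nat 13 (s - (i + 1)) ?_ rfl fun μ₄ a₄ v13 _ => ?_
    · simp only [Instr.run, Cell.putNat, scal, nvar, NExpr.eval]
      rw [(a₃ 3 (by decide)).1, v3]
    have B₄ := B₃.agree a₄ (by decide)
    refine wp_seq (wp_flat_cliff (k := s - (i + 1)) (M := M) B₄ v13
      (t3.agree a₄ (by decide) (by decide) (by decide)) hM3) ?_
    rintro μ₅ T₅ _ ⟨a₅, t5, hT₅⟩
    refine wp_mono (wp_flat_weigh (gate := false) (t := 0) (M := M) (fun b _ => b)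
      (fun b w => b + w) (B₄.agree a₅ (by decide)) (by simp) (fun _ => rfl) (fun _ => rfl) t5
      (by rwa [List.length_map])) ?_
    rintro μ₆ T₆ _ ⟨a₆, t6, hT₆⟩
    exact ⟨t6, by omega⟩
  · rintro μ' T ha ⟨h1, h2⟩
    refine ⟨ha.mono (by decide), h1, h2.trans ?_⟩
    have h5 : 1502 * unitT x.n M + 2 ≤ 1504 * unitT x.n M := by omega
    exact Nat.add_le_add_left (Nat.mul_le_mul (le_refl s) h5) 2

/-- The Pauli operators of low weight, with their weights. -/
def seeds (x : Input) : List (Entry x.n) :=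
  (levels x.n (min x.n (x.ℓ / (ncDepth x.circuit + 1)))).flatMap
    (weighE Finset.univ (fun _ _ => 0) (fun _ w => w) x.ℓ x.damp)

/-- Everything that propagates backward from a Pauli operator of low weight to the observable. -/
def sources (x : Input) : List (Entry x.n) :=
  (List.range (ncDepth x.circuit + 1)).flatMap fun s => bwdL x s (seeds x) s

/-- The relevant part of the observable. -/
def startL (x : Input) : List (Entry x.n) := (dedupe (sources x)).flatMap (obsE x.obs)

lemma levels_length (n r : ℕ) :
    (levels n r).length = ∑ i ∈ Finset.range (r + 1), (level n i).length := by
  rw [levels, List.length_flatMap]; rfl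

/-- The program for `sources`. -/
def sourcesProg : Program :=
  .seq (enumerate (.add (.read 0 (.const 0) (.const 1)) (.const 1)))
  (.seq (moveTab 68 60)
  (.seq (flat (weighBody false (.const 0) (nvar 11)))
  (.seq (moveTab 60 68)
  (.seq (clear 72)
  (forLoop 18 (.add (.read 0 (.const 0) (.const 1)) (.const 1))
    (.seq (moveTab 68 60) (.seq bwdProg (appendTab 60 72))))))))

/-- The seeds are propagated backward separately from every level s ≤ d, in s steps each; this is
the origin of the factor (d + 1)². -/
lemma wp_sourcesProg {x : Input} {μ : Mem} {M : ℕ} (hB : Base x μ)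
    (he : RowIs μ 50 0 (⟨0, 0, 0, 0⟩ : Entry x.n))
    (h1 : (levels x.n (min x.n (x.ℓ / (ncDepth x.circuit + 1)))).length ≤ M)
    (h2 : ∀ s ≤ ncDepth x.circuit, (bwdL x s (seeds x) s).length ≤ M)
    (hE : ∀ s ≤ ncDepth x.circuit, ∀ i < s, ∀ m ≤ x.n,
      (expandTo true (ncLayer x.circuit (s - (i + 1))).gates x.ℓ m
        (bwdL x s (seeds x) i)).length ≤ M) :
    wp x sourcesProg μ fun μ' T => Base x μ' ∧ Tab μ' 72 (sources x) ∧
      T ≤ 8000 * (ncDepth x.circuit + 1) ^ 2 * unitT x.n M := by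
  have hu := one_le_unitT x.n M
  set d := ncDepth x.circuit with hd
  set r := min x.n (x.ℓ / (d + 1)) with hr
  refine wp_seq (wp_enumerate (st := d + 1) hB (by omega) (fun μ' h => ?_) he) ?_
  · simp only [NExpr.eval, h.2.1, hd]
  rintro μ₁ T₁ _ ⟨a₁, t1, hT₁⟩
  have B₁ := hB.agree a₁ (by decide)
  refine wp_seq (wp_move B₁ (by norm_num) (by norm_num) (by norm_num) t1 h1) ?_
  rintro μ₂ T₂ _ ⟨a₂, t2, hT₂⟩
  have B₂ := B₁.agree a₂ (by decide)
  refine wp_seq (wp_flat_weigh (gate := false) (t := 0) (M := M) (fun _ _ => 0)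
      (fun _ w => w) B₂ (by simp) (fun _ => rfl) (fun _ => rfl) t2 h1) ?_
  rintro μ₃ T₃ _ ⟨a₃, t3, hT₃⟩
  have B₃ := B₂.agree a₃ (by decide)
  have t3 : Tab μ₃ 60 (seeds x) := t3
  have hs : (seeds x).length ≤ M := by
    have := length_flatMap_le (levels x.n r) fun e _ =>
      weighE_length_le Finset.univ (fun _ _ => 0) (fun _ w => w) x.ℓ x.damp e
    exact this.trans (by omega)
  refine wp_seq (wp_move B₃ (by norm_num) (by norm_num) (by norm_num) t3 hs) ?_
  rintro μ₄ T₄ _ ⟨a₄, t4, hT₄⟩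
  have B₄ := B₃.agree a₄ (by decide)
  refine wp_seq wp_clear ?_
  rintro μ₅ T₅ a₅ ⟨t5, hT₅⟩
  have a₅ : Agree [74] μ₄ μ₅ := a₅
  have B₅ := B₄.agree a₅ (by decide)
  have t5' := t4.agree a₅ (by decide) (by decide) (by decide)
  refine wp_mono (wp_for (fun s μ' => Tab μ' 72 ((List.range s).flatMap fun s =>
    bwdL x s (seeds x) s)) (d + 1) (1002 * unitT x.n M + d * (1504 * unitT x.n M))
    (by decide) ?_ ?_ t5 ?_) ?_
  · intro μ' ha
    simp only [NExpr.eval, (ha 0 (by decide)).1, B₅.2.1, hd]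
  · intro i μ₆ μ₇ ha h
    exact h.agree ha (by decide) (by decide) (by decide)
  · intro s hsd μ₆ ha v18 hI
    have B₆ : Base x μ₆ := B₅.agree ha (by decide)
    refine wp_seq (wp_move B₆ (by norm_num) (by norm_num) (by norm_num)
      (t5'.agree ha (by decide) (by decide) (by decide)) hs) ?_
    rintro μ₇ T₇ _ ⟨a₇, t7, hT₇⟩
    have B₇ := B₆.agree a₇ (by decide)
    refine wp_seq (wp_bwdProg (s := s) (M := M) B₇ ?_ t7 (hE s (by omega))) ?_
    · rw [(a₇ 18 (by decide)).1, v18]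
    rintro μ₈ T₈ _ ⟨a₈, t8, hT₈⟩
    refine wp_mono (wp_append (B₇.agree a₈ (by decide)) (by norm_num) (by norm_num) (by norm_num)
      t8 ((hI.agree a₇ (by decide) (by decide) (by decide)).agree a₈ (by decide) (by decide)
        (by decide)) (h2 s (by omega))) ?_
    rintro μ₉ T₉ _ ⟨a₉, t9, hT₉⟩
    refine ⟨by rwa [List.range_succ, List.flatMap_append, List.flatMap_singleton], ?_⟩
    have := Nat.mul_le_mul_right (1504 * unitT x.n M) (show s ≤ d by omega)
    omega
  · rintro μ' T ha ⟨h3, h4⟩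
    refine ⟨B₅.agree ha (by decide), h3, ?_⟩
    have hlev : 1 + ∑ i ∈ Finset.range r, (level x.n i).length ≤ M + 1 := by
      have := levels_length x.n r
      rw [Finset.sum_range_succ] at this
      omega
    have hen : T₁ ≤ 300 * unitT x.n M := by
      refine hT₁.trans ?_
      unfold unitT
      have := Nat.mul_le_mul_left (300 * (x.n + 1) ^ 2) (hlev.trans (by nlinarith : M + 1 ≤ (M + 1) ^ 2))
      linarith
    have e1 : 8000 * (d + 1) ^ 2 * unitT x.n M = 8000 * (d * d * unitT x.n M) +
      16000 * (d * unitT x.n M) + 8000 * unitT x.n M := by ring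
    have e2 : (d + 1) * (1002 * unitT x.n M + d * (1504 * unitT x.n M) + 2) =
      1504 * (d * d * unitT x.n M) + 2506 * (d * unitT x.n M) + 1002 * unitT x.n M + 2 * d + 2 := by
      ring
    have e3 : d ≤ d * unitT x.n M := Nat.le_mul_of_pos_right _ hu
    omega

/-- Outputs the coefficient of the identity in the observable. -/
def trivialProg : Program := .instr (.askObs ⟨0, .const 0, .const 1⟩ ⟨50, .const 0⟩)

/-- Uniform noise, arbitrary observables. -/
def uniformProg : Program :=
  .ite (.nlt thresh (.add (.read 0 (.const 0) (.const 1)) (.const 1))) trivialProg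
    (.seq sourcesProg (.seq (moveTab 72 60) (.seq (flat dedupeBody) (.seq (flat obsBody)
      (.seq (heisProg false) sumUp)))))

/-- Uniform noise, observables given by a list of terms. -/
def termsProg : Program :=
  .ite (.nlt thresh (.add (.read 0 (.const 0) (.const 1)) (.const 1))) trivialProg
    (.seq readTerms (.seq (heisProg false) sumUp))

/-- Gate-based noise. -/
def gateProg : Program :=
  .ite (.nlt thresh (.const 1)) trivialProg
    (.seq (enumerate (.const 1)) (.seq (moveTab 68 60) (.seq (flat obsBody)
      (.seq (heisProg true) sumUp))))

/-! ### Outputs and running times of the three programs, given bounds for their tables. -/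

lemma base_init (x : Input) : Base x x.init := ⟨rfl, rfl, rfl, rfl, rfl⟩

lemma rowIs_init (x : Input) : RowIs x.init 50 0 (⟨0, 0, 0, 0⟩ : Entry x.n) :=
  ⟨fun _ => rfl, rfl, rfl, by simp [Input.init]⟩

lemma wp_trivialProg (x : Input) : wp x trivialProg x.init fun μ' T =>
    μ'.real 0 0 1 = x.obs 0 ∧ T ≤ 1 := by
  refine wp_instr ⟨?_, le_rfl⟩
  -- Register 50 has not been written yet, so it holds only zeros, the letters of the identity.
  have : x.init.getRow x.n 50 0 = 0 := (rowIs_init x).getRow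
  simp [Instr.run, Cell.putReal, NExpr.eval, Row.get, Mem.setReal, this]

lemma computes_of_wp {x : Input} {p : Program} {v : ℝ} {B : ℕ}
    (h : wp x p x.init fun μ' T => μ'.real 0 0 1 = v ∧ T ≤ B) :
    ∃ T, Computes p x v T ∧ T ≤ B := by
  obtain ⟨μ', T, h1, h2, h3⟩ := h
  exact ⟨T, ⟨μ', h1, h2⟩, h3⟩

lemma computes_uniformProg_trivial {x : Input} (h : x.ℓ < ncDepth x.circuit + 1) :
    ∃ T, Computes uniformProg x (x.obs 0) T ∧ T ≤ 2 := by
  refine computes_of_wp (wp_ite (fun _ => ?_) fun hb => absurd ?_ hb)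
  · exact wp_mono (wp_trivialProg x) fun μ' T _ h => ⟨h.1, by omega⟩
  · simpa only [Test.holds, thresh, NExpr.eval, (base_init x).2.1, (base_init x).2.2.1] using h

lemma computes_termsProg_trivial {x : Input} (h : x.ℓ < ncDepth x.circuit + 1) :
    ∃ T, Computes termsProg x (x.obs 0) T ∧ T ≤ 2 := by
  refine computes_of_wp (wp_ite (fun _ => ?_) fun hb => absurd ?_ hb)
  · exact wp_mono (wp_trivialProg x) fun μ' T _ h => ⟨h.1, by omega⟩
  · simpa only [Test.holds, thresh, NExpr.eval, (base_init x).2.1, (base_init x).2.2.1] using h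

lemma computes_gateProg_trivial {x : Input} (h : x.ℓ = 0) :
    ∃ T, Computes gateProg x (x.obs 0) T ∧ T ≤ 2 := by
  refine computes_of_wp (wp_ite (fun _ => ?_) fun hb => absurd ?_ hb)
  · exact wp_mono (wp_trivialProg x) fun μ' T _ h => ⟨h.1, by omega⟩
  · simp only [Test.holds, thresh, NExpr.eval, (base_init x).2.2.1]; omega

lemma computes_uniformProg {x : Input} {M : ℕ} (h : ncDepth x.circuit + 1 ≤ x.ℓ)
    (h1 : (levels x.n (min x.n (x.ℓ / (ncDepth x.circuit + 1)))).length ≤ M)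
    (h2 : ∀ s ≤ ncDepth x.circuit, (bwdL x s (seeds x) s).length ≤ M)
    (hE : ∀ s ≤ ncDepth x.circuit, ∀ i < s, ∀ m ≤ x.n,
      (expandTo true (ncLayer x.circuit (s - (i + 1))).gates x.ℓ m
        (bwdL x s (seeds x) i)).length ≤ M)
    (h3 : (sources x).length ≤ M)
    (hF : ∀ t < ncDepth x.circuit, ∀ m ≤ x.n, (expandTo false (ncLayer x.circuit t).gates x.ℓ m
      (heisL x false (startL x) t)).length ≤ M)
    (h4 : (heisL x false (startL x) (ncDepth x.circuit)).length ≤ M) :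
    ∃ T, Computes uniformProg x
      (sumE (fun e => e.c * x.state e.P) (heisL x false (startL x) (ncDepth x.circuit))) T ∧
      T ≤ 13000 * (ncDepth x.circuit + 1) ^ 2 * unitT x.n M := by
  have hu := one_le_unitT x.n M
  refine computes_of_wp (wp_ite (fun hb => absurd hb ?_) fun _ => ?_)
  · simp only [Test.holds, thresh, NExpr.eval, (base_init x).2.1, (base_init x).2.2.1]; omega
  refine wp_seq (wp_sourcesProg (base_init x) (rowIs_init x) h1 h2 hE) ?_
  rintro μ₁ T₁ _ ⟨B₁, t1, hT₁⟩
  refine wp_seq (wp_move B₁ (by norm_num) (by norm_num) (by norm_num) t1 h3) ?_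
  rintro μ₂ T₂ _ ⟨a₂, t2, hT₂⟩
  have B₂ := B₁.agree a₂ (by decide)
  refine wp_seq (wp_flat_dedupe B₂ t2 h3) ?_
  rintro μ₃ T₃ _ ⟨a₃, t3, hT₃⟩
  have B₃ := B₂.agree a₃ (by decide)
  have h5 := (dedupe_length_le (sources x)).trans h3
  refine wp_seq (wp_flat_obs B₃ t3) ?_
  rintro μ₄ T₄ _ ⟨a₄, t4, hT₄⟩
  have h6 : (startL x).length ≤ M := by
    have := length_flatMap_le (dedupe (sources x)) fun e _ => obsE_length_le x.obs e
    exact this.trans (by omega)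
  refine wp_seq (wp_heisProg (M := M) (B₃.agree a₄ (by decide)) t4 h6 hF) ?_
  rintro μ₅ T₅ _ ⟨B₅, t5, hT₅⟩
  refine wp_mono (wp_sumUp B₅ t5 h4) ?_
  rintro μ₆ T₆ _ ⟨h7, hT₆⟩
  refine ⟨h7, ?_⟩
  have h8 := table_cost h5 (n := x.n) (k := 12 * x.n + 31) (by omega)
  set d := ncDepth x.circuit
  have e1 : 13000 * (d + 1) ^ 2 * unitT x.n M = 8000 * (d + 1) ^ 2 * unitT x.n M +
      2100 * (d + 1) * unitT x.n M + 2900 * unitT x.n M +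
      (5000 * (d * d * unitT x.n M) + 7900 * (d * unitT x.n M)) := by ring
  omega

lemma computes_termsProg {x : Input} {M : ℕ} (h : ncDepth x.circuit + 1 ≤ x.ℓ)
    (h3 : x.terms.length ≤ M)
    (hF : ∀ t < ncDepth x.circuit, ∀ m ≤ x.n, (expandTo false (ncLayer x.circuit t).gates x.ℓ m
      (heisL x false (x.terms.map fun a => ⟨a.1, 0, 0, a.2⟩) t)).length ≤ M)
    (h4 : (heisL x false (x.terms.map fun a => ⟨a.1, 0, 0, a.2⟩)
      (ncDepth x.circuit)).length ≤ M) :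
    ∃ T, Computes termsProg x
      (sumE (fun e => e.c * x.state e.P) (heisL x false (x.terms.map fun a => ⟨a.1, 0, 0, a.2⟩)
        (ncDepth x.circuit))) T ∧
      T ≤ 3200 * (ncDepth x.circuit + 1) * unitT x.n M := by
  have hu := one_le_unitT x.n M
  refine computes_of_wp (wp_ite (fun hb => absurd hb ?_) fun _ => ?_)
  · simp only [Test.holds, thresh, NExpr.eval, (base_init x).2.1, (base_init x).2.2.1]; omega
  refine wp_seq (wp_readTerms (base_init x)) ?_
  rintro μ₁ T₁ a₁ ⟨t1, hT₁⟩
  refine wp_seq (wp_heisProg (M := M) ((base_init x).agree a₁ (by decide)) t1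
    (by rwa [List.length_map]) hF) ?_
  rintro μ₅ T₅ _ ⟨B₅, t5, hT₅⟩
  refine wp_mono (wp_sumUp B₅ t5 h4) ?_
  rintro μ₆ T₆ _ ⟨h7, hT₆⟩
  refine ⟨h7, ?_⟩
  have h8 := table_cost h3 (n := x.n) (k := 4 * x.n + 10) (by omega)
  set d := ncDepth x.circuit
  have e1 : 3200 * (d + 1) * unitT x.n M = 2100 * (d + 1) * unitT x.n M + 1100 * unitT x.n M +
    1100 * (d * unitT x.n M) := by ring
  omega

/-- The low-weight part of the observable. -/
def lowL (x : Input) : List (Entry x.n) := (levels x.n (min x.n x.ℓ)).flatMap (obsE x.obs)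

/-- The enumeration is charged separately: there may be far more Pauli operators of weight at most ℓ
than M, which only has to bound the tables after the operators with zero coefficient have been
discarded. -/
lemma computes_gateProg {x : Input} {M : ℕ} (h : 1 ≤ x.ℓ) (h3 : (lowL x).length ≤ M)
    (hF : ∀ t < ncDepth x.circuit, ∀ m ≤ x.n, (expandTo false (ncLayer x.circuit t).gates x.ℓ m
      (heisL x true (lowL x) t)).length ≤ M)
    (h4 : (heisL x true (lowL x) (ncDepth x.circuit)).length ≤ M) :
    ∃ T, Computes gateProg x
      (sumE (fun e => e.c * x.state e.P) (heisL x true (lowL x) (ncDepth x.circuit))) T ∧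
      T ≤ 2700 * (ncDepth x.circuit + 1) * unitT x.n M +
        (300 * (x.n + 1) ^ 2 * (1 + ∑ i ∈ Finset.range (min x.n x.ℓ), (level x.n i).length) +
          50 * (x.n + 1) * (1 + (levels x.n (min x.n x.ℓ)).length)) := by
  have hu := one_le_unitT x.n M
  refine computes_of_wp (wp_ite (fun hb => absurd hb ?_) fun _ => ?_)
  · simp only [Test.holds, thresh, NExpr.eval, (base_init x).2.2.1]; omega
  refine wp_seq (wp_enumerate (st := 1) (base_init x) le_rfl (fun _ _ => rfl) (rowIs_init x)) ?_
  rw [Nat.div_one]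
  rintro μ₁ T₁ _ ⟨a₁, t1, hT₁⟩
  have B₁ := (base_init x).agree a₁ (by decide)
  refine wp_seq (wp_moveTab (t := 60) B₁ (by norm_num) (by norm_num) (by norm_num) t1) ?_
  rintro μ₂ T₂ a₂ ⟨t2, hT₂⟩
  have B₂ := B₁.agree a₂ (by decide)
  refine wp_seq (wp_flat_obs B₂ t2) ?_
  rintro μ₄ T₄ _ ⟨a₄, t4, hT₄⟩
  refine wp_seq (wp_heisProg (M := M) (B₂.agree a₄ (by decide)) t4 h3 hF) ?_
  rintro μ₅ T₅ _ ⟨B₅, t5, hT₅⟩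
  refine wp_mono (wp_sumUp B₅ t5 h4) ?_
  rintro μ₆ T₆ _ ⟨h7, hT₆⟩
  refine ⟨h7, ?_⟩
  set d := ncDepth x.circuit
  have e1 : 2700 * (d + 1) * unitT x.n M = 2100 * (d + 1) * unitT x.n M + 600 * unitT x.n M +
    600 * (d * unitT x.n M) := by ring
  have e2 : 50 * (x.n + 1) * (1 + (levels x.n (min x.n x.ℓ)).length) =
    50 * x.n + 50 + (levels x.n (min x.n x.ℓ)).length * (6 * x.n + 13) +
    (levels x.n (min x.n x.ℓ)).length * (12 * x.n + 31) +
    (levels x.n (min x.n x.ℓ)).length * (32 * x.n + 6) := by ring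
  omega

/-! ## Layers and blocks -/

lemma prod_mul_conjTranspose {n : ℕ} {l : List (Op n)} (h : ∀ U ∈ l, U * Uᴴ = 1) :
    l.prod * l.prodᴴ = 1 := by
  induction l with
  | nil => simp
  | cons U l ih =>
    rw [List.prod_cons, Matrix.conjTranspose_mul, Matrix.mul_assoc, ← Matrix.mul_assoc l.prod,
      ih fun V hV => h V (List.mem_cons_of_mem _ hV), Matrix.one_mul, h U List.mem_cons_self]

lemma prod_isClifford {n : ℕ} {l : List (Op n)} (h : ∀ U ∈ l, IsClifford U) :
    IsClifford l.prod := by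
  induction l with
  | nil => exact isClifford_one
  | cons U l ih =>
    rw [List.prod_cons]
    exact (h U List.mem_cons_self).mul (ih fun V hV => h V (List.mem_cons_of_mem _ hV))

lemma Layer.toOp_mul_conjTranspose {n : ℕ} (L : Layer n) : L.toOp * L.toOpᴴ = 1 :=
  prod_mul_conjTranspose fun U hU => by
    obtain ⟨g, _, rfl⟩ := List.mem_map.1 hU
    exact g.toOp_mul_conjTranspose

lemma Layer.conjTranspose_mul_toOp {n : ℕ} (L : Layer n) : L.toOpᴴ * L.toOp = 1 :=
  mul_eq_one_comm.1 L.toOp_mul_conjTranspose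

lemma Layer.isClifford {n : ℕ} {L : Layer n} (h : ¬ L.NonClifford) : IsClifford L.toOp :=
  prod_isClifford fun U hU => by
    obtain ⟨g, hg, rfl⟩ := List.mem_map.1 hU
    by_contra hc
    exact h ⟨g, hg, hc⟩

lemma blocks_cons {n : ℕ} (L : Layer n) (C : Circuit n) : blocks (L :: C) =
    if L.NonClifford then ([], (L, (blocks C).1) :: (blocks C).2)
    else (L :: (blocks C).1, (blocks C).2) := by rw [blocks]

lemma blocks_fst {n : ℕ} (C : Circuit n) : ∀ L ∈ (blocks C).1, ¬ L.NonClifford := by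
  induction C with
  | nil => simp [blocks]
  | cons L C ih =>
    unfold blocks
    split_ifs with h
    · simp
    · simpa [h] using ih

lemma blocks_snd {n : ℕ} (C : Circuit n) :
    ∀ B ∈ (blocks C).2, B.1.NonClifford ∧ ∀ L ∈ B.2, ¬ L.NonClifford := by
  induction C with
  | nil => simp [blocks]
  | cons L C ih =>
    unfold blocks
    split_ifs with h
    · intro B hB
      rcases List.mem_cons.1 hB with rfl | hB
      · exact ⟨h, blocks_fst C⟩
      · exact ih B hB
    · exact ih

lemma blocks_length {n : ℕ} (C : Circuit n) : (blocks C).2.length = ncDepth C := by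
  induction C with
  | nil => rfl
  | cons L C ih =>
    rw [blocks_cons]
    unfold ncDepth at *
    rw [List.filter_cons]
    split_ifs with h h' h' <;> simp_all

lemma ncLayer_eq {n : ℕ} {C : Circuit n} {t : ℕ} (h : t < (blocks C).2.length) :
    ncLayer C t = ((blocks C).2[t]).1 := by
  rw [ncLayer, List.getD_eq_getElem _ _ (by simpa using h), List.getElem_map]

lemma ncLayer_nonClifford {n : ℕ} {C : Circuit n} {t : ℕ} (h : t < ncDepth C) :
    (ncLayer C t).NonClifford := by
  rw [← blocks_length] at h
  rw [ncLayer_eq h]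
  exact (blocks_snd C _ (List.getElem_mem h)).1

/-- The layers of the `k`-th block of consecutive Clifford layers. -/
def cliffordLayers {n : ℕ} (C : Circuit n) (k : ℕ) : List (Layer n) :=
  ((blocks C).1 :: (blocks C).2.map Prod.snd).getD k []

lemma cliffordLayers_succ {n : ℕ} {C : Circuit n} {t : ℕ} (h : t < (blocks C).2.length) :
    cliffordLayers C (t + 1) = ((blocks C).2[t]).2 := by
  rw [cliffordLayers, List.getD_cons_succ, List.getD_eq_getElem _ _ (by simpa using h),
    List.getElem_map]

lemma not_nonClifford_of_mem_cliffordLayers {n : ℕ} {C : Circuit n} {k : ℕ} :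
    ∀ L ∈ cliffordLayers C k, ¬ L.NonClifford := by
  cases k with
  | zero => exact blocks_fst C
  | succ t =>
    by_cases h : t < (blocks C).2.length
    · rw [cliffordLayers_succ h]
      exact (blocks_snd C _ (List.getElem_mem h)).2
    · rw [cliffordLayers, List.getD_cons_succ, List.getD_eq_default _ _ (by simpa using h)]
      simp

lemma cliffordBlock_mul_conjTranspose {n : ℕ} (C : Circuit n) (k : ℕ) :
    cliffordBlock C k * (cliffordBlock C k)ᴴ = 1 :=
  prod_mul_conjTranspose fun U hU => by
    obtain ⟨L, _, rfl⟩ := List.mem_map.1 hU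
    exact L.toOp_mul_conjTranspose

lemma cliffordBlock_isClifford {n : ℕ} (C : Circuit n) (k : ℕ) : IsClifford (cliffordBlock C k) :=
  prod_isClifford fun U hU => by
    obtain ⟨L, hL, rfl⟩ := List.mem_map.1 hU
    exact L.isClifford (not_nonClifford_of_mem_cliffordLayers L hL)

/-- A fold over a circuit, block by block. -/
lemma foldl_blocks {n : ℕ} {α : Type*} (step : α → Layer n → α) (C : Circuit n) (f : α) :
    C.foldl step f = (blocks C).2.foldl (fun f B => B.2.foldl step (step f B.1))
      ((blocks C).1.foldl step f) := by
  induction C generalizing f with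
  | nil => rfl
  | cons L C ih =>
    rw [List.foldl_cons, ih, blocks_cons]
    split_ifs with h <;> simp

/-- A sequence that follows the blocks of a circuit computes the fold over the circuit. -/
lemma foldl_eq_of_blocks {n : ℕ} {α : Type*} (step : α → Layer n → α) (C : Circuit n) (f : α)
    (F : ℕ → α) (h0 : F 0 = (cliffordLayers C 0).foldl step f)
    (hs : ∀ t < ncDepth C, F (t + 1) =
      (cliffordLayers C (t + 1)).foldl step (step (F t) (ncLayer C t))) :
    C.foldl step f = F (ncDepth C) := by
  rw [foldl_blocks]
  have key : ∀ k ≤ (blocks C).2.length, ((blocks C).2.take k).foldl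
      (fun f B => B.2.foldl step (step f B.1)) ((blocks C).1.foldl step f) = F k := by
    intro k
    induction k with
    | zero => intro _; rw [h0]; rfl
    | succ k ih =>
      intro hk
      rw [List.take_add_one, List.getElem?_eq_getElem (by omega), List.foldl_append, ih (by omega),
        hs k (by rw [← blocks_length]; omega), ncLayer_eq (by omega),
        cliffordLayers_succ (by omega)]
      rfl
  rw [← blocks_length, ← key _ le_rfl, List.take_length]

/-! ## Noise in the Pauli basis -/

/-- The effect of the noise on Pauli coefficients. -/
def damped {n : ℕ} (γ : ℝ) (S : Finset (Fin n)) (f : PauliString n → ℝ) : PauliString n → ℝ :=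
  fun P => Real.exp (-γ) ^ wt S P * f P

lemma ofCoeff_apply {n : ℕ} (f : PauliString n → ℝ) (x y : Fin n → Fin 2) :
    ofCoeff f x y = ∑ P, (f P : ℂ) * pauliOp P x y := by
  simp [ofCoeff, Matrix.sum_apply]

/-- The partial trace over qubit j kills X, Y and Z at j and keeps the identity, so each Pauli
operator is an eigenvector, with eigenvalue e^{-γ} or 1. -/
lemma depolarize_ofCoeff {n : ℕ} (γ : ℝ) (j : Fin n) (f : PauliString n → ℝ) :
    depolarize γ j (ofCoeff f) =
      ofCoeff fun P => (if P j = 0 then 1 else Real.exp (-γ)) * f P := by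
  ext x y
  have hupd : ∀ (P : PauliString n) b, pauliOp P (Function.update x j b) (Function.update y j b) =
      pauliMat (P j) b b * ∏ k ∈ Finset.univ.erase j, pauliMat (P k) (x k) (y k) := by
    intro P b
    rw [pauliOp, Matrix.of_apply, ← Finset.mul_prod_erase _ _ (Finset.mem_univ j)]
    congr 1
    · simp
    · refine Finset.prod_congr rfl fun k hk => ?_
      have : k ≠ j := Finset.ne_of_mem_erase hk
      simp [this]
  have hp : ∀ P : PauliString n, pauliOp P x y =
      pauliMat (P j) (x j) (y j) * ∏ k ∈ Finset.univ.erase j, pauliMat (P k) (x k) (y k) := by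
    intro P
    have := hupd P (x j)
    rw [pauliOp, Matrix.of_apply, ← Finset.mul_prod_erase _ _ (Finset.mem_univ j)]
  have hone : ∀ P : PauliString n, (Real.exp (-γ) : ℂ) * pauliOp P x y +
      (1 - (Real.exp (-γ) : ℂ)) * (if x j = y j then
        (∑ b : Fin 2, pauliOp P (Function.update x j b) (Function.update y j b)) / 2 else 0) =
      (((if P j = 0 then 1 else Real.exp (-γ) : ℝ)) : ℂ) * pauliOp P x y := by
    intro P
    simp only [hupd, hp P, Fin.sum_univ_two]
    generalize ∏ k ∈ Finset.univ.erase j, pauliMat (P k) (x k) (y k) = r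
    generalize P j = p
    generalize x j = a
    generalize y j = b
    have : pauliMat p 0 0 + pauliMat p 1 1 = if p = 0 then 2 else 0 := by
      fin_cases p <;> (simp [pauliMat]; try norm_num)
    rw [← add_mul, this]
    by_cases hp : p = 0
    · subst hp
      rw [pauliMat_zero, Matrix.one_apply]
      by_cases hab : a = b
      · simp [hab]; ring
      · simp [hab]
    · simp [hp]
  simp only [depolarize, Matrix.of_apply, ofCoeff_apply]
  have : ∀ P : PauliString n,
      (((if P j = 0 then 1 else Real.exp (-γ)) * f P : ℝ) : ℂ) * pauliOp P x y =
      (f P : ℂ) * ((Real.exp (-γ) : ℂ) * pauliOp P x y +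
      (1 - (Real.exp (-γ) : ℂ)) * (if x j = y j then
        (∑ b : Fin 2, pauliOp P (Function.update x j b) (Function.update y j b)) / 2 else 0)) := by
    intro P
    rw [hone]; push_cast; ring
  simp only [this, mul_add, Finset.sum_add_distrib]
  congr 1
  · rw [Finset.mul_sum]
    exact Finset.sum_congr rfl fun P _ => by ring
  · split_ifs with h
    · rw [Finset.sum_comm, Finset.sum_div, Finset.mul_sum]
      refine Finset.sum_congr rfl fun P _ => ?_
      rw [← Finset.mul_sum]; ring
    · simp

lemma depolarizeOn_ofCoeff {n : ℕ} (γ : ℝ) (S : Finset (Fin n)) (f : PauliString n → ℝ) :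
    depolarizeOn γ S (ofCoeff f) = ofCoeff (damped γ S f) := by
  have key : ∀ l : List (Fin n), l.foldr (depolarize γ) (ofCoeff f) = ofCoeff fun P =>
      Real.exp (-γ) ^ (l.filter fun j => decide (P j ≠ 0)).length * f P := by
    intro l
    induction l with
    | nil => simp
    | cons j l ih =>
      rw [List.foldr_cons, ih, depolarize_ofCoeff]
      congr 1
      funext P
      rw [List.filter_cons]
      by_cases h : P j = 0
      · simp [h]
      · simp [h, pow_succ]; ring
  rw [depolarizeOn, key]
  congr 1
  funext P
  rw [damped]
  congr 2
  rw [List.filter_filter, wt, ← List.toFinset_card_of_nodup ((List.nodup_finRange n).filter _)]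
  congr 1
  ext j
  simp [and_comm]

/-! ## Expectation values in the Pauli basis -/

/-- A layer in the Heisenberg picture. -/
def heisStep {n : ℕ} (γ : ℝ) (noise : Layer n → Finset (Fin n)) (f : PauliString n → ℝ)
    (L : Layer n) : PauliString n → ℝ := damped γ (noise L) (push L.toOp f)

/-- The noisy observable in the Heisenberg picture. -/
def heis {n : ℕ} (γ : ℝ) (noise : Layer n → Finset (Fin n)) (C : Circuit n)
    (f : PauliString n → ℝ) : PauliString n → ℝ :=
  C.foldl (heisStep γ noise) (damped γ Finset.univ f)

lemma sum_damped_mul {n : ℕ} (γ : ℝ) (S : Finset (Fin n)) (f g : PauliString n → ℝ) :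
    ∑ P, damped γ S f P * g P = ∑ P, f P * damped γ S g P :=
  Finset.sum_congr rfl fun P _ => by simp only [damped]; ring

lemma sum_push_conjTranspose_mul {n : ℕ} (U : Op n) (f g : PauliString n → ℝ) :
    ∑ P, push Uᴴ f P * g P = ∑ P, f P * push U g P := by
  simp only [push, Finset.sum_mul, Finset.mul_sum, amp_conjTranspose]
  rw [Finset.sum_comm]
  exact Finset.sum_congr rfl fun P _ => Finset.sum_congr rfl fun Q _ => by ring

lemma trace_mul_ofCoeff_re {n : ℕ} (ρ : Op n) (f : PauliString n → ℝ) :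
    (ρ * ofCoeff f).trace.re = ∑ P, (ρ * pauliOp P).trace.re * f P := by
  rw [Matrix.trace_mul_comm, trace_ofCoeff_mul, Complex.re_sum]
  refine Finset.sum_congr rfl fun P _ => ?_
  rw [Complex.re_ofReal_mul, Matrix.trace_mul_comm, mul_comm]

/-- Conjugation by U and by its adjoint have transposed matrices, and noise is diagonal, so the
pairing of state and observable can be shifted layer by layer from the one to the other. The head of
the list acts last on the state and first on the observable; the statement for all g lets the
induction run in both orders at once. -/
lemma exists_evolve {n : ℕ} (γ : ℝ) (noise : Layer n → Finset (Fin n)) (C : Circuit n)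
    (r : PauliString n → ℝ) : ∃ s, evolve γ noise C (ofCoeff r) = ofCoeff s ∧
      ∀ g : PauliString n → ℝ, ∑ P, s P * g P = ∑ P, r P * C.foldl (heisStep γ noise) g P := by
  induction C with
  | nil => exact ⟨r, rfl, fun g => rfl⟩
  | cons L C ih =>
    obtain ⟨s, h1, h2⟩ := ih
    refine ⟨push L.toOpᴴ (damped γ (noise L) s), ?_, fun g => ?_⟩
    · rw [evolve, h1, depolarizeOn_ofCoeff, ← conj_ofCoeff, Matrix.conjTranspose_conjTranspose]
    · rw [sum_push_conjTranspose_mul, sum_damped_mul, List.foldl_cons, h2]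
      rfl

/-- The expectation value is the pairing of the state with the evolved observable. -/
lemma expectation_eq {n : ℕ} (γ : ℝ) (noise : Layer n → Finset (Fin n)) (C : Circuit n)
    {O ρ : Op n} (hO : O.IsHermitian) (hρ : ρ.IsHermitian) :
    expectation γ noise C O ρ = ∑ P, (ρ * pauliOp P).trace.re * heis γ noise C (coeff O) P := by
  obtain ⟨s, h1, h2⟩ := exists_evolve γ noise C (coeff ρ)
  rw [expectation, noisyCircuit, ← ofCoeff_coeff hρ, h1, depolarizeOn_ofCoeff, ofCoeff_coeff hρ]
  conv_lhs => rw [← ofCoeff_coeff hO]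
  rw [trace_ofCoeff_mul_ofCoeff, Complex.ofReal_re, sum_damped_mul, h2, Finset.mul_sum]
  refine Finset.sum_congr rfl fun P _ => ?_
  have : (ρ * pauliOp P).trace.re = 2 ^ n * coeff ρ P := by
    have h := coeff_coe hρ P
    have h3 : (ρ * pauliOp P).trace = ((2 ^ n * coeff ρ P : ℝ) : ℂ) := by
      push_cast; rw [h]; field_simp
    rw [h3, Complex.ofReal_re]
  rw [this, heis]; ring

/-! ## The root-mean-square error over a low-average ensemble -/

-- The variance of X in the state ρ is non-negative: expand tr(ρ (X - m)²) ≥ 0 with m = tr(ρX).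
open scoped ComplexOrder in
lemma trace_mul_sq_le {n : ℕ} {ρ X : Op n} (hρ : ρ.PosSemidef) (h1 : ρ.trace = 1)
    (hX : X.IsHermitian) : (ρ * X).trace.re ^ 2 ≤ (ρ * (X * X)).trace.re := by
  set m : ℝ := (ρ * X).trace.re with hm
  set Y : Op n := X - (m : ℂ) • 1 with hY
  have hYH : Yᴴ = Y := by
    rw [hY, Matrix.conjTranspose_sub, hX.eq, Matrix.conjTranspose_smul, Matrix.conjTranspose_one]
    simp
  have h2 : 0 ≤ (Yᴴ * ρ * Y).trace.re :=
    (Complex.le_def.1 (hρ.conjTranspose_mul_mul_same Y).trace_nonneg).1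
  have h3 : (Yᴴ * ρ * Y).trace = (ρ * (X * X)).trace - 2 * (m : ℂ) * (ρ * X).trace +
      (m : ℂ) ^ 2 := by
    rw [hYH, Matrix.trace_mul_comm, ← Matrix.mul_assoc, Matrix.trace_mul_comm]
    have : Y * Y = X * X - (2 * (m : ℂ)) • X + ((m : ℂ) ^ 2) • 1 := by
      rw [hY]
      simp only [Matrix.sub_mul, Matrix.mul_sub, Matrix.smul_mul, Matrix.mul_smul, Matrix.one_mul,
        Matrix.mul_one]
      module
    rw [this]
    simp [Matrix.mul_add, Matrix.mul_sub, h1]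
  rw [h3] at h2
  have h4 : ((ρ * (X * X)).trace - 2 * (m : ℂ) * (ρ * X).trace + (m : ℂ) ^ 2).re =
      (ρ * (X * X)).trace.re - 2 * m * m + m ^ 2 := by
    have e1 : (2 * (m : ℂ) * (ρ * X).trace).re = 2 * m * m := by
      rw [show (2 * (m : ℂ)) = ((2 * m : ℝ) : ℂ) by push_cast; ring, Complex.re_ofReal_mul, ← hm]
    rw [Complex.add_re, Complex.sub_re, e1, ← Complex.ofReal_pow, Complex.ofReal_re]
  rw [h4] at h2
  nlinarith

-- Diagonal entry k of Xᴴ A X is ⟨v, A v⟩ for the column v of X with index k, so its real part is at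
-- most ‖A‖ ‖v‖². Summing over k gives the traces.
open scoped Matrix.Norms.L2Operator in
lemma trace_conj_le {n : ℕ} (A X : Op n) :
    (Xᴴ * A * X).trace.re ≤ ‖A‖ * (Xᴴ * X).trace.re := by
  have hcol : ∀ (B : Op n) k, (Xᴴ * B * X) k k = star (X.col k) ⬝ᵥ (B *ᵥ X.col k) := by
    intro B k
    rw [Matrix.mul_assoc, Matrix.mul_apply]
    rfl
  have hk : ∀ k, ((Xᴴ * A * X) k k).re ≤ ‖A‖ * ((Xᴴ * (1 : Op n) * X) k k).re := by
    intro k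
    rw [hcol, hcol, Matrix.one_mulVec]
    set v : EuclideanSpace ℂ (Fin n → Fin 2) := WithLp.toLp 2 (X.col k) with hv
    set w : EuclideanSpace ℂ (Fin n → Fin 2) := WithLp.toLp 2 (A *ᵥ X.col k) with hw
    have e1 : star (X.col k) ⬝ᵥ (A *ᵥ X.col k) = inner ℂ v w := by
      rw [EuclideanSpace.inner_eq_star_dotProduct, dotProduct_comm]
    have e2 : star (X.col k) ⬝ᵥ X.col k = inner ℂ v v := by
      rw [EuclideanSpace.inner_eq_star_dotProduct, dotProduct_comm]
    have e3 : ‖w‖ ≤ ‖A‖ * ‖v‖ := Matrix.l2_opNorm_mulVec A v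
    rw [e1, e2, inner_self_eq_norm_sq_to_K]
    have e4 : (inner ℂ v w).re ≤ ‖v‖ * ‖w‖ :=
      (Complex.re_le_norm _).trans (norm_inner_le_norm v w)
    have e5 : ((‖v‖ : ℂ) ^ 2).re = ‖v‖ ^ 2 := by
      rw [← Complex.ofReal_pow, Complex.ofReal_re]
    refine e4.trans ?_
    refine (mul_le_mul_of_nonneg_left e3 (norm_nonneg v)).trans (le_of_eq ?_)
    change _ = ‖A‖ * ((‖v‖ : ℂ) ^ 2).re
    rw [e5]; ring
  rw [Matrix.mul_one] at hk
  simp only [Matrix.trace, Matrix.diag_apply, Complex.re_sum, Finset.mul_sum]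
  exact Finset.sum_le_sum fun k _ => hk k

/-- The root-mean-square expectation value of an operator. -/
lemma rmsError_le {n N : ℕ} {c : ℝ} {ρ : Fin N → Op n} (h : IsLowAverage c ρ)
    (f : PauliString n → ℝ) {u v : Fin N → ℝ}
    (huv : ∀ i, u i - v i = ∑ P, (ρ i * pauliOp P).trace.re * f P) :
    rmsError u v ≤ Real.sqrt (c * ∑ P, f P ^ 2) := by
  obtain ⟨hN, hρ, hc⟩ := h
  have hX := ofCoeff_isHermitian f
  have hN' : (0 : ℝ) < N := by exact_mod_cast hN
  refine Real.sqrt_le_sqrt ?_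
  rw [div_le_iff₀ hN']
  have h1 : ∀ i, (u i - v i) ^ 2 ≤ (ρ i * (ofCoeff f * ofCoeff f)).trace.re := by
    intro i
    rw [huv, ← trace_mul_ofCoeff_re]
    exact trace_mul_sq_le (hρ i).1 (hρ i).2 hX
  have h2 : ((ofCoeff f)ᴴ * ofCoeff f).trace.re = 2 ^ n * ∑ P, f P ^ 2 := by
    rw [hX.eq, trace_ofCoeff_mul_ofCoeff, Complex.ofReal_re]
    simp only [pow_two]
  -- The role of A is played by the average state; its norm bound c / 2^n cancels the factor 2^n in
  -- the trace of the squared observable.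
  have h3 := trace_conj_le ((N : ℂ)⁻¹ • ∑ i, ρ i) (ofCoeff f)
  rw [h2] at h3
  have h4 : ((ofCoeff f)ᴴ * ((N : ℂ)⁻¹ • ∑ i, ρ i) * ofCoeff f).trace.re =
      (N : ℝ)⁻¹ * ∑ i, (ρ i * (ofCoeff f * ofCoeff f)).trace.re := by
    rw [hX.eq, Matrix.trace_mul_comm, ← Matrix.mul_assoc, Matrix.trace_mul_comm, Matrix.smul_mul,
      Matrix.trace_smul, Finset.sum_mul, Matrix.trace_sum, smul_eq_mul]
    rw [show ((N : ℂ)⁻¹) = (((N : ℝ)⁻¹ : ℝ) : ℂ) by push_cast; rfl, Complex.re_ofReal_mul,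
      Complex.re_sum]
  rw [h4] at h3
  have h5 : 0 ≤ 2 ^ n * ∑ P, f P ^ 2 := by positivity
  have h6 := h3.trans (mul_le_mul_of_nonneg_right hc h5)
  have h7 : c / 2 ^ n * (2 ^ n * ∑ P, f P ^ 2) = c * ∑ P, f P ^ 2 := by field_simp
  rw [h7, inv_mul_le_iff₀ hN', mul_comm] at h6
  exact (Finset.sum_le_sum fun i _ => h1 i).trans h6

/-! ## The Heisenberg picture, block by block -/

lemma push_sub {n : ℕ} (U : Op n) (f g : PauliString n → ℝ) :
    push U (fun P => f P - g P) = fun Q => push U f Q - push U g Q := by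
  funext Q; simp [push, sub_mul, Finset.sum_sub_distrib]

lemma push_sum {n : ℕ} {ι : Type*} (U : Op n) (s : Finset ι) (r : ι → ℝ)
    (f : ι → PauliString n → ℝ) :
    push U (fun P => ∑ i ∈ s, r i * f i P) = fun Q => ∑ i ∈ s, r i * push U (f i) Q := by
  funext Q
  simp only [push, Finset.sum_mul, Finset.mul_sum]
  rw [Finset.sum_comm]
  exact Finset.sum_congr rfl fun i _ => Finset.sum_congr rfl fun P _ => by ring

/-- A block of Clifford layers and the non-Clifford layer that follows it. -/
def roundOp {n : ℕ} (C : Circuit n) (t : ℕ) : Op n := cliffordBlock C t * (ncLayer C t).toOp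

lemma roundOp_mul_conjTranspose {n : ℕ} (C : Circuit n) (t : ℕ) :
    roundOp C t * (roundOp C t)ᴴ = 1 := by
  rw [roundOp, Matrix.conjTranspose_mul, Matrix.mul_assoc, ← Matrix.mul_assoc _ _ (_)ᴴ,
    Layer.toOp_mul_conjTranspose, Matrix.one_mul, cliffordBlock_mul_conjTranspose]

/-- The noisy observable before the Clifford block number `t`. -/
def heisAt {n : ℕ} (γ : ℝ) (S : ℕ → Finset (Fin n)) (C : Circuit n) (f : PauliString n → ℝ) :
    ℕ → PauliString n → ℝ
  | 0 => damped γ Finset.univ f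
  | t + 1 => damped γ (S t) (push (roundOp C t) (heisAt γ S C f t))

lemma damped_empty {n : ℕ} (γ : ℝ) (f : PauliString n → ℝ) : damped γ ∅ f = f := by
  funext P; simp [damped, wt]

lemma foldl_heisStep {n : ℕ} {γ : ℝ} {noise : Layer n → Finset (Fin n)} {l : List (Layer n)}
    (h : ∀ L ∈ l, noise L = ∅) (f : PauliString n → ℝ) :
    l.foldl (heisStep γ noise) f = push (l.map Layer.toOp).prod f := by
  induction l generalizing f with
  | nil => simp [push_one]
  | cons L l ih =>
    rw [List.foldl_cons, ih fun L' h' => h L' (List.mem_cons_of_mem _ h'), heisStep,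
      h L List.mem_cons_self, damped_empty, List.map_cons, List.prod_cons, push_mul]

/-- Clifford layers are noiseless, so each block collapses to one unitary. In the Heisenberg order a
block is joined with the non-Clifford layer that follows it, which leaves the recursion `heisAt` and
one last block. -/
lemma heis_eq {n : ℕ} {γ : ℝ} {noise : Layer n → Finset (Fin n)} {S : ℕ → Finset (Fin n)}
    {C : Circuit n} (h0 : ∀ L : Layer n, ¬ L.NonClifford → noise L = ∅)
    (hS : ∀ t < ncDepth C, noise (ncLayer C t) = S t) (f : PauliString n → ℝ) :
    heis γ noise C f = push (cliffordBlock C (ncDepth C)) (heisAt γ S C f (ncDepth C)) := by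
  have hc : ∀ k, ∀ L ∈ cliffordLayers C k, noise L = ∅ := fun k L hL =>
    h0 L (not_nonClifford_of_mem_cliffordLayers L hL)
  refine foldl_eq_of_blocks _ _ _ (fun t => push (cliffordBlock C t) (heisAt γ S C f t)) ?_ ?_
  · exact (foldl_heisStep (hc 0) _).symm
  · intro t ht
    rw [foldl_heisStep (hc _), heisStep, hS t ht, ← push_mul]
    rfl

lemma uniformNoise_clifford {n : ℕ} {L : Layer n} (h : ¬ L.NonClifford) : uniformNoise L = ∅ :=
  if_neg h

lemma gateNoise_clifford {n : ℕ} {L : Layer n} (h : ¬ L.NonClifford) : gateNoise L = ∅ :=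
  Finset.filter_eq_empty_iff.2 fun _ _ ⟨g, hg, hc, _⟩ => h ⟨g, hg, hc⟩

/-! ## Traceless observables under uniform noise -/

/-- The squared norm of the traceless part. -/
def tracelessSq {n : ℕ} (f : PauliString n → ℝ) : ℝ := ∑ P, f P ^ 2 - f 0 ^ 2

lemma push_apply_zero {n : ℕ} {U : Op n} (hU : U * Uᴴ = 1) (f : PauliString n → ℝ) :
    push U f 0 = f 0 := by
  simp [push, amp_zero_right hU]

lemma damped_apply_zero {n : ℕ} (γ : ℝ) (S : Finset (Fin n)) (f : PauliString n → ℝ) :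
    damped γ S f 0 = f 0 := by simp [damped, wt]

lemma tracelessSq_push {n : ℕ} {U : Op n} (hU : U * Uᴴ = 1) (f : PauliString n → ℝ) :
    tracelessSq (push U f) = tracelessSq f := by
  rw [tracelessSq, sum_push_sq hU, push_apply_zero hU, tracelessSq]

lemma tracelessSq_eq {n : ℕ} (f : PauliString n → ℝ) :
    tracelessSq f = ∑ P ∈ Finset.univ.erase 0, f P ^ 2 := by
  rw [tracelessSq, ← Finset.add_sum_erase _ _ (Finset.mem_univ 0), add_sub_cancel_left]

lemma weight_pos {n : ℕ} {P : PauliString n} (h : P ≠ 0) : 1 ≤ weight P := by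
  rw [weight, Nat.one_le_iff_ne_zero, ne_eq, Finset.card_eq_zero]
  intro h'
  refine h (funext fun j => ?_)
  by_contra hj
  exact Finset.notMem_empty j (h' ▸ Finset.mem_filter.2 ⟨Finset.mem_univ j, hj⟩)

lemma tracelessSq_damped {n : ℕ} {γ : ℝ} (hγ : 0 ≤ γ) (f : PauliString n → ℝ) :
    tracelessSq (damped γ Finset.univ f) ≤ Real.exp (-γ) ^ 2 * tracelessSq f := by
  rw [tracelessSq_eq, tracelessSq_eq, Finset.mul_sum]
  refine Finset.sum_le_sum fun P hP => ?_
  rw [damped, wt_univ, mul_pow]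
  refine mul_le_mul_of_nonneg_right ?_ (sq_nonneg _)
  have h1 : Real.exp (-γ) ^ weight P ≤ Real.exp (-γ) ^ 1 :=
    pow_le_pow_of_le_one (Real.exp_nonneg _) (Real.exp_le_one_iff.2 (by linarith))
      (weight_pos (Finset.ne_of_mem_erase hP))
  rw [pow_one] at h1
  exact pow_le_pow_left₀ (by positivity) h1 2

lemma heisAt_apply_zero {n : ℕ} (γ : ℝ) (S : ℕ → Finset (Fin n)) (C : Circuit n)
    (f : PauliString n → ℝ) (t : ℕ) : heisAt γ S C f t 0 = f 0 := by
  induction t with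
  | zero => exact damped_apply_zero _ _ _
  | succ t ih =>
    rw [heisAt, damped_apply_zero, push_apply_zero (roundOp_mul_conjTranspose C t), ih]

/-- Each of the t + 1 rounds of noise shrinks the traceless part by e^{-γ}, as every other Pauli
operator has a letter to damp, and the unitaries in between preserve the norm and the identity
coefficient. -/
lemma tracelessSq_heisAt {n : ℕ} {γ : ℝ} (hγ : 0 ≤ γ) (C : Circuit n)
    (f : PauliString n → ℝ) (t : ℕ) :
    tracelessSq (heisAt γ (fun _ => Finset.univ) C f t) ≤
      Real.exp (-γ) ^ (2 * (t + 1)) * ∑ P, f P ^ 2 := by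
  induction t with
  | zero =>
    refine (tracelessSq_damped hγ f).trans ?_
    refine mul_le_mul_of_nonneg_left ?_ (by positivity)
    rw [tracelessSq]
    linarith [sq_nonneg (f 0)]
  | succ t ih =>
    refine (tracelessSq_damped hγ _).trans ?_
    rw [tracelessSq_push (roundOp_mul_conjTranspose C t)]
    refine (mul_le_mul_of_nonneg_left ih (by positivity)).trans (le_of_eq ?_)
    ring

/-! ## Grading by total weight -/

lemma sum_range_shift (K w : ℕ) (G : ℕ → ℕ → ℝ) :
    ∑ k ∈ Finset.range K, (if w ≤ k then G (k - w) k else 0) =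
      ∑ j ∈ Finset.range K, if j + w < K then G j (j + w) else 0 := by
  rw [← Finset.sum_filter, ← Finset.sum_filter]
  refine Finset.sum_bij' (fun k _ => k - w) (fun j _ => j + w) ?_ ?_ ?_ ?_ ?_
  · intro k hk
    simp only [Finset.mem_filter, Finset.mem_range] at hk ⊢
    omega
  · intro j hj
    simp only [Finset.mem_filter, Finset.mem_range] at hj ⊢
    omega
  · intro k hk
    simp only [Finset.mem_filter, Finset.mem_range] at hk
    omega
  · intro j _; omega
  · intro k hk
    simp only [Finset.mem_filter, Finset.mem_range] at hk
    rw [Nat.sub_add_cancel hk.2]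

/-- The contribution of the Pauli paths of total weight `k` up to the Clifford block number `t`. -/
def graded {n : ℕ} (C : Circuit n) (f : PauliString n → ℝ) : ℕ → ℕ → PauliString n → ℝ
  | 0 => fun k Q => if weight Q ≤ k then (if k - weight Q = 0 then f Q else 0) else 0
  | t + 1 => fun k Q =>
      if weight Q ≤ k then push (roundOp C t) (graded C f t (k - weight Q)) Q else 0

/-- G is arbitrary with G k 0 = 0 because the formula serves both for sums of squares and for linear
sums weighted by powers of the damping factor. -/
lemma sum_graded_zero {n : ℕ} (C : Circuit n) (f : PauliString n → ℝ) (K : ℕ) (Q : PauliString n)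
    (G : ℕ → ℝ → ℝ) (hG : ∀ k, G k 0 = 0) :
    ∑ k ∈ Finset.range K, G k (graded C f 0 k Q) =
      if weight Q < K then G (weight Q) (f Q) else 0 := by
  have : ∀ k, G k (graded C f 0 k Q) = if k = weight Q then G (weight Q) (f Q) else 0 := by
    intro k
    simp only [graded]
    by_cases h : k = weight Q
    · subst h; simp
    · rw [if_neg h]
      split_ifs with h1 h2
      · omega
      · exact hG k
      · exact hG k
  simp only [this, Finset.sum_ite_eq', Finset.mem_range]

lemma sum_graded_succ {n : ℕ} (C : Circuit n) (f : PauliString n → ℝ) (t K : ℕ)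
    (Q : PauliString n) (G : ℕ → ℝ → ℝ) (hG : ∀ k, G k 0 = 0) :
    ∑ k ∈ Finset.range K, G k (graded C f (t + 1) k Q) =
      ∑ j ∈ Finset.range K, if j + weight Q < K then
        G (j + weight Q) (push (roundOp C t) (graded C f t j) Q) else 0 := by
  rw [← sum_range_shift K (weight Q) fun j k => G k (push (roundOp C t) (graded C f t j) Q)]
  refine Finset.sum_congr rfl fun k _ => ?_
  simp only [graded]
  split_ifs
  · rfl
  · exact hG k

/-- A round is an orthogonal map on each part, followed by a relabelling: the coefficient of Q in
part j moves to part j + weight Q. For fixed Q no two of these meet, so the sum of squares is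
unchanged except for what leaves the range of k. -/
lemma graded_sq_le {n : ℕ} (C : Circuit n) (f : PauliString n → ℝ) (t K : ℕ) :
    ∑ k ∈ Finset.range K, ∑ Q, graded C f t k Q ^ 2 ≤ ∑ P, f P ^ 2 := by
  induction t with
  | zero =>
    rw [Finset.sum_comm]
    refine Finset.sum_le_sum fun Q _ => ?_
    rw [sum_graded_zero C f K Q (fun _ r => r ^ 2) (by simp)]
    split_ifs
    · exact le_rfl
    · positivity
  | succ t ih =>
    refine le_trans ?_ ih
    simp only [← sum_push_sq (roundOp_mul_conjTranspose C t) (graded C f t _)]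
    rw [Finset.sum_comm, Finset.sum_comm (s := Finset.range K)]
    refine Finset.sum_le_sum fun Q _ => ?_
    rw [sum_graded_succ C f t K Q (fun _ r => r ^ 2) (by simp)]
    refine Finset.sum_le_sum fun j _ => ?_
    split_ifs
    · exact le_rfl
    · positivity

/-- A round of noise multiplies the coefficient of Q by e^{-γ} to the power weight Q, and the grade
rises by exactly weight Q. As this is at most n per round, finitely many grades suffice. -/
lemma heisAt_eq_sum_graded {n : ℕ} (γ : ℝ) (C : Circuit n) (f : PauliString n → ℝ) (t : ℕ) :
    ∃ K₀, ∀ K ≥ K₀, heisAt γ (fun _ => Finset.univ) C f t =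
      fun Q => ∑ k ∈ Finset.range K, Real.exp (-γ) ^ k * graded C f t k Q := by
  have hw : ∀ Q : PauliString n, weight Q ≤ n := fun Q =>
    (Finset.card_le_univ _).trans (by simp)
  induction t with
  | zero =>
    refine ⟨n + 1, fun K hK => funext fun Q => ?_⟩
    rw [sum_graded_zero C f K Q (fun k r => Real.exp (-γ) ^ k * r) (by simp),
      if_pos (by have := hw Q; omega)]
    rfl
  | succ t ih =>
    obtain ⟨K₀, h⟩ := ih
    refine ⟨K₀ + n, fun K hK => funext fun Q => ?_⟩
    rw [sum_graded_succ C f t K Q (fun k r => Real.exp (-γ) ^ k * r) (by simp)]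
    have hQ := hw Q
    rw [heisAt, h (K - weight Q) (by omega), push_sum, damped, wt_univ, Finset.mul_sum,
      ← Finset.sum_filter]
    refine Finset.sum_congr ?_ fun k _ => by ring
    ext k
    simp only [Finset.mem_filter, Finset.mem_range]
    omega

/-- The part of the noisy observable from Pauli paths of total weight at most `ℓ`. -/
def truncAt {n : ℕ} (γ : ℝ) (ℓ : ℕ) (C : Circuit n) (f : PauliString n → ℝ) (t : ℕ) :
    PauliString n → ℝ :=
  fun Q => ∑ k ∈ Finset.range (ℓ + 1), Real.exp (-γ) ^ k * graded C f t k Q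

lemma sum_Ico_pow_le {r : ℝ} (h0 : 0 ≤ r) (h1 : r < 1) (a b : ℕ) :
    ∑ k ∈ Finset.Ico a b, r ^ k ≤ r ^ a / (1 - r) := by
  rw [Finset.sum_Ico_eq_sum_range]
  simp only [pow_add, ← Finset.mul_sum]
  rw [div_eq_mul_inv]
  refine mul_le_mul_of_nonneg_left ?_ (by positivity)
  rw [← tsum_geometric_of_lt_one h0 h1]
  exact (summable_geometric_of_lt_one h0 h1).sum_le_tsum _ fun _ _ => by positivity

/-- For each Q, Cauchy–Schwarz in k between the powers e^{-γk} with k > ℓ and the graded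
coefficients. The first factor is a geometric tail; the second, summed over Q, is bounded by
`graded_sq_le`. The parts need not be orthogonal, which costs the factor 1 / (1 - e^{-2γ}). -/
lemma heisAt_sub_truncAt_sq_le {n : ℕ} {γ : ℝ} (hγ : 0 < γ) (ℓ : ℕ) (C : Circuit n)
    (f : PauliString n → ℝ) (t : ℕ) :
    ∑ Q, (truncAt γ ℓ C f t Q - heisAt γ (fun _ => Finset.univ) C f t Q) ^ 2 ≤
      (Real.exp (-γ) ^ 2) ^ (ℓ + 1) / (1 - Real.exp (-γ) ^ 2) * ∑ P, f P ^ 2 := by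
  obtain ⟨K₀, h⟩ := heisAt_eq_sum_graded γ C f t
  set K := max K₀ (ℓ + 1)
  have hr0 := Real.exp_nonneg (-γ)
  have hr1 : Real.exp (-γ) ^ 2 < 1 :=
    pow_lt_one₀ hr0 (by simpa using hγ) two_ne_zero
  have h1 : ∀ Q, (truncAt γ ℓ C f t Q - heisAt γ (fun _ => Finset.univ) C f t Q) ^ 2 ≤
      (Real.exp (-γ) ^ 2) ^ (ℓ + 1) / (1 - Real.exp (-γ) ^ 2) *
        ∑ k ∈ Finset.range K, graded C f t k Q ^ 2 := by
    intro Q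
    have e : truncAt γ ℓ C f t Q - heisAt γ (fun _ => Finset.univ) C f t Q =
        -∑ k ∈ Finset.Ico (ℓ + 1) K, Real.exp (-γ) ^ k * graded C f t k Q := by
      rw [h K (le_max_left _ _), truncAt, Finset.sum_Ico_eq_sub _ (le_max_right _ _)]
      ring
    rw [e, neg_sq]
    refine (Finset.sum_mul_sq_le_sq_mul_sq _ _ _).trans ?_
    refine mul_le_mul ?_ ?_ (Finset.sum_nonneg fun _ _ => sq_nonneg _) ?_
    · simp only [← pow_mul, mul_comm _ 2]
      simp only [pow_mul]
      exact sum_Ico_pow_le (sq_nonneg _) hr1 _ _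
    · refine Finset.sum_le_sum_of_subset_of_nonneg (fun k hk => ?_) fun _ _ _ => sq_nonneg _
      exact Finset.mem_range.2 (Finset.mem_Ico.1 hk).2
    · exact div_nonneg (by positivity) (by linarith)
  refine (Finset.sum_le_sum fun Q _ => h1 Q).trans ?_
  rw [← Finset.mul_sum, Finset.sum_comm]
  exact mul_le_mul_of_nonneg_left (graded_sq_le C f t K) (div_nonneg (by positivity) (by linarith))

lemma graded_sub {n : ℕ} (C : Circuit n) (f g : PauliString n → ℝ) (t k : ℕ) :
    graded C (fun P => f P - g P) t k = fun Q => graded C f t k Q - graded C g t k Q := by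
  induction t generalizing k with
  | zero => funext Q; simp only [graded]; split_ifs <;> simp
  | succ t ih =>
    funext Q
    simp only [graded]
    split_ifs
    · rw [ih, push_sub]
    · simp

/-- A non-zero contribution comes from a Pauli path. -/
lemma exists_path_of_graded_ne_zero {n : ℕ} {C : Circuit n} {f : PauliString n → ℝ} {t k : ℕ}
    {Q : PauliString n} (h : graded C f t k Q ≠ 0) :
    ∃ r : ℕ → PauliString n, f (r 0) ≠ 0 ∧ r t = Q ∧
      (∀ i < t, amp (roundOp C i) (r i) (r (i + 1)) ≠ 0) ∧
      ∑ i ∈ Finset.range (t + 1), weight (r i) = k := by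
  induction t generalizing k Q with
  | zero =>
    simp only [graded] at h
    split_ifs at h with h1 h2
    · exact ⟨fun _ => Q, h, rfl, fun i hi => absurd hi (by omega), by simp; omega⟩
    · exact absurd rfl h
    · exact absurd rfl h
  | succ t ih =>
    simp only [graded] at h
    split_ifs at h with h1
    · obtain ⟨P, _, hP⟩ := Finset.exists_ne_zero_of_sum_ne_zero h
      obtain ⟨r, r1, r2, r3, r4⟩ := ih (left_ne_zero_of_mul hP)
      refine ⟨fun i => if i ≤ t then r i else Q, by simpa using r1, by simp, fun i hi => ?_, ?_⟩
      · dsimp only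
        rw [if_pos (by omega)]
        by_cases hit : i = t
        · subst hit
          rw [if_neg (by omega), r2]
          exact right_ne_zero_of_mul hP
        · rw [if_pos (by omega)]
          exact r3 i (by omega)
      · dsimp only
        rw [Finset.sum_range_succ, if_neg (by omega), Finset.sum_congr rfl fun i hi => by
          rw [if_pos (by have := Finset.mem_range.1 hi; omega)], r4]
        omega
    · exact absurd rfl h

/-! ## Gates met by a Pauli operator and by its images -/

/-- A gate with support T fixes an operator that is the identity on T and, being invertible, cannot
produce one from anything else; a gate disjoint from T does not change the letters on T. -/
lemma zero_iff_of_amp_ne_zero {n : ℕ} {G : List (Gate n)} {T : Finset (Fin n)}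
    (hT : ∀ g ∈ G, Disjoint g.support T ∨ g.support = T) {P Q : PauliString n}
    (h : amp (G.map Gate.toOp).prod P Q ≠ 0) : (∀ k ∈ T, P k = 0) ↔ ∀ k ∈ T, Q k = 0 := by
  induction G generalizing P with
  | nil =>
    simp only [List.map_nil, List.prod_nil, amp_one] at h
    rw [(ite_ne_right_iff.1 h).1]
  | cons g G ih =>
    rw [List.map_cons, List.prod_cons, amp_mul] at h
    obtain ⟨R, _, hR⟩ := Finset.exists_ne_zero_of_sum_ne_zero h
    rw [← ih (fun g' hg' => hT g' (List.mem_cons_of_mem _ hg')) (right_ne_zero_of_mul hR)]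
    have h1 := left_ne_zero_of_mul hR
    rcases hT g List.mem_cons_self with h2 | rfl
    · exact forall₂_congr fun k hk => by
        rw [g.localOn.amp_ne_zero h1 fun hc => Finset.disjoint_left.1 h2 hc hk]
    · constructor
      · intro h3
        have h4 : amp g.toOp P R = _ := amp_untouched false g h3 R
        rw [h4] at h1
        rwa [← (ite_ne_right_iff.1 h1).1]
      · intro h3
        have h4 := amp_untouched true g h3 P
        rw [amp_dirOp, if_pos rfl] at h4
        rw [h4] at h1
        rwa [← (ite_ne_right_iff.1 h1).1]

/-- A layer does not change the set of the gates that are met. -/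
lemma Layer.touched_eq {n : ℕ} (L : Layer n) {P Q : PauliString n}
    (h : amp L.toOp P Q ≠ 0) : L.touched P = L.touched Q := by
  unfold Layer.touched
  congr 1
  refine List.filter_congr fun g hg => ?_
  have h1 := not_congr (zero_iff_of_amp_ne_zero (T := g.support) (fun g' hg' => ?_) h)
  · push Not at h1
    rw [decide_eq_decide, h1]
  · by_cases e : g' = g
    · exact Or.inr (e ▸ rfl)
    · exact Or.inl ((have : Std.Symm fun g h : Gate n => Disjoint g.support h.support :=
        ⟨fun _ _ h => h.symm⟩
      L.disjoint.forall hg' hg e))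

/-- Each non-Clifford gate that is met contains a qubit of the support of P. The gates are disjoint,
so these qubits are distinct, and gate-based noise damps all of them. -/
lemma Layer.touched_le_wt {n : ℕ} (L : Layer n) (P : PauliString n) :
    L.touched P ≤ wt (gateNoise L) P := by
  have key : ∀ G : List (Gate n), DisjointGates G →
      (G.filter fun g => decide (¬ IsClifford g.toOp ∧ ∃ j ∈ g.support, P j ≠ 0)).length ≤
      wt (Finset.univ.filter fun j => ∃ g ∈ G, ¬ IsClifford g.toOp ∧ j ∈ g.support) P := by
    intro G hG
    induction G with
    | nil => simp
    | cons g G ih =>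
      have hG := List.pairwise_cons.1 hG
      rw [List.filter_cons]
      split_ifs with hp
      · obtain ⟨hc, j, hj, hP⟩ := of_decide_eq_true hp
        refine (Nat.add_le_add_right (ih hG.2) 1).trans ?_
        unfold wt
        rw [← Finset.card_insert_of_notMem (a := j)]
        · refine Finset.card_le_card fun k hk => ?_
          simp only [Finset.mem_insert, Finset.mem_filter, Finset.mem_univ, true_and,
            List.mem_cons, exists_eq_or_imp] at hk ⊢
          rcases hk with rfl | hk
          · exact ⟨Or.inl ⟨hc, hj⟩, hP⟩
          · exact ⟨Or.inr hk.1, hk.2⟩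
        · simp only [Finset.mem_filter, Finset.mem_univ, true_and, not_and]
          rintro ⟨g', hg', _, hj'⟩
          exact absurd hj' (Finset.disjoint_left.1 (hG.1 g' hg') hj)
      · refine (ih hG.2).trans (Finset.card_le_card fun k hk => ?_)
        simp only [Finset.mem_filter, Finset.mem_univ, true_and, List.mem_cons,
          exists_eq_or_imp] at hk ⊢
        exact ⟨Or.inr hk.1, hk.2⟩
  exact key L.gates L.disjoint

lemma Layer.touched_le_weight_self {n : ℕ} (L : Layer n) (P : PauliString n) :
    L.touched P ≤ weight P :=
  (L.touched_le_wt P).trans (Finset.card_le_card (Finset.filter_subset_filter _ (Finset.subset_univ _)))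

/-- The gates met before and after the layer are the same. The weight after the layer is the one
that enters the total weight in forward propagation. -/
lemma Layer.touched_le_weight {n : ℕ} (L : Layer n) {P Q : PauliString n}
    (h : amp L.toOp P Q ≠ 0) : L.touched P ≤ weight Q :=
  (L.touched_eq h).trans_le (L.touched_le_weight_self Q)

/-! ## Sums over tables -/

lemma sumE_map {n : ℕ} (φ : Entry n → ℝ) (f : Entry n → Entry n) (l : List (Entry n)) :
    sumE φ (l.map f) = sumE (fun e => φ (f e)) l := by
  simp [sumE, Function.comp_def]

lemma sumE_roundL {n : ℕ} (g : Bool) (S : Finset (Fin n)) (V : Op n) (ℓ : ℕ) (damp : ℝ)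
    (l : List (Entry n)) (φ : Entry n → ℝ) :
    sumE φ (roundL g S V ℓ damp l) = sumE (fun e => if cntB g e.b (wt S e.P) ≤ ℓ then
      φ ⟨cliffordImage V e.P, cntA g e.b (wt S e.P), cntB g e.b (wt S e.P),
        e.c * damp ^ wt S e.P * amp V e.P (cliffordImage V e.P)⟩ else 0) l := by
  rw [roundL, sumE_map, sumE_flatMap]
  refine sumE_congr fun e _ => ?_
  unfold weighE
  split_ifs
  · rw [sumE_cons, sumE_nil, add_zero]; rfl
  · rfl

lemma IsClifford.sum_amp_mul {n : ℕ} {V : Op n} (hV : IsClifford V) (P : PauliString n)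
    (φ : PauliString n → ℝ) :
    ∑ Q, amp V P Q * φ Q = amp V P (cliffordImage V P) * φ (cliffordImage V P) := by
  refine Finset.sum_eq_single _ (fun Q _ hQ => ?_) (by simp)
  rw [ne_eq, ← cliffordImage_spec hV, not_not] at hQ
  rw [hQ, zero_mul]

lemma sum_push_mul {n : ℕ} (U : Op n) (f g : PauliString n → ℝ) :
    ∑ Q, push U f Q * g Q = ∑ P, f P * ∑ Q, amp U P Q * g Q := by
  simp only [push, Finset.sum_mul, Finset.mul_sum]
  rw [Finset.sum_comm]
  exact Finset.sum_congr rfl fun P _ => Finset.sum_congr rfl fun Q _ => by ring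

lemma mem_roundL {n : ℕ} {g : Bool} {S : Finset (Fin n)} {V : Op n} {ℓ : ℕ} {damp : ℝ}
    {l : List (Entry n)} {e : Entry n} : e ∈ roundL g S V ℓ damp l ↔
      ∃ e' ∈ l, cntB g e'.b (wt S e'.P) ≤ ℓ ∧
        e = ⟨cliffordImage V e'.P, cntA g e'.b (wt S e'.P), cntB g e'.b (wt S e'.P),
          e'.c * damp ^ wt S e'.P * amp V e'.P (cliffordImage V e'.P)⟩ := by
  simp only [roundL, List.mem_map, List.mem_flatMap, weighE]
  constructor
  · rintro ⟨e₁, ⟨e', h', h1⟩, rfl⟩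
    split_ifs at h1 with h2
    · rw [List.mem_singleton] at h1
      subst h1
      exact ⟨e', h', h2, rfl⟩
    · simp at h1
  · rintro ⟨e', h', h2, rfl⟩
    exact ⟨_, ⟨e', h', by rw [if_pos h2]; exact List.mem_singleton_self _⟩, rfl⟩

lemma heisL_false_a {x : Input} {l : List (Entry x.n)} (t : ℕ) :
    ∀ e ∈ heisL x false l t, e.a = e.b ∧ e.a ≤ x.ℓ := by
  have key : ∀ S V l, ∀ e ∈ roundL (n := x.n) false S V x.ℓ x.damp l, e.a = e.b ∧ e.a ≤ x.ℓ := by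
    intro S V l e he
    obtain ⟨e', _, h1, rfl⟩ := mem_roundL.1 he
    exact ⟨rfl, h1⟩
  cases t with
  | zero => exact key _ _ _
  | succ t => exact key _ _ _

/-- The table represents the part of the noisy observable from Pauli paths of low weight. -/
lemma sumE_heisL_false {x : Input} {l : List (Entry x.n)}
    {f : PauliString x.n → ℝ} (hb : ∀ e ∈ l, e.b = 0)
    (hf : ∀ φ : PauliString x.n → ℝ, sumE (fun e => e.c * φ e.P) l = ∑ P, f P * φ P) (t : ℕ)
    (h : ℕ → PauliString x.n → ℝ) :
    sumE (fun e => e.c * h e.b e.P) (heisL x false l t) = ∑ k ∈ Finset.range (x.ℓ + 1),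
      ∑ Q, x.damp ^ k * push (cliffordBlock x.circuit t) (graded x.circuit f t k) Q * h k Q := by
  have hV := cliffordBlock_isClifford x.circuit
  -- one round of the table
  have hround : ∀ (h : ℕ → PauliString x.n → ℝ) t l, sumE (fun e => e.c * h e.b e.P)
      (roundL false Finset.univ (cliffordBlock x.circuit t) x.ℓ x.damp l) =
      sumE (fun e => e.c * if e.b + weight e.P ≤ x.ℓ then x.damp ^ weight e.P *
        ∑ R, amp (cliffordBlock x.circuit t) e.P R * h (e.b + weight e.P) R else 0) l := by
    intro h t l
    rw [sumE_roundL]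
    refine sumE_congr fun e _ => ?_
    simp only [cntB, wt_univ, Bool.false_eq_true, if_false]
    split_ifs
    · rw [(hV t).sum_amp_mul]; ring
    · ring
  -- one round of the graded functions
  have hsum : ∀ (h : ℕ → PauliString x.n → ℝ) t, ∑ k ∈ Finset.range (x.ℓ + 1),
      ∑ Q, x.damp ^ k * push (cliffordBlock x.circuit t) (graded x.circuit f t k) Q * h k Q =
      ∑ Q, ∑ k ∈ Finset.range (x.ℓ + 1), x.damp ^ k * graded x.circuit f t k Q *
        ∑ R, amp (cliffordBlock x.circuit t) Q R * h k R := by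
    intro h t
    rw [Finset.sum_comm (s := Finset.univ)]
    refine Finset.sum_congr rfl fun k _ => ?_
    simp only [mul_assoc]
    rw [← Finset.mul_sum, sum_push_mul, Finset.mul_sum]
  induction t generalizing h with
  | zero =>
    rw [heisL, hround, hsum, sumE_congr (ψ := fun e => e.c * if weight e.P ≤ x.ℓ then
      x.damp ^ weight e.P * ∑ R, amp (cliffordBlock x.circuit 0) e.P R * h (weight e.P) R else 0)
      fun e he => by rw [hb e he, zero_add], hf fun P => if weight P ≤ x.ℓ then
      x.damp ^ weight P * ∑ R, amp (cliffordBlock x.circuit 0) P R * h (weight P) R else 0]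
    refine Finset.sum_congr rfl fun Q _ => ?_
    rw [sum_graded_zero _ _ _ _ (fun k r => x.damp ^ k * r *
      ∑ R, amp (cliffordBlock x.circuit 0) Q R * h k R) (by simp)]
    simp only [Nat.lt_add_one_iff]
    split_ifs
    · ring
    · ring
  | succ t ih =>
    rw [heisL, if_neg (by simp)]
    change sumE _ (roundL false Finset.univ _ _ _ _) = _
    rw [hround, hsum, expandL_sum _ _ fun e he => (heisL_false_a t e he).2]
    have e1 : ∀ e ∈ heisL x false l t, (if e.a + (ncLayer x.circuit t).touched e.P ≤ x.ℓ then
        ∑ Q, (if amp (dirOp false (ncLayer x.circuit t).toOp) e.P Q ≠ 0 then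
          (e.c * amp (dirOp false (ncLayer x.circuit t).toOp) e.P Q) *
          (if e.b + weight Q ≤ x.ℓ then x.damp ^ weight Q *
            ∑ R, amp (cliffordBlock x.circuit (t + 1)) Q R * h (e.b + weight Q) R else 0) else 0)
        else 0) = e.c * ∑ Q, amp (ncLayer x.circuit t).toOp e.P Q *
          (if e.b + weight Q ≤ x.ℓ then x.damp ^ weight Q *
            ∑ R, amp (cliffordBlock x.circuit (t + 1)) Q R * h (e.b + weight Q) R else 0) := by
      intro e he
      rw [Finset.mul_sum]
      change (if _ then ∑ Q, (if amp (ncLayer x.circuit t).toOp e.P Q ≠ 0 then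
        (e.c * amp (ncLayer x.circuit t).toOp e.P Q) * _ else 0) else 0) = _
      split_ifs with h1
      · refine Finset.sum_congr rfl fun Q _ => ?_
        split_ifs with h2
        · ring
        · ring
        · rw [not_not.1 h2]; ring
        · ring
      -- The expansion has dropped this entry because it meets too many gates. Each of its images
      -- has at least that weight, so its total weight exceeds ℓ and it contributes nothing on the
      -- other side either.
      · symm
        refine Finset.sum_eq_zero fun Q _ => ?_
        by_cases h2 : amp (ncLayer x.circuit t).toOp e.P Q = 0
        · rw [h2]; ring
        · have h3 := (ncLayer x.circuit t).touched_le_weight h2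
          have h4 := (heisL_false_a t e he).1
          rw [if_neg (by omega)]
          ring
    rw [sumE_congr e1, ih fun b P => ∑ Q, amp (ncLayer x.circuit t).toOp P Q *
      (if b + weight Q ≤ x.ℓ then x.damp ^ weight Q *
        ∑ R, amp (cliffordBlock x.circuit (t + 1)) Q R * h (b + weight Q) R else 0)]
    have e2 : ∀ Q, ∑ k ∈ Finset.range (x.ℓ + 1), x.damp ^ k * graded x.circuit f (t + 1) k Q *
        ∑ R, amp (cliffordBlock x.circuit (t + 1)) Q R * h k R =
        ∑ j ∈ Finset.range (x.ℓ + 1), x.damp ^ j *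
          (push (ncLayer x.circuit t).toOp
            (push (cliffordBlock x.circuit t) (graded x.circuit f t j)) Q *
          (if j + weight Q ≤ x.ℓ then x.damp ^ weight Q *
            ∑ R, amp (cliffordBlock x.circuit (t + 1)) Q R * h (j + weight Q) R else 0)) := by
      intro Q
      rw [sum_graded_succ _ _ _ _ _ (fun k r => x.damp ^ k * r *
        ∑ R, amp (cliffordBlock x.circuit (t + 1)) Q R * h k R) (by simp)]
      refine Finset.sum_congr rfl fun j _ => ?_
      rw [← push_mul]
      simp only [Nat.lt_add_one_iff]
      split_ifs
      · rw [pow_add, roundOp]; ring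
      · ring
    rw [Finset.sum_congr rfl fun Q _ => e2 Q, Finset.sum_comm (s := Finset.univ)]
    refine Finset.sum_congr rfl fun k _ => ?_
    simp only [mul_assoc]
    rw [← Finset.mul_sum, ← Finset.mul_sum, sum_push_mul (ncLayer x.circuit t).toOp]

/-! ## Merging entries -/

lemma insertE_cases {n : ℕ} (acc : List (Entry n)) (e : Entry n) :
    (∃ i, ∃ h : i < acc.length, acc[i].P = e.P ∧ insertE acc e =
      acc.set i ⟨acc[i].P, 0, min acc[i].b (e.a + e.b), acc[i].c + e.c⟩) ∨
    ((∀ e' ∈ acc, e'.P ≠ e.P) ∧ insertE acc e = acc ++ [⟨e.P, 0, e.a + e.b, e.c⟩]) := by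
  unfold insertE
  split_ifs with h
  · refine Or.inl ⟨_, h, ?_, rfl⟩
    simpa using List.findIdx_getElem (w := h)
  · refine Or.inr ⟨fun e' he' hP => h ?_, rfl⟩
    exact List.findIdx_lt_length_of_exists ⟨e', he', by simpa using hP⟩

lemma insertE_nodup {n : ℕ} {acc : List (Entry n)} (e : Entry n)
    (h : (acc.map Entry.P).Nodup) : ((insertE acc e).map Entry.P).Nodup := by
  rcases insertE_cases acc e with ⟨i, hi, hP, h1⟩ | ⟨hP, h1⟩
  · rw [h1, List.map_set]
    have : (acc.map Entry.P).set i acc[i].P = acc.map Entry.P := by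
      conv_lhs => rw [show acc[i].P = (acc.map Entry.P)[i]'(by simpa using hi) by simp]
      exact List.set_getElem_self _
    rwa [this]
  · rw [h1, List.map_append, List.nodup_append]
    refine ⟨h, by simp, fun a ha b hb hab => ?_⟩
    obtain ⟨e', he', rfl⟩ := List.mem_map.1 ha
    simp only [List.map_cons, List.map_nil, List.mem_singleton] at hb
    exact hP e' he' (hab.trans hb)

lemma dedupe_nodup {n : ℕ} (l : List (Entry n)) : ((dedupe l).map Entry.P).Nodup := by
  suffices ∀ acc : List (Entry n), (acc.map Entry.P).Nodup →
      ((l.foldl insertE acc).map Entry.P).Nodup from this [] List.nodup_nil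
  induction l with
  | nil => exact fun _ h => h
  | cons e l ih => exact fun acc h => ih _ (insertE_nodup e h)

lemma sumE_set {n : ℕ} (φ : Entry n → ℝ) (l : List (Entry n)) (i : ℕ) (h : i < l.length)
    (e : Entry n) : sumE φ (l.set i e) = sumE φ l + (φ e - φ l[i]) := by
  induction l generalizing i with
  | nil => simp at h
  | cons a l ih =>
    cases i with
    | zero => simp; ring
    | succ i =>
      simp only [List.set_cons_succ, sumE_cons, List.getElem_cons_succ]
      rw [ih i (by simpa using h)]
      ring

lemma sumE_insertE {n : ℕ} (acc : List (Entry n)) (e : Entry n) (h : PauliString n → ℝ) :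
    sumE (fun e => e.c * h e.P) (insertE acc e) = sumE (fun e => e.c * h e.P) acc +
      e.c * h e.P := by
  rcases insertE_cases acc e with ⟨i, hi, hP, h1⟩ | ⟨hP, h1⟩
  · rw [h1, sumE_set _ _ _ hi]
    dsimp only
    rw [hP]; ring
  · rw [h1, sumE_append]; simp

lemma sumE_dedupe {n : ℕ} (l : List (Entry n)) (h : PauliString n → ℝ) :
    sumE (fun e => e.c * h e.P) (dedupe l) = sumE (fun e => e.c * h e.P) l := by
  suffices ∀ acc : List (Entry n), sumE (fun e => e.c * h e.P) (l.foldl insertE acc) =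
      sumE (fun e => e.c * h e.P) acc + sumE (fun e => e.c * h e.P) l by
    simpa [dedupe] using this []
  induction l with
  | nil => intro acc; simp
  | cons e l ih => intro acc; rw [List.foldl_cons, ih, sumE_insertE, sumE_cons]; ring

/-- Merging keeps the smaller counter, so it does not change whether P occurs with counter at most
k. A new entry is compared by a + b because this is where the gates met in the current layer are
added to the distance. -/
lemma exists_mem_insertE {n : ℕ} {acc : List (Entry n)} (e : Entry n)
    (h0 : ∀ e' ∈ acc, e'.a = 0) (P : PauliString n) (k : ℕ) :
    (∀ e' ∈ insertE acc e, e'.a = 0) ∧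
    ((∃ e' ∈ insertE acc e, e'.P = P ∧ e'.b ≤ k) ↔
      (∃ e' ∈ acc, e'.P = P ∧ e'.b ≤ k) ∨ (e.P = P ∧ e.a + e.b ≤ k)) := by
  rcases insertE_cases acc e with ⟨i, hi, hP, h1⟩ | ⟨hP, h1⟩
  · rw [h1]
    refine ⟨fun e' he' => ?_, ?_⟩
    · rcases List.mem_or_eq_of_mem_set he' with h | rfl
      exacts [h0 e' h, rfl]
    constructor
    · rintro ⟨e', he', h2, h3⟩
      rcases List.mem_or_eq_of_mem_set he' with h | rfl
      · exact Or.inl ⟨e', h, h2, h3⟩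
      · rcases min_le_iff.1 h3 with h4 | h4
        · exact Or.inl ⟨acc[i], List.getElem_mem hi, h2, h4⟩
        · exact Or.inr ⟨hP ▸ h2, h4⟩
    · rintro (⟨e', he', h2, h3⟩ | ⟨h2, h3⟩)
      · obtain ⟨j, hj, rfl⟩ := List.getElem_of_mem he'
        by_cases hij : i = j
        · subst hij
          exact ⟨_, List.mem_set hi _, h2, (min_le_left _ _).trans h3⟩
        · refine ⟨acc[j], ?_, h2, h3⟩
          have : (acc.set i ⟨acc[i].P, 0, min acc[i].b (e.a + e.b), acc[i].c + e.c⟩)[j]'(by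
            simpa using hj) = acc[j] := List.getElem_set_ne hij _
          rw [← this]
          exact List.getElem_mem _
      · exact ⟨_, List.mem_set hi _, hP.trans h2, (min_le_right _ _).trans h3⟩
  · rw [h1]
    simp only [List.mem_append, List.mem_singleton, or_imp, forall_and, forall_eq]
    refine ⟨⟨h0, trivial⟩, ?_⟩
    constructor
    · rintro ⟨e', h | rfl, h2, h3⟩
      exacts [Or.inl ⟨e', h, h2, h3⟩, Or.inr ⟨h2, h3⟩]
    · rintro (⟨e', he', h2, h3⟩ | ⟨h2, h3⟩)
      exacts [⟨e', Or.inl he', h2, h3⟩, ⟨_, Or.inr rfl, h2, h3⟩]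

lemma exists_mem_dedupe {n : ℕ} (l : List (Entry n)) :
    (∀ e ∈ dedupe l, e.a = 0) ∧ ∀ (P : PauliString n) (k : ℕ),
    ((∃ e ∈ dedupe l, e.P = P ∧ e.b ≤ k) ↔ ∃ e ∈ l, e.P = P ∧ e.a + e.b ≤ k) := by
  suffices ∀ acc : List (Entry n), (∀ e ∈ acc, e.a = 0) →
      (∀ e ∈ l.foldl insertE acc, e.a = 0) ∧ ∀ (P : PauliString n) (k : ℕ),
      ((∃ e ∈ l.foldl insertE acc, e.P = P ∧ e.b ≤ k) ↔
        (∃ e ∈ acc, e.P = P ∧ e.b ≤ k) ∨ ∃ e ∈ l, e.P = P ∧ e.a + e.b ≤ k) by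
    simpa [dedupe] using this [] (by simp)
  induction l with
  | nil => intro acc h; exact ⟨h, by simp⟩
  | cons e l ih =>
    intro acc h
    obtain ⟨h1, h2⟩ := ih (insertE acc e) (exists_mem_insertE e h 0 0).1
    refine ⟨h1, fun P k => ?_⟩
    rw [List.foldl_cons, h2, (exists_mem_insertE e h P k).2, List.exists_mem_cons_iff, or_assoc]

lemma exists_mem_dedupe_iff {n : ℕ} (l : List (Entry n)) (P : PauliString n) :
    (∃ e ∈ dedupe l, e.P = P) ↔ ∃ e ∈ l, e.P = P := by
  constructor
  · rintro ⟨e, he, h⟩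
    obtain ⟨e', he', h', _⟩ := ((exists_mem_dedupe l).2 P e.b).1 ⟨e, he, h, le_rfl⟩
    exact ⟨e', he', h'⟩
  · rintro ⟨e, he, h⟩
    obtain ⟨e', he', h', _⟩ := ((exists_mem_dedupe l).2 P (e.a + e.b)).2 ⟨e, he, h, le_rfl⟩
    exact ⟨e', he', h'⟩

/-- A sum over a table without repeated Pauli operators. -/
lemma sumE_of_nodup {n : ℕ} {l : List (Entry n)} (h : (l.map Entry.P).Nodup)
    (φ : PauliString n → ℝ) :
    sumE (fun e => φ e.P) l = ∑ P, if ∃ e ∈ l, e.P = P then φ P else 0 := by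
  have h1 : sumE (fun e => φ e.P) l = ((l.map Entry.P).map φ).sum := by
    simp [sumE, Function.comp_def]
  rw [h1, ← List.sum_toFinset _ h, ← Finset.sum_filter]
  refine Finset.sum_congr ?_ fun _ _ => rfl
  ext P
  simp

/-! ## Enumeration by weight -/

lemma exists_low {n : ℕ} (P : PauliString n) : ∃ j, ∀ h : j < n, P ⟨j, h⟩ ≠ 0 :=
  ⟨n, fun h => absurd h (lt_irrefl n)⟩

/-- The first qubit on which `P` acts (`n` if there is none). -/
def lowest {n : ℕ} (P : PauliString n) : ℕ := Nat.find (exists_low P)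

lemma lowest_le {n : ℕ} (P : PauliString n) : lowest P ≤ n :=
  Nat.find_min' _ fun h => absurd h (lt_irrefl n)

lemma lowest_eq {n : ℕ} {P : PauliString n} {b : ℕ} (h : ∀ h : b < n, P ⟨b, h⟩ ≠ 0)
    (h0 : ∀ k : Fin n, k.val < b → P k = 0) (hb : b ≤ n) : lowest P = b := by
  refine (Nat.find_eq_iff _).2 ⟨h, fun j hj hc => ?_⟩
  exact hc (hj.trans_le hb) (h0 ⟨j, hj.trans_le hb⟩ hj)

lemma apply_of_lt_lowest {n : ℕ} {P : PauliString n} {k : Fin n} (h : k.val < lowest P) :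
    P k = 0 := by
  have := Nat.find_min (exists_low P) h
  push Not at this
  exact this.2

lemma apply_lowest {n : ℕ} {P : PauliString n} (h : lowest P < n) : P ⟨lowest P, h⟩ ≠ 0 :=
  Nat.find_spec (exists_low P) h

lemma weight_eq_sum {n : ℕ} (P : PauliString n) : weight P = ∑ j, if P j ≠ 0 then 1 else 0 := by
  rw [weight, Finset.card_filter]

lemma weight_zero {n : ℕ} : weight (0 : PauliString n) = 0 := by simp [weight]

lemma weight_le {n : ℕ} (P : PauliString n) : weight P ≤ n :=
  (Finset.card_le_univ _).trans (by simp)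

lemma setLetter_eq_update {n : ℕ} (P : PauliString n) {j : ℕ} (hj : j < n) (x : ℕ) :
    setLetter P j x = Function.update P ⟨j, hj⟩ (Fin.ofNat 4 x) := by
  funext k
  simp only [setLetter, Function.update_apply, Fin.ext_iff]

lemma weight_update {n : ℕ} {P : PauliString n} {k : Fin n} (hk : P k = 0) {x : Fin 4}
    (hx : x ≠ 0) : weight (Function.update P k x) = weight P + 1 := by
  rw [weight_eq_sum, weight_eq_sum, ← Finset.add_sum_erase _ _ (Finset.mem_univ k),
    ← Finset.add_sum_erase (f := fun j => if P j ≠ 0 then 1 else 0) (h := Finset.mem_univ k)]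
  rw [Function.update_self, if_pos hx, if_neg (not_not.2 hk), zero_add, add_comm]
  congr 1
  refine Finset.sum_congr rfl fun j hj => ?_
  rw [Function.update_of_ne (Finset.ne_of_mem_erase hj)]

lemma lowest_lt_of_weight {n : ℕ} {P : PauliString n} (h : weight P ≠ 0) : lowest P < n := by
  refine (lowest_le P).lt_of_ne fun he => h ?_
  rw [weight, Finset.card_eq_zero, Finset.filter_eq_empty_iff]
  intro j _
  rw [not_not]
  exact apply_of_lt_lowest (he.symm ▸ j.2)

/-- Together with `setLetter_at_lowest` this is a bijection: each Pauli operator of weight i + 1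
arises exactly once, from the operator of weight i that lacks its first non-identity letter. New
letters are placed only before the support, so the enumeration has no repetitions. -/
lemma setLetter_below_lowest {n : ℕ} {P : PauliString n} {q y : ℕ} (hq : q < lowest P)
    (hy : y < 3) : lowest (setLetter P q (y + 1)) = q ∧
      weight (setLetter P q (y + 1)) = weight P + 1 ∧ setLetter (setLetter P q (y + 1)) q 0 = P ∧
      letter (setLetter P q (y + 1)) q - 1 = y := by
  have hqn := hq.trans_le (lowest_le P)
  have h0 : P ⟨q, hqn⟩ = 0 := apply_of_lt_lowest hq
  have hy0 : (Fin.ofNat 4 (y + 1)) ≠ 0 := by interval_cases y <;> decide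
  refine ⟨?_, ?_, ?_, ?_⟩
  · rw [setLetter_eq_update P hqn]
    refine lowest_eq (fun h => by rwa [Function.update_self]) (fun k hk => ?_) hqn.le
    rw [Function.update_of_ne (by rintro rfl; exact lt_irrefl _ hk)]
    exact apply_of_lt_lowest (hk.trans hq)
  · rw [setLetter_eq_update P hqn, weight_update h0 hy0]
  · rw [setLetter_eq_update P hqn, setLetter_eq_update _ hqn, Function.update_idem]
    have : (Fin.ofNat 4 0 : Fin 4) = P ⟨q, hqn⟩ := h0.symm
    rw [this, Function.update_eq_self]
  · rw [letter, dif_pos hqn, setLetter, if_pos rfl]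
    interval_cases y <;> rfl

lemma setLetter_at_lowest {n : ℕ} {Q : PauliString n} (h : weight Q ≠ 0) :
    weight Q = weight (setLetter Q (lowest Q) 0) + 1 ∧
      lowest Q < lowest (setLetter Q (lowest Q) 0) ∧ letter Q (lowest Q) - 1 < 3 ∧
      setLetter (setLetter Q (lowest Q) 0) (lowest Q) (letter Q (lowest Q) - 1 + 1) = Q := by
  have hl : lowest Q < n := lowest_lt_of_weight h
  have h1 := apply_lowest hl
  have h2 : letter Q (lowest Q) = (Q ⟨lowest Q, hl⟩).val := dif_pos hl
  have h3 : (Q ⟨lowest Q, hl⟩).val ≠ 0 := fun h => h1 (Fin.ext h)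
  have h4 : Fin.ofNat 4 (Q ⟨lowest Q, hl⟩).val = Q ⟨lowest Q, hl⟩ :=
    Fin.ext (Nat.mod_eq_of_lt (Q ⟨lowest Q, hl⟩).2)
  have hs : setLetter Q (lowest Q) 0 = Function.update Q ⟨lowest Q, hl⟩ 0 :=
    setLetter_eq_update Q hl 0
  set P := Function.update Q ⟨lowest Q, hl⟩ 0 with hP
  have hQP : Function.update P ⟨lowest Q, hl⟩ (Q ⟨lowest Q, hl⟩) = Q := by
    rw [hP, Function.update_idem, Function.update_eq_self]
  rw [hs]
  refine ⟨?_, ?_, ?_, ?_⟩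
  · conv_lhs => rw [← hQP]
    exact weight_update (by rw [hP, Function.update_self]) h1
  · by_contra hc
    push Not at hc
    have hlt : lowest P < n := by omega
    refine apply_lowest hlt ?_
    by_cases he : lowest P = lowest Q
    · have : (⟨lowest P, hlt⟩ : Fin n) = ⟨lowest Q, hl⟩ := Fin.ext he
      exact (congrArg P this).trans (Function.update_self ..)
    · refine (Function.update_of_ne (fun h => he (Fin.ext_iff.1 h)) _ _).trans ?_
      exact apply_of_lt_lowest (show lowest P < lowest Q by omega)
  · have := (Q ⟨lowest Q, hl⟩).2
    omega
  · rw [setLetter_eq_update _ hl, h2, Nat.sub_add_cancel (by omega), h4, hQP]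

lemma sumE_level {n : ℕ} (i : ℕ) (φ : Entry n → ℝ) :
    sumE φ (level n i) = ∑ P ∈ Finset.univ.filter fun P : PauliString n => weight P = i,
      φ ⟨P, 0, lowest P, 0⟩ := by
  induction i generalizing φ with
  | zero =>
    have h0 : Finset.univ.filter (fun P : PauliString n => weight P = 0) = {0} := by
      ext P
      simp only [Finset.mem_filter, Finset.mem_univ, true_and, Finset.mem_singleton]
      constructor
      · intro h
        by_contra hc
        have := weight_pos hc
        omega
      · rintro rfl; exact weight_zero
    rw [h0, Finset.sum_singleton, level, sumE_cons, sumE_nil, add_zero,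
      lowest_eq (P := 0) (b := n) (fun h => absurd h (lt_irrefl n)) (fun _ _ => rfl) le_rfl]
  | succ i ih =>
    rw [level, sumE_flatMap, ih]
    simp only [extendE, sumE_flatMap_range, sumE_cons, sumE_nil, add_zero]
    simp only [← Finset.sum_product']
    rw [Finset.sum_sigma']
    refine Finset.sum_bij' (fun q _ => setLetter q.1 q.2.1 (q.2.2 + 1))
      (fun Q _ => ⟨setLetter Q (lowest Q) 0, lowest Q, letter Q (lowest Q) - 1⟩) ?_ ?_ ?_ ?_ ?_
    all_goals simp only [Finset.mem_sigma, Finset.mem_filter, Finset.mem_univ, true_and,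
      Finset.mem_product, Finset.mem_range]
    · rintro ⟨P, q, y⟩ ⟨hP, hq, hy⟩
      rw [(setLetter_below_lowest hq hy).2.1, hP]
    · intro Q hQ
      obtain ⟨h1, h2, h3, _⟩ := setLetter_at_lowest (Q := Q) (by omega)
      exact ⟨by omega, h2, h3⟩
    · rintro ⟨P, q, y⟩ ⟨hP, hq, hy⟩
      obtain ⟨h1, _, h3, h4⟩ := setLetter_below_lowest hq hy
      dsimp only
      rw [h1, h3, h4]
    · intro Q hQ
      exact (setLetter_at_lowest (Q := Q) (by omega)).2.2.2
    · rintro ⟨P, q, y⟩ ⟨hP, hq, hy⟩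
      rw [(setLetter_below_lowest hq hy).1]

lemma sumE_levels {n : ℕ} (r : ℕ) (φ : Entry n → ℝ) :
    sumE φ (levels n r) = ∑ P ∈ Finset.univ.filter fun P : PauliString n => weight P ≤ r,
      φ ⟨P, 0, lowest P, 0⟩ := by
  rw [levels, sumE_flatMap_range]
  simp only [sumE_level, Finset.sum_filter]
  rw [Finset.sum_comm]
  refine Finset.sum_congr rfl fun P _ => ?_
  rw [Finset.sum_ite_eq]
  simp only [Finset.mem_range, Nat.lt_add_one_iff]

lemma exists_mem_levels {n r : ℕ} {P : PauliString n} (h : weight P ≤ r) :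
    ∃ e ∈ levels n r, e.P = P := by
  rw [mem_iff_sumE, sumE_levels]
  dsimp only
  rw [Finset.sum_pos_iff_of_nonneg fun _ _ => by split_ifs <;> norm_num]
  exact ⟨P, by simpa using h, by simp⟩

/-! ## Completeness of the backward propagation -/

lemma mem_weighE {n : ℕ} {S : Finset (Fin n)} {fa fb : ℕ → ℕ → ℕ} {ℓ : ℕ} {damp : ℝ}
    {e e' : Entry n} : e' ∈ weighE S fa fb ℓ damp e ↔ fb e.b (wt S e.P) ≤ ℓ ∧
      e' = ⟨e.P, fa e.b (wt S e.P), fb e.b (wt S e.P), e.c * damp ^ wt S e.P⟩ := by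
  unfold weighE
  split_ifs with h <;> simp [h]

lemma bwdL_a_le {x : Input} {s : ℕ} (i : ℕ) : ∀ e ∈ bwdL x s (seeds x) i, e.a ≤ x.ℓ := by
  cases i with
  | zero =>
    intro e he
    obtain ⟨e', _, h⟩ := List.mem_flatMap.1 he
    rw [(mem_weighE.1 h).2]
    exact Nat.zero_le _
  | succ i =>
    intro e he
    obtain ⟨e', _, h⟩ := List.mem_flatMap.1 he
    obtain ⟨h1, rfl⟩ := mem_weighE.1 h
    exact (Nat.le_add_right _ _).trans h1

/-- The path is followed backward from r s, and nothing on it is pruned: the gates met in the next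
layer number at most the weight of the current operator, so the first counter stays at most b, a
partial sum of the total weight. -/
lemma exists_mem_bwdL {x : Input} {s : ℕ} {r : ℕ → PauliString x.n}
    (hr : ∀ i < s, amp (roundOp x.circuit i) (r i) (r (i + 1)) ≠ 0)
    (hs : weight (r s) ≤ x.ℓ / (ncDepth x.circuit + 1))
    (hk : ∑ i ∈ Finset.range (s + 1), weight (r i) ≤ x.ℓ) (i : ℕ) (hi : i ≤ s) :
    ∃ e ∈ bwdL x s (seeds x) i, e.P = r (s - i) ∧ e.a + weight e.P = e.b ∧
      e.b = ∑ j ∈ Finset.Ico (s - i) (s + 1), weight (r j) := by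
  have hle : ∀ i, ∑ j ∈ Finset.Ico (s - i) (s + 1), weight (r j) ≤ x.ℓ := fun i =>
    le_trans (Finset.sum_le_sum_of_subset fun j hj =>
      Finset.mem_range.2 (Finset.mem_Ico.1 hj).2) hk
  induction i with
  | zero =>
    obtain ⟨e, he, hP⟩ := exists_mem_levels
      (r := min x.n (x.ℓ / (ncDepth x.circuit + 1))) (le_min (weight_le (r s)) hs)
    have h0 := hle 0
    simp only [tsub_zero, Nat.Ico_succ_singleton, Finset.sum_singleton] at h0
    refine ⟨⟨e.P, 0, weight e.P, e.c * x.damp ^ weight e.P⟩, ?_, hP, by simp, by simp [hP]⟩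
    refine List.mem_flatMap.2 ⟨e, he, mem_weighE.2 ⟨?_, rfl⟩⟩
    rwa [wt_univ, hP]
  | succ i ih =>
    obtain ⟨e, he, hP, ha, hb⟩ := ih (by omega)
    set t := s - (i + 1) with ht
    have ht1 : s - i = t + 1 := by omega
    rw [ht1] at hP hb
    have hsum : ∑ j ∈ Finset.Ico t (s + 1), weight (r j) = weight (r t) + e.b := by
      rw [hb, Finset.sum_eq_sum_Ico_succ_bot (by omega)]
    have hV := cliffordBlock_isClifford x.circuit t
    set V := cliffordBlock x.circuit t with hVdef
    set Q := cliffordImage V (r t) with hQ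
    -- The Clifford block has a single image of r t, so the non-zero amplitude of the round factors
    -- through it.
    have h1 : amp (ncLayer x.circuit t).toOp Q (r (t + 1)) ≠ 0 := by
      have := hr t (by omega)
      rw [roundOp, amp_mul, hV.sum_amp_mul] at this
      exact right_ne_zero_of_mul this
    have h2 : cliffordImage (dirOp true V) Q = r t := by
      refine ((cliffordImage_spec (hV.dirOp (cliffordBlock_mul_conjTranspose _ _) true) _ _).1
        ?_).symm
      rw [amp_dirOp, if_pos rfl, cliffordImage_spec hV]
    obtain ⟨e₁, he₁, hP₁, -, hb₁⟩ := (expandL_mem true (ncLayer x.circuit t) (bwdL_a_le i)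
      (fun e' => e'.P = Q ∧ True ∧ e'.b = e.b)).2 ⟨e, he, by
        have h3 := (ncLayer x.circuit t).touched_le_weight_self e.P
        have h4 := hle i
        rw [ht1, ← hb] at h4
        omega, Q, by rwa [amp_dirOp, if_pos rfl, hP], rfl, trivial, rfl⟩
    refine ⟨⟨r t, e.b, e.b + weight (r t), e₁.c * amp (dirOp true V) e₁.P
      (cliffordImage (dirOp true V) e₁.P) * x.damp ^ weight (r t)⟩, ?_, rfl, rfl, ?_⟩
    · have hl := hle (i + 1)
      rw [← ht, hsum] at hl
      have h5 : (cliffE (dirOp true V) e₁).P = r t := by rw [cliffE, hP₁, h2]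
      have h6 : (cliffE (dirOp true V) e₁).b = e.b := hb₁
      refine List.mem_flatMap.2 ⟨cliffE (dirOp true V) e₁, List.mem_map_of_mem he₁,
        mem_weighE.2 ?_⟩
      rw [wt_univ, h5, h6]
      exact ⟨by omega, rfl⟩
    · rw [hsum, add_comm]

/-- Pauli operators that start a Pauli path of low total weight are sources. -/
lemma exists_mem_sources {x : Input} {f : PauliString x.n → ℝ} {k : ℕ} {Q : PauliString x.n}
    (hk : k ≤ x.ℓ) (h : graded x.circuit f (ncDepth x.circuit) k Q ≠ 0) :
    ∃ e ∈ sources x, f e.P ≠ 0 := by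
  obtain ⟨r, h0, -, hr, hsum⟩ := exists_path_of_graded_ne_zero h
  set d := ncDepth x.circuit with hd
  -- Pigeonhole: d + 1 weights with sum at most ℓ cannot all exceed ℓ / (d + 1).
  obtain ⟨s, hs, hw⟩ : ∃ s ≤ d, weight (r s) ≤ x.ℓ / (d + 1) := by
    by_contra hc
    push Not at hc
    have h1 : ∑ i ∈ Finset.range (d + 1), (x.ℓ / (d + 1) + 1) ≤
        ∑ i ∈ Finset.range (d + 1), weight (r i) :=
      Finset.sum_le_sum fun i hi => hc i (by have := Finset.mem_range.1 hi; omega)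
    rw [Finset.sum_const, Finset.card_range, smul_eq_mul] at h1
    have h2 := Nat.lt_mul_div_succ x.ℓ (show 0 < d + 1 by omega)
    omega
  obtain ⟨e, he, hP, -⟩ := exists_mem_bwdL (fun i hi => hr i (by omega)) hw
    (le_trans (Finset.sum_le_sum_of_subset (Finset.range_mono (by omega))) (hsum ▸ hk)) s le_rfl
  refine ⟨e, List.mem_flatMap.2 ⟨s, List.mem_range.2 (by omega), he⟩, ?_⟩
  rwa [hP, Nat.sub_self]

/-- The coefficients on the sources. -/
def sourcePart (x : Input) (P : PauliString x.n) : ℝ :=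
  if ∃ e ∈ sources x, e.P = P then x.obs P else 0

/-- Grading is linear in the observable. The difference of the two observables vanishes on all
sources, whereas a non-zero part of grade at most ℓ would need a source where it does not vanish. -/
lemma graded_sourcePart {x : Input} {k : ℕ} (hk : k ≤ x.ℓ) :
    graded x.circuit (sourcePart x) (ncDepth x.circuit) k =
      graded x.circuit x.obs (ncDepth x.circuit) k := by
  funext Q
  refine (sub_eq_zero.1 ?_).symm
  have h1 := congrFun (graded_sub x.circuit x.obs (sourcePart x) (ncDepth x.circuit) k) Q
  rw [← h1]
  by_contra hc
  obtain ⟨e, he, h⟩ := exists_mem_sources hk hc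
  exact h (by rw [sourcePart, if_pos ⟨e, he, rfl⟩, sub_self])

lemma sumE_startL (x : Input) (φ : PauliString x.n → ℝ) :
    sumE (fun e => e.c * φ e.P) (startL x) = ∑ P, sourcePart x P * φ P := by
  rw [startL, sumE_flatMap]
  have : ∀ e : Entry x.n, sumE (fun e => e.c * φ e.P) (obsE x.obs e) = x.obs e.P * φ e.P := by
    intro e
    unfold obsE
    split_ifs with h
    · simp
    · rw [not_not.1 h]; simp
  rw [sumE_congr fun e _ => this e, sumE_of_nodup (dedupe_nodup _) fun P => x.obs P * φ P]
  refine Finset.sum_congr rfl fun P _ => ?_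
  simp only [exists_mem_dedupe_iff, sourcePart]
  split_ifs <;> simp

lemma counters_of_mem_obsE {n : ℕ} {o : PauliString n → ℝ} {l : List (Entry n)} :
    ∀ e ∈ l.flatMap (obsE o), e.a = 0 ∧ e.b = 0 := by
  intro e he
  obtain ⟨e', _, h⟩ := List.mem_flatMap.1 he
  unfold obsE at h
  split_ifs at h
  · rw [List.mem_singleton] at h; rw [h]; exact ⟨rfl, rfl⟩
  · simp at h

/-! ## The error under uniform noise -/

lemma heis_uniform {n : ℕ} (γ : ℝ) (C : Circuit n) (f : PauliString n → ℝ) :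
    heis γ uniformNoise C f = push (cliffordBlock C (ncDepth C))
      (heisAt γ (fun _ => Finset.univ) C f (ncDepth C)) :=
  heis_eq (fun _ => uniformNoise_clifford) (fun _ ht => if_pos (ncLayer_nonClifford ht)) f

lemma sum_coeff_sq {n : ℕ} {O : Op n} (hO : O.IsHermitian) (h1 : frobNorm O = 1) :
    ∑ P, coeff O P ^ 2 = 1 := by rw [← frobNorm_sq hO, h1, one_pow]

open scoped ComplexOrder in
lemma IsLowAverage.isHermitian {n N : ℕ} {c : ℝ} {ρ : Fin N → Op n} (h : IsLowAverage c ρ)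
    (i : Fin N) : (ρ i).IsHermitian := (h.2.1 i).1.isHermitian

open scoped Matrix.Norms.L2Operator in
lemma IsLowAverage.nonneg {n N : ℕ} {c : ℝ} {ρ : Fin N → Op n} (h : IsLowAverage c ρ) :
    0 ≤ c := by
  have h1 := (norm_nonneg _).trans h.2.2
  by_contra hc
  exact absurd h1 (not_le.2 (div_neg_of_neg_of_pos (not_le.1 hc) (by positivity)))

/-- The error of the coefficient of the identity as an estimate. -/
lemma rmsError_obs_zero_le {n N : ℕ} {γ c : ℝ} (hγ : 0 ≤ γ) {C : Circuit n} {O : Op n}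
    (hO : O.IsHermitian) (h1 : frobNorm O = 1) {ρ : Fin N → Op n} (hρ : IsLowAverage c ρ) :
    rmsError (fun _ => coeff O 0) (fun i => expectation γ uniformNoise C O (ρ i)) ≤
      Real.sqrt (c * Real.exp (-γ) ^ (2 * (ncDepth C + 1))) := by
  set h := heis γ uniformNoise C (coeff O) with hh
  have hV := cliffordBlock_mul_conjTranspose C (ncDepth C)
  have h0 : h 0 = coeff O 0 := by
    rw [hh, heis_uniform, push_apply_zero hV, heisAt_apply_zero]
  have hc := hρ.nonneg
  refine (rmsError_le hρ (fun P => (if P = 0 then h 0 else 0) - h P) fun i => ?_).trans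
    (Real.sqrt_le_sqrt (mul_le_mul_of_nonneg_left ?_ hc))
  · rw [expectation_eq γ uniformNoise C hO (hρ.isHermitian i), ← hh]
    simp only [mul_sub, Finset.sum_sub_distrib, mul_ite, mul_zero, Finset.sum_ite_eq',
      Finset.mem_univ, if_true]
    rw [pauliOp_zero, Matrix.mul_one, (hρ.2.1 i).2, h0, Complex.one_re, one_mul]
  · have : ∑ P, ((if P = 0 then h 0 else 0) - h P) ^ 2 = tracelessSq h := by
      rw [tracelessSq_eq, ← Finset.add_sum_erase _ _ (Finset.mem_univ 0), if_pos rfl, sub_self,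
        zero_pow two_ne_zero, zero_add]
      exact Finset.sum_congr rfl fun P hP => by
        rw [if_neg (Finset.ne_of_mem_erase hP), zero_sub, neg_sq]
    rw [this, hh, heis_uniform, tracelessSq_push hV]
    refine (tracelessSq_heisAt hγ C _ _).trans ?_
    rw [sum_coeff_sq hO h1, mul_one]

/-- The estimate from the Pauli paths of total weight at most `ℓ`. -/
def pathEstimate {n : ℕ} (γ : ℝ) (ℓ : ℕ) (C : Circuit n) (O ρ : Op n) : ℝ :=
  ∑ P, (ρ * pauliOp P).trace.re *
    push (cliffordBlock C (ncDepth C)) (truncAt γ ℓ C (coeff O) (ncDepth C)) P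

lemma rmsError_pathEstimate_le {n N : ℕ} {γ c : ℝ} (hγ : 0 < γ) (ℓ : ℕ) {C : Circuit n} {O : Op n}
    (hO : O.IsHermitian) (h1 : frobNorm O = 1) {ρ : Fin N → Op n} (hρ : IsLowAverage c ρ) :
    rmsError (fun i => pathEstimate γ ℓ C O (ρ i))
      (fun i => expectation γ uniformNoise C O (ρ i)) ≤
      Real.sqrt (c * ((Real.exp (-γ) ^ 2) ^ (ℓ + 1) / (1 - Real.exp (-γ) ^ 2))) := by
  have hV := cliffordBlock_mul_conjTranspose C (ncDepth C)
  have hc := hρ.nonneg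
  refine (rmsError_le hρ (push (cliffordBlock C (ncDepth C)) fun P =>
    truncAt γ ℓ C (coeff O) (ncDepth C) P -
      heisAt γ (fun _ => Finset.univ) C (coeff O) (ncDepth C) P) fun i => ?_).trans
    (Real.sqrt_le_sqrt (mul_le_mul_of_nonneg_left ?_ hc))
  · rw [expectation_eq γ uniformNoise C hO (hρ.isHermitian i), heis_uniform, pathEstimate,
      push_sub, ← Finset.sum_sub_distrib]
    exact Finset.sum_congr rfl fun P _ => by ring
  · rw [sum_push_sq hV]
    refine (heisAt_sub_truncAt_sq_le hγ ℓ C _ _).trans ?_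
    rw [sum_coeff_sq hO h1, mul_one]

/-- The table computes the estimate from the Pauli paths of low weight. -/
lemma sumE_heisL_eq_pathEstimate {x : Input} {γ : ℝ} {O ρ : Op x.n}
    (hd : x.damp = Real.exp (-γ)) (ho : x.obs = coeff O)
    (hs : x.state = fun P => (ρ * pauliOp P).trace.re) {l : List (Entry x.n)}
    {f : PauliString x.n → ℝ} (hb : ∀ e ∈ l, e.b = 0)
    (hf : ∀ φ : PauliString x.n → ℝ, sumE (fun e => e.c * φ e.P) l = ∑ P, f P * φ P)
    (hg : ∀ k ≤ x.ℓ, graded x.circuit f (ncDepth x.circuit) k =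
      graded x.circuit x.obs (ncDepth x.circuit) k) :
    sumE (fun e => e.c * x.state e.P) (heisL x false l (ncDepth x.circuit)) =
      pathEstimate γ x.ℓ x.circuit O ρ := by
  rw [sumE_heisL_false hb hf _ fun _ => x.state, pathEstimate, Finset.sum_comm]
  refine Finset.sum_congr rfl fun P _ => ?_
  unfold truncAt
  rw [push_sum, Finset.mul_sum]
  refine Finset.sum_congr rfl fun k hk => ?_
  rw [hg k (Nat.lt_succ_iff.1 (Finset.mem_range.1 hk)), hd, ho, hs]
  ring

lemma sumOfTerms_eq {n : ℕ} (l : List (PauliString n × ℝ)) :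
    sumOfTerms l = ofCoeff fun P => (l.map fun a => if a.1 = P then a.2 else 0).sum := by
  induction l with
  | nil => simp [sumOfTerms, ofCoeff]
  | cons a l ih =>
    have : sumOfTerms (a :: l) = (a.2 : ℂ) • pauliOp a.1 + sumOfTerms l := by simp [sumOfTerms]
    rw [this, ih]
    unfold ofCoeff
    have h1 : (a.2 : ℂ) • pauliOp a.1 =
        ∑ P, ((if a.1 = P then a.2 else 0 : ℝ) : ℂ) • pauliOp P := by
      rw [Finset.sum_eq_single a.1 (fun P _ hP => by rw [if_neg hP.symm]; simp) (by simp),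
        if_pos rfl]
    rw [h1, ← Finset.sum_add_distrib]
    refine Finset.sum_congr rfl fun P _ => ?_
    dsimp only
    rw [List.map_cons, List.sum_cons, Complex.ofReal_add, add_smul]

lemma sumOfTerms_isHermitian {n : ℕ} (l : List (PauliString n × ℝ)) :
    (sumOfTerms l).IsHermitian := by
  rw [sumOfTerms_eq]; exact ofCoeff_isHermitian _

lemma sumE_terms {n : ℕ} (l : List (PauliString n × ℝ)) (φ : PauliString n → ℝ) :
    sumE (fun e => e.c * φ e.P) (l.map fun a => (⟨a.1, 0, 0, a.2⟩ : Entry n)) =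
      ∑ P, coeff (sumOfTerms l) P * φ P := by
  rw [sumOfTerms_eq, coeff_ofCoeff]
  induction l with
  | nil => simp
  | cons a l ih =>
    simp only [List.map_cons, sumE_cons, ih, List.sum_cons, add_mul, Finset.sum_add_distrib]
    simp

/-- The threshold on the total weight of Pauli paths. -/
def pathThreshold (γ ε : ℝ) : ℕ :=
  if Real.exp (-γ) ≤ ε then 0 else ⌈1 / γ * Real.log (2 / (ε * γ))⌉₊

/-- The factor γ / 2 pays for the geometric series in `rms_bound`, where the square root of 1 -
e^{-2γ} is at least γ / 2. If e^{-γ} ≤ ε, the identity coefficient alone is accurate enough, and the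
threshold 0 forces this estimate. -/
lemma exp_neg_mul_pathThreshold_le {γ ε : ℝ} (hγ : 0 < γ) (hε : 0 < ε)
    (h : ¬ Real.exp (-γ) ≤ ε) : Real.exp (-γ) ^ pathThreshold γ ε ≤ ε * γ / 2 := by
  rw [pathThreshold, if_neg h, ← Real.exp_nat_mul]
  have h1 := Nat.le_ceil (1 / γ * Real.log (2 / (ε * γ)))
  set m : ℝ := ((⌈1 / γ * Real.log (2 / (ε * γ))⌉₊ : ℕ) : ℝ)
  have h2 : Real.log (2 / (ε * γ)) ≤ m * γ := by
    rw [one_div, inv_mul_le_iff₀ hγ] at h1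
    linarith
  have h3 : Real.log (2 / (ε * γ)) = -Real.log (ε * γ / 2) := by
    rw [← Real.log_inv, inv_div]
  rw [← Real.exp_log (show 0 < ε * γ / 2 by positivity)]
  exact Real.exp_le_exp.2 (by linarith)

lemma rms_bound_trivial {γ ε c : ℝ} (hγ : 0 < γ) (hγ1 : γ < 1) (hε : 0 < ε) {d : ℕ}
    (hd : pathThreshold γ ε < d + 1) :
    Real.sqrt (c * Real.exp (-γ) ^ (2 * (d + 1))) ≤ ε * Real.sqrt c := by
  have h1 : Real.exp (-γ) ^ (d + 1) ≤ ε := by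
    have he1 : Real.exp (-γ) ≤ 1 := by simpa using hγ.le
    by_cases h : Real.exp (-γ) ≤ ε
    · refine le_trans ?_ h
      simpa using pow_le_pow_of_le_one (Real.exp_nonneg _) he1 (show 1 ≤ d + 1 by omega)
    · refine (pow_le_pow_of_le_one (Real.exp_nonneg _) he1 hd.le).trans
        ((exp_neg_mul_pathThreshold_le hγ hε h).trans ?_)
      nlinarith
  rw [mul_comm 2, pow_mul, mul_comm c, Real.sqrt_mul (by positivity), Real.sqrt_sq (by positivity)]
  exact mul_le_mul_of_nonneg_right h1 (Real.sqrt_nonneg _)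

lemma rms_bound {γ ε c : ℝ} (hγ : 0 < γ) (hγ1 : γ < 1) (hε : 0 < ε) {d : ℕ}
    (hd : d + 1 ≤ pathThreshold γ ε) :
    Real.sqrt (c * ((Real.exp (-γ) ^ 2) ^ (pathThreshold γ ε + 1) /
      (1 - Real.exp (-γ) ^ 2))) ≤ ε * Real.sqrt c := by
  have he0 := Real.exp_pos (-γ)
  have he1 : Real.exp (-γ) < 1 := by simpa using hγ
  have h : ¬ Real.exp (-γ) ≤ ε := by
    intro h
    rw [pathThreshold, if_pos h] at hd
    omega
  have h1 := exp_neg_mul_pathThreshold_le hγ hε h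
  -- As e^{-γ} ≤ 1 / (1 + γ) and γ < 1, already 1 - e^{-γ} is at least γ / 2.
  have h2 : γ ^ 2 / 4 ≤ 1 - Real.exp (-γ) ^ 2 := by
    have h3 : Real.exp (-γ) * (1 + γ) ≤ 1 := by
      have := Real.add_one_le_exp γ
      calc Real.exp (-γ) * (1 + γ) ≤ Real.exp (-γ) * Real.exp γ :=
            mul_le_mul_of_nonneg_left (by linarith) he0.le
        _ = 1 := by rw [← Real.exp_add]; simp
    nlinarith
  have h3 : 0 < 1 - Real.exp (-γ) ^ 2 := by nlinarith
  have h4 : (Real.exp (-γ) ^ 2) ^ (pathThreshold γ ε + 1) / (1 - Real.exp (-γ) ^ 2) ≤ ε ^ 2 := by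
    rw [div_le_iff₀ h3, ← pow_mul, mul_comm 2, pow_mul]
    have h5 : Real.exp (-γ) ^ (pathThreshold γ ε + 1) ≤ ε * γ / 2 := by
      refine le_trans ?_ h1
      exact pow_le_pow_of_le_one he0.le he1.le (by omega)
    calc (Real.exp (-γ) ^ (pathThreshold γ ε + 1)) ^ 2 ≤ (ε * γ / 2) ^ 2 :=
          pow_le_pow_left₀ (by positivity) h5 2
      _ = ε ^ 2 * (γ ^ 2 / 4) := by ring
      _ ≤ _ := mul_le_mul_of_nonneg_left h2 (by positivity)
  have h5 : 0 ≤ (Real.exp (-γ) ^ 2) ^ (pathThreshold γ ε + 1) / (1 - Real.exp (-γ) ^ 2) := by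
    positivity
  rw [mul_comm c, Real.sqrt_mul h5]
  refine mul_le_mul_of_nonneg_right ?_ (Real.sqrt_nonneg _)
  rw [Real.sqrt_le_left hε.le]
  exact h4

/-! ## The size of the tables -/

/-- A step that counts no gate has no gate to apply, a gate that sees only identity letters, or a
Clifford gate; none of these branches. -/
lemma stepOp_unique_image {n : ℕ} (dir : Bool) {G : List (Gate n)} {j : ℕ} {P : PauliString n}
    (h : stepTouch G j P = 0) :
    ∃ R, ∀ Q, amp (dirOp dir (stepOp G j)) P Q ≠ 0 → Q = R := by
  have hid : ∀ V : Op n, (∀ Q, amp V P Q = if P = Q then 1 else 0) →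
      ∃ R, ∀ Q, amp V P Q ≠ 0 → Q = R := fun V hV => ⟨P, fun Q hQ => by
    rw [hV] at hQ
    by_contra hc
    exact hQ (if_neg fun h => hc h.symm)⟩
  have h1 : ∀ Q, amp (dirOp dir (1 : Op n)) P Q = if P = Q then 1 else 0 := fun Q => by
    rw [dirOp_one, amp_one]
  unfold stepTouch at h
  unfold stepOp
  rcases hg : gateOn G j with _ | g
  · exact hid _ h1
  · rw [hg] at h
    dsimp only at h ⊢
    split_ifs at h ⊢ with h2 h3
    · exact hid _ h1
    · rw [not_and_or, not_not] at h3
      rcases h3 with h3 | h3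
      · exact ⟨_, fun Q hQ =>
          (cliffordImage_spec (h3.dirOp g.toOp_mul_conjTranspose dir) P Q).1 hQ⟩
      · push Not at h3
        exact hid _ (amp_untouched dir g h3)

lemma stepTouch_le_one {n : ℕ} (G : List (Gate n)) (j : ℕ) (P : PauliString n) :
    stepTouch G j P ≤ 1 := by
  unfold stepTouch
  split
  · exact Nat.zero_le _
  · split_ifs <;> simp

lemma stage_length_le {n : ℕ} (dir : Bool) (G : List (Gate n)) (ℓ j : ℕ) (e : Entry n) :
    (stage dir G ℓ j e).length ≤ 16 := by
  have h1 : ∀ (f : ℕ → List (Entry n)) k, (∀ i, (f i).length ≤ k) →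
      ((List.range 4).flatMap f).length ≤ 4 * k := by
    intro f k hf
    have h0 := hf 0
    have h1 := hf 1
    have h2 := hf 2
    have h3 := hf 3
    simp only [List.range_succ, List.range_zero, List.flatMap_append, List.length_append,
      List.flatMap_cons, List.flatMap_nil, List.append_nil, List.nil_append]
    omega
  unfold stage
  split
  · simp
  · split_ifs
    all_goals first
      | exact h1 _ 4 fun x => h1 _ 1 fun y => by split_ifs <;> simp
      | simp

/-- A non-Clifford gate that is met has at most 16 images but raises the first counter by one; in
all other cases there is at most one image. Pruning only removes terms. The factor ψ is carried
along freely since a gate does not change the second counter. -/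
lemma stage_potential {n : ℕ} (dir : Bool) (G : List (Gate n)) {ℓ j : ℕ} {e : Entry n}
    (he : e.a ≤ ℓ) {ψ : ℕ → ℝ} (hψ : ∀ b, 0 ≤ ψ b) :
    sumE (fun e => ψ e.b * (1 / 16) ^ e.a) (stage dir G ℓ j e) ≤ ψ e.b * (1 / 16) ^ e.a := by
  have hlen := stage_sum dir G (j := j) he fun _ => 1
  rw [sumE_one] at hlen
  rw [stage_sum dir G he]
  have h0 : 0 ≤ ψ e.b * (1 / 16 : ℝ) ^ e.a := mul_nonneg (hψ _) (by positivity)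
  split_ifs at hlen ⊢ with h1
  · dsimp only
    have h2 : ∀ Q, (if amp (dirOp dir (stepOp G j)) e.P Q ≠ 0 then
        ψ e.b * (1 / 16 : ℝ) ^ (e.a + stepTouch G j e.P) else 0) =
        ψ e.b * (1 / 16 : ℝ) ^ (e.a + stepTouch G j e.P) *
          (if amp (dirOp dir (stepOp G j)) e.P Q ≠ 0 then 1 else 0) := fun Q => by
      split_ifs <;> simp
    rw [Finset.sum_congr rfl fun Q _ => h2 Q, ← Finset.mul_sum, ← hlen]
    rcases Nat.le_one_iff_eq_zero_or_eq_one.1 (stepTouch_le_one G j e.P) with h3 | h3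
    · obtain ⟨R, hR⟩ := stepOp_unique_image dir h3
      have h4 : ((stage dir G ℓ j e).length : ℝ) ≤ 1 := by
        rw [hlen]
        refine (Finset.sum_le_sum (g := fun Q => if Q = R then (1 : ℝ) else 0)
          fun Q _ => ?_).trans (by simp)
        by_cases hQ : amp (dirOp dir (stepOp G j)) e.P Q ≠ 0
        · rw [if_pos hQ, if_pos (hR Q hQ)]
        · rw [if_neg hQ]; split_ifs <;> norm_num
      rw [h3, add_zero]
      exact mul_le_of_le_one_right h0 h4
    · have h4 : ((stage dir G ℓ j e).length : ℝ) ≤ 16 := by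
        exact_mod_cast stage_length_le dir G ℓ j e
      rw [h3, pow_succ, ← mul_assoc, mul_assoc]
      refine mul_le_of_le_one_right h0 ?_
      linarith
  · exact h0

lemma expandTo_potential {n : ℕ} (dir : Bool) (G : List (Gate n)) {ℓ : ℕ} (m : ℕ)
    {l : List (Entry n)} (hl : ∀ e ∈ l, e.a ≤ ℓ) {ψ : ℕ → ℝ} (hψ : ∀ b, 0 ≤ ψ b) :
    sumE (fun e => ψ e.b * (1 / 16) ^ e.a) (expandTo dir G ℓ m l) ≤
      sumE (fun e => ψ e.b * (1 / 16) ^ e.a) l := by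
  induction m with
  | zero => exact le_rfl
  | succ m ih =>
    rw [expandTo_succ, sumE_flatMap]
    exact (sumE_mono fun e he => stage_potential dir G (expandTo_a_le hl e he) hψ).trans ih

/-- A bound on the length from a lower bound on each term of a sum. -/
lemma length_le_of_sumE {n : ℕ} {l : List (Entry n)} {φ : Entry n → ℝ} {r s : ℝ} (hr : 0 < r)
    (h : ∀ e ∈ l, r ≤ φ e) (hs : sumE φ l ≤ s) : (l.length : ℝ) ≤ s / r := by
  rw [le_div_iff₀ hr]
  refine le_trans ?_ hs
  rw [mul_comm, ← sumE_one, ← sumE_const_mul]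
  exact sumE_mono fun e he => by rw [mul_one]; exact h e he

/-- The sum of `16^(-a)` over a table. -/
def potential {n : ℕ} (l : List (Entry n)) : ℝ := sumE (fun e => (1 / 16 : ℝ) ^ e.a) l

lemma length_le_of_potential {n ℓ s : ℕ} {l : List (Entry n)} (ha : ∀ e ∈ l, e.a ≤ ℓ)
    (hs : potential l ≤ s) : l.length ≤ s * 16 ^ ℓ := by
  have h := length_le_of_sumE (r := (1 / 16 : ℝ) ^ ℓ) (by positivity)
    (fun e he => pow_le_pow_of_le_one (by norm_num) (by norm_num) (ha e he)) hs
  have : (s : ℝ) / (1 / 16 : ℝ) ^ ℓ = ((s * 16 ^ ℓ : ℕ) : ℝ) := by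
    push_cast; rw [one_div, inv_pow, div_inv_eq_mul]
  rw [this] at h
  exact_mod_cast h

lemma potential_expandTo_le {n : ℕ} (dir : Bool) (G : List (Gate n)) {ℓ : ℕ} (m : ℕ)
    {l : List (Entry n)} (hl : ∀ e ∈ l, e.a ≤ ℓ) :
    potential (expandTo dir G ℓ m l) ≤ potential l := by
  simpa [potential] using expandTo_potential dir G m hl (ψ := fun _ => 1) fun _ => zero_le_one

lemma potential_of_a_eq_zero {n : ℕ} {l : List (Entry n)} (h : ∀ e ∈ l, e.a = 0) :
    potential l = l.length := by
  rw [potential, sumE_congr (ψ := fun _ => 1) fun e he => by rw [h e he, pow_zero], sumE_one]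

/-- The tables of the forward propagation. -/
lemma potential_heisL_le {x : Input} {l : List (Entry x.n)} (hl : ∀ e ∈ l, e.a = 0) (t : ℕ) :
    potential (heisL x false l t) ≤ l.length := by
  have hround : ∀ S V (l : List (Entry x.n)),
      (∀ e ∈ l, e.a ≤ e.b + wt S e.P) →
      potential (roundL false S V x.ℓ x.damp l) ≤ potential l := by
    intro S V l h
    rw [potential, sumE_roundL, potential]
    refine sumE_mono fun e he => ?_
    split_ifs
    · exact pow_le_pow_of_le_one (by norm_num) (by norm_num) (h e he)
    · positivity
  induction t with
  | zero =>
    rw [heisL, ← potential_of_a_eq_zero hl]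
    exact hround _ _ _ fun e he => by rw [hl e he]; exact Nat.zero_le _
  | succ t ih =>
    rw [heisL, if_neg (by simp)]
    refine le_trans (hround _ _ _ ?_)
      ((potential_expandTo_le false _ _ fun e he => (heisL_false_a t e he).2).trans ih)
    -- The round resets the first counter to the total weight including the image Q. This is at
    -- least the old total weight plus the gates just met, so the potential cannot rise.
    intro e he
    obtain ⟨e', he', _, Q, hQ, rfl⟩ := (expandL_mem false (ncLayer x.circuit t)
      (fun e he => (heisL_false_a t e he).2) (fun e' => e' = e)).1 ⟨e, he, rfl⟩
    have h1 := (ncLayer x.circuit t).touched_le_weight hQ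
    have h2 := (heisL_false_a t e' he').1
    change e'.a + _ ≤ e'.b + wt Finset.univ Q
    rw [wt_univ]
    omega

lemma heisL_false_length_le {x : Input} {l : List (Entry x.n)} (hl : ∀ e ∈ l, e.a = 0) (t : ℕ) :
    (heisL x false l t).length ≤ l.length * 16 ^ x.ℓ :=
  length_le_of_potential (fun e he => (heisL_false_a t e he).2) (potential_heisL_le hl t)

lemma expandTo_heisL_false_length_le {x : Input} {l : List (Entry x.n)} (hl : ∀ e ∈ l, e.a = 0)
    (G : List (Gate x.n)) (t m : ℕ) :
    (expandTo false G x.ℓ m (heisL x false l t)).length ≤ l.length * 16 ^ x.ℓ :=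
  length_le_of_potential (expandTo_a_le fun e he => (heisL_false_a t e he).2)
    ((potential_expandTo_le _ _ _ fun e he => (heisL_false_a t e he).2).trans
      (potential_heisL_le hl t))

lemma level_length_le (n i : ℕ) : (level n i).length ≤ (3 * n) ^ i := by
  induction i with
  | zero => simp [level]
  | succ i ih =>
    exact (level_length_succ_le i).trans (by rw [pow_succ]; exact Nat.mul_le_mul_right _ ih)

lemma sum_level_length_le (n r : ℕ) :
    ∑ i ∈ Finset.range (r + 1), (level n i).length ≤ (3 * n + 1) ^ r := by
  refine (Finset.sum_le_sum fun i _ => level_length_le n i).trans ?_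
  rw [add_pow]
  refine Finset.sum_le_sum fun i hi => ?_
  rw [one_pow, mul_one]
  exact Nat.le_mul_of_pos_right _ (Nat.choose_pos (Nat.lt_succ_iff.1 (Finset.mem_range.1 hi)))

lemma bwdL_inv {x : Input} {s : ℕ} (i : ℕ) :
    ∀ e ∈ bwdL x s (seeds x) i, e.a + weight e.P = e.b := by
  cases i with
  | zero =>
    intro e he
    obtain ⟨e', _, h⟩ := List.mem_flatMap.1 he
    rw [(mem_weighE.1 h).2]
    exact Nat.zero_add _
  | succ i =>
    intro e he
    obtain ⟨e', _, h⟩ := List.mem_flatMap.1 he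
    rw [(mem_weighE.1 h).2]
    rfl

lemma seeds_length_le (x : Input) :
    (seeds x).length ≤ (levels x.n (min x.n (x.ℓ / (ncDepth x.circuit + 1)))).length := by
  have := length_flatMap_le (levels x.n (min x.n (x.ℓ / (ncDepth x.circuit + 1))))
    fun e _ => weighE_length_le Finset.univ (fun _ _ => 0) (fun _ w => w) x.ℓ x.damp e
  rwa [mul_one] at this

/-- In a backward step the first counter is reset to the old second one. This never lowers it: the
gates met in the layer are at most the weight of the operator before the step, which the second
counter already includes (`bwdL_inv`). -/
lemma potential_bwdL_le (x : Input) (s i : ℕ) :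
    potential (bwdL x s (seeds x) i) ≤ (seeds x).length := by
  induction i with
  | zero =>
    refine (potential_of_a_eq_zero fun e he => ?_).le
    obtain ⟨e', _, h⟩ := List.mem_flatMap.1 he
    rw [(mem_weighE.1 h).2]
  | succ i ih =>
    refine le_trans ?_ ((potential_expandTo_le true (ncLayer x.circuit (s - (i + 1))).gates x.n
      (bwdL_a_le i)).trans ih)
    rw [bwdL, bwdStep, potential, sumE_flatMap, sumE_map, potential]
    refine sumE_mono fun e he => ?_
    have hab : e.a ≤ e.b := by
      obtain ⟨e', he', _, Q, hQ, rfl⟩ := (expandL_mem true (ncLayer x.circuit (s - (i + 1)))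
        (bwdL_a_le i) (fun e' => e' = e)).1 ⟨e, he, rfl⟩
      have h1 := (ncLayer x.circuit (s - (i + 1))).touched_le_weight_self e'.P
      have h2 := bwdL_inv i e' he'
      change e'.a + _ ≤ e'.b
      omega
    unfold weighE
    split_ifs
    · rw [sumE_cons, sumE_nil, add_zero]
      exact pow_le_pow_of_le_one (by norm_num) (by norm_num) hab
    · rw [sumE_nil]; positivity

lemma sources_length_le (x : Input) :
    (sources x).length ≤ (ncDepth x.circuit + 1) * ((seeds x).length * 16 ^ x.ℓ) := by
  rw [sources, List.length_flatMap]
  refine (List.sum_le_card_nsmul _ ((seeds x).length * 16 ^ x.ℓ) fun k hk => ?_).trans ?_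
  · obtain ⟨s, _, rfl⟩ := List.mem_map.1 hk
    exact length_le_of_potential (bwdL_a_le s) (potential_bwdL_le x s s)
  · simp

lemma startL_a (x : Input) : ∀ e ∈ startL x, e.a = 0 := fun e he =>
  (counters_of_mem_obsE e he).1

lemma startL_length_le (x : Input) : (startL x).length ≤ (sources x).length := by
  have := length_flatMap_le (dedupe (sources x)) fun e _ => obsE_length_le x.obs e
  rw [mul_one] at this
  exact this.trans (dedupe_length_le _)

/-- The running time of the program for uniform noise. -/
lemma computes_uniformProg_le {x : Input} (h : ncDepth x.circuit + 1 ≤ x.ℓ) (hn : 1 ≤ x.n) :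
    ∃ T, Computes uniformProg x
      (sumE (fun e => e.c * x.state e.P) (heisL x false (startL x) (ncDepth x.circuit))) T ∧
      T ≤ 52000 * (2 ^ (26 * x.ℓ) * x.n ^ (4 * (x.ℓ / (ncDepth x.circuit + 1)))) := by
  set d := ncDepth x.circuit
  set r := x.ℓ / (d + 1) with hr
  set s := (seeds x).length * 16 ^ x.ℓ with hs
  -- The exponent 11 in units of ℓ: 2 for the light operators, as (3n + 1)^r ≤ 4^r n^r; 4 for the
  -- branching backward; 1 for the d + 1 ≤ 2^ℓ starting levels; 4 for the branching forward.
  set M := 2 ^ (11 * x.ℓ) * x.n ^ r with hM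
  have hr1 : 1 ≤ r := (Nat.one_le_div_iff (by omega)).2 h
  have hrℓ : r ≤ x.ℓ := Nat.div_le_self _ _
  have hd : d + 1 ≤ 2 ^ x.ℓ := h.trans Nat.lt_two_pow_self.le
  have hlev : (levels x.n (min x.n r)).length ≤ 2 ^ (2 * x.ℓ) * x.n ^ r := by
    rw [levels_length]
    refine (sum_level_length_le _ _).trans ((Nat.pow_le_pow_left (show 3 * x.n + 1 ≤ 4 * x.n by
      omega) _).trans ((Nat.pow_le_pow_right (by omega) (min_le_right _ _)).trans ?_))
    rw [mul_pow, pow_mul]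
    exact Nat.mul_le_mul_right _ (Nat.pow_le_pow_right (by norm_num) hrℓ)
  have h16 : (16 : ℕ) ^ x.ℓ = 2 ^ (4 * x.ℓ) := by rw [pow_mul]; norm_num
  have hseeds := (seeds_length_le x).trans hlev
  have hsM : s ≤ 2 ^ (6 * x.ℓ) * x.n ^ r := by
    refine (Nat.mul_le_mul_right _ hseeds).trans (le_of_eq ?_)
    rw [h16]; ring
  have hsrc : (sources x).length ≤ 2 ^ (7 * x.ℓ) * x.n ^ r := by
    refine (sources_length_le x).trans ((Nat.mul_le_mul hd hsM).trans (le_of_eq ?_))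
    ring
  have hstart : (startL x).length * 16 ^ x.ℓ ≤ M := by
    refine (Nat.mul_le_mul_right _ ((startL_length_le x).trans hsrc)).trans (le_of_eq ?_)
    rw [h16]; ring
  have hmono : ∀ a ≤ 11, 2 ^ (a * x.ℓ) * x.n ^ r ≤ M := fun a ha =>
    Nat.mul_le_mul_right _ (Nat.pow_le_pow_right (by norm_num) (Nat.mul_le_mul_right _ ha))
  obtain ⟨T, hT, hle⟩ := computes_uniformProg (M := M) h (hlev.trans (hmono 2 (by norm_num)))
    (fun s' _ => (length_le_of_potential (bwdL_a_le s') (potential_bwdL_le x s' s')).trans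
      (hsM.trans (hmono 6 (by norm_num))))
    (fun s' _ i _ m _ => (length_le_of_potential (expandTo_a_le (bwdL_a_le i))
      ((potential_expandTo_le _ _ _ (bwdL_a_le i)).trans (potential_bwdL_le x s' i))).trans
        (hsM.trans (hmono 6 (by norm_num))))
    (hsrc.trans (hmono 7 (by norm_num)))
    (fun t _ m _ => (expandTo_heisL_false_length_le (startL_a x) _ t m).trans hstart)
    ((heisL_false_length_le (startL_a x) _).trans hstart)
  refine ⟨T, hT, hle.trans ?_⟩
  have hM1 : M + 1 ≤ 2 ^ (12 * x.ℓ) * x.n ^ r := by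
    have h1 : 1 ≤ M := Nat.mul_pos (by positivity) (by positivity)
    have h2 : 2 ≤ 2 ^ x.ℓ := Nat.le_self_pow (by omega) 2
    calc M + 1 ≤ 2 * M := by omega
      _ ≤ 2 ^ x.ℓ * M := Nat.mul_le_mul_right _ h2
      _ = _ := by rw [hM]; ring
  have hn1 : (x.n + 1) ^ 2 ≤ 4 * x.n ^ (2 * r) := by
    calc (x.n + 1) ^ 2 ≤ (2 * x.n) ^ 2 := Nat.pow_le_pow_left (by omega) 2
      _ = 4 * x.n ^ 2 := by ring
      _ ≤ _ := Nat.mul_le_mul_left _ (Nat.pow_le_pow_right (by omega) (by omega))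
  -- Altogether 2^{2ℓ} for (d + 1)², 4 n^{2r} for (n + 1)², using r ≥ 1, and 2^{24ℓ} n^{2r} for (M +
  -- 1)².
  calc 13000 * (d + 1) ^ 2 * unitT x.n M
      ≤ 13000 * (2 ^ x.ℓ) ^ 2 * ((4 * x.n ^ (2 * r)) * (2 ^ (12 * x.ℓ) * x.n ^ r) ^ 2) :=
        Nat.mul_le_mul (Nat.mul_le_mul_left _ (Nat.pow_le_pow_left hd 2))
          (Nat.mul_le_mul hn1 (Nat.pow_le_pow_left hM1 2))
    _ = _ := by ring

/-- The running time of the program for explicit sums. -/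
lemma computes_termsProg_le {x : Input} (h : ncDepth x.circuit + 1 ≤ x.ℓ) {s : ℕ}
    (hs : x.terms.length ≤ s) :
    ∃ T, Computes termsProg x
      (sumE (fun e => e.c * x.state e.P) (heisL x false (x.terms.map fun a => ⟨a.1, 0, 0, a.2⟩)
        (ncDepth x.circuit))) T ∧
      T ≤ 3200 * (x.n + 1) ^ 2 * (s + 1) ^ 2 * 2 ^ (9 * x.ℓ) := by
  have hl : ∀ e ∈ x.terms.map fun a => (⟨a.1, 0, 0, a.2⟩ : Entry x.n), e.a = 0 := by
    intro e he
    obtain ⟨a, _, rfl⟩ := List.mem_map.1 he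
    rfl
  set l := x.terms.map fun a => (⟨a.1, 0, 0, a.2⟩ : Entry x.n) with hldef
  have hls : l.length * 16 ^ x.ℓ ≤ s * 16 ^ x.ℓ :=
    Nat.mul_le_mul_right _ (by rwa [hldef, List.length_map])
  obtain ⟨T, hT, hle⟩ := computes_termsProg (M := s * 16 ^ x.ℓ) h
    (hs.trans (Nat.le_mul_of_pos_right _ (by positivity)))
    (fun t _ m _ => (expandTo_heisL_false_length_le hl _ t m).trans hls)
    ((heisL_false_length_le hl _).trans hls)
  refine ⟨T, hT, hle.trans ?_⟩
  have hd : ncDepth x.circuit + 1 ≤ 2 ^ x.ℓ := h.trans Nat.lt_two_pow_self.le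
  have hM1 : s * 16 ^ x.ℓ + 1 ≤ (s + 1) * 2 ^ (4 * x.ℓ) := by
    have h1 : 1 ≤ 16 ^ x.ℓ := Nat.one_le_pow _ _ (by norm_num)
    rw [pow_mul, add_mul]
    norm_num
    omega
  calc 3200 * (ncDepth x.circuit + 1) * unitT x.n (s * 16 ^ x.ℓ)
      ≤ 3200 * 2 ^ x.ℓ * ((x.n + 1) ^ 2 * ((s + 1) * 2 ^ (4 * x.ℓ)) ^ 2) :=
        Nat.mul_le_mul (Nat.mul_le_mul_left _ hd)
          (Nat.mul_le_mul_left _ (Nat.pow_le_pow_left hM1 2))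
    _ = _ := by ring

/-! ## Running times under uniform noise -/

/-- The logarithm in the threshold is log 2 + log(1/ε) + log(1/γ). Here log 2 is absorbed by
log(1/γ) / log(1/γ₀) ≥ 1, the only reason why the constant depends on γ₀, and the unit lost in
rounding by γ < log(1/ε), which holds because the threshold is not 0. -/
lemma pathThreshold_le {γ₀ γ ε : ℝ} (hγ : 0 < γ) (hγ₀ : γ ≤ γ₀) (h1 : γ₀ < 1) (hε : 0 < ε)
    {d : ℕ} (hd : d + 1 ≤ pathThreshold γ ε) :
    (pathThreshold γ ε : ℝ) ≤ (1 + 1 / Real.log (1 / γ₀)) * (Real.log (1 / γ) / γ) +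
      2 * (Real.log (1 / ε) / γ) ∧ γ < Real.log (1 / ε) := by
  have h : ¬ Real.exp (-γ) ≤ ε := by
    intro h
    rw [pathThreshold, if_pos h] at hd
    omega
  have hγ0 : 0 < γ₀ := hγ.trans_le hγ₀
  have hlε : γ < Real.log (1 / ε) := by
    rw [one_div, Real.log_inv, lt_neg, Real.log_lt_iff_lt_exp hε]
    exact not_le.1 h
  refine ⟨?_, hlε⟩
  have hl0 : 0 < Real.log (1 / γ₀) := Real.log_pos (by rw [lt_div_iff₀ hγ0]; linarith)
  have hl : Real.log (1 / γ₀) ≤ Real.log (1 / γ) :=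
    Real.log_le_log (by positivity) (one_div_le_one_div_of_le hγ hγ₀)
  have he : Real.log (2 / (ε * γ)) = Real.log 2 + Real.log (1 / ε) + Real.log (1 / γ) := by
    rw [← Real.log_mul (by norm_num) (by positivity), ← Real.log_mul (by positivity) (by positivity)]
    congr 1
    field_simp
  have h2 : Real.log 2 ≤ 1 := by have := Real.log_two_lt_d9; linarith
  have hlog2 : 0 < Real.log 2 := Real.log_pos (by norm_num)
  have h3 : 1 ≤ 1 / Real.log (1 / γ₀) * Real.log (1 / γ) := by
    rw [one_div, ← div_eq_inv_mul, le_div_iff₀ hl0]; linarith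
  rw [pathThreshold, if_neg h]
  refine (Nat.ceil_lt_add_one ?_).le.trans ?_
  · rw [he]
    have : 0 < Real.log (1 / γ) := by linarith
    have : 0 < Real.log (1 / ε) := by linarith
    positivity
  · rw [he]
    have e1 : (1 + 1 / Real.log (1 / γ₀)) * (Real.log (1 / γ) / γ) + 2 * (Real.log (1 / ε) / γ) =
        (Real.log (1 / γ) + 1 / Real.log (1 / γ₀) * Real.log (1 / γ) + 2 * Real.log (1 / ε)) / γ := by
      ring
    rw [e1, le_div_iff₀ hγ]
    have e2 : (1 / γ * (Real.log 2 + Real.log (1 / ε) + Real.log (1 / γ)) + 1) * γ =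
        Real.log 2 + Real.log (1 / ε) + Real.log (1 / γ) + γ := by field_simp
    rw [e2]
    linarith

/-- The constant in the bound for `2 ^ ℓ`. -/
def sizeConst (γ₀ : ℝ) : ℝ := 1 + 3 / Real.log (1 / γ₀)

/-- Both terms are brought to the form log(1/γ) log(1/ε) / γ²: the first is multiplied by log(1/ε) /
γ > 1, the second by log(1/γ) / log(1/γ₀) ≥ 1 and by 1/γ > 1. -/
lemma pathThreshold_le' {γ₀ γ ε : ℝ} (hγ : 0 < γ) (hγ₀ : γ ≤ γ₀) (h1 : γ₀ < 1) (hε : 0 < ε)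
    {d : ℕ} (hd : d + 1 ≤ pathThreshold γ ε) :
    (pathThreshold γ ε : ℝ) ≤
      sizeConst γ₀ * (Real.log (1 / γ) / γ ^ 2) * Real.log (1 / ε) := by
  obtain ⟨h2, h3⟩ := pathThreshold_le hγ hγ₀ h1 hε hd
  refine h2.trans ?_
  have hγ0 : 0 < γ₀ := hγ.trans_le hγ₀
  have hl0 : 0 < Real.log (1 / γ₀) := Real.log_pos (by rw [lt_div_iff₀ hγ0]; linarith)
  have hl : Real.log (1 / γ₀) ≤ Real.log (1 / γ) :=
    Real.log_le_log (by positivity) (one_div_le_one_div_of_le hγ hγ₀)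
  set L := Real.log (1 / γ)
  set E := Real.log (1 / ε)
  set L₀ := Real.log (1 / γ₀)
  have hL : 0 < L := by linarith
  have hE : 0 < E := by linarith
  have h4 : L / γ ≤ L / γ ^ 2 * E := by
    rw [div_mul_eq_mul_div, div_le_div_iff₀ hγ (by positivity)]
    have : L * γ * γ ≤ L * γ * E := mul_le_mul_of_nonneg_left h3.le (by positivity)
    nlinarith
  have h5 : E / γ ≤ 1 / L₀ * (L / γ ^ 2 * E) := by
    have e : 1 / L₀ * (L / γ ^ 2 * E) = (L / L₀) * (1 / γ) * (E / γ) := by field_simp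
    rw [e]
    refine le_mul_of_one_le_left (by positivity) ?_
    have h6 : 1 ≤ L / L₀ := by rw [le_div_iff₀ hl0]; linarith
    have h7 : 1 ≤ 1 / γ := by rw [le_div_iff₀ hγ]; linarith
    nlinarith
  have h8 : (1 + 1 / L₀) * (L / γ) ≤ (1 + 1 / L₀) * (L / γ ^ 2 * E) :=
    mul_le_mul_of_nonneg_left h4 (by positivity)
  have e3 : sizeConst γ₀ * (L / γ ^ 2) * E = (1 + 1 / L₀) * (L / γ ^ 2 * E) +
      2 * (1 / L₀ * (L / γ ^ 2 * E)) := by rw [sizeConst]; ring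
  rw [e3]
  linarith

lemma two_pow_le {a K A ε : ℝ} {k ℓ : ℕ} (hε : 0 < ε) (hA : 0 ≤ A) (hE : 0 ≤ Real.log (1 / ε))
    (hℓ : (ℓ : ℝ) ≤ a * A * Real.log (1 / ε)) (hK : k * a ≤ K) :
    (2 : ℝ) ^ (k * ℓ) ≤ (1 / ε) ^ (K * A) := by
  rw [Real.rpow_def_of_pos (by positivity), ← Real.rpow_natCast, Real.rpow_def_of_pos two_pos]
  refine Real.exp_le_exp.2 ?_
  have h2 : Real.log 2 ≤ 1 := by have := Real.log_two_lt_d9; linarith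
  push_cast
  calc Real.log 2 * (k * ℓ) ≤ 1 * (k * ℓ) := mul_le_mul_of_nonneg_right h2 (by positivity)
    _ ≤ k * (a * A * Real.log (1 / ε)) := by
        rw [one_mul]; exact mul_le_mul_of_nonneg_left hℓ (by positivity)
    _ = (k * a) * (A * Real.log (1 / ε)) := by ring
    _ ≤ K * (A * Real.log (1 / ε)) := mul_le_mul_of_nonneg_right hK (by positivity)
    _ = _ := by ring

theorem uniform_noise_any_observable :
    ∃ (prog : Program) (ℓ : ℝ → ℝ → ℕ → ℕ), ∀ γ₀ : ℝ, 0 < γ₀ → γ₀ < 1 → ∃ K : ℝ, 0 < K ∧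
      ∀ (γ ε : ℝ), 0 < γ → γ ≤ γ₀ → 0 < ε → ε ≤ 1 →
      ∀ (n : ℕ), 1 ≤ n → ∀ (C : Circuit n) (O : Op n), O.IsHermitian → frobNorm O = 1 →
      ∀ (N : ℕ) (c : ℝ) (ρ : Fin N → Op n), IsLowAverage c ρ →
      ∃ out : Fin N → ℝ,
        (∀ i, ∃ T : ℕ, Computes prog (oracleInput γ (ℓ γ ε (ncDepth C)) C O (ρ i)) (out i) T ∧
          (T : ℝ) ≤ K *
            (n : ℝ) ^ (K * (Real.log (1 / γ) / γ) +
              K * (Real.log (1 / ε) / (γ * (max 1 (ncDepth C) : ℕ)))) *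
            (1 / ε) ^ (K * (Real.log (1 / γ) / γ ^ 2))) ∧
        rmsError out (fun i => expectation γ uniformNoise C O (ρ i)) ≤ ε * Real.sqrt c := by
  -- The threshold does not depend on the depth; the comparison with d + 1 is made by the program.
  refine ⟨uniformProg, fun γ ε _ => pathThreshold γ ε, fun γ₀ hγ₀ hγ₁ => ?_⟩
  have hl0 : 0 < Real.log (1 / γ₀) := Real.log_pos (by rw [lt_div_iff₀ hγ₀]; linarith)
  have hs : 1 ≤ sizeConst γ₀ := by rw [sizeConst]; have := div_pos three_pos hl0; linarith
  set K := 52000 * sizeConst γ₀ with hK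
  refine ⟨K, by linarith, fun γ ε hγ hγγ hε hε1 n hn C O hO hO1 N c ρ hρ => ?_⟩
  have hl : Real.log (1 / γ₀) ≤ Real.log (1 / γ) :=
    Real.log_le_log (by positivity) (one_div_le_one_div_of_le hγ hγγ)
  have hL : 0 < Real.log (1 / γ) := by linarith
  have hE : 0 ≤ Real.log (1 / ε) := Real.log_nonneg (by rw [le_div_iff₀ hε]; linarith)
  have hn' : (1 : ℝ) ≤ n := by exact_mod_cast hn
  have hmax : (0 : ℝ) < (max 1 (ncDepth C) : ℕ) := by positivity
  by_cases hd : pathThreshold γ ε < ncDepth C + 1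
  · refine ⟨fun _ => coeff O 0, fun i => ?_, (rmsError_obs_zero_le hγ.le hO hO1 hρ).trans
      (rms_bound_trivial hγ (by linarith) hε hd)⟩
    obtain ⟨T, hT, hle⟩ := computes_uniformProg_trivial
      (x := oracleInput γ (pathThreshold γ ε) C O (ρ i)) hd
    refine ⟨T, hT, ?_⟩
    have h1 : 1 ≤ (n : ℝ) ^ (K * (Real.log (1 / γ) / γ) +
        K * (Real.log (1 / ε) / (γ * (max 1 (ncDepth C) : ℕ)))) :=
      Real.one_le_rpow hn' (by positivity)
    have h2 : 1 ≤ (1 / ε) ^ (K * (Real.log (1 / γ) / γ ^ 2)) :=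
      Real.one_le_rpow (by rw [le_div_iff₀ hε]; linarith) (by positivity)
    have h3 : (T : ℝ) ≤ 2 := by exact_mod_cast hle
    have h4 : 2 ≤ K := by linarith
    calc (T : ℝ) ≤ K * 1 * 1 := by linarith
      _ ≤ _ := by gcongr
  · rw [not_lt] at hd
    refine ⟨fun i => pathEstimate γ (pathThreshold γ ε) C O (ρ i), fun i => ?_,
      (rmsError_pathEstimate_le hγ _ hO hO1 hρ).trans (rms_bound hγ (by linarith) hε hd)⟩
    set x := oracleInput γ (pathThreshold γ ε) C O (ρ i) with hx
    obtain ⟨T, hT, hle⟩ := computes_uniformProg_le (x := x) hd hn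
    rw [sumE_heisL_eq_pathEstimate (x := x) (γ := γ) (O := O) (l := startL x) (ρ := ρ i) rfl rfl
      rfl (fun e he => (counters_of_mem_obsE e he).2)
      (sumE_startL x) fun k hk => graded_sourcePart hk] at hT
    refine ⟨T, hT, ?_⟩
    obtain ⟨h1, -⟩ := pathThreshold_le hγ hγγ hγ₁ hε hd
    have h2 := pathThreshold_le' hγ hγγ hγ₁ hε hd
    have h3 : (T : ℝ) ≤ 52000 * (2 ^ (26 * pathThreshold γ ε) *
        (n : ℝ) ^ (4 * (pathThreshold γ ε / (ncDepth C + 1)))) := by exact_mod_cast hle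
    have h4 := two_pow_le (k := 26) (K := K) hε (A := Real.log (1 / γ) / γ ^ 2) (by positivity) hE h2
      (by push_cast; linarith)
    have h5 : (n : ℝ) ^ (4 * (pathThreshold γ ε / (ncDepth C + 1))) ≤
        (n : ℝ) ^ (K * (Real.log (1 / γ) / γ) +
          K * (Real.log (1 / ε) / (γ * (max 1 (ncDepth C) : ℕ)))) := by
      rw [← Real.rpow_natCast]
      refine Real.rpow_le_rpow_of_exponent_le hn' ?_
      -- The exponent of n is governed by ℓ / (d + 1); the claim has max(1, d), so the denominator
      -- is made smaller.
      have h6 : ((pathThreshold γ ε / (ncDepth C + 1) : ℕ) : ℝ) ≤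
          (pathThreshold γ ε : ℝ) / ((max 1 (ncDepth C) : ℕ) : ℝ) := by
        refine Nat.cast_div_le.trans ?_
        refine div_le_div_of_nonneg_left (by positivity) hmax ?_
        exact_mod_cast (show max 1 (ncDepth C) ≤ ncDepth C + 1 by omega)
      have h7 : (1 : ℝ) ≤ (max 1 (ncDepth C) : ℕ) := by exact_mod_cast le_max_left _ _
      set D : ℝ := ((max 1 (ncDepth C) : ℕ) : ℝ)
      set A := Real.log (1 / γ) / γ with hA
      set B := Real.log (1 / ε) / γ with hB
      have hA0 : 0 ≤ A := by positivity
      have hB0 : 0 ≤ B := by positivity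
      have e1 : Real.log (1 / ε) / (γ * D) = B / D := by rw [hB, div_div]
      rw [e1]
      push_cast
      have h8 : (pathThreshold γ ε : ℝ) / D ≤
          (1 + 1 / Real.log (1 / γ₀)) * A + 2 * (B / D) := by
        rw [div_le_iff₀ hmax]
        -- In the term without ε the gain 1 / max(1, d) is given away.
        have h9 : (1 + 1 / Real.log (1 / γ₀)) * A * 1 ≤ (1 + 1 / Real.log (1 / γ₀)) * A * D :=
          mul_le_mul_of_nonneg_left h7 (by positivity)
        have e2 : ((1 + 1 / Real.log (1 / γ₀)) * A + 2 * (B / D)) * D =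
            (1 + 1 / Real.log (1 / γ₀)) * A * D + 2 * B := by field_simp
        rw [e2]
        linarith
      have h10 : 4 * (1 + 1 / Real.log (1 / γ₀)) ≤ K := by
        rw [hK, sizeConst]
        have := div_pos one_pos hl0
        have e3 : 3 / Real.log (1 / γ₀) = 3 * (1 / Real.log (1 / γ₀)) := by ring
        rw [e3]
        linarith
      have h11 : 4 * (1 + 1 / Real.log (1 / γ₀)) * A ≤ K * A := mul_le_mul_of_nonneg_right h10 hA0
      have h12 : 8 * (B / D) ≤ K * (B / D) := mul_le_mul_of_nonneg_right (by linarith) (by positivity)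
      have e4 : (4 : ℝ) * ((pathThreshold γ ε / (ncDepth C + 1) : ℕ) : ℝ) ≤
          4 * ((1 + 1 / Real.log (1 / γ₀)) * A + 2 * (B / D)) := by linarith
      refine e4.trans ?_
      linarith
    calc (T : ℝ) ≤ _ := h3
      _ = 52000 * (n : ℝ) ^ (4 * (pathThreshold γ ε / (ncDepth C + 1))) *
          2 ^ (26 * pathThreshold γ ε) := by ring
      _ ≤ _ := by
        have : (52000 : ℝ) ≤ K := by linarith
        gcongr

theorem uniform_noise_explicit_sum :
    ∃ (prog : Program) (ℓ : ℝ → ℝ → ℕ → ℕ), ∀ γ₀ : ℝ, 0 < γ₀ → γ₀ < 1 → ∃ K : ℝ, 0 < K ∧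
      ∀ p : Polynomial ℕ, ∃ q : Polynomial ℕ,
      ∀ (γ ε : ℝ), 0 < γ → γ ≤ γ₀ → 0 < ε → ε ≤ 1 →
      ∀ (n : ℕ), 1 ≤ n → ∀ (C : Circuit n) (l : List (PauliString n × ℝ)),
      l.length ≤ p.eval n → frobNorm (sumOfTerms l) = 1 →
      ∀ (N : ℕ) (c : ℝ) (ρ : Fin N → Op n), IsLowAverage c ρ →
      ∃ out : Fin N → ℝ,
        (∀ i, ∃ T : ℕ, Computes prog (listInput γ (ℓ γ ε (ncDepth C)) C l (ρ i)) (out i) T ∧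
          (T : ℝ) ≤ (q.eval n : ℕ) * (1 / ε) ^ (K * (Real.log (1 / γ) / γ ^ 2))) ∧
        rmsError out (fun i => expectation γ uniformNoise C (sumOfTerms l) (ρ i)) ≤
          ε * Real.sqrt c := by
  refine ⟨termsProg, fun γ ε _ => pathThreshold γ ε, fun γ₀ hγ₀ hγ₁ => ?_⟩
  have hl0 : 0 < Real.log (1 / γ₀) := Real.log_pos (by rw [lt_div_iff₀ hγ₀]; linarith)
  have hs : 1 ≤ sizeConst γ₀ := by rw [sizeConst]; have := div_pos three_pos hl0; linarith
  set K := 9 * sizeConst γ₀ with hK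
  -- The polynomial is the bound of `computes_termsProg_le` with p(n) terms.
  refine ⟨K, by linarith, fun p => ⟨3200 * (Polynomial.X + 1) ^ 2 * (p + 1) ^ 2, ?_⟩⟩
  intro γ ε hγ hγγ hε hε1 n hn C l hl hO1 N c ρ hρ
  have hlog : Real.log (1 / γ₀) ≤ Real.log (1 / γ) :=
    Real.log_le_log (by positivity) (one_div_le_one_div_of_le hγ hγγ)
  have hL : 0 < Real.log (1 / γ) := by linarith
  have hE : 0 ≤ Real.log (1 / ε) := Real.log_nonneg (by rw [le_div_iff₀ hε]; linarith)
  have hO := sumOfTerms_isHermitian l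
  have hq : (3200 * (Polynomial.X + 1) ^ 2 * (p + 1) ^ 2 : Polynomial ℕ).eval n =
      3200 * (n + 1) ^ 2 * (p.eval n + 1) ^ 2 := by
    simp only [Polynomial.eval_mul, Polynomial.eval_pow, Polynomial.eval_add, Polynomial.eval_X,
      Polynomial.eval_one, Polynomial.eval_ofNat]
  rw [hq]
  by_cases hd : pathThreshold γ ε < ncDepth C + 1
  · refine ⟨fun _ => coeff (sumOfTerms l) 0, fun i => ?_,
      (rmsError_obs_zero_le hγ.le hO hO1 hρ).trans (rms_bound_trivial hγ (by linarith) hε hd)⟩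
    obtain ⟨T, hT, hle⟩ := computes_termsProg_trivial
      (x := listInput γ (pathThreshold γ ε) C l (ρ i)) hd
    refine ⟨T, hT, ?_⟩
    have h2 : 1 ≤ (1 / ε) ^ (K * (Real.log (1 / γ) / γ ^ 2)) :=
      Real.one_le_rpow (by rw [le_div_iff₀ hε]; linarith) (by positivity)
    have h3 : T ≤ 3200 * (n + 1) ^ 2 * (p.eval n + 1) ^ 2 := by
      have h4 : 1 ≤ (n + 1) ^ 2 * (p.eval n + 1) ^ 2 := Nat.mul_pos (by positivity) (by positivity)
      rw [mul_assoc]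
      omega
    calc (T : ℝ) ≤ ((3200 * (n + 1) ^ 2 * (p.eval n + 1) ^ 2 : ℕ) : ℝ) * 1 := by
          rw [mul_one]; exact_mod_cast h3
      _ ≤ _ := mul_le_mul_of_nonneg_left h2 (Nat.cast_nonneg _)
  · rw [not_lt] at hd
    refine ⟨fun i => pathEstimate γ (pathThreshold γ ε) C (sumOfTerms l) (ρ i), fun i => ?_,
      (rmsError_pathEstimate_le hγ _ hO hO1 hρ).trans (rms_bound hγ (by linarith) hε hd)⟩
    set x := listInput γ (pathThreshold γ ε) C l (ρ i) with hx
    obtain ⟨T, hT, hle⟩ := computes_termsProg_le (x := x) hd hl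
    rw [sumE_heisL_eq_pathEstimate (x := x) (γ := γ) (O := sumOfTerms l) (ρ := ρ i)
      (l := x.terms.map fun a => (⟨a.1, 0, 0, a.2⟩ : Entry x.n)) (f := x.obs) rfl rfl rfl (fun e he => by obtain ⟨a, _, rfl⟩ := List.mem_map.1 he; rfl)
      (by exact sumE_terms l) fun k _ => rfl] at hT
    refine ⟨T, hT, ?_⟩
    have h2 := pathThreshold_le' hγ hγγ hγ₁ hε hd
    have h4 := two_pow_le (k := 9) (K := K) hε (A := Real.log (1 / γ) / γ ^ 2) (by positivity) hE h2
      (by push_cast; linarith)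
    refine le_trans ?_ (mul_le_mul_of_nonneg_left h4 (Nat.cast_nonneg _))
    exact_mod_cast hle

/-! ## Non-Clifford distance, layer by layer -/

lemma eq_of_forall_le_coe {a b : ℕ∞} (h : ∀ k : ℕ, a ≤ k ↔ b ≤ k) : a = b := by
  refine le_antisymm ?_ ?_
  · induction b using ENat.recTopCoe with
    | top => exact le_top
    | coe k => exact (h k).2 le_rfl
  · induction a using ENat.recTopCoe with
    | top => exact le_top
    | coe k => exact (h k).1 le_rfl

/-- In ℕ∞ the inequality a ≤ k is the strict inequality a < k + 1, so an infimum bounded by a finite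
number has a witness. Bounds for distances thus become the existence of paths. -/
lemma iInf_le_coe_iff {ι : Sort*} (φ : ι → ℕ∞) (k : ℕ) : ⨅ i, φ i ≤ k ↔ ∃ i, φ i ≤ k := by
  have h : ∀ a : ℕ∞, a ≤ k ↔ a < (k + 1 : ℕ) := by
    intro a
    induction a using ENat.recTopCoe with
    | top => simp
    | coe j => norm_cast; omega
  simp only [h, iInf_lt_iff]

/-- The distances after a unitary, if `P` is at distance `D P + τ P` from its images. -/
def distPush {n : ℕ} (U : Op n) (τ : PauliString n → ℕ) (D : PauliString n → ℕ∞) :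
    PauliString n → ℕ∞ := fun Q => ⨅ (P) (_ : amp U P Q ≠ 0), D P + τ P

lemma distPush_le_iff {n : ℕ} {U : Op n} {τ : PauliString n → ℕ} {D : PauliString n → ℕ∞}
    {Q : PauliString n} {k : ℕ} :
    distPush U τ D Q ≤ k ↔ ∃ P, amp U P Q ≠ 0 ∧ D P + τ P ≤ k := by
  simp only [distPush, iInf_le_coe_iff, exists_prop]

lemma distPush_le {n : ℕ} {U : Op n} {τ : PauliString n → ℕ} {D : PauliString n → ℕ∞}
    {P Q : PauliString n} (h : amp U P Q ≠ 0) : distPush U τ D Q ≤ D P + τ P :=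
  iInf₂_le P h

/-- The total number of non-Clifford gates that a sequence of Pauli operators meets. -/
def pathTouched {n : ℕ} (C : Circuit n) (r : ℕ → PauliString n) : ℕ :=
  ∑ s : Fin C.length, (C.get s).touched (r s)

/-- Paths are taken as functions on all of ℕ, so that adding a layer does not change the index type.
-/
lemma ncDistance_le_iff {n : ℕ} {O : Op n} {C : Circuit n} {P : PauliString n} {k : ℕ} :
    ncDistance O C P ≤ k ↔ ∃ r : ℕ → PauliString n, coeff O (r 0) ≠ 0 ∧ r C.length = P ∧
      (∀ s : Fin C.length, amp (C.get s).toOp (r s) (r (s + 1)) ≠ 0) ∧ pathTouched C r ≤ k := by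
  simp only [ncDistance, iInf_le_coe_iff, exists_prop, Nat.cast_le]
  constructor
  · rintro ⟨p, ⟨h0, h1, h2⟩, hk⟩
    obtain ⟨r, hr⟩ : ∃ r : ℕ → PauliString n, ∀ s (hs : s < C.length + 1), r s = p ⟨s, hs⟩ :=
      ⟨fun s => if h : s < C.length + 1 then p ⟨s, h⟩ else 0, fun s hs => dif_pos hs⟩
    refine ⟨r, by rw [hr 0 (by omega)]; exact h0, by rw [hr _ (by omega)]; exact h1,
      fun s => ?_, le_trans (le_of_eq (Finset.sum_congr rfl fun s _ => ?_)) hk⟩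
    · rw [hr _ (by omega), hr _ (by omega)]
      exact h2 s
    · rw [hr _ (by omega)]
      rfl
  · rintro ⟨r, h0, h1, h2, hk⟩
    exact ⟨fun s => r s, ⟨h0, h1, h2⟩, hk⟩

lemma pathTouched_append {n : ℕ} (C : Circuit n) (L : Layer n) (r : ℕ → PauliString n) :
    pathTouched (C ++ [L]) r = pathTouched C r + L.touched (r C.length) := by
  have h : ∀ C : Circuit n, pathTouched C r = ∑ s ∈ Finset.range C.length,
      (C[s]?.map fun L => L.touched (r s)).getD 0 := by
    intro C
    rw [pathTouched, Finset.sum_range]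
    exact Finset.sum_congr rfl fun s _ => by simp
  rw [h, h, List.length_append, List.length_singleton, Finset.sum_range_succ]
  congr 1
  · refine Finset.sum_congr rfl fun s hs => ?_
    rw [List.getElem?_append_left (Finset.mem_range.1 hs)]
  · simp

/-- Dynamic programming: a shortest path through one more layer consists of a shortest path to its
last but one operator and the gates which that operator meets. -/
lemma ncDistance_append {n : ℕ} (O : Op n) (C : Circuit n) (L : Layer n) :
    ncDistance O (C ++ [L]) = distPush L.toOp L.touched (ncDistance O C) := by
  have hlen : (C ++ [L]).length = C.length + 1 := by simp
  have hget : ∀ r : ℕ → PauliString n,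
      (∀ s : Fin (C ++ [L]).length, amp ((C ++ [L]).get s).toOp (r s) (r (s + 1)) ≠ 0) ↔
      (∀ s : Fin C.length, amp (C.get s).toOp (r s) (r (s + 1)) ≠ 0) ∧
        amp L.toOp (r C.length) (r (C.length + 1)) ≠ 0 := by
    intro r
    constructor
    · intro h
      refine ⟨fun s => ?_, ?_⟩
      · have := h ⟨s, by omega⟩
        simpa [List.getElem_append_left s.2] using this
      · have := h ⟨C.length, by omega⟩
        simpa using this
    · rintro ⟨h1, h2⟩ ⟨s, hs⟩
      rcases Nat.lt_or_ge s C.length with h | h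
      · simpa [List.getElem_append_left h] using h1 ⟨s, h⟩
      · obtain rfl : s = C.length := by omega
        simpa using h2
  funext Q
  refine eq_of_forall_le_coe fun k => ?_
  rw [distPush_le_iff, ncDistance_le_iff]
  constructor
  · rintro ⟨r, h0, h1, h2, hk⟩
    rw [hlen] at h1
    obtain ⟨h3, h4⟩ := (hget r).1 h2
    rw [pathTouched_append] at hk
    refine ⟨r C.length, h1 ▸ h4, ?_⟩
    have : ncDistance O C (r C.length) ≤ (pathTouched C r : ℕ) :=
      ncDistance_le_iff.2 ⟨r, h0, rfl, h3, le_rfl⟩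
    refine (add_le_add_left this _).trans ?_
    exact_mod_cast hk
  · rintro ⟨P, hP, hk⟩
    obtain ⟨j, hj⟩ : ∃ j : ℕ, ncDistance O C P = j := by
      refine ⟨_, (ENat.natCast_toNat fun h => ?_).symm⟩
      rw [h, top_add] at hk
      exact absurd hk (by simp)
    obtain ⟨r, h0, h1, h2, h3⟩ := ncDistance_le_iff.1 hj.le
    rw [hj] at hk
    have hk : j + L.touched P ≤ k := by exact_mod_cast hk
    set r' : ℕ → PauliString n := fun s => if s ≤ C.length then r s else Q with hr'
    have e : ∀ s ≤ C.length, r' s = r s := fun s hs => if_pos hs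
    have e' : r' (C.length + 1) = Q := if_neg (by omega)
    refine ⟨r', by rwa [e 0 (by omega)], by rw [hlen, e'], (hget r').2 ⟨fun s => ?_, ?_⟩, ?_⟩
    · rw [e s (by omega), e (s + 1) (by omega)]; exact h2 s
    · rwa [e _ le_rfl, e', h1]
    · rw [pathTouched_append, e _ le_rfl, h1]
      have : pathTouched C r' = pathTouched C r :=
        Finset.sum_congr rfl fun s _ => by rw [e s (by omega)]
      omega

/-! ## The truncated evolution, layer by layer -/

/-- A layer acting on distances and on a truncated observable. -/
def truncStep {n : ℕ} (γ : ℝ) (ℓ : ℕ) (σ : (PauliString n → ℕ∞) × (PauliString n → ℝ))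
    (L : Layer n) : (PauliString n → ℕ∞) × (PauliString n → ℝ) :=
  (distPush L.toOp L.touched σ.1, fun Q => if distPush L.toOp L.touched σ.1 Q ≤ ℓ then
    heisStep γ gateNoise σ.2 L Q else 0)

/-- The coefficients of weight at most `ℓ`. -/
def lowCoeff {n : ℕ} (ℓ : ℕ) (O : Op n) (P : PauliString n) : ℝ :=
  if weight P ≤ ℓ then coeff O P else 0

/-- The initial distances, and the initial truncated observable. -/
def truncInit {n : ℕ} (γ : ℝ) (ℓ : ℕ) (O : Op n) : (PauliString n → ℕ∞) × (PauliString n → ℝ) :=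
  (fun P => if lowCoeff ℓ O P ≠ 0 then 0 else ⊤, damped γ Finset.univ (lowCoeff ℓ O))

lemma project_eq {n : ℕ} {S : Set (PauliString n)} {O : Op n} {f : PauliString n → ℝ}
    (h : ∀ P ∈ S, f P = coeff O P) (h0 : ∀ P ∉ S, f P = 0) : project S O = ofCoeff f := by
  refine Finset.sum_congr rfl fun P _ => ?_
  by_cases hP : P ∈ S
  · simp [hP, h P hP]
  · simp [hP, h0 P hP]

lemma lowWeight_eq {n : ℕ} (ℓ : ℕ) (O : Op n) : lowWeight ℓ O = ofCoeff (lowCoeff ℓ O) :=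
  project_eq (fun _ hP => if_pos hP) fun _ hP => if_neg hP

lemma ncDistance_nil {n : ℕ} (ℓ : ℕ) (O : Op n) :
    ncDistance (lowWeight ℓ O) [] = fun P => if lowCoeff ℓ O P ≠ 0 then 0 else ⊤ := by
  funext P
  refine eq_of_forall_le_coe fun k => ?_
  rw [ncDistance_le_iff, lowWeight_eq, coeff_ofCoeff]
  split_ifs with h
  · simp only [zero_le, iff_true]
    exact ⟨fun _ => P, h, rfl, fun s => s.elim0, Nat.zero_le _⟩
  · simp only [top_le_iff, ENat.natCast_ne_top, iff_false]
    rintro ⟨r, h0, h1, -⟩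
    exact h (h1 ▸ h0)

/-- Distances and coefficients are carried along as one pair, so that the truncated evolution is a
fold over the layers, which `foldl_eq_of_blocks` can cut into Clifford blocks. -/
lemma truncEvolution_eq {n : ℕ} (γ : ℝ) (ℓ : ℕ) (O : Op n) (C : Circuit n) {t : ℕ}
    (ht : t ≤ C.length) :
    ncDistance (lowWeight ℓ O) (C.take t) =
      ((C.take t).foldl (truncStep γ ℓ) (truncInit γ ℓ O)).1 ∧
    truncEvolution γ ℓ O C t =
      ofCoeff ((C.take t).foldl (truncStep γ ℓ) (truncInit γ ℓ O)).2 := by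
  induction t with
  | zero =>
    refine ⟨ncDistance_nil ℓ O, ?_⟩
    rw [truncEvolution, lowWeight_eq, depolarizeOn_ofCoeff]
    rfl
  | succ t ih =>
    obtain ⟨h1, h2⟩ := ih (by omega)
    have hL : C[t]? = some C[t] := List.getElem?_eq_getElem (by omega)
    have ht1 : C.take (t + 1) = C.take t ++ [C[t]] := by rw [List.take_add_one, hL]; rfl
    have h3 : ncDistance (lowWeight ℓ O) (C.take (t + 1)) =
        ((C.take (t + 1)).foldl (truncStep γ ℓ) (truncInit γ ℓ O)).1 := by
      rw [ht1, ncDistance_append, h1, List.foldl_append]; rfl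
    refine ⟨h3, ?_⟩
    simp only [truncEvolution, hL]
    rw [h2, conj_ofCoeff, depolarizeOn_ofCoeff, h3, ht1, List.foldl_append]
    refine project_eq (fun P hP => ?_) fun P hP => if_neg hP
    rw [coeff_ofCoeff]
    exact if_pos hP

/-- The distances and the truncated observable at the end of the circuit. -/
def truncFinal {n : ℕ} (γ : ℝ) (ℓ : ℕ) (C : Circuit n) (O : Op n) :
    (PauliString n → ℕ∞) × (PauliString n → ℝ) := C.foldl (truncStep γ ℓ) (truncInit γ ℓ O)

lemma ncEstimate_eq {n : ℕ} (γ : ℝ) (ℓ : ℕ) (C : Circuit n) (O ρ : Op n) :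
    ncEstimate γ ℓ C O ρ = ∑ P, (ρ * pauliOp P).trace.re * (truncFinal γ ℓ C O).2 P := by
  rw [ncEstimate, (truncEvolution_eq γ ℓ O C le_rfl).2, List.take_length, trace_mul_ofCoeff_re]
  rfl

/-- The truncated observable is supported on small distances. -/
def SmallSupport {n : ℕ} (ℓ : ℕ) (σ : (PauliString n → ℕ∞) × (PauliString n → ℝ)) : Prop :=
  ∀ P, σ.2 P ≠ 0 → σ.1 P ≤ ℓ

lemma smallSupport_truncInit {n : ℕ} (γ : ℝ) (ℓ : ℕ) (O : Op n) :
    SmallSupport ℓ (truncInit γ ℓ O) := by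
  intro P hP
  have : lowCoeff ℓ O P ≠ 0 := right_ne_zero_of_mul hP
  simp [truncInit, this]

lemma smallSupport_truncStep {n : ℕ} (γ : ℝ) (ℓ : ℕ)
    (σ : (PauliString n → ℕ∞) × (PauliString n → ℝ)) (L : Layer n) :
    SmallSupport ℓ (truncStep γ ℓ σ L) := by
  intro P hP
  by_contra h
  exact hP (if_neg h)

lemma Layer.touched_eq_zero {n : ℕ} {L : Layer n} (h : ¬ L.NonClifford) : L.touched = 0 := by
  funext P
  rw [Layer.touched, List.filter_eq_nil_iff.2 fun g hg => ?_]
  · rfl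
  · rw [decide_eq_true_eq]
    exact fun hc => h ⟨g, hg, hc.1⟩

lemma push_ne_zero {n : ℕ} {U : Op n} {f : PauliString n → ℝ} {Q : PauliString n}
    (h : push U f Q ≠ 0) : ∃ P, f P ≠ 0 ∧ amp U P Q ≠ 0 := by
  obtain ⟨P, _, hP⟩ := Finset.exists_ne_zero_of_sum_ne_zero h
  exact ⟨P, left_ne_zero_of_mul hP, right_ne_zero_of_mul hP⟩

/-- Clifford layers do not drop anything. -/
lemma truncStep_clifford {n : ℕ} {γ : ℝ} {ℓ : ℕ} {L : Layer n} (hL : ¬ L.NonClifford)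
    {σ : (PauliString n → ℕ∞) × (PauliString n → ℝ)} (h : SmallSupport ℓ σ) :
    truncStep γ ℓ σ L = (distPush L.toOp 0 σ.1, push L.toOp σ.2) := by
  have h0 := Layer.touched_eq_zero hL
  refine Prod.ext (by rw [truncStep, h0]) (funext fun Q => ?_)
  simp only [truncStep, heisStep, gateNoise_clifford hL, damped_empty, h0]
  split_ifs with h1
  · rfl
  · by_contra hc
    obtain ⟨P, hP, hPQ⟩ := push_ne_zero (Ne.symm hc)
    refine h1 ((distPush_le hPQ).trans ?_)
    simpa using h P hP

lemma distPush_one {n : ℕ} (D : PauliString n → ℕ∞) : distPush (1 : Op n) 0 D = D := by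
  funext Q
  refine eq_of_forall_le_coe fun k => ?_
  rw [distPush_le_iff]
  simp [amp_one]

/-- Distances refer to paths through single layers. In general the amplitude of a product can vanish
by cancellation although such a path exists; a Clifford U leaves only one intermediate operator, so
there is nothing to cancel. -/
lemma distPush_mul {n : ℕ} {U V : Op n} (hU : IsClifford U) (D : PauliString n → ℕ∞) :
    distPush (U * V) 0 D = distPush V 0 (distPush U 0 D) := by
  funext Q
  refine eq_of_forall_le_coe fun k => ?_
  rw [distPush_le_iff, distPush_le_iff]
  simp only [Pi.zero_apply, Nat.cast_zero, add_zero, distPush_le_iff, amp_mul, hU.sum_amp_mul]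
  constructor
  · rintro ⟨P, hP, hk⟩
    exact ⟨cliffordImage U P, right_ne_zero_of_mul hP, P, left_ne_zero_of_mul hP, hk⟩
  · rintro ⟨R, hR, P, hP, hk⟩
    rw [cliffordImage_spec hU] at hP
    subst hP
    exact ⟨P, mul_ne_zero ((cliffordImage_spec hU P _).2 rfl) hR, hk⟩

lemma foldl_truncStep_clifford {n : ℕ} {γ : ℝ} {ℓ : ℕ} {l : List (Layer n)}
    (hl : ∀ L ∈ l, ¬ L.NonClifford) {σ : (PauliString n → ℕ∞) × (PauliString n → ℝ)}
    (h : SmallSupport ℓ σ) : l.foldl (truncStep γ ℓ) σ =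
      (distPush (l.map Layer.toOp).prod 0 σ.1, push (l.map Layer.toOp).prod σ.2) := by
  induction l generalizing σ with
  | nil => simp [distPush_one, push_one]
  | cons L l ih =>
    have hL := hl L List.mem_cons_self
    rw [List.foldl_cons, ih (fun L' h' => hl L' (List.mem_cons_of_mem _ h'))
      (smallSupport_truncStep γ ℓ σ L), truncStep_clifford hL h, List.map_cons, List.prod_cons,
      distPush_mul (Layer.isClifford hL), push_mul]

/-! ## The tables of the truncated evolution -/

/-- The table lists all Pauli operators of small distance, with their distances, and with the
coefficients of the observable. -/
structure Represents {n : ℕ} (ℓ : ℕ) (T : List (Entry n))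
    (σ : (PauliString n → ℕ∞) × (PauliString n → ℝ)) : Prop where
  a_eq : ∀ e ∈ T, e.a = 0
  b_le : ∀ e ∈ T, e.b ≤ ℓ
  nodup : (T.map Entry.P).Nodup
  dist : ∀ P k, k ≤ ℓ → ((∃ e ∈ T, e.P = P ∧ e.b ≤ k) ↔ σ.1 P ≤ k)
  sum : ∀ φ : PauliString n → ℝ, sumE (fun e => e.c * φ e.P) T = ∑ P, σ.2 P * φ P

/-- A unitary of Clifford layers acting on distances and on an observable. -/
def cliffStep {n : ℕ} (V : Op n) (σ : (PauliString n → ℕ∞) × (PauliString n → ℝ)) :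
    (PauliString n → ℕ∞) × (PauliString n → ℝ) := (distPush V 0 σ.1, push V σ.2)

/-- Without repetitions, b is the distance as far as it is at most ℓ, so dropping the entries with b
> ℓ is the same as the truncation. The coefficients need to be right only at distance at most ℓ, and
the hypothesis on sums is restricted to test functions supported there. -/
lemma represents_roundL {n ℓ : ℕ} {γ : ℝ} {S : Finset (Fin n)} {V : Op n} (hV : IsClifford V)
    (hU : V * Vᴴ = 1) {T : List (Entry n)} {D : PauliString n → ℕ∞} {f : PauliString n → ℝ}
    (hn : (T.map Entry.P).Nodup)
    (hd : ∀ P k, k ≤ ℓ → ((∃ e ∈ T, e.P = P ∧ e.b ≤ k) ↔ D P ≤ k))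
    (hs : ∀ φ : PauliString n → ℝ, (∀ P, ¬ D P ≤ ℓ → φ P = 0) →
      sumE (fun e => e.c * φ e.P) T = ∑ P, f P * φ P) :
    Represents ℓ (roundL true S V ℓ (Real.exp (-γ)) T)
      (cliffStep V (D, fun P => if D P ≤ ℓ then damped γ S f P else 0)) := by
  have hb : ∀ e ∈ T, (e.b ≤ ℓ ↔ D e.P ≤ ℓ) := by
    intro e he
    rw [← hd _ _ le_rfl]
    refine ⟨fun h => ⟨e, he, rfl, h⟩, ?_⟩
    rintro ⟨e', he', h1, h2⟩
    rwa [← List.inj_on_of_nodup_map hn he' he h1]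
  refine ⟨fun e he => ?_, fun e he => ?_, ?_, fun Q k hk => ?_, fun φ => ?_⟩
  · obtain ⟨e', _, _, rfl⟩ := mem_roundL.1 he
    rfl
  · obtain ⟨e', _, h, rfl⟩ := mem_roundL.1 he
    exact h
  · have h1 : (roundL true S V ℓ (Real.exp (-γ)) T).map Entry.P =
        ((T.filter fun e => decide (e.b ≤ ℓ)).map Entry.P).map (cliffordImage V) := by
      clear hn hd hs hb
      induction T with
      | nil => rfl
      | cons e T ih =>
        simp only [roundL, List.flatMap_cons, List.map_append, weighE, cntB] at ih ⊢
        rw [ih, List.filter_cons]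
        by_cases h : e.b ≤ ℓ <;> simp [h, cliffE]
    rw [h1]
    exact (hn.sublist (List.filter_sublist.map _)).map (cliffordImage_injective hV hU)
  · rw [cliffStep, distPush_le_iff]
    simp only [mem_roundL, Pi.zero_apply, Nat.cast_zero, add_zero, cliffordImage_spec hV,
      ← hd _ k hk]
    constructor
    · rintro ⟨_, ⟨e, he, -, rfl⟩, h1, h2⟩
      exact ⟨e.P, h1.symm, e, he, rfl, h2⟩
    · rintro ⟨P, h1, e, he, rfl, h2⟩
      exact ⟨_, ⟨e, he, h2.trans hk, rfl⟩, h1.symm, h2⟩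
  · rw [cliffStep, sum_push_mul, sumE_roundL]
    simp only [hV.sum_amp_mul]
    refine (sumE_congr fun e he => ?_).trans ((hs (fun P => if D P ≤ ℓ then
      Real.exp (-γ) ^ wt S P * (amp V P (cliffordImage V P) * φ (cliffordImage V P)) else 0)
      fun P hP => if_neg hP).trans (Finset.sum_congr rfl fun P _ => ?_))
    · simp only [cntB, if_true, hb e he]
      split_ifs <;> ring
    · simp only [damped]
      split_ifs <;> ring

/-- The distances and the truncated observable after the Clifford block number `t`. -/
def truncBlock {n : ℕ} (γ : ℝ) (ℓ : ℕ) (C : Circuit n) (O : Op n) :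
    ℕ → (PauliString n → ℕ∞) × (PauliString n → ℝ)
  | 0 => cliffStep (cliffordBlock C 0) (truncInit γ ℓ O)
  | t + 1 => cliffStep (cliffordBlock C (t + 1)) (truncStep γ ℓ (truncBlock γ ℓ C O t) (ncLayer C t))

lemma truncFinal_eq {n : ℕ} (γ : ℝ) (ℓ : ℕ) (C : Circuit n) (O : Op n) :
    truncFinal γ ℓ C O = truncBlock γ ℓ C O (ncDepth C) :=
  foldl_eq_of_blocks _ _ _ _ (foldl_truncStep_clifford not_nonClifford_of_mem_cliffordLayers
    (smallSupport_truncInit γ ℓ O)).symm fun _ _ => (foldl_truncStep_clifford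
      not_nonClifford_of_mem_cliffordLayers (smallSupport_truncStep γ ℓ _ _)).symm

lemma sumE_lowL {x : Input} {O : Op x.n} (ho : x.obs = coeff O) (φ : Entry x.n → ℝ) :
    sumE φ (lowL x) = ∑ P, if lowCoeff x.ℓ O P ≠ 0 then φ ⟨P, 0, 0, coeff O P⟩ else 0 := by
  rw [lowL, sumE_flatMap, sumE_levels, Finset.sum_filter]
  refine Finset.sum_congr rfl fun P _ => ?_
  have h1 := weight_le P
  by_cases h : weight P ≤ x.ℓ
  · by_cases h2 : coeff O P = 0 <;> simp [obsE, lowCoeff, ho, h, h1, h2]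
  · simp [lowCoeff, h]

lemma count_map_P {n : ℕ} (l : List (Entry n)) (P : PauliString n) :
    ((l.map Entry.P).count P : ℝ) = sumE (fun e => if e.P = P then 1 else 0) l := by
  induction l with
  | nil => simp
  | cons e l ih =>
    rw [List.map_cons, List.count_cons, sumE_cons, Nat.cast_add, ih, add_comm]
    simp

/-- Before a layer a = 0, and b is the distance. After it, a + b is the length of one candidate
path, and merging takes the minimum over the candidates, which is the recursion for `distPush`. -/
lemma represents_heisL {x : Input} {γ : ℝ} {O : Op x.n} (hd : x.damp = Real.exp (-γ))
    (ho : x.obs = coeff O) (t : ℕ) :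
    Represents x.ℓ (heisL x true (lowL x) t) (truncBlock γ x.ℓ x.circuit O t) := by
  have hV := cliffordBlock_isClifford x.circuit
  have hU := cliffordBlock_mul_conjTranspose x.circuit
  induction t with
  | zero =>
    have hb : ∀ e ∈ lowL x, e.b = 0 := fun e he => (counters_of_mem_obsE e he).2
    have hc : ∀ P, ((lowL x).map Entry.P).count P = if lowCoeff x.ℓ O P ≠ 0 then 1 else 0 := by
      intro P
      have h := count_map_P (lowL x) P
      rw [sumE_lowL ho, Finset.sum_eq_single P (fun Q _ hQ => by simp [hQ]) (by simp)] at h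
      simp only [if_true] at h
      exact_mod_cast h
    have h := represents_roundL (ℓ := x.ℓ) (γ := γ) (S := Finset.univ) (hV 0) (hU 0)
      (T := lowL x) (D := (truncInit γ x.ℓ O).1) (f := lowCoeff x.ℓ O) ?_ ?_ ?_
    · rw [heisL, hd, truncBlock]
      convert h using 2
      refine Prod.ext rfl (funext fun P => ?_)
      by_cases h1 : lowCoeff x.ℓ O P = 0 <;> simp [truncInit, damped, h1]
    · rw [List.nodup_iff_count_le_one]
      intro P
      rw [hc]
      split_ifs <;> simp
    · intro P k hk
      have : (∃ e ∈ lowL x, e.P = P ∧ e.b ≤ k) ↔ P ∈ (lowL x).map Entry.P := by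
        rw [List.mem_map]
        exact exists_congr fun e => and_congr_right fun he => by simp [hb e he]
      rw [this, ← List.count_pos_iff, hc, truncInit]
      dsimp only
      by_cases h1 : lowCoeff x.ℓ O P = 0 <;> simp [h1]
    · intro φ _
      rw [sumE_lowL ho]
      refine Finset.sum_congr rfl fun P _ => ?_
      by_cases h1 : lowCoeff x.ℓ O P = 0
      · simp [h1]
      · rw [if_pos h1]
        unfold lowCoeff at h1 ⊢
        rw [if_pos (ite_ne_right_iff.1 h1).1]
  | succ t ih =>
    have ha : ∀ e ∈ heisL x true (lowL x) t, e.a ≤ x.ℓ := fun e he =>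
      (ih.a_eq e he).trans_le (Nat.zero_le _)
    rw [heisL, if_pos rfl, hd, truncBlock]
    refine represents_roundL (hV _) (hU _) (dedupe_nodup _) (fun Q k hk => ?_) fun φ hφ => ?_
    · rw [(exists_mem_dedupe _).2, expandL_mem false _ ha fun e => e.P = Q ∧ e.a + e.b ≤ k,
        distPush_le_iff]
      constructor
      · rintro ⟨e, he, -, R, hR, rfl, h2⟩
        refine ⟨e.P, hR, ?_⟩
        rw [ih.a_eq e he, zero_add] at h2
        have h3 := (ih.dist e.P e.b (ih.b_le e he)).1 ⟨e, he, rfl, le_rfl⟩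
        refine (add_le_add_left h3 _).trans ?_
        rw [add_comm] at h2
        exact_mod_cast h2
      · rintro ⟨P, hP, h1⟩
        obtain ⟨j, hj⟩ : ∃ j : ℕ, (truncBlock γ x.ℓ x.circuit O t).1 P = j := by
          refine ⟨_, (ENat.natCast_toNat fun h => ?_).symm⟩
          rw [h, top_add] at h1
          exact absurd h1 (by simp)
        rw [hj] at h1
        have h1 : j + (ncLayer x.circuit t).touched P ≤ k := by exact_mod_cast h1
        obtain ⟨e, he, rfl, h2⟩ := (ih.dist P j (by omega)).2 hj.le
        refine ⟨e, he, ?_, Q, hP, rfl, ?_⟩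
        · rw [ih.a_eq e he]; omega
        · dsimp only; rw [ih.a_eq e he]; omega
    · rw [sumE_dedupe, expandL_sum false _ ha, sum_push_mul, ← ih.sum]
      refine sumE_congr fun e he => ?_
      change (if _ then ∑ Q, (if amp (ncLayer x.circuit t).toOp e.P Q ≠ 0 then
        (e.c * amp (ncLayer x.circuit t).toOp e.P Q) * _ else 0) else 0) = _
      rw [ih.a_eq e he, zero_add, Finset.mul_sum]
      split_ifs with h1
      · refine Finset.sum_congr rfl fun Q _ => ?_
        by_cases h2 : amp (ncLayer x.circuit t).toOp e.P Q = 0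
        · simp [h2]
        · rw [if_pos h2, mul_assoc]
      · refine (Finset.sum_eq_zero fun Q _ => ?_).symm
        by_cases h2 : amp (ncLayer x.circuit t).toOp e.P Q = 0
        · simp [h2]
        -- Every operator leading to Q meets the same number of gates as Q, and so does `e.P`. If
        -- that number exceeds ℓ, so that the expansion dropped the entry, Q has distance above ℓ
        -- and φ vanishes at Q.
        rw [hφ Q fun h3 => ?_, mul_zero, mul_zero]
        obtain ⟨P, hP, h4⟩ := distPush_le_iff.1 h3
        have h5 := (le_add_self.trans h4 : ((ncLayer x.circuit t).touched P : ℕ∞) ≤ x.ℓ)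
        rw [Layer.touched_eq _ hP, ← Layer.touched_eq _ h2] at h5
        exact h1 (by exact_mod_cast h5)

/-! ## The error of the truncated evolution -/

/-- A distance, cut off at `K`. -/
def capped (K : ℕ) (D : ℕ∞) : ℕ := (min D K).toNat

lemma capped_coe (K d : ℕ) : capped K d = min d K := by
  rcases le_total d K with h | h
  · rw [capped, min_eq_left h, min_eq_left (by exact_mod_cast h), ENat.toNat_natCast]
  · rw [capped, min_eq_right h, min_eq_right (by exact_mod_cast h), ENat.toNat_natCast]

lemma capped_top (K : ℕ) : capped K ⊤ = K := by simp [capped]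

lemma capped_le_add {K k : ℕ} {D D' : ℕ∞} (h : D' ≤ D + k) : capped K D' ≤ capped K D + k := by
  induction D using ENat.recTopCoe with
  | top =>
    induction D' using ENat.recTopCoe with
    | top => exact Nat.le_add_right _ _
    | coe d' => rw [capped_top, capped_coe]; omega
  | coe d =>
    induction D' using ENat.recTopCoe with
    | top => exact absurd (top_le_iff.1 h) (by exact_mod_cast ENat.natCast_ne_top (d + k))
    | coe d' =>
      have h : d' ≤ d + k := by exact_mod_cast h
      rw [capped_coe, capped_coe]; omega

lemma capped_eq {ℓ : ℕ} {D : ℕ∞} (h : ¬ D ≤ ℓ) : capped (ℓ + 1) D = ℓ + 1 := by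
  induction D using ENat.recTopCoe with
  | top => exact capped_top _
  | coe d =>
    have : ¬ d ≤ ℓ := by exact_mod_cast h
    rw [capped_coe]; omega

/-- Raising the cap from K to K + 1 multiplies the power by r exactly where the distance exceeds K.
This layer-cake formula reduces weighted norms to norms on the sets of distance above K. -/
lemma pow_capped_succ (r : ℝ) (K : ℕ) (D : ℕ∞) :
    r ^ capped (K + 1) D = r ^ capped K D + if D ≤ K then 0 else (r - 1) * r ^ K := by
  split_ifs with h
  · obtain ⟨d, rfl⟩ : ∃ d : ℕ, D = d := ⟨_, (ENat.natCast_toNat fun h' => by simp [h'] at h).symm⟩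
    have : d ≤ K := by exact_mod_cast h
    rw [capped_coe, capped_coe, min_eq_left this, min_eq_left (by omega), add_zero]
  · have : capped K D = K := by
      induction D using ENat.recTopCoe with
      | top => exact capped_top _
      | coe d =>
        have : ¬ d ≤ K := by exact_mod_cast h
        rw [capped_coe]; omega
    rw [capped_eq h, this, pow_succ]; ring

/-- The squared norm, weighted by exponentials of the distances up to `K`. -/
def energy {n : ℕ} (γ : ℝ) (K : ℕ) (D : PauliString n → ℕ∞) (f : PauliString n → ℝ) : ℝ :=
  ∑ P, Real.exp (2 * γ) ^ capped K (D P) * f P ^ 2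

/-- Induction on the cap. To operators at distance above K after U only operators at distance above
K before U contribute, so there the image of f agrees with the image of its restriction, and U
preserves the norm of the latter. -/
lemma energy_push_le {n : ℕ} {γ : ℝ} (hγ : 0 ≤ γ) {U : Op n} (hU : U * Uᴴ = 1)
    (D : PauliString n → ℕ∞) (f : PauliString n → ℝ) (K : ℕ) :
    energy γ K (distPush U 0 D) (push U f) ≤ energy γ K D f := by
  have hr : 1 ≤ Real.exp (2 * γ) := Real.one_le_exp (by linarith)
  induction K with
  | zero =>
    have : ∀ D, capped 0 D = 0 := fun D => by simp [capped]
    simp only [energy, this, pow_zero, one_mul]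
    exact (sum_push_sq hU f).le
  | succ K ih =>
    have h : ∀ (D : PauliString n → ℕ∞) f, energy γ (K + 1) D f = energy γ K D f +
        (Real.exp (2 * γ) - 1) * Real.exp (2 * γ) ^ K *
          ∑ P, (if D P ≤ K then 0 else f P) ^ 2 := by
      intro D f
      rw [energy, energy, Finset.mul_sum, ← Finset.sum_add_distrib]
      refine Finset.sum_congr rfl fun P _ => ?_
      rw [pow_capped_succ]
      split_ifs <;> ring
    rw [h, h]
    refine add_le_add ih (mul_le_mul_of_nonneg_left ?_
      (mul_nonneg (by linarith) (by positivity)))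
    rw [← sum_push_sq hU fun P => if D P ≤ K then 0 else f P]
    refine Finset.sum_le_sum fun Q _ => ?_
    split_ifs with h1
    · rw [zero_pow two_ne_zero]; positivity
    · refine le_of_eq (congrArg (· ^ 2) (Finset.sum_congr rfl fun P _ => ?_))
      by_cases h2 : amp U P Q = 0
      · simp [h2]
      · dsimp only
        rw [if_neg fun h3 => h1 (distPush_le_iff.2 ⟨P, h2, by simpa using h3⟩)]

/-- Damping w letters contributes e^{-2γw} to the square, which compensates for a growth of the
distance by up to w. -/
lemma exp_pow_mul_le {γ : ℝ} (hγ : 0 ≤ γ) {a b w : ℕ} (h : a ≤ b + w) (r : ℝ) :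
    Real.exp (2 * γ) ^ a * (Real.exp (-γ) ^ w * r) ^ 2 ≤ Real.exp (2 * γ) ^ b * r ^ 2 := by
  have h1 : Real.exp (2 * γ) ^ w * (Real.exp (-γ) ^ w) ^ 2 = 1 := by
    rw [← pow_mul, mul_comm w 2, pow_mul, ← mul_pow, ← Real.exp_nat_mul, ← Real.exp_add]
    simp
  calc _ ≤ Real.exp (2 * γ) ^ (b + w) * (Real.exp (-γ) ^ w * r) ^ 2 :=
        mul_le_mul_of_nonneg_right (pow_le_pow_right₀ (Real.one_le_exp (by linarith)) h)
          (sq_nonneg _)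
    _ = Real.exp (2 * γ) ^ b * r ^ 2 * (Real.exp (2 * γ) ^ w * (Real.exp (-γ) ^ w) ^ 2) := by ring
    _ = _ := by rw [h1, mul_one]

/-- The gates met are the same before and after the layer, so the distance at Q grows by at most the
number of gates that Q meets, and Q has at least as many damped letters. -/
lemma energy_heisStep_le {n : ℕ} {γ : ℝ} (hγ : 0 ≤ γ) (L : Layer n)
    (D : PauliString n → ℕ∞) (f : PauliString n → ℝ) (K : ℕ) :
    energy γ K (distPush L.toOp L.touched D) (heisStep γ gateNoise f L) ≤ energy γ K D f := by
  refine le_trans (Finset.sum_le_sum fun Q _ => ?_)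
    (energy_push_le hγ L.toOp_mul_conjTranspose D f K)
  refine exp_pow_mul_le hγ ((capped_le_add ?_).trans
    (Nat.add_le_add_left (L.touched_le_wt Q) _)) _
  rcases eq_or_ne (distPush L.toOp 0 D Q) ⊤ with h | h
  · rw [h, top_add]; exact le_top
  · obtain ⟨k, hk⟩ : ∃ k : ℕ, distPush L.toOp 0 D Q = k := ⟨_, (ENat.natCast_toNat h).symm⟩
    obtain ⟨P, hP, h1⟩ := distPush_le_iff.1 hk.le
    refine (distPush_le hP).trans ?_
    rw [← L.touched_eq hP, hk]
    exact add_le_add_left (by simpa using h1) _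

lemma sum_heisStep_sub_sq_le {n : ℕ} {γ : ℝ} (hγ : 0 ≤ γ) (noise : Layer n → Finset (Fin n))
    (L : Layer n) (f g : PauliString n → ℝ) :
    ∑ P, (heisStep γ noise f L P - heisStep γ noise g L P) ^ 2 ≤ ∑ P, (f P - g P) ^ 2 := by
  rw [← sum_push_sq L.toOp_mul_conjTranspose fun P => f P - g P, push_sub]
  refine Finset.sum_le_sum fun Q _ => ?_
  rw [heisStep, heisStep, damped, damped, ← mul_sub, mul_pow]
  exact mul_le_of_le_one_left (sq_nonneg _) (pow_le_one₀ (by positivity)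
    (pow_le_one₀ (Real.exp_nonneg _) (Real.exp_le_one_iff.2 (by linarith))))

/-- The truncated observable `σ.2` is close to the observable `h`, if `k` truncations dropped
terms of squared norm `R` in total. -/
structure TruncInv {n : ℕ} (γ : ℝ) (ℓ k : ℕ) (R : ℝ) (h : PauliString n → ℝ)
    (σ : (PauliString n → ℕ∞) × (PauliString n → ℝ)) : Prop where
  small : SmallSupport ℓ σ
  nonneg : 0 ≤ R
  dist_sq : ∑ P, (h P - σ.2 P) ^ 2 ≤ k * R
  energy_le : energy γ (ℓ + 1) σ.1 σ.2 + Real.exp (2 * γ) ^ (ℓ + 1) * R ≤ 1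

/-- Dropped coefficients have distance above ℓ, so dropping squared norm G removes energy
e^{2γ(ℓ+1)} G. The new error is the old one, of squared norm at most kR, plus the dropped part; (u +
v)² ≤ (1 + 1/k) u² + (1 + k) v² gives at most (k + 1)(R + G). Clifford layers drop nothing and leave
k alone. -/
lemma TruncInv.step {n : ℕ} {γ : ℝ} (hγ : 0 ≤ γ) {ℓ k : ℕ} (hk : 1 ≤ k) {R : ℝ}
    {h : PauliString n → ℝ} {σ : (PauliString n → ℕ∞) × (PauliString n → ℝ)}
    (H : TruncInv γ ℓ k R h σ) (L : Layer n) :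
    ∃ R', TruncInv γ ℓ (k + if L.NonClifford then 1 else 0) R' (heisStep γ gateNoise h L)
      (truncStep γ ℓ σ L) := by
  set g := heisStep γ gateNoise σ.2 L with hg
  set D' := distPush L.toOp L.touched σ.1 with hD
  have h1 := (sum_heisStep_sub_sq_le hγ gateNoise L h σ.2).trans H.dist_sq
  have h2 := energy_heisStep_le hγ L σ.1 σ.2 (ℓ + 1)
  rw [← hg, ← hD] at h2
  rw [← hg] at h1
  have hs := smallSupport_truncStep γ ℓ σ L
  split_ifs with hL
  · set G := ∑ Q, (if D' Q ≤ ℓ then 0 else g Q) ^ 2 with hG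
    have hG0 : 0 ≤ G := Finset.sum_nonneg fun _ _ => sq_nonneg _
    have hE : energy γ (ℓ + 1) D' (truncStep γ ℓ σ L).2 + Real.exp (2 * γ) ^ (ℓ + 1) * G =
        energy γ (ℓ + 1) D' g := by
      rw [energy, energy, hG, Finset.mul_sum, ← Finset.sum_add_distrib]
      refine Finset.sum_congr rfl fun Q _ => ?_
      simp only [truncStep, ← hg, ← hD]
      split_ifs with h3
      · ring
      · rw [capped_eq h3]; ring
    refine ⟨R + G, hs, add_nonneg H.nonneg hG0, ?_, ?_⟩
    · have hk' : (1 : ℝ) ≤ k := by exact_mod_cast hk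
      have h3 : ∀ Q, (heisStep γ gateNoise h L Q - (truncStep γ ℓ σ L).2 Q) ^ 2 ≤
          (1 + 1 / k) * (heisStep γ gateNoise h L Q - g Q) ^ 2 +
            (1 + k) * (if D' Q ≤ ℓ then 0 else g Q) ^ 2 := by
        intro Q
        have e : heisStep γ gateNoise h L Q - (truncStep γ ℓ σ L).2 Q =
            (heisStep γ gateNoise h L Q - g Q) + if D' Q ≤ ℓ then 0 else g Q := by
          simp only [truncStep, ← hg, ← hD]
          split_ifs <;> ring
        rw [e]
        generalize heisStep γ gateNoise h L Q - g Q = u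
        generalize (if D' Q ≤ ℓ then 0 else g Q) = v
        have h4 : (1 + 1 / k) * u ^ 2 + (1 + k) * v ^ 2 - (u + v) ^ 2 = (u - k * v) ^ 2 / k := by
          field_simp; ring
        have : 0 ≤ (u - k * v) ^ 2 / k := by positivity
        linarith
      refine (Finset.sum_le_sum fun Q _ => h3 Q).trans ?_
      rw [Finset.sum_add_distrib, ← Finset.mul_sum, ← Finset.mul_sum, ← hG]
      refine (add_le_add_left (mul_le_mul_of_nonneg_left h1 (by positivity)) _).trans
        (le_of_eq ?_)
      push_cast; field_simp; ring
    · change energy γ (ℓ + 1) D' (truncStep γ ℓ σ L).2 + _ ≤ 1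
      have := H.energy_le
      linarith
  · have h3 : truncStep γ ℓ σ L = (D', g) := by
      rw [truncStep_clifford hL H.small, hD, hg, heisStep, gateNoise_clifford hL, damped_empty,
        Layer.touched_eq_zero hL]
    refine ⟨R, hs, H.nonneg, ?_, ?_⟩
    · rw [h3]; exact h1
    · rw [h3]; have := H.energy_le; dsimp only; linarith

lemma TruncInv.foldl {n : ℕ} {γ : ℝ} (hγ : 0 ≤ γ) {ℓ k : ℕ} (hk : 1 ≤ k) {R : ℝ}
    {h : PauliString n → ℝ} {σ : (PauliString n → ℕ∞) × (PauliString n → ℝ)}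
    (H : TruncInv γ ℓ k R h σ) (C : Circuit n) :
    ∃ R', TruncInv γ ℓ (k + ncDepth C) R' (C.foldl (heisStep γ gateNoise) h)
      (C.foldl (truncStep γ ℓ) σ) := by
  induction C generalizing k R h σ with
  | nil => exact ⟨R, H⟩
  | cons L C ih =>
    obtain ⟨R', H'⟩ := H.step hγ hk L
    have e : k + ncDepth (L :: C) = (k + if L.NonClifford then 1 else 0) + ncDepth C := by
      unfold ncDepth
      rw [List.filter_cons]
      by_cases hL : L.NonClifford <;> simp [hL]
      omega
    rw [e]
    exact ih (by omega) H'

/-- The truncation by weight counts as the first one. Read-out noise multiplies the squares of the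
dropped coefficients by at most e^{-2γ(ℓ+1)}; the coefficients that are kept have distance 0 and
thus energy factor 1. -/
lemma truncInv_init {n : ℕ} {γ : ℝ} (hγ : 0 ≤ γ) (ℓ : ℕ) {O : Op n}
    (hO : ∑ P, coeff O P ^ 2 ≤ 1) :
    ∃ R, TruncInv γ ℓ 1 R (damped γ Finset.univ (coeff O)) (truncInit γ ℓ O) := by
  refine ⟨∑ P, (damped γ Finset.univ (coeff O) P - (truncInit γ ℓ O).2 P) ^ 2,
    smallSupport_truncInit γ ℓ O, Finset.sum_nonneg fun _ _ => sq_nonneg _, by simp,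
    le_trans ?_ hO⟩
  rw [energy, Finset.mul_sum, ← Finset.sum_add_distrib]
  refine Finset.sum_le_sum fun P _ => ?_
  simp only [truncInit, damped, wt_univ, lowCoeff]
  by_cases h : weight P ≤ ℓ
  · have := exp_pow_mul_le hγ (a := 0) (b := 0) (w := weight P) (by omega) (coeff O P)
    by_cases h0 : coeff O P = 0
    · simp [h0]
    · simpa [h, h0, capped] using this
  · have := exp_pow_mul_le hγ (a := ℓ + 1) (b := 0) (w := weight P) (by omega) (coeff O P)
    simpa [h] using this

/-- At the end k = d + 1, and the energy bound gives R ≤ e^{-2γ(ℓ+1)}, so the squared error is at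
most (d + 1) e^{-2γ(ℓ+1)}. -/
theorem rmsError_ncEstimate_le {n : ℕ} {γ ε : ℝ} (hγ : 0 < γ) (hε : 0 < ε) {C : Circuit n}
    {O : Op n} (hO : O.IsHermitian) (h1 : frobNorm O = 1) {N : ℕ} {c : ℝ} {ρ : Fin N → Op n}
    (hρ : IsLowAverage c ρ) {ℓ : ℕ} (hℓ : ℓ = gateThreshold γ ε (ncDepth C)) :
    rmsError (fun i => ncEstimate γ ℓ C O (ρ i)) (fun i => expectation γ gateNoise C O (ρ i)) ≤
      ε * Real.sqrt c := by
  obtain ⟨R₀, H₀⟩ := truncInv_init hγ.le ℓ (sum_coeff_sq hO h1).le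
  obtain ⟨R, H⟩ := H₀.foldl hγ.le le_rfl C
  have hd : (0 : ℝ) < ncDepth C + 1 := by positivity
  -- This is how the threshold is chosen: γ(ℓ + 1) is at least log(√(d+1) / ε).
  have hx : (ncDepth C + 1) / ε ^ 2 ≤ Real.exp (2 * γ) ^ (ℓ + 1) := by
    have h2 := Nat.le_ceil (1 / γ * Real.log (Real.sqrt (ncDepth C + 1) / ε) - 1)
    rw [← gateThreshold, ← hℓ, sub_le_iff_le_add, one_div, inv_mul_le_iff₀ hγ,
      Real.log_le_iff_le_exp (by positivity)] at h2
    have h3 := pow_le_pow_left₀ (by positivity) h2 2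
    rw [div_pow, Real.sq_sqrt hd.le, ← Real.exp_nat_mul] at h3
    refine h3.trans (le_of_eq ?_)
    rw [← Real.exp_nat_mul]
    push_cast; ring_nf
  have hR : (ncDepth C + 1) * R ≤ ε ^ 2 := by
    have h2 : 0 ≤ energy γ (ℓ + 1) (C.foldl (truncStep γ ℓ) (truncInit γ ℓ O)).1
        (C.foldl (truncStep γ ℓ) (truncInit γ ℓ O)).2 :=
      Finset.sum_nonneg fun _ _ => by positivity
    have h3 := (mul_le_mul_of_nonneg_right hx H.nonneg).trans 
      ((le_add_of_nonneg_left h2).trans H.energy_le)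
    rwa [div_mul_eq_mul_div, div_le_one (by positivity)] at h3
  refine (rmsError_le hρ (fun P => (truncFinal γ ℓ C O).2 P - heis γ gateNoise C (coeff O) P)
    fun i => ?_).trans (le_trans (Real.sqrt_le_sqrt (mul_le_mul_of_nonneg_left
      (b := ∑ P, _) (c := ε ^ 2) ?_ hρ.nonneg)) ?_)
  · rw [expectation_eq γ gateNoise C hO (hρ.isHermitian i), ncEstimate_eq,
      ← Finset.sum_sub_distrib]
    exact Finset.sum_congr rfl fun P _ => by ring
  · refine le_trans (le_of_eq (Finset.sum_congr rfl fun P _ => sub_sq_comm _ _))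
      (H.dist_sq.trans ?_)
    push_cast
    linarith
  · rw [mul_comm, Real.sqrt_mul (sq_nonneg _), Real.sqrt_sq hε.le]

/-! ## Running time under gate-based noise -/

/-- When two entries are merged, only one of their two terms survives in the sum, and the terms are
non-negative. -/
lemma sumE_dedupe_le {n : ℕ} {ψ : ℕ → ℝ} (hψ : ∀ b, 0 ≤ ψ b) (l : List (Entry n)) :
    sumE (fun e => ψ e.b) (dedupe l) ≤ sumE (fun e => ψ (e.a + e.b)) l := by
  suffices ∀ acc : List (Entry n), sumE (fun e => ψ e.b) (l.foldl insertE acc) ≤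
      sumE (fun e => ψ e.b) acc + sumE (fun e => ψ (e.a + e.b)) l by
    simpa [dedupe] using this []
  induction l with
  | nil => intro acc; simp
  | cons e l ih =>
    intro acc
    refine (ih _).trans ?_
    rw [sumE_cons, ← add_assoc]
    refine add_le_add_left ?_ _
    rcases insertE_cases acc e with ⟨i, hi, hP, h1⟩ | ⟨hP, h1⟩
    · rw [h1, sumE_set _ _ _ hi]
      dsimp only
      rcases min_choice acc[i].b (e.a + e.b) with h | h <;> rw [h]
      · linarith [hψ (e.a + e.b)]
      · linarith [hψ acc[i].b]
    · rw [h1, sumE_append, sumE_cons, sumE_nil, add_zero]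

/-- A gate that is met multiplies the number of entries by at most 16 and adds one to a, which
merging adds to b. So the sum of 16^{-b} never exceeds the initial number of entries. -/
lemma sumE_heisL_true_le {x : Input} {l : List (Entry x.n)} {t : ℕ}
    (ha : ∀ t, ∀ e ∈ heisL x true l t, e.a = 0 ∧ e.b ≤ x.ℓ) :
    sumE (fun e => (1 / 16 : ℝ) ^ e.b) (heisL x true l t) ≤ l.length := by
  have hround : ∀ S V (T : List (Entry x.n)),
      sumE (fun e => (1 / 16 : ℝ) ^ e.b) (roundL true S V x.ℓ x.damp T) ≤
        sumE (fun e => (1 / 16 : ℝ) ^ e.b) T := by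
    intro S V T
    rw [sumE_roundL]
    refine sumE_mono fun e _ => ?_
    split_ifs
    · exact le_rfl
    · positivity
  induction t with
  | zero =>
    rw [heisL, ← sumE_one]
    exact (hround _ _ _).trans (sumE_mono fun e _ => pow_le_one₀ (by norm_num) (by norm_num))
  | succ t ih =>
    rw [heisL, if_pos rfl]
    refine (hround _ _ _).trans ((sumE_dedupe_le (fun b => by positivity) _).trans
      (le_trans ?_ ih))
    have h := expandTo_potential false (ncLayer x.circuit t).gates x.n
      (fun e he => ((ha t e he).1.trans_le (Nat.zero_le x.ℓ)))
      (ψ := fun b => (1 / 16 : ℝ) ^ b) fun b => by positivity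
    refine le_trans (le_of_eq (sumE_congr fun e _ => ?_)) (h.trans (le_of_eq
      (sumE_congr fun e he => ?_)))
    · rw [add_comm, pow_add]
    · rw [(ha t e he).1, pow_zero, mul_one]

/-- Within a layer a starts from 0 and is cut off at ℓ on its own, so a + b can reach 2ℓ before
`weighE` removes the excess; hence 256 = 16². The minimum in ψ bounds it from below without
information on b in the intermediate tables. -/
lemma expandTo_heisL_true_length_le {x : Input} {l : List (Entry x.n)}
    (ha : ∀ t, ∀ e ∈ heisL x true l t, e.a = 0 ∧ e.b ≤ x.ℓ) (G : List (Gate x.n)) (t m : ℕ) :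
    (expandTo false G x.ℓ m (heisL x true l t)).length ≤ l.length * 256 ^ x.ℓ := by
  have h0 : ∀ e ∈ heisL x true l t, e.a ≤ x.ℓ := fun e he =>
    (ha t e he).1.trans_le (Nat.zero_le x.ℓ)
  have h := (expandTo_potential false G m h0 (ψ := fun b => (1 / 16 : ℝ) ^ min b x.ℓ)
    fun b => by positivity).trans ((le_of_eq (sumE_congr fun e he => by
      rw [(ha t e he).1, pow_zero, mul_one, min_eq_left (ha t e he).2])).trans
        (sumE_heisL_true_le ha))
  have h1 := length_le_of_sumE (r := (1 / 256 : ℝ) ^ x.ℓ) (by positivity) (fun e he => ?_) h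
  · rw [one_div, inv_pow, div_inv_eq_mul] at h1
    exact_mod_cast h1
  · rw [show (1 / 256 : ℝ) = 1 / 16 * (1 / 16) by norm_num, mul_pow]
    exact mul_le_mul (pow_le_pow_of_le_one (by norm_num) (by norm_num) (min_le_right _ _))
      (pow_le_pow_of_le_one (by norm_num) (by norm_num) (expandTo_a_le h0 e he))
      (by positivity) (by positivity)

lemma expandTo_length_le {n : ℕ} (dir : Bool) (G : List (Gate n)) (ℓ m : ℕ) (l : List (Entry n)) :
    (expandTo dir G ℓ m l).length ≤ l.length * 16 ^ m := by
  induction m with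
  | zero => exact (Nat.mul_one _).ge
  | succ m ih =>
    rw [expandTo_succ, pow_succ, ← mul_assoc]
    exact (length_flatMap_le _ fun e _ => stage_length_le dir G ℓ m e).trans
      (Nat.mul_le_mul_right _ ih)

lemma length_le_of_nodup {n : ℕ} {l : List (Entry n)} (h : (l.map Entry.P).Nodup) :
    l.length ≤ 4 ^ n := by
  simpa using h.length_le_card

lemma lowL_length {x : Input} {O : Op x.n} (ho : x.obs = coeff O) :
    (lowL x).length = pauliCount x.ℓ O := by
  have h := sumE_lowL ho fun _ => 1
  rw [sumE_one, Finset.sum_boole] at h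
  rw [pauliCount, ← Nat.cast_inj (R := ℝ), h]
  congr 2
  ext P
  simp [lowCoeff, and_comm]

/-- The running time for few qubits. -/
def smallT (n : ℕ) : ℕ := (n + 1) ^ 2 * (2700 * (64 ^ n + 1) ^ 2 + 900 * (3 * n + 1) ^ n)

/-- The constant in the running time. -/
def gateConst : ℕ := 3000000000 + ∑ n ∈ Finset.range 256, smallT n

lemma le_gateConst : 3000000000 ≤ gateConst := by
  unfold gateConst; exact Nat.le_add_right _ _

lemma smallT_le_gateConst {n : ℕ} (h : n < 256) : smallT n ≤ gateConst := by
  unfold gateConst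
  exact (Finset.single_le_sum (f := smallT) (fun _ _ => Nat.zero_le _)
    (Finset.mem_range.2 h)).trans (Nat.le_add_left _ _)

-- From here on only the two lower bounds are used; the value itself is a huge number that must not
-- be computed.
attribute [irreducible] gateConst

lemma computes_gateProg_le {x : Input} {γ : ℝ} {O : Op x.n} (hd : x.damp = Real.exp (-γ))
    (ho : x.obs = coeff O) (hn : 1 ≤ x.n) (hℓ : 1 ≤ x.ℓ) :
    ∃ T, Computes gateProg x (∑ P, x.state P * (truncFinal γ x.ℓ x.circuit O).2 P) T ∧
      T ≤ gateConst * (ncDepth x.circuit + 1) * max 1 (pauliCount x.ℓ O) ^ 2 * x.n ^ (2 * x.ℓ) := by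
  have hrep := represents_heisL (x := x) hd ho
  have ha : ∀ t, ∀ e ∈ heisL x true (lowL x) t, e.a = 0 ∧ e.b ≤ x.ℓ := fun t e he =>
    ⟨(hrep t).a_eq e he, (hrep t).b_le e he⟩
  set d := ncDepth x.circuit
  set m := pauliCount x.ℓ O with hm
  -- The highest level is r + 1. Its operators are handled in time O(n) each and only the levels up
  -- to r are extended, so the enumeration costs O((n + 1)² (3n + 1)^r).
  obtain ⟨r, hr⟩ : ∃ r, min x.n x.ℓ = r + 1 := ⟨min x.n x.ℓ - 1, by omega⟩
  have key : ∀ M, m ≤ M → (∀ t k, k ≤ x.n →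
      (expandTo false (ncLayer x.circuit t).gates x.ℓ k (heisL x true (lowL x) t)).length ≤ M) →
      ∃ T, Computes gateProg x (∑ P, x.state P * (truncFinal γ x.ℓ x.circuit O).2 P) T ∧
        T ≤ (d + 1) * ((x.n + 1) ^ 2 * (2700 * (M + 1) ^ 2 + 900 * (3 * x.n + 1) ^ r)) := by
    intro M hM hE
    obtain ⟨T, hT, hle⟩ := computes_gateProg (M := M) hℓ ((lowL_length ho).trans_le hM)
      (fun t _ k hk => hE t k hk) (hE d 0 (Nat.zero_le _))
    rw [(hrep d).sum, ← truncFinal_eq] at hT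
    refine ⟨T, by simpa only [mul_comm] using hT, hle.trans ?_⟩
    have h1 := sum_level_length_le x.n r
    have h2 := sum_level_length_le x.n (r + 1)
    have hY : 1 ≤ (3 * x.n + 1) ^ r := Nat.one_le_pow _ _ (by omega)
    rw [hr, levels_length]
    rw [pow_succ] at h2
    set Y := (3 * x.n + 1) ^ r
    calc _ ≤ 2700 * (d + 1) * unitT x.n M + (300 * (x.n + 1) ^ 2 * (Y + Y) +
          50 * (x.n + 1) * (Y * (3 * x.n + 1) + Y * (3 * x.n + 1))) := by
          gcongr
          nlinarith
      _ ≤ 2700 * (d + 1) * unitT x.n M + 900 * (x.n + 1) ^ 2 * Y := by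
          have : (x.n + 1) * (3 * x.n + 1) ≤ 3 * (x.n + 1) ^ 2 := by nlinarith
          nlinarith
      _ ≤ 2700 * (d + 1) * unitT x.n M + (d + 1) * (900 * (x.n + 1) ^ 2 * Y) :=
          Nat.add_le_add_left (Nat.le_mul_of_pos_left _ (by omega)) _
      _ = _ := by unfold unitT; ring
  have hm1 : 1 ≤ max 1 m ^ 2 := Nat.one_le_pow _ _ (by omega)
  have hnp : 1 ≤ x.n ^ (2 * x.ℓ) := Nat.one_le_pow _ _ hn
  -- For n ≥ 256 write ℓ = k + 1: the squared table length contains 256^{2ℓ} ≤ 256² n^{2k}, and the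
  -- missing n² pays for the factor (n + 1)² of the table operations. For n < 256 a table has at
  -- most 4^n rows, times 16^n within a layer, and everything except d + 1 goes into the constant.
  rcases lt_or_ge x.n 256 with h | h
  · have hm4 : m ≤ 64 ^ x.n := by
      refine (Finset.card_le_univ _).trans ?_
      simpa using Nat.pow_le_pow_left (show 4 ≤ 64 by norm_num) x.n
    obtain ⟨T, hT, hle⟩ := key (64 ^ x.n) hm4 fun t k hk =>
      (expandTo_length_le _ _ _ _ _).trans ((Nat.mul_le_mul (length_le_of_nodup (hrep t).nodup)
        (Nat.pow_le_pow_right (by norm_num) hk)).trans (le_of_eq (by rw [← mul_pow]; norm_num)))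
    refine ⟨T, hT, hle.trans ?_⟩
    have h1 : (x.n + 1) ^ 2 * (2700 * (64 ^ x.n + 1) ^ 2 + 900 * (3 * x.n + 1) ^ r) ≤
        gateConst :=
      le_trans (Nat.mul_le_mul_left _ (Nat.add_le_add_left (Nat.mul_le_mul_left _
        (Nat.pow_le_pow_right (by omega) (by omega))) _)) (smallT_le_gateConst h)
    calc _ ≤ (d + 1) * gateConst := Nat.mul_le_mul_left _ h1
      _ = gateConst * (d + 1) * 1 * 1 := by ring
      _ ≤ _ := Nat.mul_le_mul (Nat.mul_le_mul_left _ hm1) hnp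
  · obtain ⟨T, hT, hle⟩ := key (m * 256 ^ x.ℓ) (Nat.le_mul_of_pos_right _ (by positivity))
      fun t k _ => by
        have := expandTo_heisL_true_length_le ha (ncLayer x.circuit t).gates t k
        rwa [lowL_length ho] at this
    refine ⟨T, hT, hle.trans ?_⟩
    obtain ⟨k, hk⟩ : ∃ k, x.ℓ = k + 1 := ⟨x.ℓ - 1, by omega⟩
    have hrk : r ≤ k := by omega
    have h1 : (x.n + 1) ^ 2 ≤ 4 * x.n ^ 2 := by nlinarith
    have h2 : (m * 256 ^ x.ℓ + 1) ^ 2 ≤ 262144 * (max 1 m ^ 2 * x.n ^ (2 * k)) := by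
      have h3 : m * 256 ^ x.ℓ + 1 ≤ 2 * (max 1 m * 256 ^ x.ℓ) := by
        have h4 : m * 256 ^ x.ℓ ≤ max 1 m * 256 ^ x.ℓ := Nat.mul_le_mul_right _ (le_max_right _ _)
        have h5 : 1 ≤ max 1 m * 256 ^ x.ℓ := Nat.mul_pos (by omega) (by positivity)
        omega
      calc _ ≤ (2 * (max 1 m * 256 ^ x.ℓ)) ^ 2 := Nat.pow_le_pow_left h3 2
        _ = 262144 * (max 1 m ^ 2 * (256 ^ k) ^ 2) := by rw [hk]; ring
        _ ≤ 262144 * (max 1 m ^ 2 * (x.n ^ k) ^ 2) := by gcongr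
        _ = _ := by ring
    have h3 : (3 * x.n + 1) ^ r ≤ max 1 m ^ 2 * x.n ^ (2 * k) := by
      calc (3 * x.n + 1) ^ r ≤ (x.n ^ 2) ^ r := Nat.pow_le_pow_left (by nlinarith) r
        _ = 1 * x.n ^ (2 * r) := by rw [← pow_mul, one_mul]
        _ ≤ _ := Nat.mul_le_mul hm1 (Nat.pow_le_pow_right hn (by omega))
    calc _ ≤ (d + 1) * (4 * x.n ^ 2 * (2700 * (262144 * (max 1 m ^ 2 * x.n ^ (2 * k))) +
          900 * (max 1 m ^ 2 * x.n ^ (2 * k)))) := by gcongr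
      _ = 2831158800 * (d + 1) * max 1 m ^ 2 * x.n ^ (2 * x.ℓ) := by rw [hk]; ring
      _ ≤ _ := by
        gcongr
        exact le_trans (by norm_num) le_gateConst

/-- With threshold `0` only the identity is kept. -/
lemma ncEstimate_zero {n : ℕ} (γ : ℝ) (C : Circuit n) (O : Op n) {ρ : Op n} (hρ : ρ.trace = 1) :
    ncEstimate γ 0 C O ρ = coeff O 0 := by
  have key : ∀ σ : (PauliString n → ℕ∞) × (PauliString n → ℝ), SmallSupport 0 σ →
      (∀ P ≠ 0, σ.2 P = 0) → (∀ P ≠ 0, (C.foldl (truncStep γ 0) σ).2 P = 0) ∧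
        (C.foldl (truncStep γ 0) σ).2 0 = σ.2 0 := by
    induction C with
    | nil => exact fun σ _ h => ⟨h, rfl⟩
    | cons L C ih =>
      intro σ hs h
      have h1 : ∀ Q, push L.toOp σ.2 Q = σ.2 0 * amp L.toOp 0 Q := fun Q =>
        Finset.sum_eq_single 0 (fun P _ hP => by rw [h P hP, zero_mul]) (by simp)
      obtain ⟨h2, h3⟩ := ih (truncStep γ 0 σ L) (smallSupport_truncStep γ 0 σ L) fun P hP => by
        simp [truncStep, heisStep, damped, h1, amp_zero_left L.conjTranspose_mul_toOp, hP]
      refine ⟨h2, h3.trans ?_⟩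
      rw [truncStep, heisStep]
      dsimp only
      rw [damped_apply_zero, push_apply_zero L.toOp_mul_conjTranspose]
      split_ifs with h4
      · rfl
      -- The identity meets no gates and is mapped to itself. If it is dropped now, its distance was
      -- above 0 before, and then its coefficient was already 0.
      · by_contra hc
        refine h4 ((distPush_le (P := 0) (by
          simp [amp_zero_right L.toOp_mul_conjTranspose])).trans ?_)
        have h5 := L.touched_le_weight_self 0
        rw [weight_zero, Nat.le_zero] at h5
        simpa [h5] using hs 0 (Ne.symm hc)
  obtain ⟨h1, h2⟩ := key _ (smallSupport_truncInit γ 0 O) fun P hP => by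
    simp [truncInit, damped, lowCoeff, Nat.one_le_iff_ne_zero.1 (weight_pos hP)]
  rw [ncEstimate_eq, Finset.sum_eq_single 0 (fun P _ hP => by
    rw [truncFinal, h1 P hP, mul_zero]) (by simp), truncFinal, h2]
  simp [truncInit, damped, lowCoeff, weight_zero, hρ, wt_univ, pauliOp_zero]

theorem gate_noise :
    ∃ (prog : Program) (K : ℝ), 0 < K ∧
      ∀ (γ ε : ℝ), 0 < γ → 0 < ε → ε ≤ 1 →
      ∀ (n : ℕ), 1 ≤ n → ∀ (C : Circuit n) (O : Op n), O.IsHermitian → frobNorm O = 1 →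
      ∀ (d ℓ m : ℕ), d = ncDepth C → ℓ = gateThreshold γ ε d → m = pauliCount ℓ O →
      ∀ (N : ℕ) (c : ℝ) (ρ : Fin N → Op n), IsLowAverage c ρ →
        (∀ i, ∃ T : ℕ, Computes prog (oracleInput γ ℓ C O (ρ i)) (ncEstimate γ ℓ C O (ρ i)) T ∧
          (T : ℝ) ≤ K * (max 1 d : ℕ) * ((max 1 m : ℕ) : ℝ) ^ 2 *
            (n : ℝ) ^ (2 / γ * Real.log (Real.sqrt (d + 1) / ε))) ∧
        rmsError (fun i => ncEstimate γ ℓ C O (ρ i))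
          (fun i => expectation γ gateNoise C O (ρ i)) ≤ ε * Real.sqrt c := by
  have hK : (3000000000 : ℝ) ≤ gateConst := by exact_mod_cast le_gateConst
  refine ⟨gateProg, 2 * gateConst, by linarith, ?_⟩
  rintro γ ε hγ hε hε1 n hn C O hO hO1 d ℓ m hd hℓ hm N c ρ hρ
  refine ⟨fun i => ?_, rmsError_ncEstimate_le hγ hε hO hO1 hρ (hd ▸ hℓ)⟩
  have hn' : (1 : ℝ) ≤ n := by exact_mod_cast hn
  have hd1 : (1 : ℝ) ≤ (max 1 d : ℕ) := by exact_mod_cast le_max_left 1 d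
  have hm1 : (1 : ℝ) ≤ ((max 1 m : ℕ) : ℝ) ^ 2 :=
    one_le_pow₀ (by exact_mod_cast le_max_left 1 m)
  rcases Nat.eq_zero_or_pos ℓ with h0 | h0
  · obtain ⟨T, hT, hle⟩ := computes_gateProg_trivial (x := oracleInput γ ℓ C O (ρ i)) h0
    refine ⟨T, ?_, ?_⟩
    · rw [h0, ncEstimate_zero γ C O (hρ.2.1 i).2, ← h0]
      exact hT
    · have hlog : 0 ≤ Real.log (Real.sqrt (d + 1) / ε) := by
        refine Real.log_nonneg ((one_le_div hε).2 (hε1.trans ?_))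
        rw [Real.one_le_sqrt]; linarith [Nat.cast_nonneg (α := ℝ) d]
      have h1 : 1 ≤ (n : ℝ) ^ (2 / γ * Real.log (Real.sqrt (d + 1) / ε)) :=
        Real.one_le_rpow hn' (by positivity)
      have hT2 : (T : ℝ) ≤ 2 := by exact_mod_cast hle
      have h2 := one_le_mul_of_one_le_of_one_le (one_le_mul_of_one_le_of_one_le hd1 hm1) h1
      calc (T : ℝ) ≤ 2 * gateConst * 1 := by linarith
        _ ≤ 2 * gateConst * _ := mul_le_mul_of_nonneg_left h2 (by linarith)
        _ = _ := by ring
  · obtain ⟨T, hT, hle⟩ := computes_gateProg_le (x := oracleInput γ ℓ C O (ρ i)) rfl rfl hn h0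
    refine ⟨T, by rw [ncEstimate_eq]; exact hT, ?_⟩
    -- For ℓ ≥ 1 the ceiling exceeds its argument by less than one, and the -1 in the threshold
    -- absorbs this.
    have h1 : (ℓ : ℝ) ≤ 1 / γ * Real.log (Real.sqrt (d + 1) / ε) := by
      rw [hℓ, gateThreshold, gt_iff_lt, Nat.ceil_pos] at h0
      have := (Nat.ceil_lt_add_one h0.le).le
      rw [hℓ, gateThreshold]
      linarith
    have h2 : ((n ^ (2 * ℓ) : ℕ) : ℝ) ≤ (n : ℝ) ^ (2 / γ * Real.log (Real.sqrt (d + 1) / ε)) := by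
      push_cast
      rw [← Real.rpow_natCast]
      refine Real.rpow_le_rpow_of_exponent_le hn' ?_
      push_cast
      calc (2 : ℝ) * ℓ ≤ 2 * (1 / γ * Real.log (Real.sqrt (d + 1) / ε)) := by linarith
        _ = _ := by ring
    -- The factor 2 in the constant comes from here: the time contains d + 1, the claim max(1, d).
    have h3 : ((d + 1 : ℕ) : ℝ) ≤ 2 * (max 1 d : ℕ) := by
      exact_mod_cast (by omega : d + 1 ≤ 2 * max 1 d)
    have h4 : (T : ℝ) ≤ gateConst * ((d + 1 : ℕ) : ℝ) * ((max 1 m : ℕ) : ℝ) ^ 2 *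
        ((n ^ (2 * ℓ) : ℕ) : ℝ) := by
      rw [hd, hm]; exact_mod_cast hle
    refine h4.trans ?_
    rw [show 2 * (gateConst : ℝ) * (max 1 d : ℕ) = gateConst * (2 * (max 1 d : ℕ)) by ring]
    exact mul_le_mul (mul_le_mul_of_nonneg_right (mul_le_mul_of_nonneg_left h3 (Nat.cast_nonneg _))
      (sq_nonneg _)) h2 (Nat.cast_nonneg _) (by positivity)

end

end NoisySim

open NoisySim
theorem mainTheorem9 :
    -- uniform noise, arbitrary observables
    (∃ (prog : Program) (ℓ : ℝ → ℝ → ℕ → ℕ), ∀ γ₀ : ℝ, 0 < γ₀ → γ₀ < 1 → ∃ K : ℝ, 0 < K ∧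
      ∀ (γ ε : ℝ), 0 < γ → γ ≤ γ₀ → 0 < ε → ε ≤ 1 →
      ∀ (n : ℕ), 1 ≤ n → ∀ (C : Circuit n) (O : Op n), O.IsHermitian → frobNorm O = 1 →
      ∀ (N : ℕ) (c : ℝ) (ρ : Fin N → Op n), IsLowAverage c ρ →
      ∃ out : Fin N → ℝ,
        (∀ i, ∃ T : ℕ, Computes prog (oracleInput γ (ℓ γ ε (ncDepth C)) C O (ρ i)) (out i) T ∧
          (T : ℝ) ≤ K *
            (n : ℝ) ^ (K * (Real.log (1 / γ) / γ) +
              K * (Real.log (1 / ε) / (γ * (max 1 (ncDepth C) : ℕ)))) *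
            (1 / ε) ^ (K * (Real.log (1 / γ) / γ ^ 2))) ∧
        rmsError out (fun i => expectation γ uniformNoise C O (ρ i)) ≤ ε * Real.sqrt c) ∧
    -- uniform noise, sums of polynomially many Pauli operators
    (∃ (prog : Program) (ℓ : ℝ → ℝ → ℕ → ℕ), ∀ γ₀ : ℝ, 0 < γ₀ → γ₀ < 1 → ∃ K : ℝ, 0 < K ∧
      ∀ p : Polynomial ℕ, ∃ q : Polynomial ℕ,
      ∀ (γ ε : ℝ), 0 < γ → γ ≤ γ₀ → 0 < ε → ε ≤ 1 →
      ∀ (n : ℕ), 1 ≤ n → ∀ (C : Circuit n) (l : List (PauliString n × ℝ)),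
      l.length ≤ p.eval n → frobNorm (sumOfTerms l) = 1 →
      ∀ (N : ℕ) (c : ℝ) (ρ : Fin N → Op n), IsLowAverage c ρ →
      ∃ out : Fin N → ℝ,
        (∀ i, ∃ T : ℕ, Computes prog (listInput γ (ℓ γ ε (ncDepth C)) C l (ρ i)) (out i) T ∧
          (T : ℝ) ≤ (q.eval n : ℕ) * (1 / ε) ^ (K * (Real.log (1 / γ) / γ ^ 2))) ∧
        rmsError out (fun i => expectation γ uniformNoise C (sumOfTerms l) (ρ i)) ≤
          ε * Real.sqrt c) ∧
    -- gate-based noise, truncation by non-Clifford distance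
    (∃ (prog : Program) (K : ℝ), 0 < K ∧
      ∀ (γ ε : ℝ), 0 < γ → 0 < ε → ε ≤ 1 →
      ∀ (n : ℕ), 1 ≤ n → ∀ (C : Circuit n) (O : Op n), O.IsHermitian → frobNorm O = 1 →
      ∀ (d ℓ m : ℕ), d = ncDepth C → ℓ = gateThreshold γ ε d → m = pauliCount ℓ O →
      ∀ (N : ℕ) (c : ℝ) (ρ : Fin N → Op n), IsLowAverage c ρ →
        (∀ i, ∃ T : ℕ, Computes prog (oracleInput γ ℓ C O (ρ i)) (ncEstimate γ ℓ C O (ρ i)) T ∧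
          (T : ℝ) ≤ K * (max 1 d : ℕ) * ((max 1 m : ℕ) : ℝ) ^ 2 *
            (n : ℝ) ^ (2 / γ * Real.log (Real.sqrt (d + 1) / ε))) ∧
        rmsError (fun i => ncEstimate γ ℓ C O (ρ i))
          (fun i => expectation γ gateNoise C O (ρ i)) ≤ ε * Real.sqrt c) :=
  ⟨uniform_noise_any_observable, uniform_noise_explicit_sum, gate_noise⟩
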